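/- Let $\mathcal P$ be a Picard groupoid (a symmetric monoidal groupoid, written additively with unit $e$, commutativity constraint $c$, in which every functor $y\mapsto x+y$ is an equivalence) and let $G$ be a group. Torsors. A $\mathcal P$-torsor is a nonempty category $\mathcal L$ with an action of $\mathcal P$ (with coherent associativity and unit constraints) such that all functors $v\mapsto x+v$ on $\mathcal L$ and $x\mapsto x+v$ from $\mathcal P$ to $\mathcal L$ are equivalences. A $1$-morphism is a functor $F$ with natural isomorphisms $F(x+v)\simeq x+F(v)$ compatible with associativity; a $2$-morphism is a natural isomorphism compatible with these. For $z\in\mathcal P$ let $\mathcal Z(z):\mathcal L\to\mathcal L$ be the $1$-morphism $v\mapsto z+v$, with $z+(x+v)\simeq x+(z+v)$ given by $c$. The sum $\mathcal L_1+\mathcal L_2$ has as objects the pairs $(v,w)$ and as morphisms $(v,w)\to(v',w')$ the equivalence classes of triples $(x,\ \varphi_1:v\to x+v',\ \varphi_2:x+w\to w')$; the action is $x+(v,w)=(x+v,w)$. The sum has associativity constraints $A$ given by $((v,w),u)\mapsto(v,(w,u))$, and commutativity constraints $C:\mathcal L_1+\mathcal L_2\to\mathcal L_2+\mathcal L_1$,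 $C(v,w)=(w,v)$. The $1$-morphism $C$ sends the canonical isomorphism $t:(x+v,w)\simeq(v,x+w)$ (the class of $(x,\mathrm{id},\mathrm{id})$) to the inverse of the canonical isomorphism $(x+w,v)\simeq(w,x+v)$, and this inverse is also its structure isomorphism $C(x+(v,w))=(w,x+v)\simeq(x+w,v)=x+C(v,w)$; one has $C\circ C=\mathrm{id}$. Central extensions. A central extension $\mathcal L$ of $G$ by $\mathcal P$ assigns to every $g\in G$ a $\mathcal P$-torsor $\mathcal L_g$, to every $g,g'$ an equivalence $D_{g,g'}:\mathcal L_{gg'}\to\mathcal L_g+\mathcal L_{g'}$ of $\mathcal P$-torsors, and to every $g,g',g''$ a $2$-isomorphism $A\circ(D_{g,g'}+1)\circ D_{gg',g''}\simeq(1+D_{g',g''})\circ D_{g,g'g''}$, such that for all $g,g',g'',g'''$ the two resulting $2$-isomorphisms between $1$-morphisms $\mathcal L_{gg'g''g'''}\to\mathcal L_g+(\mathcal L_{g'}+(\mathcal L_{g''}+\mathcal L_{g'''}))$ coincide. Bimultiplicative and anti-symmetric $1$-morphisms. Let $Z_2\subset G\times G$ be the set of commuting pairs. A bimultiplicative $1$-morphism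 is a map $f:Z_2\to\mathcal P$ with isomorphisms $f(g_1g_2,h)\simeq f(g_1,h)+f(g_2,h)$ and $f(g,h_1h_2)\simeq f(g,h_1)+f(g,h_2)$, each compatible with the associativity constraint of $\mathcal P$, and such that the two isomorphisms from $f(g_1g_2,h_1h_2)$ to $(f(g_1,h_1)+f(g_2,h_1))+(f(g_1,h_2)+f(g_2,h_2))\simeq(f(g_1,h_1)+f(g_1,h_2))+(f(g_2,h_1)+f(g_2,h_2))$ coincide. Choose for each $x\in\mathcal P$ an inverse $-x$ with $x+(-x)\simeq e$, so that $x\mapsto-x$ is functorial on isomorphisms. An anti-symmetric structure on $f$ consists of isomorphisms $\theta:f(g,h)\simeq-f(h,g)$ such that $f(g,h)\simeq-f(h,g)\simeq-(-f(g,h))\simeq f(g,h)$ is the identity, where $-(-x)\simeq x$ is the composition $-(-x)\simeq e+(-(-x))\simeq(x+(-x))+(-(-x))\simeq x+((-x)+(-(-x)))\simeq x+e\simeq x$. Theorem. Let $\mathcal L$ be a central extension of $G$ by $\mathcal P$. (1) There is a map $C_2^{\mathcal L}:Z_2\to\mathcal P$ together with, for every $(g,g')\in Z_2$, a $2$-isomorphism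 from $\mathcal Z(C_2^{\mathcal L}(g,g'))$ to the composition $$\mathcal L_{gg'}\xrightarrow{D_{g,g'}}\mathcal L_g+\mathcal L_{g'}\xrightarrow{C}\mathcal L_{g'}+\mathcal L_g\xrightarrow{D_{g',g}^{-1}}\mathcal L_{g'g}=\mathcal L_{gg'}.$$ These data are unique up to a unique isomorphism. (2) For any such data there is exactly one bimultiplicative structure on $C_2^{\mathcal L}$ for which the following two identities hold. (2a) The isomorphism $C_2^{\mathcal L}(ab,c)\simeq C_2^{\mathcal L}(a,c)+C_2^{\mathcal L}(b,c)$ is induced by the structure of $\mathcal L$ and the commutativity constraint: in the category of $1$-morphisms $\mathcal L_{abc}\to\mathcal L_c+(\mathcal L_a+\mathcal L_b)$, the $2$-isomorphism obtained by first replacing $\mathcal Z(C_2^{\mathcal L}(a,c))\circ\mathcal Z(C_2^{\mathcal L}(b,c))$ by $\mathcal Z(C_2^{\mathcal L}(ab,c))$ and then the latter by the commutativity constraint $\mathcal L_{ab}+\mathcal L_c\simeq\mathcal L_c+\mathcal L_{ab}$ agrees with the one obtained by replacing first $\mathcal Z(C_2^{\mathcal L}(a,c))$ and then $\mathcal Z(C_2^{\mathcal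 L}(b,c))$ by the commutativity constraints of $\mathcal L_a,\mathcal L_c$ and of $\mathcal L_b,\mathcal L_c$, where one passes between the decompositions of $\mathcal L_{abc}$ by the associativity $2$-isomorphisms of $\mathcal L$ for $(c,a,b)$, $(a,c,b)$, $(a,b,c)$. (2b) The isomorphism $C_2^{\mathcal L}(a,bc)\simeq C_2^{\mathcal L}(a,b)+C_2^{\mathcal L}(a,c)$ is induced in the same way: the corresponding two $2$-isomorphisms between $1$-morphisms $\mathcal L_{abc}\to\mathcal L_b+(\mathcal L_c+\mathcal L_a)$, starting from $\mathcal Z(C_2^{\mathcal L}(a,c))\circ\mathcal Z(C_2^{\mathcal L}(a,b))\simeq\mathcal Z(C_2^{\mathcal L}(a,b)+C_2^{\mathcal L}(a,c))$ and using the associativity $2$-isomorphisms for $(b,c,a)$, $(b,a,c)$, $(a,b,c)$, agree. (3) For any such data and any choice of inverses there is exactly one anti-symmetric structure $\theta$ on $C_2^{\mathcal L}$ such that the isomorphism $C_2^{\mathcal L}(h,g)+C_2^{\mathcal L}(g,h)\simeq C_2^{\mathcal L}(h,g)+(-C_2^{\mathcal L}(h,g))\simeq e$ given by $\theta$ corresponds,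 under the $2$-isomorphisms of (1), to the identity $C\circ C=\mathrm{id}$ of $\mathcal L_g+\mathcal L_h$. In particular $C_2^{\mathcal L}:Z_2\to\mathcal P$ is an anti-symmetric bimultiplicative $1$-morphism. -/

import Mathlib

open CategoryTheory MonoidalCategory MonoidalLeftAction

universe u v w₁ t₁ w₂ t₂ w₃ t₃ w₄ t₄

namespace PicardTorsor

/-! ### Module categories over a symmetric monoidal category -/

section Swap

variable {P : Type u} [Category.{v} P] [MonoidalCategory P] [SymmetricCategory P]
  {L : Type w₁} [Category.{t₁} L] [MonoidalLeftAction P L]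

/-- The isomorphism `x + (y + v) ≃ y + (x + v)` given by the commutativity constraint of `P`. -/
def swap (x y : P) (v : L) : x ⊙ₗ y ⊙ₗ v ≅ y ⊙ₗ x ⊙ₗ v where
  hom := (αₗ x y v).inv ≫ (β_ x y).hom ⊵ₗ v ≫ (αₗ y x v).hom
  inv := (αₗ y x v).inv ≫ (β_ y x).hom ⊵ₗ v ≫ (αₗ x y v).hom
  hom_inv_id := by simp [← comp_actionHomLeft_assoc]
  inv_hom_id := by simp [← comp_actionHomLeft_assoc]

lemma swap_nat_right (x y : P) {v v' : L} (f : v ⟶ v') :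
    x ⊴ₗ y ⊴ₗ f ≫ (swap x y v').hom = (swap x y v).hom ≫ y ⊴ₗ x ⊴ₗ f := by
  have := action_exchange (β_ x y).hom f
  simp at this
  rw [← cancel_epi (αₗ x y v).hom]
  simp [swap, reassoc_of% this]

lemma swap_nat_left {x x' : P} (f : x ⟶ x') (y : P) (v : L) :
    f ⊵ₗ (y ⊙ₗ v) ≫ (swap x' y v).hom = (swap x y v).hom ≫ y ⊴ₗ f ⊵ₗ v := by
  have : (f ▷ y) ⊵ₗ v ≫ (β_ x' y).hom ⊵ₗ v = (β_ x y).hom ⊵ₗ v ≫ (y ◁ f) ⊵ₗ v := by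
    simp only [← comp_actionHomLeft, BraidedCategory.braiding_naturality_left]
  simp [swap, reassoc_of% this]

lemma swap_nat_mid (x : P) {y y' : P} (f : y ⟶ y') (v : L) :
    x ⊴ₗ f ⊵ₗ v ≫ (swap x y' v).hom = (swap x y v).hom ≫ f ⊵ₗ (x ⊙ₗ v) := by
  have : (x ◁ f) ⊵ₗ v ≫ (β_ x y').hom ⊵ₗ v = (β_ x y).hom ⊵ₗ v ≫ (f ▷ x) ⊵ₗ v := by
    simp only [← comp_actionHomLeft, BraidedCategory.braiding_naturality_right]
  rw [← cancel_epi (αₗ _ _ _).hom]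
  simp at this
  simp [swap, reassoc_of% this]

lemma swap_swap (x y : P) (v : L) : (swap x y v).hom ≫ (swap y x v).hom = 𝟙 _ :=
  (swap x y v).hom_inv_id

lemma swap_hom (x y : P) (v : L) :
    (swap x y v).hom = (αₗ x y v).inv ≫ (β_ x y).hom ⊵ₗ v ≫ (αₗ y x v).hom := rfl

lemma swap_unit (x : P) (v : L) :
    (swap x (𝟙_ P) v).hom = x ⊴ₗ (λₗ v).hom ≫ (λₗ _).inv := by
  have e : (β_ x (𝟙_ P)).hom = (ρ_ x).hom ≫ (λ_ x).inv := by simp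
  have h2 : (λ_ x).inv ⊵ₗ v = (λₗ _).inv ≫ (αₗ _ _ _).inv := by
    rw [← cancel_mono ((λ_ x).hom ⊵ₗ v), inv_hom_actionHomLeft]; simp
  rw [swap_hom, e]
  simp [h2]

lemma braid_act (x y : P) (v : L) :
    (β_ x y).hom ⊵ₗ v = (αₗ x y v).hom ≫ (swap x y v).hom ≫ (αₗ y x v).inv := by
  simp [swap_hom]

lemma assoc_act {P : Type u} [Category.{v} P] [MonoidalCategory P]
    {L : Type w₁} [Category.{t₁} L] [MonoidalLeftAction P L] (x y z : P) (v : L) :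
    (α_ x y z).hom ⊵ₗ v = (αₗ (x ⊗ y) z v).hom ≫ (αₗ x y (z ⊙ₗ v)).hom ≫
      x ⊴ₗ (αₗ y z v).inv ≫ (αₗ x (y ⊗ z) v).inv := by
  rw [← associator_actionHom_assoc]; simp

/-- hexagon -/
lemma swap_mul (x y z : P) (v : L) :
    (swap x (y ⊗ z) v).hom ≫ (αₗ _ _ _).hom = x ⊴ₗ (αₗ _ _ _).hom ≫ (swap x y (z ⊙ₗ v)).hom ≫
      y ⊴ₗ (swap x z v).hom := by
  have h := congrArg (fun f => (αₗ _ _ _).inv ≫ (αₗ _ _ _).inv ≫ f ⊵ₗ v ≫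
    (αₗ _ _ _).hom ≫ _ ⊴ₗ (αₗ _ _ _).hom) (BraidedCategory.hexagon_forward x y z)
  simp only [comp_actionHomLeft, assoc_act, braid_act, whiskerLeft_actionHomLeft,
    whiskerRight_actionHomLeft, Category.assoc, Iso.inv_hom_id_assoc,
    actionHomRight_comp, Category.comp_id,
    actionHomRight_inv_hom_assoc, actionHomRight_inv_hom] at h
  rw [← cancel_epi (x ⊴ₗ (αₗ y z v).inv), h]
  simp

lemma swap_mul' (x y z : P) (v : L) :
    (αₗ _ _ _).hom ≫ x ⊴ₗ (swap y z v).hom ≫ (swap x z (y ⊙ₗ v)).hom =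
      (swap (x ⊗ y) z v).hom ≫ z ⊴ₗ (αₗ x y v).hom := by
  rw [← cancel_epi (swap z (x ⊗ y) v).hom, reassoc_of% (swap_swap z (x ⊗ y) v),
    reassoc_of% (swap_mul z x y v)]
  simp only [← actionHomRight_comp_assoc, swap_swap, actionHomRight_id, Category.id_comp,
    Category.comp_id]

lemma swap_yb (x y z : P) (v : L) :
    (swap x y (z ⊙ₗ v)).hom ≫ y ⊴ₗ (swap x z v).hom ≫ (swap y z (x ⊙ₗ v)).hom =
      x ⊴ₗ (swap y z v).hom ≫ (swap x z (y ⊙ₗ v)).hom ≫ z ⊴ₗ (swap x y v).hom := by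
  have h := swap_nat_mid x (β_ y z).hom v
  simp only [braid_act, actionHomRight_comp, Category.assoc] at h
  have h1 := swap_mul x y z v
  have h2 := swap_mul x z y v
  have h3 : (swap x z (y ⊙ₗ v)).hom ≫ z ⊴ₗ (swap x y v).hom =
      x ⊴ₗ (αₗ z y v).inv ≫ (swap x (z ⊗ y) v).hom ≫ (αₗ z y _).hom := by rw [h2]; simp
  rw [← cancel_epi (x ⊴ₗ (αₗ y z v).hom), ← reassoc_of% h1, h3, reassoc_of% h]
  simp

end Swap

/-! ### The sum of two torsors -/

section Sum

/-- The objects of the sum `L + M` of two `P`-torsors: pairs `(v, w)`. -/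
structure TSum (P : Type u) (L : Type w₁) (M : Type w₂) where
  fst : L
  snd : M

variable {P : Type u} [Category.{v} P] [MonoidalCategory P] [SymmetricCategory P]
  {L : Type w₁} [Category.{t₁} L] [MonoidalLeftAction P L]
  {M : Type w₂} [Category.{t₂} M] [MonoidalLeftAction P M]

namespace TSum

/-- Triples `(x, φ₁, φ₂)` with `φ₁ : v ⟶ x + v'` and `φ₂ : x + w ⟶ w'`. -/
structure PreHom (a b : TSum P L M) where
  shift : P
  left : a.fst ⟶ shift ⊙ₗ b.fst
  right : shift ⊙ₗ a.snd ⟶ b.snd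

/-- `(x, φ₁, φ₂) ∼ (y, ψ₁, ψ₂)` if some `f : x ⟶ y` carries one triple to the other. -/
def PreHom.Rel {a b : TSum P L M} (p q : PreHom a b) : Prop :=
  ∃ f : p.shift ⟶ q.shift, p.left ≫ f ⊵ₗ b.fst = q.left ∧ p.right = f ⊵ₗ a.snd ≫ q.right

/-- Composition of triples; the commutativity constraint of `P` enters through `swap`. -/
def PreHom.comp {a b c : TSum P L M} (p : PreHom a b) (q : PreHom b c) : PreHom a c where
  shift := p.shift ⊗ q.shift
  left := p.left ≫ p.shift ⊴ₗ q.left ≫ (αₗ _ _ _).inv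
  right := (αₗ _ _ _).hom ≫ (swap p.shift q.shift a.snd).hom ≫ q.shift ⊴ₗ p.right ≫ q.right

lemma PreHom.comp_rel_left {a b c : TSum P L M} {p p' : PreHom a b} (h : p.Rel p')
    (q : PreHom b c) : (p.comp q).Rel (p'.comp q) := by
  obtain ⟨f, h1, h2⟩ := h
  refine ⟨f ▷ q.shift, ?_, ?_⟩
  · simp only [comp, whiskerRight_actionHomLeft, Category.assoc, Iso.inv_hom_id_assoc, ← h1]
    simp only [← action_exchange_assoc]
  · simp only [comp, whiskerRight_actionHomLeft, Category.assoc, Iso.inv_hom_id_assoc, h2,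
      reassoc_of% (swap_nat_left f q.shift a.snd), actionHomRight_comp]

lemma PreHom.comp_rel_right {a b c : TSum P L M} (p : PreHom a b) {q q' : PreHom b c}
    (h : q.Rel q') : (p.comp q).Rel (p.comp q') := by
  obtain ⟨f, h1, h2⟩ := h
  refine ⟨p.shift ◁ f, ?_, ?_⟩
  · simp only [comp, whiskerLeft_actionHomLeft, Category.assoc, Iso.inv_hom_id_assoc, ← h1,
      actionHomRight_comp]
  · simp only [comp, whiskerLeft_actionHomLeft, Category.assoc, Iso.inv_hom_id_assoc, h2,
      reassoc_of% (swap_nat_mid p.shift f a.snd), action_exchange_assoc]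

instance : Category (TSum P L M) where
  Hom a b := Quot (PreHom.Rel (P := P) (a := a) (b := b))
  id a := Quot.mk _ ⟨𝟙_ P, (λₗ _).inv, (λₗ _).hom⟩
  comp := Quot.map₂ PreHom.comp (fun p _ _ h => PreHom.comp_rel_right p h)
    (fun _ _ q h => PreHom.comp_rel_left h q)
  id_comp := by
    rintro a b ⟨x, φ, ψ⟩
    refine Quot.sound ⟨(λ_ x).hom, ?_, ?_⟩
    · simp [PreHom.comp]
    · have : (swap (𝟙_ P) x a.snd).hom = (λₗ _).hom ≫ x ⊴ₗ (λₗ _).inv := by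
        rw [← cancel_epi (swap x (𝟙_ P) a.snd).hom, swap_swap, swap_unit]; simp
      simp [PreHom.comp, this]
  comp_id := by
    rintro a b ⟨x, φ, ψ⟩
    refine Quot.sound ⟨(ρ_ x).hom, ?_, ?_⟩
    · simp [PreHom.comp]
    · simp [PreHom.comp, swap_unit]
  assoc := by
    rintro a b c d ⟨x, φ₁, φ₂⟩ ⟨y, ψ₁, ψ₂⟩ ⟨z, χ₁, χ₂⟩
    refine Quot.sound ⟨(α_ x y z).hom, ?_, ?_⟩
    · simp [PreHom.comp, assoc_act]
    · simp only [PreHom.comp, assoc_act, Category.assoc, actionHomRight_comp,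
        Iso.inv_hom_id_assoc, tensor_actionHomRight]
      rw [reassoc_of% (swap_mul x y z a.snd), reassoc_of% (swap_nat_right y z φ₂)]
      simp only [actionHomRight_inv_hom_assoc]
      rw [← reassoc_of% (swap_mul' x y z a.snd), reassoc_of% (swap_yb x y z a.snd)]

/-- The class of a triple. -/
def homMk {a b : TSum P L M} (x : P) (φ : a.fst ⟶ x ⊙ₗ b.fst) (ψ : x ⊙ₗ a.snd ⟶ b.snd) : a ⟶ b :=
  Quot.mk _ ⟨x, φ, ψ⟩

variable (P) in
/-- The morphism of `L + M` given by a morphism of `L` and a morphism of `M`. -/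
def inj {v v' : L} {w w' : M} (f : v ⟶ v') (g : w ⟶ w') : (⟨v, w⟩ : TSum P L M) ⟶ ⟨v', w'⟩ :=
  homMk (𝟙_ P) (f ≫ (λₗ _).inv) ((λₗ _).hom ≫ g)

/-- The canonical morphism `(x + v, w) ⟶ (v, x + w)`. -/
def slide (x : P) (v : L) (w : M) : (⟨x ⊙ₗ v, w⟩ : TSum P L M) ⟶ ⟨v, x ⊙ₗ w⟩ :=
  homMk x (𝟙 _) (𝟙 _)

lemma homMk_eq {a b : TSum P L M} {x y : P} {φ : a.fst ⟶ x ⊙ₗ b.fst} {ψ : x ⊙ₗ a.snd ⟶ b.snd}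
    {φ' : a.fst ⟶ y ⊙ₗ b.fst} {ψ' : y ⊙ₗ a.snd ⟶ b.snd} (f : x ⟶ y)
    (h₁ : φ ≫ f ⊵ₗ b.fst = φ') (h₂ : ψ = f ⊵ₗ a.snd ≫ ψ') : homMk x φ ψ = homMk y φ' ψ' :=
  Quot.sound ⟨f, h₁, h₂⟩

lemma homMk_comp {a b c : TSum P L M} (x y : P) (φ : a.fst ⟶ x ⊙ₗ b.fst) (ψ : x ⊙ₗ a.snd ⟶ b.snd)
    (φ' : b.fst ⟶ y ⊙ₗ c.fst) (ψ' : y ⊙ₗ b.snd ⟶ c.snd) :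
    homMk x φ ψ ≫ homMk y φ' ψ' = homMk (x ⊗ y) (φ ≫ x ⊴ₗ φ' ≫ (αₗ _ _ _).inv)
      ((αₗ _ _ _).hom ≫ (swap x y a.snd).hom ≫ y ⊴ₗ ψ ≫ ψ') := rfl

lemma inj_id (v : L) (w : M) : inj P (𝟙 v) (𝟙 w) = 𝟙 _ := by
  simp only [inj, Category.id_comp, Category.comp_id]; rfl

lemma homMk_inj {a b : TSum P L M} (x : P) (φ : a.fst ⟶ x ⊙ₗ b.fst) (ψ : x ⊙ₗ a.snd ⟶ b.snd)
    {v : L} {w : M} (f : b.fst ⟶ v) (g : b.snd ⟶ w) :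
    homMk x φ ψ ≫ inj P f g = homMk (b := ⟨v, w⟩) x (φ ≫ x ⊴ₗ f) (ψ ≫ g) := by
  refine homMk_eq (ρ_ x).hom ?_ ?_ <;> simp [swap_unit]

lemma inj_homMk {b : TSum P L M} {v v' : L} {w w' : M} (f : v ⟶ v') (g : w ⟶ w') (x : P)
    (φ : v' ⟶ x ⊙ₗ b.fst) (ψ : x ⊙ₗ w' ⟶ b.snd) :
    inj P f g ≫ homMk (a := ⟨v', w'⟩) x φ ψ = homMk (a := ⟨v, w⟩) x (f ≫ φ) (x ⊴ₗ g ≫ ψ) := by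
  have : (swap (𝟙_ P) x w).hom = (λₗ _).hom ≫ x ⊴ₗ (λₗ _).inv := by
    rw [← cancel_epi (swap x (𝟙_ P) w).hom, swap_swap, swap_unit]; simp
  refine homMk_eq (λ_ x).hom ?_ ?_ <;> simp [this]

lemma inj_comp {v v' v'' : L} {w w' w'' : M} (f : v ⟶ v') (g : w ⟶ w') (f' : v' ⟶ v'')
    (g' : w' ⟶ w'') : inj P f g ≫ inj P f' g' = inj P (f ≫ f') (g ≫ g') := by
  conv_lhs => rw [inj]
  rw [homMk_inj, inj]
  congr 1 <;> simp

lemma homMk_factor {v v' : L} {w w' : M} (x : P) (φ : v ⟶ x ⊙ₗ v') (ψ : x ⊙ₗ w ⟶ w') :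
    (homMk x φ ψ : (⟨v, w⟩ : TSum P L M) ⟶ ⟨v', w'⟩) = inj P φ (𝟙 w) ≫ slide x v' w ≫ inj P (𝟙 v') ψ := by
  rw [slide, homMk_inj, inj_homMk]; simp

lemma slide_nat (x : P) {v v' : L} {w w' : M} (f : v ⟶ v') (g : w ⟶ w') :
    inj P (x ⊴ₗ f) g ≫ slide x v' w' = slide x v w ≫ inj P f (x ⊴ₗ g) := by
  rw [slide, slide, homMk_inj, inj_homMk]; simp

lemma slide_natx {x y : P} (f : x ⟶ y) (v : L) (w : M) :
    inj P (f ⊵ₗ v) (𝟙 w) ≫ slide y v w = slide x v w ≫ inj P (𝟙 v) (f ⊵ₗ w) := by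
  rw [slide, slide, homMk_inj, inj_homMk]
  exact (homMk_eq f (by simp) (by simp)).symm

lemma slide_unit (v : L) (w : M) :
    slide (𝟙_ P) v w = inj P (λₗ v).hom (λₗ w).inv :=
  by rw [slide, inj]; simp

lemma slide_mul (x y : P) (v : L) (w : M) :
    slide (x ⊗ y) v w = inj P (αₗ x y v).hom (𝟙 w) ≫ slide x (y ⊙ₗ v) w ≫ slide y v (x ⊙ₗ w) ≫
      inj P (𝟙 v) ((swap y x w).hom ≫ (αₗ x y w).inv) := by
  rw [slide, slide, slide, homMk_inj, homMk_comp, inj_homMk]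
  congr 1
  · simp
  · simp [reassoc_of% (swap_swap x y w)]

end TSum

/-- Data defining a functor out of `L + M`: a functor of two variables `B` together with
isomorphisms `B (x + v, w) ≃ B (v, x + w)`. -/
structure Balanced (P : Type u) [Category.{v} P] [MonoidalCategory P] [SymmetricCategory P]
    (L : Type w₁) [Category.{t₁} L] [MonoidalLeftAction P L]
    (M : Type w₂) [Category.{t₂} M] [MonoidalLeftAction P M]
    (E : Type w₃) [Category.{t₃} E] where
  obj : L → M → E
  map {v v' : L} {w w' : M} (f : v ⟶ v') (g : w ⟶ w') : obj v w ⟶ obj v' w'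
  map_id (v : L) (w : M) : map (𝟙 v) (𝟙 w) = 𝟙 _
  map_comp {v v' v'' : L} {w w' w'' : M} (f : v ⟶ v') (g : w ⟶ w') (f' : v' ⟶ v'')
    (g' : w' ⟶ w'') : map (f ≫ f') (g ≫ g') = map f g ≫ map f' g'
  bal (x : P) (v : L) (w : M) : obj (x ⊙ₗ v) w ⟶ obj v (x ⊙ₗ w)
  bal_nat (x : P) {v v' : L} {w w' : M} (f : v ⟶ v') (g : w ⟶ w') :
    map (x ⊴ₗ f) g ≫ bal x v' w' = bal x v w ≫ map f (x ⊴ₗ g)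
  bal_natx {x y : P} (f : x ⟶ y) (v : L) (w : M) :
    map (f ⊵ₗ v) (𝟙 w) ≫ bal y v w = bal x v w ≫ map (𝟙 v) (f ⊵ₗ w)
  bal_unit (v : L) (w : M) : bal (𝟙_ P) v w = map (λₗ v).hom (λₗ w).inv
  bal_mul (x y : P) (v : L) (w : M) :
    bal (x ⊗ y) v w = map (αₗ x y v).hom (𝟙 w) ≫ bal x (y ⊙ₗ v) w ≫ bal y v (x ⊙ₗ w) ≫
      map (𝟙 v) ((swap y x w).hom ≫ (αₗ x y w).inv)

namespace Balanced

variable {E : Type w₃} [Category.{t₃} E]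

lemma map_comp_left (B : Balanced P L M E) {v v' v'' : L} (f : v ⟶ v') (f' : v' ⟶ v'') (w : M) :
    B.map (f ≫ f') (𝟙 w) = B.map f (𝟙 w) ≫ B.map f' (𝟙 w) := by
  rw [← B.map_comp, Category.comp_id]

/-- The functor out of `L + M` given by balanced data. -/
def desc (B : Balanced P L M E) : TSum P L M ⥤ E where
  obj a := B.obj a.fst a.snd
  map {a b} := Quot.lift (fun p => B.map p.left (𝟙 _) ≫ B.bal p.shift b.fst a.snd ≫ B.map (𝟙 _) p.right) (by
    rintro ⟨x, φ, ψ⟩ ⟨y, φ', ψ'⟩ ⟨f, h₁, h₂⟩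
    dsimp at f h₁ h₂ ⊢
    subst h₁ h₂
    have e1 := B.map_comp φ (𝟙 a.snd) (f ⊵ₗ b.fst) (𝟙 a.snd)
    have e2 := B.map_comp (𝟙 b.fst) (f ⊵ₗ a.snd) (𝟙 b.fst) ψ'
    simp only [Category.comp_id] at e1 e2
    rw [e1, e2, Category.assoc, reassoc_of% (B.bal_natx f)])
  map_id a := by
    change B.map _ _ ≫ B.bal _ _ _ ≫ B.map _ _ = _
    rw [B.bal_unit, ← B.map_comp, ← B.map_comp]
    simp [B.map_id]
  map_comp := by
    rintro a b c ⟨x, φ, ψ⟩ ⟨y, φ', ψ'⟩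
    change B.map _ _ ≫ B.bal _ _ _ ≫ B.map _ _ =
      (B.map _ _ ≫ B.bal _ _ _ ≫ B.map _ _) ≫ B.map _ _ ≫ B.bal _ _ _ ≫ B.map _ _
    dsimp only [TSum.PreHom.comp]
    have n1 := B.bal_nat x φ' (𝟙 a.snd)
    have n2 := B.bal_nat y (𝟙 c.fst) ψ
    rw [actionHomRight_id] at n1 n2
    have e : B.map φ' (𝟙 (x ⊙ₗ a.snd)) ≫ B.map (𝟙 _) ψ = B.map (𝟙 _) ψ ≫ B.map φ' (𝟙 _) := by
      simp [← B.map_comp]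
    rw [B.bal_mul, B.map_comp_left φ, B.map_comp_left (x ⊴ₗ φ')]
    have c1 : B.map (αₗ x y c.fst).inv (𝟙 a.snd) ≫ B.map (αₗ x y c.fst).hom (𝟙 a.snd) = 𝟙 _ := by
      rw [← B.map_comp]; simp [B.map_id]
    have c2 : B.map (𝟙 c.fst) ((swap y x a.snd).hom ≫ (αₗ x y a.snd).inv) ≫
        B.map (𝟙 c.fst) ((αₗ x y a.snd).hom ≫ (swap x y a.snd).hom ≫ y ⊴ₗ ψ ≫ ψ') =
        B.map (𝟙 c.fst) (y ⊴ₗ ψ) ≫ B.map (𝟙 c.fst) ψ' := by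
      rw [← B.map_comp, ← B.map_comp]
      simp [reassoc_of% (swap_swap y x a.snd)]
    simp only [Category.assoc]
    rw [reassoc_of% c1, c2, ← reassoc_of% n2, reassoc_of% n1, ← reassoc_of% e]

lemma desc_inj (B : Balanced P L M E) {v v' : L} {w w' : M} (f : v ⟶ v') (g : w ⟶ w') :
    B.desc.map (TSum.inj P f g) = B.map f g := by
  change B.map _ _ ≫ B.bal _ _ _ ≫ B.map _ _ = _
  rw [B.bal_unit, ← B.map_comp, ← B.map_comp]
  simp

lemma desc_slide (B : Balanced P L M E) (x : P) (v : L) (w : M) :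
    B.desc.map (TSum.slide x v w) = B.bal x v w := by
  change B.map _ _ ≫ B.bal _ _ _ ≫ B.map _ _ = _
  simp only [B.map_id]; simp

end Balanced

end Sum

section Action

variable {P : Type u} [Category.{v} P] [MonoidalCategory P] [SymmetricCategory P]
  {L : Type w₁} [Category.{t₁} L] [MonoidalLeftAction P L]
  {M : Type w₂} [Category.{t₂} M] [MonoidalLeftAction P M]
  {E : Type w₃} [Category.{t₃} E]

lemma TSum.inj_comp' {v v' v'' : L} {w w' w'' : M} {c : TSum P L M} (f : v ⟶ v') (g : w ⟶ w')
    (f' : v' ⟶ v'') (g' : w' ⟶ w'') (h : ⟨v'', w''⟩ ⟶ c) :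
    inj P f g ≫ inj P f' g' ≫ h = inj P (f ≫ f') (g ≫ g') ≫ h := by
  rw [← inj_comp, Category.assoc]

lemma TSum.slide_nat' {c : TSum P L M} (x : P) {v v' : L} {w w' : M} (f : v ⟶ v') (g : w ⟶ w')
    (h : ⟨v', x ⊙ₗ w'⟩ ⟶ c) :
    slide x v w ≫ inj P f (x ⊴ₗ g) ≫ h = inj P (x ⊴ₗ f) g ≫ slide x v' w' ≫ h := by
  rw [← Category.assoc, ← slide_nat, Category.assoc]

lemma TSum.slide_nat_left {c : TSum P L M} (x : P) {v v' : L} {w : M} (f : v ⟶ v')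
    (h : ⟨v', x ⊙ₗ w⟩ ⟶ c) :
    slide x v w ≫ inj P f (𝟙 _) ≫ h = inj P (x ⊴ₗ f) (𝟙 _) ≫ slide x v' w ≫ h := by
  rw [← slide_nat', actionHomRight_id]

lemma TSum.inj_comp_id {v v' v'' : L} (f : v ⟶ v') (f' : v' ⟶ v'') (w : M) :
    inj P f (𝟙 w) ≫ inj P f' (𝟙 w) = inj P (f ≫ f') (𝟙 w) := by
  rw [inj_comp, Category.comp_id]

/-- The functor `(v, w) ↦ (x + v, w)`. -/
def TSum.act (x : P) : Balanced P L M (TSum P L M) where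
  obj v w := ⟨x ⊙ₗ v, w⟩
  map f g := inj P (x ⊴ₗ f) g
  map_id v w := by simp [inj_id]
  map_comp f g f' g' := by simp [inj_comp]
  bal y v w := inj P (swap x y v).hom (𝟙 w) ≫ slide y (x ⊙ₗ v) w
  bal_nat y v v' w w' f g := by
    rw [← Category.assoc, inj_comp, Category.assoc, ← slide_nat, ← Category.assoc, inj_comp,
      swap_nat_right]
    simp
  bal_natx f v w := by
    rw [← Category.assoc, inj_comp, Category.assoc, actionHomRight_id, ← slide_natx,
      ← Category.assoc, inj_comp, swap_nat_mid]
  bal_unit v w := by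
    rw [slide_unit, inj_comp, swap_unit]; simp
  bal_mul y z v w := by
    rw [slide_mul]
    simp only [Category.assoc, inj_comp', slide_nat_left, swap_mul, actionHomRight_id,
      Category.id_comp]

/-- Induction on morphisms of `L + M`. -/
lemma TSum.hom_ind {motive : ∀ {a b : TSum P L M}, (a ⟶ b) → Prop}
    (h₁ : ∀ {v v' : L} {w w' : M} (f : v ⟶ v') (g : w ⟶ w'), motive (inj P f g))
    (h₂ : ∀ (x : P) (v : L) (w : M), motive (slide x v w))
    (h₃ : ∀ {a b c : TSum P L M} (φ : a ⟶ b) (ψ : b ⟶ c), motive φ → motive ψ → motive (φ ≫ ψ))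
    {a b : TSum P L M} (φ : a ⟶ b) : motive φ := by
  obtain ⟨v, w⟩ := a
  obtain ⟨v', w'⟩ := b
  obtain ⟨x, φ, ψ⟩ := φ
  change motive (homMk x φ ψ)
  rw [homMk_factor]
  exact h₃ _ _ (h₁ _ _) (h₃ _ _ (h₂ _ _ _) (h₁ _ _))

/-- The action of an object of `P` on morphisms of `L + M`. -/
def TSum.actMap (x : P) {a b : TSum P L M} (φ : a ⟶ b) :
    (⟨x ⊙ₗ a.fst, a.snd⟩ : TSum P L M) ⟶ ⟨x ⊙ₗ b.fst, b.snd⟩ := (act x).desc.map φ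

lemma TSum.actMap_inj (x : P) {v v' : L} {w w' : M} (f : v ⟶ v') (g : w ⟶ w') :
    actMap x (inj P f g) = inj P (x ⊴ₗ f) g := Balanced.desc_inj _ _ _

lemma TSum.actMap_slide (x y : P) (v : L) (w : M) :
    actMap x (slide y v w) = inj P (swap x y v).hom (𝟙 w) ≫ slide y (x ⊙ₗ v) w :=
  Balanced.desc_slide _ _ _ _

lemma TSum.actMap_comp (x : P) {a b c : TSum P L M} (φ : a ⟶ b) (ψ : b ⟶ c) :
    actMap x (φ ≫ ψ) = actMap x φ ≫ actMap x ψ := (act x).desc.map_comp φ ψ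

lemma TSum.actMap_nat {x y : P} (f : x ⟶ y) {a b : TSum P L M} (φ : a ⟶ b) :
    actMap x φ ≫ inj P (f ⊵ₗ b.fst) (𝟙 b.snd) =
      inj P (f ⊵ₗ a.fst) (𝟙 a.snd) ≫ actMap y φ := by
  induction φ using hom_ind with
  | h₁ g h => rw [actMap_inj, actMap_inj, inj_comp, inj_comp, action_exchange]; simp
  | h₂ z v w =>
    have := slide_nat_left z (f ⊵ₗ v) (w := w) (𝟙 _)
    simp only [Category.comp_id] at this
    rw [actMap_slide, actMap_slide, inj_comp', Category.assoc, this, inj_comp', swap_nat_left]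
  | h₃ φ ψ h₁ h₂ => rw [actMap_comp, actMap_comp, Category.assoc, h₂, reassoc_of% h₁]

lemma TSum.actMap_assoc (x y : P) {a b : TSum P L M} (φ : a ⟶ b) :
    actMap (x ⊗ y) φ ≫ inj P (αₗ x y b.fst).hom (𝟙 b.snd) =
      inj P (αₗ x y a.fst).hom (𝟙 a.snd) ≫ actMap x (actMap y φ) := by
  induction φ using hom_ind with
  | h₁ g h => rw [actMap_inj, actMap_inj, actMap_inj, inj_comp, inj_comp]; simp
  | h₂ z v w =>
    have := slide_nat_left z (αₗ x y v).hom (w := w) (𝟙 _)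
    simp only [Category.comp_id] at this
    rw [actMap_slide, actMap_slide, actMap_comp, actMap_inj, actMap_slide, Category.assoc,
      this, inj_comp', inj_comp', inj_comp', ← swap_mul']
    simp
  | h₃ φ ψ h₁ h₂ => simp only [actMap_comp, Category.assoc]; rw [h₂, reassoc_of% h₁]

lemma TSum.actMap_unit {a b : TSum P L M} (φ : a ⟶ b) :
    actMap (𝟙_ P) φ ≫ inj P (λₗ b.fst).hom (𝟙 b.snd) =
      inj P (λₗ a.fst).hom (𝟙 a.snd) ≫ φ := by
  induction φ using hom_ind with
  | h₁ g h => rw [actMap_inj, inj_comp (P := P), inj_comp (P := P)]; simp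
  | h₂ z v w =>
    have h1 := slide_nat_left z (λₗ[P] v).hom (w := w) (𝟙 _)
    have h2 : (swap (𝟙_ P) z v).hom ≫ z ⊴ₗ (λₗ[P] v).hom = (λₗ[P] _).hom := by
      rw [← cancel_epi (swap z (𝟙_ P) v).hom, reassoc_of% (swap_swap z (𝟙_ P) v), swap_unit]; simp
    simp only [Category.comp_id] at h1
    rw [actMap_slide, Category.assoc, h1, inj_comp', h2, Category.comp_id]
  | h₃ φ ψ h₁ h₂ => simp only [actMap_comp, Category.assoc]; rw [h₂, reassoc_of% h₁]

/-- The action of `P` on `L + M` is `x + (v, w) = (x + v, w)`. -/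
instance : MonoidalLeftActionStruct P (TSum P L M) where
  actionObj x a := ⟨x ⊙ₗ a.fst, a.snd⟩
  actionHomLeft f a := TSum.inj P (f ⊵ₗ a.fst) (𝟙 a.snd)
  actionHomRight x _ _ φ := TSum.actMap x φ
  actionAssocIso x y a :=
    { hom := TSum.inj P (αₗ x y a.fst).hom (𝟙 _)
      inv := TSum.inj P (αₗ x y a.fst).inv (𝟙 _)
      hom_inv_id := by rw [TSum.inj_comp]; simp [TSum.inj_id]
      inv_hom_id := by rw [TSum.inj_comp]; simp [TSum.inj_id] }
  actionUnitIso a :=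
    { hom := TSum.inj P (λₗ a.fst).hom (𝟙 _)
      inv := TSum.inj P (λₗ a.fst).inv (𝟙 _)
      hom_inv_id := by rw [TSum.inj_comp]; simp [TSum.inj_id]
      inv_hom_id := by rw [TSum.inj_comp]; simp [TSum.inj_id] }

instance : MonoidalLeftAction P (TSum P L M) where
  actionHom_def _ _ := rfl
  actionHomRight_id x a := (TSum.act x).desc.map_id a
  id_actionHomLeft x a := by
    change TSum.inj P (𝟙 x ⊵ₗ a.fst) (𝟙 a.snd) = 𝟙 _
    rw [id_actionHomLeft]; exact TSum.inj_id _ _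
  actionHom_comp {x y z a b c} f₁ f₂ g₁ g₂ := by
    change TSum.inj P ((f₁ ≫ f₂) ⊵ₗ a.fst) (𝟙 a.snd) ≫ TSum.actMap z (g₁ ≫ g₂) =
      (TSum.inj P (f₁ ⊵ₗ a.fst) (𝟙 a.snd) ≫ TSum.actMap y g₁) ≫
        TSum.inj P (f₂ ⊵ₗ b.fst) (𝟙 b.snd) ≫ TSum.actMap z g₂
    rw [TSum.actMap_comp, Category.assoc, reassoc_of% (TSum.actMap_nat f₂ g₁), TSum.inj_comp',
      comp_actionHomLeft, Category.comp_id]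
  actionAssocIso_hom_naturality {x x' y y' a a'} f g h := by
    change (TSum.inj P ((f ⊗ₘ g) ⊵ₗ a.fst) (𝟙 a.snd) ≫ TSum.actMap (x' ⊗ y') h) ≫
        TSum.inj P (αₗ x' y' a'.fst).hom (𝟙 a'.snd) =
      TSum.inj P (αₗ x y a.fst).hom (𝟙 a.snd) ≫ TSum.inj P (f ⊵ₗ (y ⊙ₗ a.fst)) (𝟙 a.snd) ≫
        TSum.actMap x' (TSum.inj P (g ⊵ₗ a.fst) (𝟙 a.snd) ≫ TSum.actMap y' h)
    rw [Category.assoc, TSum.actMap_assoc, TSum.actMap_comp, TSum.actMap_inj, TSum.inj_comp',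
      TSum.inj_comp', TSum.inj_comp']
    have := actionAssocIso_hom_naturality f g (𝟙 a.fst)
    simp only [actionHom_id] at this
    rw [this, actionHom_def]
    simp
  actionUnitIso_hom_naturality f := (TSum.actMap_unit f).symm
  whiskerLeft_actionHomLeft x y z f a := by
    change TSum.inj P _ _ = TSum.inj P _ _ ≫ TSum.actMap _ (TSum.inj P _ _) ≫ TSum.inj P _ _
    rw [TSum.actMap_inj, TSum.inj_comp, TSum.inj_comp, whiskerLeft_actionHomLeft]
    simp
  whiskerRight_actionHomLeft x f a := by
    refine (congrArg (fun t => TSum.inj P t (𝟙 a.snd))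
      (whiskerRight_actionHomLeft x f a.fst)).trans ?_
    rw [← TSum.inj_comp_id, ← TSum.inj_comp_id]; rfl
  associator_actionHom x y z a := by
    refine Eq.trans ?_ ((congrArg (fun t => TSum.inj P t (𝟙 a.snd))
      (associator_actionHom x y z a.fst)).trans ?_)
    · rw [← TSum.inj_comp_id, ← TSum.inj_comp_id]
      congr 2
      exact TSum.actMap_inj _ _ _
    · rw [← TSum.inj_comp_id]; rfl
  leftUnitor_actionHom x a := by
    refine (congrArg (fun t => TSum.inj P t (𝟙 a.snd)) (leftUnitor_actionHom x a.fst)).trans ?_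
    rw [← TSum.inj_comp_id]; rfl
  rightUnitor_actionHom x a := by
    change TSum.inj P _ _ = TSum.inj P _ _ ≫ TSum.actMap _ (TSum.inj P _ _)
    rw [TSum.actMap_inj, TSum.inj_comp, rightUnitor_actionHom]
    simp

end Action

/-- A Picard groupoid: a symmetric monoidal groupoid in which every functor `y ↦ x + y` is an
equivalence. -/
class PicardGroupoid (P : Type u) [Category.{v} P] [MonoidalCategory P] [SymmetricCategory P] :
    Prop extends IsGroupoid P where
  tensorLeft_isEquivalence (x : P) : (tensorLeft x).IsEquivalence

attribute [instance] PicardGroupoid.tensorLeft_isEquivalence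

/-- A torsor under a Picard groupoid `P`: a nonempty module category `L` over `P` such that all
the functors `v ↦ x + v` and `x ↦ x + v` are equivalences. -/
class IsTorsor (P : Type u) [Category.{v} P] [MonoidalCategory P]
    (L : Type w₁) [Category.{t₁} L] [MonoidalLeftAction P L] : Prop where
  nonempty : Nonempty L
  actionLeft_isEquivalence (x : P) : (actionLeft L x).IsEquivalence
  actionRight_isEquivalence (v : L) : (actionRight P v).IsEquivalence

/-- A `1`-morphism of module categories over `P`: a functor `F` together with natural isomorphisms
`F (x + v) ≃ x + F v` compatible with the associativity constraints. Between torsors, every such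
functor is an equivalence. -/
structure TorsorHom (P : Type u) [Category.{v} P] [MonoidalCategory P]
    (L : Type w₁) [Category.{t₁} L] [MonoidalLeftAction P L]
    (M : Type w₂) [Category.{t₂} M] [MonoidalLeftAction P M] where
  functor : L ⥤ M
  lin (x : P) (v : L) : functor.obj (x ⊙ₗ v) ≅ x ⊙ₗ functor.obj v
  lin_nat_left {x y : P} (f : x ⟶ y) (v : L) :
    functor.map (f ⊵ₗ v) ≫ (lin y v).hom = (lin x v).hom ≫ f ⊵ₗ functor.obj v
  lin_nat_right (x : P) {v w : L} (f : v ⟶ w) :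
    functor.map (x ⊴ₗ f) ≫ (lin x w).hom = (lin x v).hom ≫ x ⊴ₗ functor.map f
  lin_assoc (x y : P) (v : L) :
    (lin (x ⊗ y) v).hom ≫ (αₗ x y (functor.obj v)).hom =
      functor.map (αₗ x y v).hom ≫ (lin x (y ⊙ₗ v)).hom ≫ x ⊴ₗ (lin y v).hom

section Hom

variable {P : Type u} [Category.{v} P] [MonoidalCategory P]
  {L : Type w₁} [Category.{t₁} L] [MonoidalLeftAction P L]
  {M : Type w₂} [Category.{t₂} M] [MonoidalLeftAction P M]
  {N : Type w₃} [Category.{t₃} N] [MonoidalLeftAction P N]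

/-- A `2`-morphism between `1`-morphisms of torsors; as torsors are groupoids, all of them are
isomorphisms. -/
structure TorsorHom.Iso₂ (F G : TorsorHom P L M) where
  iso : F.functor ≅ G.functor
  comm (x : P) (v : L) :
    (F.lin x v).hom ≫ x ⊴ₗ iso.hom.app v = iso.hom.app (x ⊙ₗ v) ≫ (G.lin x v).hom

/-- The isomorphism `x + v ≃ x + w` induced by `v ≃ w`. -/
def actIso (x : P) {v w : L} (e : v ≅ w) : x ⊙ₗ v ≅ x ⊙ₗ w where
  hom := x ⊴ₗ e.hom
  inv := x ⊴ₗ e.inv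

namespace TorsorHom

lemma lin_unit (F : TorsorHom P L M) (v : L) :
    (F.lin (𝟙_ P) v).hom ≫ (λₗ _).hom = F.functor.map (λₗ v).hom := by
  have h1 := F.lin_assoc (𝟙_ P) (𝟙_ P) v
  have h2 := F.lin_nat_left (λ_ (𝟙_ P)).hom v
  rw [leftUnitor_actionHom, leftUnitor_actionHom, F.functor.map_comp, Category.assoc] at h2
  rw [reassoc_of% h1, cancel_epi] at h2
  have h3 : F.functor.map (λₗ[P] (𝟙_ P ⊙ₗ v)).hom = (F.lin (𝟙_ P) (𝟙_ P ⊙ₗ v)).hom ≫ (λₗ _).hom := by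
    rw [← cancel_mono (F.lin (𝟙_ P) v).hom, h2, Category.assoc, actionUnitIso_hom_naturality]
  have h4 := F.lin_nat_right (𝟙_ P) (λₗ[P] v).hom
  rw [← cancel_epi (F.functor.map (𝟙_ P ⊴ₗ (λₗ[P] v).hom)), reassoc_of% h4,
    ← actionUnitIso_hom_naturality, ← reassoc_of% h3, ← F.functor.map_comp, ← F.functor.map_comp,
    actionUnitIso_hom_naturality]

variable (P L) in
/-- The identity `1`-morphism. -/
def id : TorsorHom P L L where
  functor := 𝟭 L
  lin _ _ := Iso.refl _
  lin_nat_left _ _ := by simp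
  lin_nat_right _ _ := by simp
  lin_assoc _ _ _ := by simp

/-- Composition of `1`-morphisms. -/
def comp (F : TorsorHom P L M) (G : TorsorHom P M N) : TorsorHom P L N where
  functor := F.functor ⋙ G.functor
  lin x v := G.functor.mapIso (F.lin x v) ≪≫ G.lin x (F.functor.obj v)
  lin_nat_left f v := by
    simp only [Functor.comp_obj, Functor.comp_map, Iso.trans_hom, Functor.mapIso_hom,
      Category.assoc, ← G.lin_nat_left, ← Functor.map_comp_assoc, F.lin_nat_left]
  lin_nat_right x v w f := by
    simp only [Functor.comp_obj, Functor.comp_map, Iso.trans_hom, Functor.mapIso_hom,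
      Category.assoc, ← G.lin_nat_right, ← Functor.map_comp_assoc, F.lin_nat_right]
  lin_assoc x y v := by
    simp only [Functor.comp_obj, Functor.comp_map, Iso.trans_hom, Functor.mapIso_hom,
      Category.assoc, G.lin_assoc, ← Functor.map_comp_assoc, F.lin_assoc]
    simp only [Functor.map_comp, Category.assoc, actionHomRight_comp]
    rw [reassoc_of% (G.lin_nat_right x (F.lin y v).hom)]

/-- The counit `F (F⁻¹ v) ≃ v`. -/
noncomputable def counit (F : TorsorHom P L M) [F.functor.IsEquivalence] (v : M) :
    F.functor.obj (F.functor.inv.obj v) ≅ v := F.functor.asEquivalence.counitIso.app v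

lemma counit_nat (F : TorsorHom P L M) [F.functor.IsEquivalence] {v w : M} (f : v ⟶ w) :
    F.functor.map (F.functor.inv.map f) ≫ (F.counit w).hom = (F.counit v).hom ≫ f :=
  F.functor.asEquivalence.counitIso.hom.naturality f

/-- The structure isomorphism of `F⁻¹`: it is the isomorphism whose image under `F` corresponds
to the structure isomorphism of `F`. -/
noncomputable def invLin (F : TorsorHom P L M) [F.functor.IsEquivalence] (x : P) (v : M) :
    F.functor.inv.obj (x ⊙ₗ v) ≅ x ⊙ₗ F.functor.inv.obj v :=
  F.functor.preimageIso (F.counit (x ⊙ₗ v) ≪≫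
    actIso x (F.counit v).symm ≪≫ (F.lin x (F.functor.inv.obj v)).symm)

lemma map_invLin (F : TorsorHom P L M) [F.functor.IsEquivalence] (x : P) (v : M) :
    F.functor.map (F.invLin x v).hom ≫ (F.lin x _).hom ≫ x ⊴ₗ (F.counit v).hom =
      (F.counit (x ⊙ₗ v)).hom := by
  simp [invLin, actIso]

lemma inv_ext (F : TorsorHom P L M) [F.functor.IsEquivalence] {x : P} {u : L} {v : M}
    {f g : u ⟶ x ⊙ₗ F.functor.inv.obj v}
    (h : F.functor.map f ≫ (F.lin x _).hom ≫ x ⊴ₗ (F.counit v).hom =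
      F.functor.map g ≫ (F.lin x _).hom ≫ x ⊴ₗ (F.counit v).hom) : f = g := by
  apply F.functor.map_injective
  rwa [← cancel_mono ((F.lin x _).hom ≫ x ⊴ₗ (F.counit v).hom)]

/-- The quasi-inverse of a `1`-morphism whose underlying functor is an equivalence. -/
noncomputable def inv (F : TorsorHom P L M) [F.functor.IsEquivalence] : TorsorHom P M L where
  functor := F.functor.inv
  lin := F.invLin
  lin_nat_left {x y} f v := by
    apply F.inv_ext
    rw [F.functor.map_comp, Category.assoc, F.map_invLin, F.counit_nat, F.functor.map_comp,
      Category.assoc, reassoc_of% (F.lin_nat_left f), ← action_exchange, reassoc_of% F.map_invLin]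
  lin_nat_right x v w f := by
    apply F.inv_ext
    rw [F.functor.map_comp, Category.assoc, F.map_invLin, F.counit_nat, F.functor.map_comp,
      Category.assoc, reassoc_of% (F.lin_nat_right x), ← actionHomRight_comp, F.counit_nat,
      actionHomRight_comp, reassoc_of% F.map_invLin]
  lin_assoc x y v := by
    rw [← Iso.eq_comp_inv]
    apply F.inv_ext
    have h : F.functor.map (αₗ x y (F.functor.inv.obj v)).inv ≫ (F.lin (x ⊗ y) _).hom =
        (F.lin x _).hom ≫ x ⊴ₗ (F.lin y _).hom ≫ (αₗ _ _ _).inv := by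
      rw [← cancel_mono (αₗ _ _ _).hom, Category.assoc, F.lin_assoc, ← Functor.map_comp_assoc]
      simp
    simp only [F.functor.map_comp, Category.assoc]
    rw [F.map_invLin, reassoc_of% h, tensor_actionHomRight, Iso.inv_hom_id_assoc,
      reassoc_of% (F.lin_nat_right x), ← actionHomRight_comp_assoc, ← actionHomRight_comp_assoc,
      Category.assoc, F.map_invLin, reassoc_of% F.map_invLin, reassoc_of% F.counit_nat]
    simp

end TorsorHom

end Hom

section SumHom

variable {P : Type u} [Category.{v} P] [MonoidalCategory P] [SymmetricCategory P]
  {L : Type w₁} [Category.{t₁} L] [MonoidalLeftAction P L]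
  {M : Type w₂} [Category.{t₂} M] [MonoidalLeftAction P M]
  {L' : Type w₃} [Category.{t₃} L'] [MonoidalLeftAction P L']
  {M' : Type w₄} [Category.{t₄} M'] [MonoidalLeftAction P M']

/-- `z + id`, with the structure isomorphism given by the commutativity constraint of `P`. -/
def TorsorHom.translation (z : P) : TorsorHom P L L where
  functor := actionLeft L z
  lin x v := swap z x v
  lin_nat_left f v := swap_nat_mid z f v
  lin_nat_right x _ _ f := swap_nat_right z x f
  lin_assoc x y v := swap_mul z x y v

lemma swap_tsum (x y : P) (a : TSum P L M) :
    (swap x y a).hom = TSum.inj P (swap x y a.fst).hom (𝟙 a.snd) := by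
  rw [swap_hom, swap_hom, ← TSum.inj_comp_id, ← TSum.inj_comp_id]; rfl

lemma TorsorHom.lin_swap (F : TorsorHom P L M) (x y : P) (v : L) :
    F.functor.map (swap x y v).hom ≫ (F.lin y (x ⊙ₗ v)).hom ≫ y ⊴ₗ (F.lin x v).hom =
      (F.lin x (y ⊙ₗ v)).hom ≫ x ⊴ₗ (F.lin y v).hom ≫ (swap x y _).hom := by
  rw [swap_hom, swap_hom]
  rw [← cancel_epi (F.functor.map (αₗ x y v).hom), ← reassoc_of% (F.lin_assoc x y v)]
  simp only [Functor.map_comp, Category.assoc, ← F.lin_assoc, Iso.hom_inv_id_assoc]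
  rw [reassoc_of% (F.lin_nat_left (β_ x y).hom v), ← Functor.map_comp_assoc]
  simp

/-- Balanced data for `F + G`. -/
def sumMap (F : TorsorHom P L L') (G : TorsorHom P M M') : Balanced P L M (TSum P L' M') where
  obj v w := ⟨F.functor.obj v, G.functor.obj w⟩
  map f g := TSum.inj P (F.functor.map f) (G.functor.map g)
  map_id v w := by simp [TSum.inj_id]
  map_comp f g f' g' := by simp [TSum.inj_comp]
  bal x v w := TSum.inj P (F.lin x v).hom (𝟙 _) ≫ TSum.slide x _ _ ≫
    TSum.inj P (𝟙 _) (G.lin x w).inv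
  bal_nat x v v' w w' f g := by
    have h : G.functor.map (x ⊴ₗ g) = (G.lin x w).hom ≫ x ⊴ₗ G.functor.map g ≫ (G.lin x w').inv := by
      rw [← reassoc_of% (G.lin_nat_right x g)]; simp
    rw [TSum.inj_comp', F.lin_nat_right, Category.assoc, Category.assoc, TSum.inj_comp, h]
    simp only [Category.comp_id, Category.id_comp, Iso.inv_hom_id_assoc]
    have := TSum.slide_nat' x (F.functor.map f) (G.functor.map g) (TSum.inj P (𝟙 _) (G.lin x w').inv)
    rw [TSum.inj_comp, Category.comp_id] at this
    rw [this, TSum.inj_comp']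
    simp
  bal_natx {x y} f v w := by
    have h : G.functor.map (f ⊵ₗ w) = (G.lin x w).hom ≫ f ⊵ₗ G.functor.obj w ≫ (G.lin y w).inv := by
      rw [← reassoc_of% (G.lin_nat_left f w)]; simp
    have h2 := TSum.slide_natx f (F.functor.obj v) (G.functor.obj w)
    rw [TSum.inj_comp', F.lin_nat_left, CategoryTheory.Functor.map_id, ← TSum.inj_comp, Category.assoc,
      reassoc_of% h2, TSum.inj_comp, Category.assoc, Category.assoc, TSum.inj_comp, h]
    simp
  bal_unit v w := by
    have h : (λₗ (G.functor.obj w)).inv ≫ (G.lin (𝟙_ P) w).inv = G.functor.map (λₗ[P] w).inv := by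
      rw [← cancel_mono (G.functor.map (λₗ[P] w).hom), Category.assoc, ← Functor.map_comp,
        ← G.lin_unit]
      simp
    rw [TSum.slide_unit, TSum.inj_comp, TSum.inj_comp, h]
    simp [F.lin_unit]
  bal_mul x y v w := by
    have h : (swap y x (G.functor.obj w)).hom ≫ (αₗ x y _).inv ≫ (G.lin (x ⊗ y) w).inv =
        y ⊴ₗ (G.lin x w).inv ≫ (G.lin y _).inv ≫ G.functor.map (swap y x w).hom ≫
          G.functor.map (αₗ x y w).inv := by
      have hA : (αₗ x y _).inv ≫ (G.lin (x ⊗ y) w).inv =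
          x ⊴ₗ (G.lin y w).inv ≫ (G.lin x _).inv ≫ G.functor.map (αₗ x y w).inv := by
        have key : (G.lin (x ⊗ y) w).hom ≫ (αₗ x y _).hom ≫ x ⊴ₗ (G.lin y w).inv ≫ (G.lin x _).inv ≫
            G.functor.map (αₗ x y w).inv = 𝟙 _ := by
          rw [reassoc_of% (G.lin_assoc x y w)]; simp
        rw [← cancel_epi (αₗ x y (G.functor.obj w)).hom, ← cancel_epi (G.lin (x ⊗ y) w).hom, key]
        simp
      have hB := G.lin_swap y x w
      rw [hA, ← cancel_epi (y ⊴ₗ (G.lin x w).hom), ← cancel_epi (G.lin y _).hom, ← reassoc_of% hB]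
      simp
    have h2 := TSum.slide_nat' x (F.lin y v).hom (𝟙 (G.functor.obj w))
      (TSum.inj P (𝟙 _) (G.lin x w).inv ≫ TSum.slide y (F.functor.obj v) _)
    have h3 := TSum.slide_nat y (𝟙 (F.functor.obj v)) (G.lin x w).inv
    rw [actionHomRight_id] at h2 h3
    simp only [TSum.slide_mul, Category.assoc, TSum.inj_comp, TSum.inj_comp', Functor.map_comp,
      CategoryTheory.Functor.map_id, Category.comp_id, Category.id_comp] at h2 ⊢
    rw [h, reassoc_of% h2, reassoc_of% h3, TSum.inj_comp', TSum.inj_comp, F.lin_assoc x y v]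
    simp

/-- A `1`-morphism out of `L + M` from balanced data with structure isomorphisms. -/
def Balanced.hom (B : Balanced P L M L')
    (lin : ∀ (x : P) (v : L) (w : M), B.obj (x ⊙ₗ v) w ≅ x ⊙ₗ B.obj v w)
    (h₁ : ∀ {x y : P} (f : x ⟶ y) (v : L) (w : M),
      B.map (f ⊵ₗ v) (𝟙 w) ≫ (lin y v w).hom = (lin x v w).hom ≫ f ⊵ₗ B.obj v w)
    (h₂ : ∀ (x : P) {v v' : L} {w w' : M} (f : v ⟶ v') (g : w ⟶ w'),
      B.map (x ⊴ₗ f) g ≫ (lin x v' w').hom = (lin x v w).hom ≫ x ⊴ₗ B.map f g)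
    (h₃ : ∀ (x y : P) (v : L) (w : M),
      B.map (swap x y v).hom (𝟙 w) ≫ B.bal y (x ⊙ₗ v) w ≫ (lin x v (y ⊙ₗ w)).hom =
        (lin x (y ⊙ₗ v) w).hom ≫ x ⊴ₗ B.bal y v w)
    (h₄ : ∀ (x y : P) (v : L) (w : M), (lin (x ⊗ y) v w).hom ≫ (αₗ x y _).hom =
      B.map (αₗ x y v).hom (𝟙 w) ≫ (lin x (y ⊙ₗ v) w).hom ≫ x ⊴ₗ (lin y v w).hom) :
    TorsorHom P (TSum P L M) L' where
  functor := B.desc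
  lin x a := lin x a.fst a.snd
  lin_nat_left f a := by
    refine Eq.trans ?_ (h₁ f a.fst a.snd)
    exact congrArg (· ≫ (lin _ a.fst a.snd).hom) (B.desc_inj _ _)
  lin_nat_right x a b φ := by
    change B.desc.map (TSum.actMap x φ) ≫ (lin x b.fst b.snd).hom =
      (lin x a.fst a.snd).hom ≫ x ⊴ₗ B.desc.map φ
    induction φ using TSum.hom_ind with
    | h₁ f g => rw [TSum.actMap_inj, B.desc_inj, B.desc_inj]; exact h₂ x f g
    | h₂ y v w =>
      rw [TSum.actMap_slide, B.desc_slide, B.desc.map_comp, B.desc_inj, B.desc_slide]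
      exact (Category.assoc _ _ _).trans (h₃ x y v w)
    | h₃ φ ψ hφ hψ =>
      rw [TSum.actMap_comp, B.desc.map_comp, B.desc.map_comp]
      refine (Category.assoc _ _ _).trans ?_
      refine (congrArg _ hψ).trans ?_
      refine (Category.assoc _ _ _).symm.trans ?_
      refine (congrArg (· ≫ _) hφ).trans ((Category.assoc _ _ _).trans ?_)
      exact congrArg _ (actionHomRight_comp _ _ _).symm
  lin_assoc x y a := by
    refine (h₄ x y a.fst a.snd).trans ?_
    exact congrArg (· ≫ (lin x (y ⊙ₗ a.fst) a.snd).hom ≫ x ⊴ₗ (lin y a.fst a.snd).hom)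
      (B.desc_inj _ _).symm

variable (P) in
/-- The isomorphism `(v, w) ≃ (v', w)` given by `v ≃ v'`. -/
def TSum.injIso {v v' : L} (e : v ≅ v') (w : M) : (⟨v, w⟩ : TSum P L M) ≅ ⟨v', w⟩ where
  hom := inj P e.hom (𝟙 w)
  inv := inj P e.inv (𝟙 w)
  hom_inv_id := by rw [TSum.inj_comp]; simp [TSum.inj_id]
  inv_hom_id := by rw [TSum.inj_comp]; simp [TSum.inj_id]

/-- The `1`-morphism `F + G`. -/
def TorsorHom.add (F : TorsorHom P L L') (G : TorsorHom P M M') :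
    TorsorHom P (TSum P L M) (TSum P L' M') :=
  (sumMap F G).hom (fun x v w => TSum.injIso P (F.lin x v) (G.functor.obj w))
    (fun {x y} f v w => by
      change TSum.inj P (F.functor.map (f ⊵ₗ v)) (G.functor.map (𝟙 w)) ≫
        TSum.inj P (F.lin y v).hom (𝟙 _) = TSum.inj P (F.lin x v).hom (𝟙 _) ≫
        TSum.inj P (f ⊵ₗ F.functor.obj v) (𝟙 _)
      rw [TSum.inj_comp, TSum.inj_comp, F.lin_nat_left, CategoryTheory.Functor.map_id])
    (fun x {v v' w w'} f g => by
      change TSum.inj P (F.functor.map (x ⊴ₗ f)) (G.functor.map g) ≫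
        TSum.inj P (F.lin x v').hom (𝟙 _) = TSum.inj P (F.lin x v).hom (𝟙 _) ≫
        TSum.actMap x (TSum.inj P (F.functor.map f) (G.functor.map g))
      rw [TSum.actMap_inj, TSum.inj_comp, TSum.inj_comp, F.lin_nat_right]
      simp)
    (fun x y v w => by
      change TSum.inj P (F.functor.map (swap x y v).hom) (G.functor.map (𝟙 w)) ≫
        (TSum.inj P (F.lin y (x ⊙ₗ v)).hom (𝟙 _) ≫ TSum.slide y _ _ ≫
          TSum.inj P (𝟙 _) (G.lin y w).inv) ≫ TSum.inj P (F.lin x v).hom (𝟙 _) =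
        TSum.inj P (F.lin x (y ⊙ₗ v)).hom (𝟙 _) ≫ TSum.actMap x
          (TSum.inj P (F.lin y v).hom (𝟙 _) ≫ TSum.slide y _ _ ≫ TSum.inj P (𝟙 _) (G.lin y w).inv)
      have h := TSum.slide_nat_left y (F.lin x v).hom (w := G.functor.obj w)
        (TSum.inj P (𝟙 _) (G.lin y w).inv)
      rw [TSum.inj_comp] at h
      rw [TSum.actMap_comp, TSum.actMap_comp, TSum.actMap_inj, TSum.actMap_inj, TSum.actMap_slide]
      simp only [Category.assoc, TSum.inj_comp, TSum.inj_comp', Category.comp_id, Category.id_comp,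
        CategoryTheory.Functor.map_id, actionHomRight_id, F.lin_swap] at h ⊢
      rw [h, TSum.inj_comp']
      simp [F.lin_swap])
    (fun x y v w => by
      change TSum.inj P (F.lin (x ⊗ y) v).hom (𝟙 _) ≫
          TSum.inj P (αₗ x y (F.functor.obj v)).hom (𝟙 (G.functor.obj w)) =
        TSum.inj P (F.functor.map (αₗ x y v).hom) (G.functor.map (𝟙 w)) ≫
          TSum.inj P (F.lin x (y ⊙ₗ v)).hom (𝟙 _) ≫
            TSum.actMap x (TSum.inj P (F.lin y v).hom (𝟙 (G.functor.obj w)))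
      rw [TSum.actMap_inj, TSum.inj_comp, TSum.inj_comp, TSum.inj_comp, F.lin_assoc]
      simp)

end SumHom

section AssocComm

variable {P : Type u} [Category.{v} P] [MonoidalCategory P] [SymmetricCategory P]
  {L : Type w₁} [Category.{t₁} L] [MonoidalLeftAction P L]
  {M : Type w₂} [Category.{t₂} M] [MonoidalLeftAction P M]
  {N : Type w₃} [Category.{t₃} N] [MonoidalLeftAction P N]

lemma slide_swap (x y : P) (v : L) (w : M) :
    TSum.inj P (swap x y v).hom (𝟙 w) ≫ TSum.slide y (x ⊙ₗ v) w ≫ TSum.slide x v (y ⊙ₗ w) =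
      TSum.slide x (y ⊙ₗ v) w ≫ TSum.slide y v (x ⊙ₗ w) ≫
        TSum.inj P (𝟙 v) (swap y x w).hom := by
  have h := TSum.slide_natx (β_ x y).hom v w
  have e : TSum.inj P (αₗ x y v).inv (𝟙 w) ≫ TSum.inj P (αₗ x y v).hom (𝟙 w) = 𝟙 _ := by
    rw [TSum.inj_comp]; simp [TSum.inj_id]
  have h2 := congrArg (fun t => TSum.inj P (αₗ x y v).inv (𝟙 w) ≫ t ≫
    TSum.inj P (𝟙 v) ((αₗ y x w).hom ≫ (swap y x w).hom)) h
  simp only [TSum.slide_mul, Category.assoc, TSum.inj_comp, TSum.inj_comp', Category.comp_id] at h2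
  have s1 := swap_swap x y w
  have s2 := swap_swap y x w
  have e2 : (αₗ x y w).inv ≫ (β_ x y).hom ⊵ₗ w ≫ (αₗ y x w).hom = (swap x y w).hom := rfl
  have e3 : (αₗ x y v).inv ≫ (β_ x y).hom ⊵ₗ v ≫ (αₗ y x v).hom = (swap x y v).hom := rfl
  rw [Iso.inv_hom_id, Iso.inv_hom_id_assoc, s1, reassoc_of% e2, reassoc_of% s2, e3,
    TSum.inj_id, TSum.inj_id] at h2
  simpa using h2

lemma swap_pair (x y : P) (w : M) (u : N) :
    (swap x y (⟨w, u⟩ : TSum P M N)).hom = TSum.inj P (swap x y w).hom (𝟙 u) := swap_tsum _ _ _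

lemma slide_swap₂ (x y : P) (v : L) (w : M) (u : N) :
    TSum.inj P (swap x y v).hom (𝟙 (⟨w, u⟩ : TSum P M N)) ≫
        TSum.slide y (x ⊙ₗ v) (⟨w, u⟩ : TSum P M N) ≫
        TSum.slide x v (⟨y ⊙ₗ w, u⟩ : TSum P M N) =
      TSum.slide x (y ⊙ₗ v) (⟨w, u⟩ : TSum P M N) ≫
        TSum.slide y v (⟨x ⊙ₗ w, u⟩ : TSum P M N) ≫
        TSum.inj P (𝟙 v) (TSum.inj P (swap y x w).hom (𝟙 u)) :=
  (slide_swap x y v (⟨w, u⟩ : TSum P M N)).trans (by rw [swap_pair]; rfl)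

lemma slide_mul₂ (x y : P) (v : L) (w : M) (u : N) :
    TSum.slide (x ⊗ y) v (⟨w, u⟩ : TSum P M N) =
      TSum.inj P (αₗ x y v).hom (𝟙 (⟨w, u⟩ : TSum P M N)) ≫
        TSum.slide x (y ⊙ₗ v) (⟨w, u⟩ : TSum P M N) ≫
        TSum.slide y v (⟨x ⊙ₗ w, u⟩ : TSum P M N) ≫
        TSum.inj P (𝟙 v) (TSum.inj P ((swap y x w).hom ≫ (αₗ x y w).inv) (𝟙 u)) :=
  (TSum.slide_mul x y v (⟨w, u⟩ : TSum P M N)).trans (by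
    rw [swap_pair, ← TSum.inj_comp_id]; rfl)

/-- The functor `(v, w) ↦ (v, (w, u))`. -/
def assocAux (L : Type w₁) [Category.{t₁} L] [MonoidalLeftAction P L]
    (M : Type w₂) [Category.{t₂} M] [MonoidalLeftAction P M] (u : N) :
    Balanced P L M (TSum P L (TSum P M N)) where
  obj v w := ⟨v, ⟨w, u⟩⟩
  map f g := TSum.inj P f (TSum.inj P g (𝟙 u))
  map_id v w := by rw [TSum.inj_id, TSum.inj_id]
  map_comp f g f' g' := by rw [TSum.inj_comp, TSum.inj_comp, Category.comp_id]
  bal x v w := TSum.slide x v (⟨w, u⟩ : TSum P M N)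
  bal_nat x v v' w w' f g := by
    have := TSum.slide_nat x f (TSum.inj P g (𝟙 u))
    refine this.trans ?_
    exact congrArg (fun t => TSum.slide x v (⟨w, u⟩ : TSum P M N) ≫ TSum.inj P f t)
      (TSum.actMap_inj x g (𝟙 u))
  bal_natx f v w := by
    rw [TSum.inj_id]
    exact TSum.slide_natx f v (⟨w, u⟩ : TSum P M N)
  bal_unit v w := TSum.slide_unit v (⟨w, u⟩ : TSum P M N)
  bal_mul x y v w := by
    rw [TSum.inj_id]
    exact slide_mul₂ x y v w u

lemma assocAux_inj (u : N) {v v' : L} {w w' : M} (f : v ⟶ v') (g : w ⟶ w') :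
    (assocAux L M u).desc.map (TSum.inj P f g) = TSum.inj P f (TSum.inj P g (𝟙 u)) :=
  Balanced.desc_inj _ _ _

lemma assocAux_slide (u : N) (x : P) (v : L) (w : M) :
    (assocAux L M u).desc.map (TSum.slide x v w) = TSum.slide x v (⟨w, u⟩ : TSum P M N) :=
  Balanced.desc_slide _ _ _ _

/-- Application of `assocAux` to morphisms. -/
def assocMap {a b : TSum P L M} (φ : a ⟶ b) (u : N) :
    (⟨a.fst, ⟨a.snd, u⟩⟩ : TSum P L (TSum P M N)) ⟶ ⟨b.fst, ⟨b.snd, u⟩⟩ :=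
  (assocAux L M u).desc.map φ

lemma assocMap_inj (u : N) {v v' : L} {w w' : M} (f : v ⟶ v') (g : w ⟶ w') :
    assocMap (TSum.inj P f g) u = TSum.inj P f (TSum.inj P g (𝟙 u)) :=
  Balanced.desc_inj _ _ _

lemma assocMap_slide (u : N) (x : P) (v : L) (w : M) :
    assocMap (TSum.slide x v w) u = TSum.slide x v (⟨w, u⟩ : TSum P M N) :=
  Balanced.desc_slide _ _ _ _

lemma assocMap_comp {a b c : TSum P L M} (φ : a ⟶ b) (ψ : b ⟶ c) (u : N) :
    assocMap (φ ≫ ψ) u = assocMap φ u ≫ assocMap ψ u :=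
  (assocAux L M u).desc.map_comp φ ψ

lemma assocMap_id (a : TSum P L M) (u : N) : assocMap (𝟙 a) u = 𝟙 _ :=
  (assocAux L M u).desc.map_id a

lemma assocMap_nat {a b : TSum P L M} (φ : a ⟶ b) {u u' : N} (g : u ⟶ u') :
    TSum.inj P (𝟙 a.fst) (TSum.inj P (𝟙 a.snd) g) ≫ assocMap φ u' =
      assocMap φ u ≫ TSum.inj P (𝟙 b.fst) (TSum.inj P (𝟙 b.snd) g) := by
  induction φ using TSum.hom_ind with
  | h₁ f h => simp only [assocMap_inj, TSum.inj_comp, Category.comp_id, Category.id_comp]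
  | h₂ x v w =>
    rw [assocMap_slide, assocMap_slide]
    have := TSum.slide_nat x (𝟙 v) (TSum.inj P (𝟙 w) g)
    rw [actionHomRight_id] at this
    refine this.trans ?_
    refine congrArg (fun t => TSum.slide x v (⟨w, u⟩ : TSum P M N) ≫ TSum.inj P (𝟙 v) t) ?_
    refine (TSum.actMap_inj x (𝟙 w) g).trans ?_
    rw [actionHomRight_id]
  | h₃ φ ψ hφ hψ =>
    rw [assocMap_comp, assocMap_comp, Category.assoc, ← hψ, reassoc_of% hφ]

lemma assocMap_act (x : P) {a b : TSum P L M} (φ : a ⟶ b) (u : N) :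
    assocMap (TSum.actMap x φ) u = TSum.actMap x (assocMap φ u) := by
  induction φ using TSum.hom_ind with
  | h₁ f g => rw [TSum.actMap_inj, assocMap_inj, assocMap_inj, TSum.actMap_inj]
  | h₂ y v w =>
    rw [TSum.actMap_slide, assocMap_comp, assocMap_inj, assocMap_slide, assocMap_slide,
      TSum.actMap_slide, TSum.inj_id]
  | h₃ φ ψ hφ hψ => rw [TSum.actMap_comp, assocMap_comp, hφ, hψ, assocMap_comp, TSum.actMap_comp]

/-- The canonical morphism `(x + v, (w, u)) ⟶ (v, (w, x + u))`. -/
def slide₂ (x : P) (v : L) (w : M) (u : N) :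
    (⟨x ⊙ₗ v, ⟨w, u⟩⟩ : TSum P L (TSum P M N)) ⟶ ⟨v, ⟨w, x ⊙ₗ u⟩⟩ :=
  TSum.slide x v (⟨w, u⟩ : TSum P M N) ≫ TSum.inj P (𝟙 v) (TSum.slide x w u)

lemma inj_slide_slide (x y : P) (v : L) (w : M) (u : N) :
    TSum.inj P (𝟙 (y ⊙ₗ v)) (TSum.slide x w u) ≫
      TSum.slide y v (⟨w, x ⊙ₗ u⟩ : TSum P M N) =
    TSum.slide y v (⟨x ⊙ₗ w, u⟩ : TSum P M N) ≫ TSum.inj P (𝟙 v) (TSum.inj P (swap y x w).hom (𝟙 u)) ≫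
      TSum.inj P (𝟙 v) (TSum.slide x (y ⊙ₗ w) u) := by
  have h := TSum.slide_nat y (𝟙 v) (TSum.slide x w u)
  rw [actionHomRight_id] at h
  refine h.trans ?_
  rw [TSum.inj_comp, ← TSum.actMap_slide, Category.comp_id]
  rfl

lemma slide₂_nat (x : P) {a b : TSum P L M} (φ : a ⟶ b) {u u' : N} (g : u ⟶ u') :
    (assocMap (TSum.actMap x φ) u ≫ TSum.inj P (𝟙 _) (TSum.inj P (𝟙 _) g)) ≫
      slide₂ x b.fst b.snd u' = slide₂ x a.fst a.snd u ≫ assocMap φ (x ⊙ₗ u) ≫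
        TSum.inj P (𝟙 _) (TSum.inj P (𝟙 _) (x ⊴ₗ g)) := by
  have hg : ∀ (v : L) (w : M), TSum.inj P (𝟙 (x ⊙ₗ v)) (TSum.inj P (𝟙 w) g) ≫ slide₂ x v w u' =
      slide₂ x v w u ≫ TSum.inj P (𝟙 _) (TSum.inj P (𝟙 _) (x ⊴ₗ g)) := by
    intro v w
    have h := TSum.slide_nat x (𝟙 v) (TSum.inj P (𝟙 w) g)
    rw [actionHomRight_id] at h
    have h2 : x ⊴ₗ (TSum.inj P (𝟙 w) g) = TSum.inj P (𝟙 _) g :=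
      (TSum.actMap_inj x (𝟙 w) g).trans (by rw [actionHomRight_id])
    have h3 := TSum.slide_nat x (𝟙 w) g
    rw [actionHomRight_id] at h3
    rw [slide₂, slide₂, reassoc_of% h, h2]
    have h4 := congrArg (fun t => TSum.inj P (𝟙 v) t) h3
    rw [Category.assoc]
    congr 1
    rw [TSum.inj_comp]
    refine Eq.trans ?_ (TSum.inj_comp _ _ _ _).symm
    rw [Category.comp_id]; exact h4
  rw [Category.assoc, hg]
  rw [← Category.assoc, ← Category.assoc]
  congr 1
  induction φ using TSum.hom_ind with
  | h₁ f h =>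
    rw [TSum.actMap_inj, assocMap_inj, assocMap_inj]
    have h1 := TSum.slide_nat x f (TSum.inj P h (𝟙 u))
    change _ = _ ≫ TSum.inj P f (TSum.actMap x (TSum.inj P h (𝟙 u))) at h1
    rw [TSum.actMap_inj] at h1
    have h3 := TSum.slide_nat x h (𝟙 u)
    rw [actionHomRight_id] at h3
    rw [slide₂, slide₂, reassoc_of% h1, Category.assoc, TSum.inj_comp]
    congr 1
    refine Eq.trans ?_ (TSum.inj_comp _ _ _ _).symm
    rw [Category.comp_id, Category.id_comp, h3]
  | h₂ y v w =>
    rw [TSum.actMap_slide, assocMap_comp, assocMap_inj, assocMap_slide, assocMap_slide]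
    rw [slide₂, slide₂, Category.assoc, Category.assoc, inj_slide_slide, TSum.inj_id,
      reassoc_of% (slide_swap₂ x y v w u)]
  | h₃ φ ψ hφ hψ =>
    rw [TSum.actMap_comp, assocMap_comp, assocMap_comp, Category.assoc, hψ, reassoc_of% hφ]

lemma slide₂_natx {x y : P} (f : x ⟶ y) (v : L) (w : M) (u : N) :
    TSum.inj P (f ⊵ₗ v) (TSum.inj P (𝟙 w) (𝟙 u)) ≫ slide₂ y v w u =
      slide₂ x v w u ≫ TSum.inj P (𝟙 v) (TSum.inj P (𝟙 w) (f ⊵ₗ u)) := by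
  have h1 : _ = _ ≫ TSum.inj P (𝟙 v) (TSum.inj P (f ⊵ₗ w) (𝟙 u)) :=
    TSum.slide_natx f v (⟨w, u⟩ : TSum P M N)
  have h2 := TSum.slide_natx f w u
  rw [TSum.inj_id, slide₂, slide₂, reassoc_of% h1, TSum.inj_comp, h2, Category.assoc,
    TSum.inj_comp]

lemma slide₂_unit (v : L) (w : M) (u : N) :
    slide₂ (𝟙_ P) v w u = TSum.inj P (λₗ v).hom (TSum.inj P (𝟙 w) (λₗ u).inv) := by
  have h1 : _ = TSum.inj P (λₗ[P] v).hom (TSum.inj P (λₗ[P] w).inv (𝟙 u)) :=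
    TSum.slide_unit v (⟨w, u⟩ : TSum P M N)
  rw [slide₂, h1, TSum.slide_unit, TSum.inj_comp, TSum.inj_comp]
  simp

lemma slide₂_mul (x y : P) (v : L) (w : M) (u : N) :
    slide₂ (x ⊗ y) v w u = TSum.inj P (αₗ x y v).hom (TSum.inj P (𝟙 w) (𝟙 u)) ≫
      slide₂ x (y ⊙ₗ v) w u ≫ slide₂ y v w (x ⊙ₗ u) ≫
        TSum.inj P (𝟙 v) (TSum.inj P (𝟙 w) ((swap y x u).hom ≫ (αₗ x y u).inv)) := by
  have h := slide_swap y x w u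
  have e : TSum.inj P (αₗ x y w).inv (𝟙 u) ≫ TSum.inj P (αₗ x y w).hom (𝟙 u) = 𝟙 _ := by
    rw [TSum.inj_comp]; simp [TSum.inj_id]
  rw [slide₂, slide₂, slide₂, slide_mul₂, TSum.slide_mul]
  simp only [Category.assoc, TSum.inj_id]
  refine congrArg (TSum.inj P (αₗ x y v).hom (𝟙 _) ≫ TSum.slide x _ _ ≫ ·) ?_
  rw [← Category.assoc (TSum.inj P (𝟙 _) (TSum.slide x w u)), inj_slide_slide]
  simp only [Category.assoc, TSum.inj_comp, Category.id_comp]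
  refine congrArg (fun t => TSum.slide y v (⟨x ⊙ₗ w, u⟩ : TSum P M N) ≫ TSum.inj P (𝟙 v) t) ?_
  rw [← TSum.inj_comp_id, Category.assoc, reassoc_of% e]

lemma assocMap_pure {v v' : L} {w w' : M} {u u' : N} (f : v ⟶ v') (g : w ⟶ w') (h : u ⟶ u') :
    assocMap (TSum.inj P f g) u ≫ TSum.inj P (𝟙 v') (TSum.inj P (𝟙 w') h) =
      TSum.inj P f (TSum.inj P g h) := by
  rw [assocMap_inj, TSum.inj_comp, TSum.inj_comp]; simp

/-- Balanced data for the associativity constraint `(L + M) + N ⟶ L + (M + N)`. -/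
def assocBal (L : Type w₁) [Category.{t₁} L] [MonoidalLeftAction P L]
    (M : Type w₂) [Category.{t₂} M] [MonoidalLeftAction P M]
    (N : Type w₃) [Category.{t₃} N] [MonoidalLeftAction P N] :
    Balanced P (TSum P L M) N (TSum P L (TSum P M N)) where
  obj a u := ⟨a.fst, ⟨a.snd, u⟩⟩
  map {a b u u'} φ g := assocMap φ u ≫ TSum.inj P (𝟙 _) (TSum.inj P (𝟙 _) g)
  map_id a u := by rw [assocMap_id, TSum.inj_id, TSum.inj_id]; simp
  map_comp φ g φ' g' := by
    rw [Category.assoc, reassoc_of% (assocMap_nat φ' g), assocMap_comp, TSum.inj_comp, TSum.inj_comp]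
    simp
  bal x a u := slide₂ x a.fst a.snd u
  bal_nat x _ _ _ _ φ g := slide₂_nat x φ g
  bal_natx {x y} f a u := by
    refine (congrArg (· ≫ slide₂ y a.fst a.snd u) (assocMap_pure _ _ _)).trans ?_
    rw [assocMap_id, Category.id_comp]
    exact slide₂_natx f a.fst a.snd u
  bal_unit a u := (slide₂_unit a.fst a.snd u).trans (assocMap_pure _ _ _).symm
  bal_mul x y a u := by
    refine (slide₂_mul x y a.fst a.snd u).trans ?_
    rw [assocMap_id, Category.id_comp]
    exact congrArg (· ≫ slide₂ x (y ⊙ₗ a.fst) a.snd u ≫ slide₂ y a.fst a.snd (x ⊙ₗ u) ≫ _)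
      (assocMap_pure _ _ _).symm

lemma assocBal_map_act (x : P) {a a' : TSum P L M} {u u' : N} (φ : a ⟶ a') (g : u ⟶ u') :
    assocMap (TSum.actMap x φ) u ≫ TSum.inj P (𝟙 _) (TSum.inj P (𝟙 _) g) =
      TSum.actMap x (assocMap φ u ≫ TSum.inj P (𝟙 _) (TSum.inj P (𝟙 _) g)) := by
  rw [TSum.actMap_comp, ← assocMap_act, TSum.actMap_inj, actionHomRight_id]

lemma assocBal_bal_act (x y : P) (v : L) (w : M) (u : N) :
    TSum.inj P (swap x y v).hom (TSum.inj P (𝟙 w) (𝟙 u)) ≫ slide₂ y (x ⊙ₗ v) w u =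
      TSum.actMap x (slide₂ y v w u) := by
  rw [slide₂, slide₂, TSum.actMap_comp, TSum.actMap_inj, TSum.actMap_slide, TSum.inj_id,
    actionHomRight_id, Category.assoc]

/-- The associativity constraint `(L + M) + N ⟶ L + (M + N)`; it is `((v, w), u) ↦ (v, (w, u))`. -/
def assoc (P : Type u) [Category.{v} P] [MonoidalCategory P] [SymmetricCategory P]
    (L : Type w₁) [Category.{t₁} L] [MonoidalLeftAction P L]
    (M : Type w₂) [Category.{t₂} M] [MonoidalLeftAction P M]
    (N : Type w₃) [Category.{t₃} N] [MonoidalLeftAction P N] :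
    TorsorHom P (TSum P (TSum P L M) N) (TSum P L (TSum P M N)) :=
  (assocBal L M N).hom (fun _ _ _ => Iso.refl _)
    (fun {x y} f a u => by
      refine (Category.comp_id _).trans (Eq.trans ?_ (Category.id_comp _).symm)
      refine (assocMap_pure (f ⊵ₗ a.fst) (𝟙 a.snd) (𝟙 u)).trans ?_
      rw [TSum.inj_id]
      rfl)
    (fun x {a a' u u'} φ g => by
      refine (Category.comp_id _).trans (Eq.trans ?_ (Category.id_comp _).symm)
      exact assocBal_map_act x φ g)
    (fun x y a u => by
      refine Eq.trans ?_ (Category.id_comp _).symm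
      refine Eq.trans ?_ (assocBal_bal_act x y a.fst a.snd u)
      refine Eq.trans (congrArg (_ ≫ ·) (Category.comp_id _)) ?_
      refine congrArg (· ≫ slide₂ y (x ⊙ₗ a.fst) a.snd u) ?_
      rw [swap_tsum]
      exact assocMap_pure _ _ _)
    (fun x y a u => by
      refine (Category.id_comp _).trans ?_
      refine Eq.trans ?_ (congrArg (_ ≫ ·) (Category.id_comp _).symm)
      refine Eq.trans ?_ (congrArg (· ≫ x ⊴ₗ 𝟙 _) (assocMap_pure (αₗ x y a.fst).hom (𝟙 a.snd) (𝟙 u)).symm)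
      rw [actionHomRight_id, TSum.inj_id]
      exact (Category.comp_id _).symm)

end AssocComm

section Comm

variable {P : Type u} [Category.{v} P] [MonoidalCategory P] [SymmetricCategory P]
  {L : Type w₁} [Category.{t₁} L] [MonoidalLeftAction P L]
  {M : Type w₂} [Category.{t₂} M] [MonoidalLeftAction P M]

lemma TSum.isIso_inj {v v' : L} {w w' : M} (f : v ⟶ v') (g : w ⟶ w') [IsIso f] [IsIso g] :
    IsIso (inj P f g) :=
  ⟨inj P (CategoryTheory.inv f) (CategoryTheory.inv g),
    by rw [inj_comp]; simp [inj_id], by rw [inj_comp]; simp [inj_id]⟩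

lemma TSum.isIso_slide [PicardGroupoid P] (x : P) (v : L) (w : M) : IsIso (slide x v w) := by
  have key : ∀ {x y : P} (_ : x ⊗ y ≅ 𝟙_ P) (v : L) (w : M),
      IsIso (slide x (y ⊙ₗ v) w ≫ slide y v (x ⊙ₗ w)) := by
    intro x y e v w
    have h := slide_natx e.hom v w
    rw [slide_unit, slide_mul] at h
    have := isIso_inj (P := P) (e.hom ⊵ₗ v) (𝟙 w)
    have := isIso_inj (P := P) (λₗ[P] v).hom (λₗ[P] w).inv
    have := isIso_inj (P := P) (αₗ x y v).hom (𝟙 w)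
    have := isIso_inj (P := P) (𝟙 v) ((swap y x w).hom ≫ (αₗ x y w).inv)
    have := isIso_inj (P := P) (𝟙 v) (e.hom ⊵ₗ w)
    have h1 : IsIso (inj P (αₗ x y v).hom (𝟙 w) ≫ (slide x (y ⊙ₗ v) w ≫ slide y v (x ⊙ₗ w)) ≫
      inj P (𝟙 v) ((swap y x w).hom ≫ (αₗ x y w).inv) ≫ inj P (𝟙 v) (e.hom ⊵ₗ w)) := by
      simp only [Category.assoc] at h ⊢
      rw [← h]; infer_instance
    have := IsIso.of_isIso_comp_left (inj P (αₗ x y v).hom (𝟙 w))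
      ((slide x (y ⊙ₗ v) w ≫ slide y v (x ⊙ₗ w)) ≫
        inj P (𝟙 v) ((swap y x w).hom ≫ (αₗ x y w).inv) ≫ inj P (𝟙 v) (e.hom ⊵ₗ w))
    exact IsIso.of_isIso_comp_right _ (inj P (𝟙 v) ((swap y x w).hom ≫ (αₗ x y w).inv) ≫ inj P (𝟙 v) (e.hom ⊵ₗ w))
  obtain ⟨y, ⟨e⟩⟩ : ∃ y, Nonempty (x ⊗ y ≅ 𝟙_ P) :=
    ⟨(tensorLeft x).objPreimage (𝟙_ P), ⟨(tensorLeft x).objObjPreimageIso (𝟙_ P)⟩⟩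
  have e' : y ⊗ x ≅ 𝟙_ P := β_ y x ≪≫ e
  have act (u : L) : ∃ f : u ⟶ y ⊙ₗ x ⊙ₗ u, IsIso f :=
    ⟨(λₗ[P] u).inv ≫ e'.inv ⊵ₗ u ≫ (αₗ y x u).hom, inferInstance⟩
  have act' (u : M) : ∃ f : u ⟶ y ⊙ₗ x ⊙ₗ u, IsIso f :=
    ⟨(λₗ[P] u).inv ≫ e'.inv ⊵ₗ u ≫ (αₗ y x u).hom, inferInstance⟩
  obtain ⟨r, hr⟩ : ∃ r, slide x v w ≫ r = 𝟙 _ := by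
    have i := key e (x ⊙ₗ v) w
    obtain ⟨f, hf⟩ := act v
    have h := slide_nat x f (𝟙 w)
    rw [actionHomRight_id] at h
    have i2 := isIso_inj (P := P) (x ⊴ₗ f) (𝟙 w)
    refine ⟨inj P f (𝟙 _) ≫ slide y (x ⊙ₗ v) (x ⊙ₗ w) ≫ CategoryTheory.inv
        (slide x (y ⊙ₗ x ⊙ₗ v) w ≫ slide y (x ⊙ₗ v) (x ⊙ₗ w)) ≫
        CategoryTheory.inv (inj P (x ⊴ₗ f) (𝟙 w)), ?_⟩
    rw [← reassoc_of% h]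
    have := IsIso.hom_inv_id (slide x (y ⊙ₗ x ⊙ₗ v) w ≫ slide y (x ⊙ₗ v) (x ⊙ₗ w))
    rw [Category.assoc] at this
    rw [reassoc_of% this, IsIso.hom_inv_id]
  obtain ⟨l, hl⟩ : ∃ l, l ≫ slide x v w = 𝟙 _ := by
    have i := key e' v (x ⊙ₗ w)
    obtain ⟨f, hf⟩ := act' w
    have h := slide_nat x (𝟙 v) f
    rw [actionHomRight_id] at h
    have i2 := isIso_inj (P := P) (𝟙 v) (x ⊴ₗ f)
    have i3 := isIso_inj (P := P) (𝟙 (x ⊙ₗ v)) f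
    refine ⟨inj P (𝟙 v) (x ⊴ₗ f) ≫ CategoryTheory.inv
        (slide y (x ⊙ₗ v) (x ⊙ₗ w) ≫ slide x v (y ⊙ₗ x ⊙ₗ w)) ≫
        slide y (x ⊙ₗ v) (x ⊙ₗ w) ≫ CategoryTheory.inv (inj P (𝟙 (x ⊙ₗ v)) f), ?_⟩
    have h' : CategoryTheory.inv (inj P (𝟙 (x ⊙ₗ v)) f) ≫ slide x v w =
        slide x v (y ⊙ₗ x ⊙ₗ w) ≫ CategoryTheory.inv (inj P (𝟙 v) (x ⊴ₗ f)) := by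
      rw [IsIso.inv_comp_eq, ← Category.assoc, IsIso.eq_comp_inv, h]
    have := IsIso.inv_hom_id (slide y (x ⊙ₗ v) (x ⊙ₗ w) ≫ slide x v (y ⊙ₗ x ⊙ₗ w))
    simp only [Category.assoc]
    rw [h', reassoc_of% this, IsIso.hom_inv_id]
  have : l = r := by rw [← Category.comp_id l, ← hr, reassoc_of% hl]
  exact ⟨r, hr, this ▸ hl⟩

/-- The isomorphism `(x + v, w) ≃ (v, x + w)`. -/
noncomputable def slideIso [PicardGroupoid P] (x : P) (v : L) (w : M) :
    (⟨x ⊙ₗ v, w⟩ : TSum P L M) ≅ ⟨v, x ⊙ₗ w⟩ :=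
  have := TSum.isIso_slide x v w
  asIso (TSum.slide x v w)

lemma slideIso_hom [PicardGroupoid P] (x : P) (v : L) (w : M) :
    (slideIso x v w).hom = TSum.slide x v w := rfl

lemma unslide_nat [PicardGroupoid P] (x : P) {v v' : L} {w w' : M} (f : v ⟶ v') (g : w ⟶ w') :
    TSum.inj P f (x ⊴ₗ g) ≫ (slideIso x v' w').inv =
      (slideIso x v w).inv ≫ TSum.inj P (x ⊴ₗ f) g := by
  rw [Iso.comp_inv_eq, Category.assoc, slideIso_hom, TSum.slide_nat, ← slideIso_hom,
    Iso.inv_hom_id_assoc]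

lemma unslide_natx [PicardGroupoid P] {x y : P} (f : x ⟶ y) (v : L) (w : M) :
    TSum.inj P (𝟙 v) (f ⊵ₗ w) ≫ (slideIso y v w).inv =
      (slideIso x v w).inv ≫ TSum.inj P (f ⊵ₗ v) (𝟙 w) := by
  rw [Iso.comp_inv_eq, Category.assoc, slideIso_hom, TSum.slide_natx, ← slideIso_hom,
    Iso.inv_hom_id_assoc]

lemma unslide_unit [PicardGroupoid P] (v : L) (w : M) :
    (slideIso (𝟙_ P) v w).inv = TSum.inj P (λₗ v).inv (λₗ w).hom := by
  rw [← cancel_mono (slideIso (𝟙_ P) v w).hom, Iso.inv_hom_id, slideIso_hom, TSum.slide_unit,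
    TSum.inj_comp]
  simp [TSum.inj_id]

lemma unslide_mul [PicardGroupoid P] (x y : P) (v : L) (w : M) :
    (slideIso (x ⊗ y) v w).inv = TSum.inj P (𝟙 v) (αₗ x y w).hom ≫ (slideIso x v (y ⊙ₗ w)).inv ≫
      (slideIso y (x ⊙ₗ v) w).inv ≫ TSum.inj P ((swap y x v).hom ≫ (αₗ x y v).inv) (𝟙 w) := by
  have e1 : (slideIso y (x ⊙ₗ v) w).inv ≫ TSum.slide y (x ⊙ₗ v) w = 𝟙 _ := Iso.inv_hom_id _
  have e2 : (slideIso x v (y ⊙ₗ w)).inv ≫ TSum.slide x v (y ⊙ₗ w) = 𝟙 _ := Iso.inv_hom_id _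
  rw [← cancel_mono (slideIso (x ⊗ y) v w).hom, Iso.inv_hom_id, slideIso_hom, TSum.slide_mul]
  simp only [Category.assoc, TSum.inj_comp', Category.comp_id, Iso.inv_hom_id]
  rw [reassoc_of% (slide_swap y x v w), TSum.inj_comp, reassoc_of% e1, reassoc_of% e2, TSum.inj_comp,
    reassoc_of% (swap_swap x y w)]
  simp [TSum.inj_id]

lemma actMap_unslide [PicardGroupoid P] (x y : P) (v : L) (w : M) :
    TSum.actMap x (slideIso y v w).inv =
      (slideIso y (x ⊙ₗ v) w).inv ≫ TSum.inj P (swap y x v).hom (𝟙 w) := by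
  have e1 : (slideIso y (x ⊙ₗ v) w).hom ≫ (slideIso y (x ⊙ₗ v) w).inv = 𝟙 _ := Iso.hom_inv_id _
  have e3 : TSum.actMap x (TSum.slide y v w) ≫ TSum.actMap x (slideIso y v w).inv = 𝟙 _ := by
    rw [← TSum.actMap_comp, ← slideIso_hom, Iso.hom_inv_id]
    exact (TSum.act x).desc.map_id _
  rw [TSum.actMap_slide, Category.assoc] at e3
  have e4 := congrArg (TSum.inj P (swap y x v).hom (𝟙 w) ≫ ·) e3
  simp only [TSum.inj_comp', swap_swap, Category.comp_id, TSum.inj_id, Category.id_comp] at e4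
  rw [← cancel_epi (slideIso y (x ⊙ₗ v) w).hom, reassoc_of% e1]
  exact e4

lemma unslide_swap [PicardGroupoid P] (x y : P) (v : L) (w : M) :
    TSum.inj P (𝟙 v) (swap x y w).hom ≫ (slideIso y v (x ⊙ₗ w)).inv ≫
        (slideIso x (y ⊙ₗ v) w).inv =
      (slideIso x v (y ⊙ₗ w)).inv ≫ TSum.actMap x (slideIso y v w).inv := by
  have e1 : (slideIso x v (y ⊙ₗ w)).inv ≫ TSum.slide x v (y ⊙ₗ w) = 𝟙 _ := Iso.inv_hom_id _
  have e2 : (slideIso y (x ⊙ₗ v) w).inv ≫ TSum.slide y (x ⊙ₗ v) w = 𝟙 _ := Iso.inv_hom_id _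
  rw [actMap_unslide, ← cancel_mono (slideIso x (y ⊙ₗ v) w).hom, slideIso_hom]
  rw [← cancel_mono (slideIso y v (x ⊙ₗ w)).hom, slideIso_hom]
  have i := TSum.isIso_inj (P := P) (𝟙 v) (swap y x w).hom
  rw [← cancel_mono (TSum.inj P (𝟙 v) (swap y x w).hom)]
  have e3 : (slideIso y v (x ⊙ₗ w)).inv ≫ TSum.slide y v (x ⊙ₗ w) = 𝟙 _ := Iso.inv_hom_id _
  have e4 : (slideIso x (y ⊙ₗ v) w).inv ≫ TSum.slide x (y ⊙ₗ v) w = 𝟙 _ := Iso.inv_hom_id _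
  simp only [Category.assoc]
  rw [reassoc_of% e4, reassoc_of% e3, ← slide_swap, TSum.inj_comp, TSum.inj_comp', swap_swap,
    swap_swap]
  simp only [Category.comp_id, TSum.inj_id, Category.id_comp]
  rw [reassoc_of% e2, e1]

lemma unslide_act [PicardGroupoid P] (x y : P) (v : L) (w : M) :
    (slideIso (x ⊗ y) v w).inv ≫ TSum.inj P (αₗ x y v).hom (𝟙 w) =
      TSum.inj P (𝟙 v) (αₗ x y w).hom ≫ (slideIso x v (y ⊙ₗ w)).inv ≫
        TSum.actMap x (slideIso y v w).inv := by
  rw [actMap_unslide, unslide_mul]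
  simp [TSum.inj_comp]

/-- Balanced data for the commutativity constraint. -/
noncomputable def commBal [PicardGroupoid P] (L : Type w₁) [Category.{t₁} L] [MonoidalLeftAction P L]
    (M : Type w₂) [Category.{t₂} M] [MonoidalLeftAction P M] : Balanced P L M (TSum P M L) where
  obj v w := ⟨w, v⟩
  map f g := TSum.inj P g f
  map_id _ _ := TSum.inj_id _ _
  map_comp _ _ _ _ := (TSum.inj_comp _ _ _ _).symm
  bal x v w := (slideIso x w v).inv
  bal_nat x _ _ _ _ f g := unslide_nat x g f
  bal_natx f v w := unslide_natx f w v
  bal_unit v w := unslide_unit w v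
  bal_mul x y v w := unslide_mul x y w v

/-- The commutativity constraint `C : L + M ⟶ M + L`. On objects it is `(v, w) ↦ (w, v)`, it carries
the canonical isomorphism `(x + v, w) ≃ (v, x + w)` to the (inverse of the) canonical isomorphism
`(x + w, v) ≃ (w, x + v)`, and its structure isomorphism is
`C (x + (v, w)) = (w, x + v) ≃ (x + w, v) = x + C (v, w)`. -/
noncomputable def comm (P : Type u) [Category.{v} P] [MonoidalCategory P] [SymmetricCategory P]
    [PicardGroupoid P] (L : Type w₁) [Category.{t₁} L] [MonoidalLeftAction P L]
    (M : Type w₂) [Category.{t₂} M] [MonoidalLeftAction P M] :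
    TorsorHom P (TSum P L M) (TSum P M L) :=
  (commBal L M).hom (fun x v w => (slideIso x w v).symm)
    (fun f v w => unslide_natx f w v)
    (fun x _ _ _ _ f g => (unslide_nat x g f).trans
      (congrArg (_ ≫ ·) (TSum.actMap_inj x g f).symm))
    (fun x y v w => unslide_swap x y w v)
    (fun x y v w => unslide_act x y w v)

end Comm

/-! ### Central extensions of a group by a Picard groupoid -/

/-- The data of a central extension of `G` by `P`: torsors `L g`, equivalences
`L (g * h) ≃ L g + L h`, and `2`-isomorphisms between the two resulting equivalences
`L (a * b * c) ≃ L a + (L b + L c)`. To avoid transport along equalities in `G`, the equivalence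
`L k ≃ L g + L h` is indexed by `g`, `h`, `k` and a proof of `g * h = k`. -/
structure CentralExtensionData (G : Type w₂) [Group G]
    (P : Type u) [Category.{v} P] [MonoidalCategory P] [SymmetricCategory P] where
  torsor : G → Type w₁
  [category (g : G) : Category.{t₁} (torsor g)]
  [action (g : G) : MonoidalLeftAction P (torsor g)]
  [isTorsor (g : G) : IsTorsor P (torsor g)]
  mul {g h k : G} (e : g * h = k) : TorsorHom P (torsor k) (TSum P (torsor g) (torsor h))
  mul_isEquivalence {g h k : G} (e : g * h = k) : (mul e).functor.IsEquivalence
  mulAssoc {a b c ab bc abc : G} (e₁ : a * b = ab) (e₂ : b * c = bc) (e₃ : ab * c = abc)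
    (e₄ : a * bc = abc) : TorsorHom.Iso₂
      (((mul e₃).comp ((mul e₁).add (TorsorHom.id P (torsor c)))).comp
        (assoc P (torsor a) (torsor b) (torsor c)))
      ((mul e₄).comp ((TorsorHom.id P (torsor a)).add (mul e₂)))

attribute [instance] CentralExtensionData.category CentralExtensionData.action
  CentralExtensionData.isTorsor CentralExtensionData.mul_isEquivalence

section

variable {G : Type w₂} [Group G]
  {P : Type u} [Category.{v} P] [MonoidalCategory P] [SymmetricCategory P]

namespace CentralExtensionData

variable (L : CentralExtensionData.{u, v, w₁, t₁, w₂} G P)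

/-- The identity of `L g`. -/
abbrev one (g : G) : TorsorHom P (L.torsor g) (L.torsor g) := TorsorHom.id P (L.torsor g)

/-- The associativity constraint `(L a + L b) + L c ⟶ L a + (L b + L c)`. -/
abbrev asc (a b c : G) := assoc P (L.torsor a) (L.torsor b) (L.torsor c)

/-- The components of the `2`-isomorphism `mulAssoc`. -/
def assocApp {a b c ab bc abc : G} (e₁ : a * b = ab) (e₂ : b * c = bc) (e₃ : ab * c = abc)
    (e₄ : a * bc = abc) (x : L.torsor abc) :
    (L.asc a b c).functor.obj (((L.mul e₁).add (L.one c)).functor.obj ((L.mul e₃).functor.obj x)) ≅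
      ((L.one a).add (L.mul e₂)).functor.obj ((L.mul e₄).functor.obj x) :=
  (L.mulAssoc e₁ e₂ e₃ e₄).iso.app x

end CentralExtensionData

/-- A central extension of `G` by `P`: the two `2`-isomorphisms between the equivalences from
`L (a * b * c * d)` to `L a + (L b + (L c + L d))` that are built from the `2`-isomorphisms
`mulAssoc` coincide. -/
structure CentralExtension (G : Type w₂) [Group G]
    (P : Type u) [Category.{v} P] [MonoidalCategory P] [SymmetricCategory P] extends
    CentralExtensionData.{u, v, w₁, t₁, w₂} G P where
  coherence {a b c d ab bc cd abc bcd abcd : G}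
    (ab_eq : a * b = ab) (bc_eq : b * c = bc) (cd_eq : c * d = cd)
    (ab_c : ab * c = abc) (a_bc : a * bc = abc) (bc_d : bc * d = bcd) (b_cd : b * cd = bcd)
    (abc_d : abc * d = abcd) (a_bcd : a * bcd = abcd) (ab_cd : ab * cd = abcd)
    (x : torsor abcd) :
    ((assoc P (torsor a) (TSum P (torsor b) (torsor c)) (torsor d)).comp
        ((TorsorHom.id P (torsor a)).add (assoc P (torsor b) (torsor c) (torsor d)))).functor.map
      (TSum.inj P (toCentralExtensionData.assocApp ab_eq bc_eq ab_c a_bc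
        ((mul abc_d).functor.obj x).fst).hom (𝟙 ((mul abc_d).functor.obj x).snd)) ≫
    (((TorsorHom.id P (torsor a)).add ((mul bc_eq).add (TorsorHom.id P (torsor d)))).comp
        ((TorsorHom.id P (torsor a)).add (assoc P (torsor b) (torsor c) (torsor d)))).functor.map
      (toCentralExtensionData.assocApp a_bc bc_d abc_d a_bcd x).hom ≫
    TSum.inj P (𝟙 ((mul a_bcd).functor.obj x).fst)
      (toCentralExtensionData.assocApp bc_eq cd_eq bc_d b_cd ((mul a_bcd).functor.obj x).snd).hom =
    (((mul ab_eq).add (TorsorHom.id P (TSum P (torsor c) (torsor d)))).comp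
        (assoc P (torsor a) (torsor b) (TSum P (torsor c) (torsor d)))).functor.map
      (toCentralExtensionData.assocApp ab_c cd_eq abc_d ab_cd x).hom ≫
    ((TorsorHom.id P (torsor a)).add ((TorsorHom.id P (torsor b)).add (mul cd_eq))).functor.map
      (toCentralExtensionData.assocApp ab_eq b_cd ab_cd a_bcd x).hom

end

/-! ### Bimultiplicative and anti-symmetric `1`-morphisms on commuting pairs -/

section Bimult

variable {G : Type w₂} [Group G] {P : Type u} [Category.{v} P] [MonoidalCategory P]

/-- The structure of a bimultiplicative `1`-morphism on a map `f` from the set of commuting pairs of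
elements of `G` to the objects of `P`: for fixed `h` the map `g ↦ f (g, h)` and for fixed `g` the
map `h ↦ f (g, h)` are homomorphisms from a centralizer to `P`, that is, they come with
isomorphisms `f (g₁ * g₂) ≃ f g₁ + f g₂` compatible with the associativity constraints, and the
two structures are compatible with each other. -/
structure Bimultiplicative [SymmetricCategory P] (f : ∀ g h : G, Commute g h → P) where
  mulLeft {g₁ g₂ g h : G} (e : g₁ * g₂ = g) (c₁ : Commute g₁ h) (c₂ : Commute g₂ h)
    (c : Commute g h) : f g h c ≅ f g₁ h c₁ ⊗ f g₂ h c₂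
  mulRight {g h₁ h₂ h : G} (e : h₁ * h₂ = h) (c₁ : Commute g h₁) (c₂ : Commute g h₂)
    (c : Commute g h) : f g h c ≅ f g h₁ c₁ ⊗ f g h₂ c₂
  assoc_left {g₁ g₂ g₃ g₁₂ g₂₃ g h : G} (e₁₂ : g₁ * g₂ = g₁₂) (e₂₃ : g₂ * g₃ = g₂₃)
    (e : g₁₂ * g₃ = g) (e' : g₁ * g₂₃ = g) (c₁ : Commute g₁ h) (c₂ : Commute g₂ h)
    (c₃ : Commute g₃ h) (c₁₂ : Commute g₁₂ h) (c₂₃ : Commute g₂₃ h) (c : Commute g h) :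
    (mulLeft e c₁₂ c₃ c).hom ≫ (mulLeft e₁₂ c₁ c₂ c₁₂).hom ▷ f g₃ h c₃ ≫ (α_ _ _ _).hom =
      (mulLeft e' c₁ c₂₃ c).hom ≫ f g₁ h c₁ ◁ (mulLeft e₂₃ c₂ c₃ c₂₃).hom
  assoc_right {g h₁ h₂ h₃ h₁₂ h₂₃ h : G} (e₁₂ : h₁ * h₂ = h₁₂) (e₂₃ : h₂ * h₃ = h₂₃)
    (e : h₁₂ * h₃ = h) (e' : h₁ * h₂₃ = h) (c₁ : Commute g h₁) (c₂ : Commute g h₂)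
    (c₃ : Commute g h₃) (c₁₂ : Commute g h₁₂) (c₂₃ : Commute g h₂₃) (c : Commute g h) :
    (mulRight e c₁₂ c₃ c).hom ≫ (mulRight e₁₂ c₁ c₂ c₁₂).hom ▷ f g h₃ c₃ ≫ (α_ _ _ _).hom =
      (mulRight e' c₁ c₂₃ c).hom ≫ f g h₁ c₁ ◁ (mulRight e₂₃ c₂ c₃ c₂₃).hom
  interchange {g₁ g₂ g h₁ h₂ h : G} (e : g₁ * g₂ = g) (e' : h₁ * h₂ = h)
    (c₁₁ : Commute g₁ h₁) (c₁₂ : Commute g₁ h₂) (c₂₁ : Commute g₂ h₁) (c₂₂ : Commute g₂ h₂)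
    (c₁ : Commute g₁ h) (c₂ : Commute g₂ h) (c₁' : Commute g h₁) (c₂' : Commute g h₂)
    (c : Commute g h) :
    (mulRight e' c₁' c₂' c).hom ≫
        ((mulLeft e c₁₁ c₂₁ c₁').hom ⊗ₘ (mulLeft e c₁₂ c₂₂ c₂').hom) ≫ tensorμ _ _ _ _ =
      (mulLeft e c₁ c₂ c).hom ≫ ((mulRight e' c₁₁ c₁₂ c₁).hom ⊗ₘ (mulRight e' c₂₁ c₂₂ c₂).hom)

/-- A choice of inverses: for every `x`, an object `-x` with an isomorphism `x + (-x) ≃ e`. -/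
structure Inverses (P : Type u) [Category.{v} P] [MonoidalCategory P] where
  neg : P → P
  iso (x : P) : x ⊗ neg x ≅ 𝟙_ P

namespace Inverses

variable [SymmetricCategory P] [PicardGroupoid P] (I : Inverses P)

/-- The isomorphism `-x ≃ -y` induced by `x ≃ y`. It is compatible with `x + (-x) ≃ e` and
`y + (-y) ≃ e`. -/
noncomputable def negMap {x y : P} (f : x ≅ y) : I.neg x ≅ I.neg y :=
  (tensorLeft x).preimageIso (I.iso x ≪≫ (I.iso y).symm ≪≫ whiskerRightIso f.symm (I.neg y))

/-- The canonical isomorphism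
`-(-x) ≃ e + (-(-x)) ≃ (x + (-x)) + (-(-x)) ≃ x + ((-x) + (-(-x))) ≃ x + e ≃ x`. -/
def negNeg (x : P) : I.neg (I.neg x) ≅ x :=
  (λ_ _).symm ≪≫ whiskerRightIso (I.iso x).symm _ ≪≫ α_ x (I.neg x) _ ≪≫
    whiskerLeftIso x (I.iso (I.neg x)) ≪≫ ρ_ x

/-- The structure of an anti-symmetric `1`-morphism on `f`: a `2`-isomorphism
`f (g, h) ≃ -f (h, g)` whose square is the canonical isomorphism. -/
structure Antisymmetric (f : ∀ g h : G, Commute g h → P) where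
  iso (g h : G) (c : Commute g h) : f g h c ≅ I.neg (f h g c.symm)
  iso_comp (g h : G) (c : Commute g h) :
    (iso g h c).hom ≫ (I.negMap (iso h g c.symm)).hom ≫ (I.negNeg (f g h c)).hom = 𝟙 (f g h c)

end Inverses

end Bimult

/-! ### The commutator of a central extension -/

section Commutator

variable {G : Type w₂} [Group G]
  {P : Type u} [Category.{v} P] [MonoidalCategory P] [SymmetricCategory P] [PicardGroupoid P]

namespace CentralExtension

variable (L : CentralExtension.{u, v, w₁, t₁, w₂} G P)

/-- The commutativity constraint `L a + L b ⟶ L b + L a`. -/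
noncomputable abbrev com (a b : G) := PicardTorsor.comm P (L.torsor a) (L.torsor b)

/-- For commuting `g` and `h`, the composition
`L (g * h) ≃ L g + L h ≃ L h + L g ≃ L (h * g) = L (g * h)`. -/
noncomputable def commutatorHom {g h k : G} (e : g * h = k) (e' : h * g = k) :
    TorsorHom P (L.torsor k) (L.torsor k) :=
  ((L.mul e).comp (L.com g h)).comp (L.mul e').inv

/-- The value of the commutator `C₂`: a map from commuting pairs to the objects of `P`
together with `2`-isomorphisms between the translation by `C₂ (g, h)` on `L (g * h)` and the
composition `commutatorHom`. -/
structure Commutator where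
  obj (g h : G) : Commute g h → P
  iso {g h k : G} (e : g * h = k) (e' : h * g = k) :
    TorsorHom.Iso₂ (TorsorHom.translation (obj g h (e.trans e'.symm))) (L.commutatorHom e e')

/-- A morphism between two choices of the commutator. -/
structure Commutator.Iso {L : CentralExtension.{u, v, w₁, t₁, w₂} G P} (C C' : L.Commutator) where
  iso (g h : G) (c : Commute g h) : C.obj g h c ≅ C'.obj g h c
  comm {g h k : G} (e : g * h = k) (e' : h * g = k) (x : L.torsor k) :
    (iso g h (e.trans e'.symm)).hom ⊵ₗ x ≫ (C'.iso e e').iso.hom.app x = (C.iso e e').iso.hom.app x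

namespace Commutator

variable {L} (C : L.Commutator)

/-- The `2`-isomorphism `mul (h, g) (C₂ (g, h) + x) ≃ (mul (g, h) x)` with the two summands of the
right hand side interchanged, obtained from the defining `2`-isomorphism of `C₂`. -/
noncomputable def app {g h k : G} (e : g * h = k) (e' : h * g = k) (x : L.torsor k) :
    (L.mul e').functor.obj (C.obj g h (e.trans e'.symm) ⊙ₗ x) ≅
      (L.com g h).functor.obj ((L.mul e).functor.obj x) :=
  (L.mul e').functor.mapIso ((C.iso e e').iso.app x) ≪≫ (L.mul e').counit _

/-- The `1`-morphism `L a + (L c + L b) ⟶ L c + (L a + L b)`. -/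
noncomputable def permLeft (L : CentralExtension.{u, v, w₁, t₁, w₂} G P) (a b c : G) :
    TorsorHom P (TSum P (L.torsor a) (TSum P (L.torsor c) (L.torsor b)))
      (TSum P (L.torsor c) (TSum P (L.torsor a) (L.torsor b))) :=
  ((PicardTorsor.comm P _ _).comp (L.asc c b a)).comp ((L.one c).add (L.com b a))

/-- The equation between `2`-isomorphisms that determines
`C₂ (a * b, c) ≃ C₂ (a, c) + C₂ (b, c)`. Both sides are `2`-isomorphisms between `1`-morphisms
`L (a * b * c) ⟶ L c + (L a + L b)`. On the left hand side, the translations by `C₂ (a, c)` and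
`C₂ (b, c)` are combined to the translation by `C₂ (a * b, c)`, which is then replaced by the
commutativity constraint of `L (a * b)` and `L c`. On the right hand side, the two translations
are replaced one after the other by the commutativity constraints of `L a` and `L c` and of `L b`
and `L c`. -/
def IsMulLeft (B : Bimultiplicative C.obj) : Prop :=
  ∀ {a b c ab ac bc abc : G} (ab_eq : a * b = ab) (ac_eq : a * c = ac) (ca_eq : c * a = ac)
    (bc_eq : b * c = bc) (cb_eq : c * b = bc) (ab_c : ab * c = abc) (c_ab : c * ab = abc)
    (a_bc : a * bc = abc) (ac_b : ac * b = abc) (x : L.torsor abc),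
  letI y := C.obj a c (ac_eq.trans ca_eq.symm)
  letI z := C.obj b c (bc_eq.trans cb_eq.symm)
  (L.assocApp ca_eq ab_eq ac_b c_ab (y ⊙ₗ z ⊙ₗ x)).hom ≫
    ((L.mul c_ab).comp ((L.one c).add (L.mul ab_eq))).functor.map
      ((αₗ y z x).inv ≫ (B.mulLeft ab_eq (ac_eq.trans ca_eq.symm) (bc_eq.trans cb_eq.symm)
        (ab_c.trans c_ab.symm)).inv ⊵ₗ x) ≫
    ((L.one c).add (L.mul ab_eq)).functor.map (C.app ab_c c_ab x).hom ≫
    (((L.one a).add (L.com b c)).comp (permLeft L a b c)).functor.map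
      (L.assocApp ab_eq bc_eq ab_c a_bc x).hom =
  (((L.mul ca_eq).add (L.one b)).comp (L.asc c a b)).functor.map
      ((L.mul ac_b).lin y (z ⊙ₗ x)).hom ≫
    (L.asc c a b).functor.map
      (TSum.inj P (C.app ac_eq ca_eq ((L.mul ac_b).functor.obj (z ⊙ₗ x)).fst).hom
        (𝟙 ((L.mul ac_b).functor.obj (z ⊙ₗ x)).snd)) ≫
    (permLeft L a b c).functor.map (L.assocApp ac_eq cb_eq ac_b a_bc (z ⊙ₗ x)).hom ≫
    (((L.one a).add (L.mul cb_eq)).comp (permLeft L a b c)).functor.map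
      (((L.mul a_bc).lin z x).hom ≫
        TSum.slide z ((L.mul a_bc).functor.obj x).fst ((L.mul a_bc).functor.obj x).snd) ≫
    (permLeft L a b c).functor.map
      (TSum.inj P (𝟙 ((L.mul a_bc).functor.obj x).fst)
        (C.app bc_eq cb_eq ((L.mul a_bc).functor.obj x).snd).hom)

/-- The `1`-morphism `L a + (L b + L c) ⟶ L b + (L c + L a)`. -/
noncomputable def permRight (L : CentralExtension.{u, v, w₁, t₁, w₂} G P) (a b c : G) :
    TorsorHom P (TSum P (L.torsor a) (TSum P (L.torsor b) (L.torsor c)))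
      (TSum P (L.torsor b) (TSum P (L.torsor c) (L.torsor a))) :=
  (PicardTorsor.comm P _ _).comp (L.asc b c a)

/-- The equation between `2`-isomorphisms that determines
`C₂ (a, b * c) ≃ C₂ (a, b) + C₂ (a, c)`. Both sides are `2`-isomorphisms between `1`-morphisms
`L (a * b * c) ⟶ L b + (L c + L a)`. On the left hand side, the translations by `C₂ (a, c)` and
`C₂ (a, b)` are combined to the translation by `C₂ (a, b * c)`, which is then replaced by the
commutativity constraint of `L a` and `L (b * c)`. On the right hand side, the two translations
are replaced one after the other by the commutativity constraints of `L a` and `L c` and of `L a`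
and `L b`. -/
def IsMulRight (B : Bimultiplicative C.obj) : Prop :=
  ∀ {a b c ab ac bc abc : G} (ab_eq : a * b = ab) (ba_eq : b * a = ab) (ac_eq : a * c = ac)
    (ca_eq : c * a = ac) (bc_eq : b * c = bc) (ab_c : ab * c = abc) (a_bc : a * bc = abc)
    (bc_a : bc * a = abc) (b_ac : b * ac = abc) (x : L.torsor abc),
  letI y := C.obj a b (ab_eq.trans ba_eq.symm)
  letI z := C.obj a c (ac_eq.trans ca_eq.symm)
  (((L.mul bc_a).comp ((L.mul bc_eq).add (L.one a))).comp (L.asc b c a)).functor.map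
      ((αₗ z y x).inv ≫ (β_ z y).hom ⊵ₗ x ≫
        (B.mulRight bc_eq (ab_eq.trans ba_eq.symm) (ac_eq.trans ca_eq.symm)
          (a_bc.trans bc_a.symm)).inv ⊵ₗ x) ≫
    (((L.mul bc_eq).add (L.one a)).comp (L.asc b c a)).functor.map (C.app a_bc bc_a x).hom =
  (L.assocApp bc_eq ca_eq bc_a b_ac (z ⊙ₗ y ⊙ₗ x)).hom ≫
    ((L.one b).add (L.mul ca_eq)).functor.map
      (((L.mul b_ac).lin z (y ⊙ₗ x)).hom ≫
        TSum.slide z ((L.mul b_ac).functor.obj (y ⊙ₗ x)).fst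
          ((L.mul b_ac).functor.obj (y ⊙ₗ x)).snd) ≫
    TSum.inj P (𝟙 ((L.mul b_ac).functor.obj (y ⊙ₗ x)).fst)
      (C.app ac_eq ca_eq ((L.mul b_ac).functor.obj (y ⊙ₗ x)).snd).hom ≫
    ((L.one b).add (L.com a c)).functor.map (L.assocApp ba_eq ac_eq ab_c b_ac (y ⊙ₗ x)).inv ≫
    ((L.asc b a c).comp ((L.one b).add (L.com a c))).functor.map
      (((L.mul ba_eq).add (L.one c)).functor.map ((L.mul ab_c).lin y x).hom ≫
        TSum.inj P (C.app ab_eq ba_eq ((L.mul ab_c).functor.obj x).fst).hom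
          (𝟙 ((L.mul ab_c).functor.obj x).snd)) ≫
    (permRight L a b c).functor.map (L.assocApp ab_eq bc_eq ab_c a_bc x).hom

/-- The equation between `2`-isomorphisms that determines `C₂ (g, h) ≃ -C₂ (h, g)`: the isomorphism
`C₂ (h, g) + C₂ (g, h) ≃ C₂ (h, g) + (-C₂ (h, g)) ≃ e` corresponds to the identity of
`L (g * h) ≃ L g + L h`, which is the square of the commutativity constraint. -/
def IsAntisymm (I : Inverses P) (A : I.Antisymmetric C.obj) : Prop :=
  ∀ {g h k : G} (e : g * h = k) (e' : h * g = k) (x : L.torsor k),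
  letI y := C.obj h g (e'.trans e.symm)
  letI z := C.obj g h (e.trans e'.symm)
  (L.mul e).functor.map ((αₗ y z x).inv ≫
      ((y ◁ (A.iso g h (e.trans e'.symm)).hom) ≫ (I.iso y).hom) ⊵ₗ x ≫ (λₗ[P] x).hom) =
    (C.app e' e (z ⊙ₗ x)).hom ≫ (L.com h g).functor.map (C.app e e' x).hom

end Commutator
end CentralExtension
end Commutator

end PicardTorsor

-- Torsors are rigid. A `1`-morphism `F` is determined on all objects `p + v₀` by its value at `v₀`.
-- Hence `F` is an equivalence, a `2`-morphism is determined by one component (`Natural.eq_of_eq`),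
-- and every isomorphism `F v₀ ≃ G v₀` extends to a `2`-morphism (`Iso₂.exists_app_eq`). Moreover
-- every morphism `x + v ⟶ y + v` is `f + v` for a unique `f : x ⟶ y`. So every `1`-morphism `L ⟶ L`
-- is a translation, by an object that is unique up to unique isomorphism. Applied to the
-- composition `commutatorHom`, this is part (1).
--
-- In (2a), (2b) and (3) two `2`-morphisms have to coincide, one of which contains an unknown
-- morphism of `P`. If both sides are natural families between the same `1`-morphisms, the equation
-- can be solved at a single object, in exactly one way, and then holds at every object. This gives
-- `kL`, `kR` and `kA`. Sources and targets match because `A` and `C` are natural, satisfy the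
-- pentagon and the hexagons, and `C ∘ C = id`. These identities are strict equalities of
-- `1`-morphisms and are checked on generators of the sums.
--
-- The axioms remain: associativity, interchange and anti-symmetry. For the first two one chooses `v
-- : L a`, `w : L b`, ... and multiplies them by the inverse of `D`. The associativity
-- `2`-isomorphisms become isomorphisms `ass : (v * w) * u ⟶ v * (w * u)`, which satisfy the
-- pentagon (`ass_pentagon`). The commutator data become exchanges `sig : C (g, h) + v * w ⟶ w * v`,
-- and the equations for `kL` and `kR` become the two hexagons `merge_kL` and `merge_kR`, as in a
-- graded braided monoidal category. Each axiom is an equality of morphisms of `P`. Since `P` acts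
-- faithfully, it may be tested on one product of chosen objects, where both sides turn out to be
-- the same succession of exchanges of adjacent factors. For `kL` (and for `kR`) this succession
-- moves three factors past one (one past three). For the interchange, four exchanges occur in two
-- orders, which differ by two exchanges of disjoint pairs. These commute up to the commutativity
-- constraint of `P`, and this is the middle exchange `tensorμ`.
--
-- For (3), naturality of the commutator together with `C ∘ C = id` yields a zigzag identity
-- relating `kA g h` and `kA h g`. The anti-symmetry axiom is a formal consequence of it
-- (`Inverses.comp_negMap_negNeg`).
--
-- Throughout, linear structure is handled by twisted morphisms `x + v ⟶ w`. A `1`-morphism acts on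
-- them by `tw`, and a family of morphisms is a `2`-morphism exactly when it commutes with these
-- actions. In a sum the twisted morphisms are generated by those of the two summands, `twR` and
-- `twL`. The constraint `C` interchanges the two kinds, and `A` only rebrackets them.

universe w₅ t₅ w₆ t₆

set_option linter.unusedSectionVars false

namespace PicardTorsor

/-! ### Torsors: rigidity, the torsor structure of a sum, twisted morphisms. -/

section Torsor

variable {P : Type u} [Category.{v} P] [MonoidalCategory P] [SymmetricCategory P]
  {L : Type w₁} [Category.{t₁} L] [MonoidalLeftAction P L]
  {M : Type w₂} [Category.{t₂} M] [MonoidalLeftAction P M]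

attribute [instance] IsTorsor.actionLeft_isEquivalence IsTorsor.actionRight_isEquivalence

variable (P L) in
lemma IsTorsor.isGroupoid [PicardGroupoid P] [IsTorsor P L] : IsGroupoid L := by
  obtain ⟨v⟩ := IsTorsor.nonempty P (L := L)
  exact isGroupoid_of_reflects_iso (actionRight P v).inv

/-- Together with `whisker_surjective` this allows equations in `P` to be solved and tested after
acting on a single object of a torsor. -/
lemma IsTorsor.whisker_injective [IsTorsor P L] {x y : P} {v : L} {f g : x ⟶ y}
    (h : f ⊵ₗ v = g ⊵ₗ v) : f = g :=
  (actionRight P v).map_injective h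

lemma IsTorsor.whisker_surjective [IsTorsor P L] {x y : P} {v : L} (f : x ⊙ₗ v ⟶ y ⊙ₗ v) :
    ∃ g : x ⟶ y, g ⊵ₗ v = f :=
  (actionRight P v).map_surjective f

lemma IsTorsor.exists_act [IsTorsor P L] (v w : L) : ∃ p : P, Nonempty (p ⊙ₗ v ≅ w) :=
  ⟨(actionRight P v).objPreimage w, ⟨(actionRight P v).objObjPreimageIso w⟩⟩

/-- A functor is an equivalence as soon as its composition with `x ↦ x + v` is isomorphic to
some `x ↦ x + w`. -/
lemma TorsorHom.isEquivalence [IsTorsor P L] [IsTorsor P M] (F : TorsorHom P L M) :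
    F.functor.IsEquivalence := by
  obtain ⟨v⟩ := IsTorsor.nonempty P (L := L)
  let e : actionRight P (F.functor.obj v) ≅ actionRight P v ⋙ F.functor :=
    NatIso.ofComponents (fun x => (F.lin x v).symm) (fun {x y} f => by
      change f ⊵ₗ F.functor.obj v ≫ (F.lin y v).inv = (F.lin x v).inv ≫ F.functor.map (f ⊵ₗ v)
      rw [Iso.comp_inv_eq, Category.assoc, F.lin_nat_left, Iso.inv_hom_id_assoc])
  have := Functor.isEquivalence_of_iso e
  exact Functor.isEquivalence_of_comp_left (actionRight P v) F.functor

lemma TSum.homMk_surjective {a b : TSum P L M} (f : a ⟶ b) : ∃ x φ ψ, f = homMk (P := P) x φ ψ := by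
  obtain ⟨x, φ, ψ⟩ := f
  exact ⟨x, φ, ψ, rfl⟩

/-- Over a groupoid the relation on triples is already an equivalence relation, so equality in the
quotient gives back a single comparison morphism. -/
lemma TSum.rel_of_homMk_eq [PicardGroupoid P] {a b : TSum P L M} {x y : P}
    {φ : a.fst ⟶ x ⊙ₗ b.fst} {ψ : x ⊙ₗ a.snd ⟶ b.snd}
    {φ' : a.fst ⟶ y ⊙ₗ b.fst} {ψ' : y ⊙ₗ a.snd ⟶ b.snd} (h : homMk x φ ψ = homMk y φ' ψ') :
    ∃ f : x ⟶ y, φ ≫ f ⊵ₗ b.fst = φ' ∧ ψ = f ⊵ₗ a.snd ≫ ψ' := by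
  have h' : Relation.EqvGen (PreHom.Rel (P := P) (a := a) (b := b)) ⟨x, φ, ψ⟩ ⟨y, φ', ψ'⟩ :=
    Quot.eqvGen_exact h
  have key : ∀ p q : PreHom a b, Relation.EqvGen PreHom.Rel p q → p.Rel q := by
    intro p q h
    induction h with
    | rel _ _ h => exact h
    | refl p => exact ⟨𝟙 _, by simp, by simp⟩
    | symm p q _ h =>
      obtain ⟨f, h1, h2⟩ := h
      exact ⟨CategoryTheory.inv f, by rw [← h1]; simp, by rw [h2]; simp⟩
    | trans p q r _ _ h h' =>
      obtain ⟨f, h1, h2⟩ := h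
      obtain ⟨g, h3, h4⟩ := h'
      exact ⟨f ≫ g, by rw [← h3, ← h1]; simp, by rw [h2, h4]; simp⟩
  exact key _ _ h'

/-- `φ` with its target decomposed. -/
lemma TSum.exists_inj_eq [PicardGroupoid P] [IsTorsor P M] {v v' : L} {w : M}
    (f : (⟨v, w⟩ : TSum P L M) ⟶ ⟨v', w⟩) : ∃ g : v ⟶ v', inj P g (𝟙 w) = f := by
  obtain ⟨x, φ, ψ, rfl⟩ := homMk_surjective f
  -- As source and target have the same second entry, `ψ` is the action on `w` of some `k : x ⟶ e`.
  -- This `k` replaces the triple by one whose shift is the unit.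
  obtain ⟨k, hk⟩ := IsTorsor.whisker_surjective (P := P) (ψ ≫ (λₗ[P] w).inv)
  refine ⟨φ ≫ k ⊵ₗ v' ≫ (λₗ v').hom, ?_⟩
  rw [inj]
  refine (homMk_eq k ?_ ?_).symm
  · simp
  · change ψ = k ⊵ₗ w ≫ _
    rw [hk]; simp

/-- The functor `x ↦ x + (v, w)` is treated first. It is enough to control morphisms that fix the
second entry, since any other difference in that entry can be moved to the first one by `slide`. -/
instance TSum.isTorsor [PicardGroupoid P] [IsTorsor P L] [IsTorsor P M] :
    IsTorsor P (TSum P L M) := by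
  have := IsTorsor.isGroupoid P M
  have hr : ∀ a : TSum P L M, (actionRight P a).IsEquivalence := by
    rintro ⟨v, w⟩
    refine { faithful := ⟨?_⟩, full := ⟨?_⟩, essSurj := ⟨?_⟩ }
    · intro x y f g h
      change inj P (f ⊵ₗ v) (𝟙 w) = inj P (g ⊵ₗ v) (𝟙 w) at h
      obtain ⟨k, h1, h2⟩ := rel_of_homMk_eq h
      -- The comparison morphism is an endomorphism of the unit that acts trivially on `w`, hence it
      -- is the identity. Its condition on the first entries then says that `f` and `g` act equally
      -- on `v`.
      have hk : k = 𝟙 _ := by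
        apply IsTorsor.whisker_injective (v := w)
        rw [← cancel_mono ((λₗ[P] w).hom ≫ 𝟙 w)]
        refine h2.symm.trans ?_
        rw [id_actionHomLeft, Category.id_comp]
      apply IsTorsor.whisker_injective (v := v)
      subst hk
      rw [← cancel_mono (λₗ[P] _).inv]
      simpa using h1
    · intro x y f
      obtain ⟨g, hg⟩ := exists_inj_eq (P := P) f
      obtain ⟨k, rfl⟩ := IsTorsor.whisker_surjective (P := P) g
      exact ⟨k, hg⟩
    · rintro ⟨v', w'⟩
      -- `p` carries `w` to `w'`, and `q` is chosen such that `q + v ≃ p + v'`. Sliding `p` into the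
      -- second entry then leads to `(v', w')`.
      obtain ⟨p, ⟨e⟩⟩ := IsTorsor.exists_act (P := P) w w'
      obtain ⟨q, ⟨e'⟩⟩ := IsTorsor.exists_act (P := P) v (p ⊙ₗ v')
      have := isIso_inj (P := P) e'.hom (𝟙 w)
      have := isIso_inj (P := P) (𝟙 v') e.hom
      have := isIso_slide (P := P) p v' w
      let i : (⟨q ⊙ₗ v, w⟩ : TSum P L M) ≅ ⟨v', w'⟩ :=
        injIso P e' w ≪≫ slideIso p v' w ≪≫ asIso (inj P (𝟙 v') e.hom)
      exact ⟨q, ⟨i⟩⟩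
  obtain ⟨v⟩ := IsTorsor.nonempty P (L := L)
  obtain ⟨w⟩ := IsTorsor.nonempty P (L := M)
  refine ⟨⟨⟨v, w⟩⟩, fun x => ?_, hr⟩
  let a : TSum P L M := ⟨v, w⟩
  have := hr a
  -- Under the equivalence `y ↦ y + a` the functor `x + -` corresponds to tensoring with `x`, which
  -- is an equivalence of `P`.
  let e : tensorLeft x ⋙ actionRight P a ≅ actionRight P a ⋙ actionLeft (TSum P L M) x :=
    NatIso.ofComponents (fun y => αₗ x y a) (fun {y z} f => by
      change (x ◁ f) ⊵ₗ a ≫ (αₗ x z a).hom = (αₗ x y a).hom ≫ x ⊴ₗ f ⊵ₗ a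
      simp)
  have := Functor.isEquivalence_of_iso e
  exact Functor.isEquivalence_of_comp_left (actionRight P a) (actionLeft (TSum P L M) x)

namespace TorsorHom

/-- The morphism `x + F v ⟶ F w` induced by `x + v ⟶ w`. -/
def tw (F : TorsorHom P L M) {x : P} {v w : L} (κ : x ⊙ₗ v ⟶ w) :
    x ⊙ₗ F.functor.obj v ⟶ F.functor.obj w :=
  (F.lin x v).inv ≫ F.functor.map κ

lemma lin_tw (F : TorsorHom P L M) {x : P} {v w : L} (κ : x ⊙ₗ v ⟶ w) :
    (F.lin x v).hom ≫ F.tw κ = F.functor.map κ := by simp [tw]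

lemma tw_map (F : TorsorHom P L M) {x : P} {v w w' : L} (κ : x ⊙ₗ v ⟶ w) (f : w ⟶ w') :
    F.tw (κ ≫ f) = F.tw κ ≫ F.functor.map f := by simp [tw]

lemma act_map_tw (F : TorsorHom P L M) {x : P} {v v' w : L} (f : v ⟶ v') (κ : x ⊙ₗ v' ⟶ w) :
    x ⊴ₗ F.functor.map f ≫ F.tw κ = F.tw (x ⊴ₗ f ≫ κ) := by
  have := F.lin_nat_right x f
  rw [tw, tw, ← cancel_epi (F.lin x v).hom, Iso.hom_inv_id_assoc, ← reassoc_of% this]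
  simp

lemma whisker_tw (F : TorsorHom P L M) {x y : P} {v w : L} (f : x ⟶ y) (κ : y ⊙ₗ v ⟶ w) :
    f ⊵ₗ F.functor.obj v ≫ F.tw κ = F.tw (f ⊵ₗ v ≫ κ) := by
  have := F.lin_nat_left f v
  rw [tw, tw, ← cancel_epi (F.lin x v).hom, Iso.hom_inv_id_assoc, ← reassoc_of% this]
  simp

lemma tw_tw (F : TorsorHom P L M) {x y : P} {u v w : L} (κ : x ⊙ₗ u ⟶ v) (κ' : y ⊙ₗ v ⟶ w) :
    y ⊴ₗ F.tw κ ≫ F.tw κ' = y ⊴ₗ (F.lin x u).inv ≫ F.tw (y ⊴ₗ κ ≫ κ') := by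
  rw [tw, actionHomRight_comp, Category.assoc, act_map_tw]

lemma assoc_tw (F : TorsorHom P L M) {x y : P} {u w : L} (κ : x ⊙ₗ y ⊙ₗ u ⟶ w) :
    F.tw ((αₗ x y u).hom ≫ κ) = (αₗ x y _).hom ≫ x ⊴ₗ (F.lin y u).inv ≫ F.tw κ := by
  have := F.lin_assoc x y u
  rw [tw, tw, ← cancel_epi (F.lin (x ⊗ y) u).hom, reassoc_of% this]
  simp

/-- `F` respects the interchange of two acting objects; this is `lin_swap` in terms of twisted
morphisms. -/
lemma swap_tw (F : TorsorHom P L M) {x y : P} {u w : L} (κ : y ⊙ₗ x ⊙ₗ u ⟶ w) :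
    (swap x y _).hom ≫ y ⊴ₗ (F.lin x u).inv ≫ F.tw κ =
      x ⊴ₗ (F.lin y u).inv ≫ F.tw ((swap x y u).hom ≫ κ) := by
  have := F.lin_swap x y u
  rw [tw, tw, ← cancel_epi (x ⊴ₗ (F.lin y u).hom), ← cancel_epi (F.lin x (y ⊙ₗ u)).hom,
    ← reassoc_of% this]
  simp

lemma comp_tw {N : Type w₃} [Category.{t₃} N] [MonoidalLeftAction P N] (F : TorsorHom P L M)
    (G : TorsorHom P M N) {x : P} {v w : L} (κ : x ⊙ₗ v ⟶ w) :
    (F.comp G).tw κ = G.tw (F.tw κ) := by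
  simp [tw, comp]

lemma id_tw {x : P} {v w : L} (κ : x ⊙ₗ v ⟶ w) : (id P L).tw κ = κ := by
  simp [tw, id]

lemma translation_tw (z : P) {x : P} {v w : L} (κ : x ⊙ₗ v ⟶ w) :
    (translation z).tw κ = (swap x z v).hom ≫ z ⊴ₗ κ := rfl

lemma Iso₂.tw_app {F G : TorsorHom P L M} (τ : Iso₂ F G) {x : P} {v w : L} (κ : x ⊙ₗ v ⟶ w) :
    x ⊴ₗ τ.iso.hom.app v ≫ G.tw κ = F.tw κ ≫ τ.iso.hom.app w := by
  have h1 := τ.comm x v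
  have h2 := τ.iso.hom.naturality κ
  rw [tw, tw, ← cancel_epi (F.lin x v).hom, reassoc_of% h1]
  simp [h2]

lemma Iso₂.tw_app_inv {F G : TorsorHom P L M} (τ : Iso₂ F G) {x : P} {v w : L} (κ : x ⊙ₗ v ⟶ w) :
    x ⊴ₗ τ.iso.inv.app v ≫ F.tw κ = G.tw κ ≫ τ.iso.inv.app w := by
  rw [← cancel_mono (τ.iso.hom.app w), Category.assoc, ← Iso₂.tw_app, ← actionHomRight_comp_assoc]
  simp

/-- The morphism `x + F⁻¹ v ⟶ F⁻¹ w` induced by `x + v ⟶ w`. -/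
noncomputable def invTw (F : TorsorHom P L M) [F.functor.IsEquivalence] {x : P} {v w : M}
    (κ : x ⊙ₗ v ⟶ w) : x ⊙ₗ F.functor.inv.obj v ⟶ F.functor.inv.obj w :=
  (F.invLin x v).inv ≫ F.functor.inv.map κ

/-- This characterizes `invTw κ` by its image under `F`, so that the inverse functor need not be
unfolded afterwards. -/
lemma tw_invTw (F : TorsorHom P L M) [F.functor.IsEquivalence] {x : P} {v w : M}
    (κ : x ⊙ₗ v ⟶ w) :
    F.tw (F.invTw κ) ≫ (F.counit w).hom = x ⊴ₗ (F.counit v).hom ≫ κ := by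
  have h1 := F.map_invLin x v
  have h2 := F.counit_nat κ
  have e : F.functor.map (F.invLin x v).inv = (F.lin x (F.functor.inv.obj v)).hom ≫
      x ⊴ₗ (F.counit v).hom ≫ (F.counit (x ⊙ₗ v)).inv := by
    have : F.functor.map (F.invLin x v).hom ≫ F.functor.map (F.invLin x v).inv = 𝟙 _ := by
      rw [← F.functor.map_comp, Iso.hom_inv_id, F.functor.map_id]
    rw [← cancel_epi (F.functor.map (F.invLin x v).hom), this, reassoc_of% h1, Iso.hom_inv_id]
  rw [tw, invTw, F.functor.map_comp, Category.assoc, Category.assoc, h2, e]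
  simp

end TorsorHom

end Torsor

end PicardTorsor

namespace PicardTorsor

/-! ### Construction and rigidity of `2`-morphisms. -/

section Iso₂

variable {P : Type u} [Category.{v} P] [MonoidalCategory P] [SymmetricCategory P]
  {L : Type w₁} [Category.{t₁} L] [MonoidalLeftAction P L]
  {M : Type w₂} [Category.{t₂} M] [MonoidalLeftAction P M]

namespace TorsorHom

lemma tw_unit (F : TorsorHom P L M) {v w : L} (f : v ⟶ w) :
    F.tw ((λₗ[P] v).hom ≫ f) = (λₗ _).hom ≫ F.functor.map f := by
  rw [tw_map, tw, ← F.lin_unit]; simp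

lemma tw_id (F : TorsorHom P L M) (x : P) (v : L) : F.tw (𝟙 (x ⊙ₗ v)) = (F.lin x v).inv := by
  simp [tw]

lemma tw_assoc_inv (F : TorsorHom P L M) {x y : P} {u w : L} (κ : (x ⊗ y) ⊙ₗ u ⟶ w) :
    x ⊴ₗ (F.lin y u).inv ≫ F.tw ((αₗ x y u).inv ≫ κ) = (αₗ x y _).inv ≫ F.tw κ := by
  have := F.assoc_tw ((αₗ x y u).inv ≫ κ)
  rw [Iso.hom_inv_id_assoc] at this
  rw [this]; simp

/-- A `2`-morphism is a family of isomorphisms compatible with the morphisms `x + v ⟶ w`. -/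
def Iso₂.ofTw {F G : TorsorHom P L M} (τ : ∀ v, F.functor.obj v ≅ G.functor.obj v)
    (h : ∀ {x : P} {v w : L} (κ : x ⊙ₗ v ⟶ w), x ⊴ₗ (τ v).hom ≫ G.tw κ = F.tw κ ≫ (τ w).hom) :
    Iso₂ F G where
  iso := NatIso.ofComponents τ (fun {v w} f => by
    -- An ordinary morphism is a morphism twisted by the unit, so naturality is the case `x = e`.
    -- The compatibility with `lin` below is the case of the identity of `x + v`.
    have := h ((λₗ[P] v).hom ≫ f)
    rw [tw_unit, tw_unit, ← reassoc_of% (actionUnitIso_hom_naturality (τ v).hom), Category.assoc,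
      cancel_epi] at this
    exact this.symm)
  comm x v := by
    have := h (𝟙 (x ⊙ₗ v))
    rw [tw_id, tw_id, Iso.comp_inv_eq, Category.assoc, Iso.eq_inv_comp] at this
    exact this

/-- A `2`-morphism with a prescribed component. -/
lemma Iso₂.exists_app_eq [PicardGroupoid P] [IsTorsor P L] [IsTorsor P M] (F G : TorsorHom P L M)
    {v₀ : L} (e : F.functor.obj v₀ ≅ G.functor.obj v₀) :
    ∃ τ : Iso₂ F G, τ.iso.hom.app v₀ = e.hom := by
  have := IsTorsor.isGroupoid P L
  have := IsTorsor.isGroupoid P M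
  choose p c using fun w : L => IsTorsor.exists_act (P := P) v₀ w
  let c' : ∀ w, p w ⊙ₗ v₀ ≅ w := fun w => (c w).some
  -- Naturality along `c' v : p v + v₀ ⟶ v` forces this formula.
  let τ : ∀ v, F.functor.obj v ≅ G.functor.obj v := fun v =>
    asIso (CategoryTheory.inv (F.tw (c' v).hom) ≫ p v ⊴ₗ e.hom ≫ G.tw (c' v).hom)
  have hτ : ∀ w, F.tw (c' w).hom ≫ (τ w).hom = p w ⊴ₗ e.hom ≫ G.tw (c' w).hom := by
    intro w
    simp [τ]
  -- The component at `w` does not depend on the choice of `c' w`: any `κ : x + v₀ ⟶ w` factors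
  -- through `c' w` by a morphism of `P`, and morphisms of `P` commute with both sides.
  have hτ' : ∀ {x : P} {w : L} (κ : x ⊙ₗ v₀ ⟶ w), F.tw κ ≫ (τ w).hom = x ⊴ₗ e.hom ≫ G.tw κ := by
    intro x w κ
    obtain ⟨k, hk⟩ := IsTorsor.whisker_surjective (P := P) (κ ≫ (c' w).inv)
    have hκ : κ = k ⊵ₗ v₀ ≫ (c' w).hom := by rw [hk]; simp
    rw [hκ, ← whisker_tw, ← whisker_tw, Category.assoc, hτ, action_exchange_assoc]
  have h : ∀ {x : P} {v w : L} (κ : x ⊙ₗ v ⟶ w),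
      x ⊴ₗ (τ v).hom ≫ G.tw κ = F.tw κ ≫ (τ w).hom := by
    intro x v w κ
    -- Precomposition with `c' v` replaces `κ` by a twisted morphism out of `v₀`, to which `hτ'`
    -- applies.
    rw [← cancel_epi (x ⊴ₗ F.tw (c' v).hom), ← actionHomRight_comp_assoc, hτ, ← Category.assoc (x ⊴ₗ F.tw _), tw_tw,
      actionHomRight_comp, Category.assoc, tw_tw, ← cancel_epi (αₗ x (p v) _).hom, Category.assoc]
    rw [← reassoc_of% (F.assoc_tw (x ⊴ₗ (c' v).hom ≫ κ)), hτ', assoc_tw]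
    simp
  refine ⟨Iso₂.ofTw τ h, ?_⟩
  change (τ v₀).hom = _
  have := hτ' ((λₗ[P] v₀).hom ≫ 𝟙 _)
  rw [tw_unit, tw_unit] at this
  simpa using this

/-- The object `z` is read off at one `v` from `z + v ≃ F v`. This isomorphism is then extended to a
`2`-morphism. -/
lemma Iso₂.exists_translation [PicardGroupoid P] [IsTorsor P L] (F : TorsorHom P L L) :
    ∃ z : P, Nonempty (Iso₂ (translation z) F) := by
  obtain ⟨v⟩ := IsTorsor.nonempty P (L := L)
  obtain ⟨z, ⟨e⟩⟩ := IsTorsor.exists_act (P := P) v (F.functor.obj v)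
  exact ⟨z, ⟨(Iso₂.exists_app_eq (translation z) F e).choose⟩⟩

/-- The components `z + x ⟶ F x` of a `2`-morphism from a translation. -/
def Iso₂.comp {F : TorsorHom P L L} {z : P} (τ : Iso₂ (translation z) F) (x : L) :
    z ⊙ₗ x ⟶ F.functor.obj x := τ.iso.hom.app x

instance {F : TorsorHom P L L} {z : P} (τ : Iso₂ (translation z) F) (x : L) : IsIso (τ.comp x) :=
  inferInstanceAs (IsIso (τ.iso.hom.app x))

lemma Iso₂.tw_comp {F : TorsorHom P L L} {z : P} (τ : Iso₂ (translation z) F) {p : P} {x y : L}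
    (κ : p ⊙ₗ x ⟶ y) : p ⊴ₗ τ.comp x ≫ F.tw κ = (swap p z x).hom ≫ z ⊴ₗ κ ≫ τ.comp y :=
  (τ.tw_app κ).trans (Category.assoc _ _ _)

/-- At one object `v` the equation has exactly one solution. It persists at `x ≃ p + v` because
translations carry `p + -` along by the commutativity constraint, which is natural in the
translating object. -/
lemma Iso₂.existsUnique_whisker [PicardGroupoid P] [IsTorsor P L] {F : TorsorHom P L L} {z z' : P}
    (τ : Iso₂ (translation z) F) (τ' : Iso₂ (translation z') F) :
    ∃! k : z ⟶ z', ∀ x, k ⊵ₗ x ≫ τ'.comp x = τ.comp x := by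
  obtain ⟨v⟩ := IsTorsor.nonempty P (L := L)
  obtain ⟨k, hk⟩ := IsTorsor.whisker_surjective (P := P) (τ.comp v ≫ CategoryTheory.inv (τ'.comp v))
  have hv : k ⊵ₗ v ≫ τ'.comp v = τ.comp v := by rw [hk]; simp
  refine ⟨k, fun x => ?_, fun k' hk' => ?_⟩
  · obtain ⟨p, ⟨c⟩⟩ := IsTorsor.exists_act (P := P) v x
    rw [← cancel_epi ((swap p z v).hom ≫ z ⊴ₗ c.hom), Category.assoc, Category.assoc, ← τ.tw_comp,
      ← hv, actionHomRight_comp, Category.assoc, τ'.tw_comp, action_exchange_assoc,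
      reassoc_of% (swap_nat_mid p k v)]
  · have h := hk' v
    rw [← hv] at h
    exact IsTorsor.whisker_injective (v := v) ((cancel_mono _).1 h)

end TorsorHom

end Iso₂

/-! ### Existence and uniqueness of the commutator data. -/

section

variable {G : Type w₂} [Group G]
  {P : Type u} [Category.{v} P] [MonoidalCategory P] [SymmetricCategory P] [PicardGroupoid P]
  (L : CentralExtension.{u, v, w₁, t₁, w₂} G P)

namespace CentralExtension

/-- The choice is made for `k = g * h`. Any other name of the product is reduced to this one by
substitution, so that the object depends only on the pair. -/
lemma nonempty_commutator : Nonempty L.Commutator := by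
  have h := fun (g h : G) (c : Commute g h) =>
    TorsorHom.Iso₂.exists_translation (L.commutatorHom (g := g) (h := h) rfl c.eq.symm)
  exact ⟨{ obj := fun g h' c => (h g h' c).choose
           iso := fun {g h' k} e e' => by
            subst e
            exact (h g h' e'.symm).choose_spec.some }⟩

lemma Commutator.nonempty_unique_iso {L : CentralExtension.{u, v, w₁, t₁, w₂} G P}
    (C C' : L.Commutator) : Nonempty (Unique (C.Iso C')) := by
  have h := fun (g h : G) (c : Commute g h) =>
    TorsorHom.Iso₂.existsUnique_whisker (C.iso (g := g) (h := h) rfl c.eq.symm) (C'.iso rfl c.eq.symm)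
  refine ⟨⟨⟨⟨fun g h' c => asIso (h g h' c).choose, fun {g h' k} e e' x => ?_⟩⟩, fun I => ?_⟩⟩
  · subst e
    exact (h g h' e'.symm).choose_spec.1 x
  · obtain ⟨i, hi⟩ := I
    congr 1
    funext g h' c
    ext
    exact (h g h' c).choose_spec.2 _ (fun x => hi rfl c.eq.symm x)

end CentralExtension
end

end PicardTorsor

namespace PicardTorsor

/-! ### Calculus of twisted morphisms, and the two kinds of generators of a sum. -/

section TwistedCalculus

variable {P : Type u} [Category.{v} P] [MonoidalCategory P] [SymmetricCategory P]
  {L : Type w₁} [Category.{t₁} L] [MonoidalLeftAction P L]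
  {M : Type w₂} [Category.{t₂} M] [MonoidalLeftAction P M]
  {N : Type w₃} [Category.{t₃} N] [MonoidalLeftAction P N]

/-- The morphism `x + (y + v) ⟶ z + v` induced by `x + y ⟶ z`. -/
def merge {x y z : P} (k : x ⊗ y ⟶ z) (v : L) : x ⊙ₗ y ⊙ₗ v ⟶ z ⊙ₗ v :=
  (αₗ x y v).inv ≫ k ⊵ₗ v

lemma merge_nat {x y z : P} (k : x ⊗ y ⟶ z) {v w : L} (f : v ⟶ w) :
    x ⊴ₗ y ⊴ₗ f ≫ merge k w = merge k v ≫ z ⊴ₗ f := by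
  rw [merge, merge, Category.assoc, ← action_exchange, ← Category.assoc, ← Category.assoc]
  congr 1
  simp

/-- The hypothesis says that `κ` acts like `κ₁` followed by `κ₂` once `x` and `y` are combined by
`k`. This relation is preserved by every `1`-morphism, and it is the form in which the isomorphisms
`kL` and `kR` are used. -/
lemma TorsorHom.merge_tw (F : TorsorHom P L M) {x y z : P} (k : x ⊗ y ⟶ z) {v v' w : L}
    {κ : z ⊙ₗ v ⟶ w} {κ₁ : y ⊙ₗ v ⟶ v'} {κ₂ : x ⊙ₗ v' ⟶ w}
    (h : merge k v ≫ κ = x ⊴ₗ κ₁ ≫ κ₂) :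
    merge k (F.functor.obj v) ≫ F.tw κ = x ⊴ₗ F.tw κ₁ ≫ F.tw κ₂ := by
  rw [tw_tw, ← h, merge, merge, Category.assoc, Category.assoc, whisker_tw, tw_assoc_inv]

lemma TorsorHom.tw_exchange (F : TorsorHom P L M) {x y : P} {u v v' w : L}
    {κ₁ : y ⊙ₗ u ⟶ v} {κ₂ : x ⊙ₗ v ⟶ w} {κ₁' : x ⊙ₗ u ⟶ v'} {κ₂' : y ⊙ₗ v' ⟶ w}
    (h : x ⊴ₗ κ₁ ≫ κ₂ = (swap x y u).hom ≫ y ⊴ₗ κ₁' ≫ κ₂') :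
    x ⊴ₗ F.tw κ₁ ≫ F.tw κ₂ = (swap x y _).hom ≫ y ⊴ₗ F.tw κ₁' ≫ F.tw κ₂' := by
  rw [tw_tw, tw_tw, h, swap_tw]

namespace TSum

/-- The morphism `x + (v, w) ⟶ (v', w)` induced by `x + v ⟶ v'`. -/
def twR {x : P} {v v' : L} (φ : x ⊙ₗ v ⟶ v') (w : M) :
    x ⊙ₗ (⟨v, w⟩ : TSum P L M) ⟶ (⟨v', w⟩ : TSum P L M) := inj P φ (𝟙 w)

/-- The morphism `x + (v, w) ⟶ (v, w')` induced by `x + w ⟶ w'`. -/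
def twL {x : P} (v : L) {w w' : M} (φ : x ⊙ₗ w ⟶ w') :
    x ⊙ₗ (⟨v, w⟩ : TSum P L M) ⟶ (⟨v, w'⟩ : TSum P L M) :=
  homMk (a := (⟨x ⊙ₗ v, w⟩ : TSum P L M)) x (𝟙 _) φ

lemma twL_eq {x : P} (v : L) {w w' : M} (φ : x ⊙ₗ w ⟶ w') :
    twL v φ = (slide x v w ≫ inj P (𝟙 v) φ : (⟨x ⊙ₗ v, w⟩ : TSum P L M) ⟶ ⟨v, w'⟩) := by
  rw [slide, homMk_inj, twL]; simp

lemma act_inj (x : P) {v v' : L} {w w' : M} (f : v ⟶ v') (g : w ⟶ w') :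
    x ⊴ₗ (inj P f g : (⟨v, w⟩ : TSum P L M) ⟶ ⟨v', w'⟩) = inj P (x ⊴ₗ f) g := actMap_inj x f g

lemma act_inj_twR {x : P} {u v v' : L} {w w' : M} (f : u ⟶ v) (g : w ⟶ w') (φ : x ⊙ₗ v ⟶ v') :
    x ⊴ₗ (inj P f g : (⟨u, w⟩ : TSum P L M) ⟶ ⟨v, w'⟩) ≫ twR φ w' =
      twR (x ⊴ₗ f ≫ φ) w ≫ inj P (𝟙 v') g := by
  rw [act_inj]
  refine (inj_comp _ _ _ _).trans ((inj_comp _ _ _ _).trans ?_).symm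
  simp

lemma twR_inj {x : P} {v v' v'' : L} (φ : x ⊙ₗ v ⟶ v') (w : M) (f : v' ⟶ v'') :
    twR φ w ≫ inj P f (𝟙 w) = twR (φ ≫ f) w :=
  (inj_comp _ _ _ _).trans (by rw [Category.comp_id]; rfl)

lemma act_inj_twL {x : P} {u v : L} {w w' w'' : M} (f : u ⟶ v) (g : w ⟶ w') (φ : x ⊙ₗ w' ⟶ w'') :
    x ⊴ₗ (inj P f g : (⟨u, w⟩ : TSum P L M) ⟶ ⟨v, w'⟩) ≫ twL v φ =
      twL u (x ⊴ₗ g ≫ φ) ≫ inj P f (𝟙 w'') := by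
  rw [act_inj]
  refine (inj_homMk _ _ _ _ _).trans ((homMk_inj _ _ _ _ _).trans ?_).symm
  simp

lemma twL_inj {x : P} (v : L) {w w' w'' : M} (φ : x ⊙ₗ w ⟶ w') (g : w' ⟶ w'') :
    twL v φ ≫ inj P (𝟙 v) g = twL v (φ ≫ g) :=
  (homMk_inj _ _ _ _ _).trans (by rw [actionHomRight_id, Category.comp_id]; rfl)

lemma merge_twR {x y z : P} (k : x ⊗ y ⟶ z) {v v' v'' : L} (w : M)
    {κ : z ⊙ₗ v ⟶ v''} {κ₁ : y ⊙ₗ v ⟶ v'} {κ₂ : x ⊙ₗ v' ⟶ v''}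
    (h : merge k v ≫ κ = x ⊴ₗ κ₁ ≫ κ₂) :
    merge k (⟨v, w⟩ : TSum P L M) ≫ twR κ w = x ⊴ₗ twR κ₁ w ≫ twR κ₂ w := by
  have h1 : merge k (⟨v, w⟩ : TSum P L M) = inj P (merge k v) (𝟙 w) := inj_comp_id _ _ _
  have h2 : x ⊴ₗ (twR κ₁ w : y ⊙ₗ (⟨v, w⟩ : TSum P L M) ⟶ _) = inj P (x ⊴ₗ κ₁) (𝟙 w) :=
    actMap_inj _ _ _
  rw [h1, h2]
  refine (inj_comp_id _ _ _).trans (Eq.trans ?_ (inj_comp_id _ _ _).symm)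
  rw [h]

lemma merge_twL {x y z : P} (k : x ⊗ y ⟶ z) (v : L) {w w' w'' : M}
    {κ : z ⊙ₗ w ⟶ w''} {κ₁ : y ⊙ₗ w ⟶ w'} {κ₂ : x ⊙ₗ w' ⟶ w''}
    (h : merge k w ≫ κ = x ⊴ₗ κ₁ ≫ κ₂) :
    merge k (⟨v, w⟩ : TSum P L M) ≫ twL v κ = x ⊴ₗ twL v κ₁ ≫ twL v κ₂ := by
  have h1 : merge k (⟨v, w⟩ : TSum P L M) = inj P (merge k v) (𝟙 w) := inj_comp_id _ _ _
  have h2 : x ⊴ₗ (twL v κ₁ : y ⊙ₗ (⟨v, w⟩ : TSum P L M) ⟶ _) =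
      inj P (swap x y v).hom (𝟙 w) ≫ slide y (x ⊙ₗ v) w ≫ inj P (𝟙 _) κ₁ := by
    rw [twL_eq]
    refine (actMap_comp x (slide y v w) (inj P (𝟙 v) κ₁)).trans ?_
    rw [actMap_slide, actMap_inj, Category.assoc, actionHomRight_id]
  rw [h1, h2, twL_eq, twL_eq]
  have h3 := slide_nat x (𝟙 v) κ₁
  rw [actionHomRight_id] at h3
  have h4 := slide_natx k v w
  -- `slide_mul` slides `x` before `y`, whereas on the right hand side `y` is slid first. The two
  -- orders are compared by `slide_swap`.
  have h5 : inj P (αₗ x y v).inv (𝟙 w) ≫ slide (x ⊗ y) v w =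
      inj P (swap x y v).hom (𝟙 w) ≫ slide y (x ⊙ₗ v) w ≫ slide x v (y ⊙ₗ w) ≫
        inj P (𝟙 v) (αₗ x y w).inv := by
    rw [slide_mul, reassoc_of% (slide_swap x y v w), inj_comp', Iso.inv_hom_id, Category.comp_id,
      inj_id, Category.id_comp, inj_comp, Category.id_comp]
  have h6 : inj P (merge k v) (𝟙 w) = inj P (αₗ x y v).inv (𝟙 w) ≫ inj P (k ⊵ₗ v) (𝟙 w) :=
    (inj_comp_id _ _ _).symm
  refine Eq.trans (congrArg (· ≫ slide z v w ≫ inj P (𝟙 v) κ) h6) ?_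
  have h7 : inj P (𝟙 v) (k ⊵ₗ w) ≫ inj P (𝟙 v) κ = inj P (𝟙 v) (k ⊵ₗ w ≫ κ) := by
    rw [inj_comp, Category.comp_id]
  rw [Category.assoc, reassoc_of% h4, h7, reassoc_of% h5]
  refine Eq.trans ?_ (Category.assoc _ _ _).symm
  congr 1
  refine Eq.trans ?_ (Category.assoc _ _ _).symm
  congr 1
  refine Eq.trans ?_ (Category.assoc _ _ _)
  refine Eq.trans ?_ (congrArg (· ≫ inj P (𝟙 v) κ₂) h3.symm)
  rw [Category.assoc, inj_comp, inj_comp, ← h, merge, Category.assoc]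

/-- Morphisms of different summands commute up to the interchange of the twisting objects. This is
the origin of the middle exchange in the compatibility of the two multiplicative structures. -/
lemma twL_twR_exchange {x y : P} {v v' : L} {w w' : M} (φ : x ⊙ₗ v ⟶ v') (ψ : y ⊙ₗ w ⟶ w') :
    x ⊴ₗ (twL v ψ : y ⊙ₗ (⟨v, w⟩ : TSum P L M) ⟶ _) ≫ twR φ w' =
      (swap x y (⟨v, w⟩ : TSum P L M)).hom ≫ y ⊴ₗ (twR φ w : x ⊙ₗ (⟨v, w⟩ : TSum P L M) ⟶ _) ≫
        twL v' ψ := by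
  have h2 : x ⊴ₗ (twL v ψ : y ⊙ₗ (⟨v, w⟩ : TSum P L M) ⟶ _) =
      inj P (swap x y v).hom (𝟙 w) ≫ slide y (x ⊙ₗ v) w ≫ inj P (𝟙 _) ψ := by
    rw [twL_eq]
    refine (actMap_comp x (slide y v w) (inj P (𝟙 v) ψ)).trans ?_
    rw [actMap_slide, actMap_inj, Category.assoc, actionHomRight_id]
  have h3 : y ⊴ₗ (twR φ w : x ⊙ₗ (⟨v, w⟩ : TSum P L M) ⟶ _) = inj P (y ⊴ₗ φ) (𝟙 w) :=
    actMap_inj _ _ _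
  rw [h2, h3, swap_tsum, twL_eq, twR]
  refine (Category.assoc _ _ _).trans ?_
  congr 1
  refine (Category.assoc _ _ _).trans ?_
  have h4 := slide_nat y φ (𝟙 w)
  rw [actionHomRight_id] at h4
  refine Eq.trans ?_ (Category.assoc _ _ _)
  refine Eq.trans ?_ (congrArg (· ≫ inj P (𝟙 v') ψ) h4.symm)
  rw [Category.assoc, inj_comp, inj_comp]
  simp

end TSum

end TwistedCalculus

/-! ### The effect of `F + G`, `A` and `C` on the generators of a sum. -/

section TwistedHoms

variable {P : Type u} [Category.{v} P] [MonoidalCategory P] [SymmetricCategory P]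
  {L : Type w₁} [Category.{t₁} L] [MonoidalLeftAction P L]
  {M : Type w₂} [Category.{t₂} M] [MonoidalLeftAction P M]
  {L' : Type w₃} [Category.{t₃} L'] [MonoidalLeftAction P L']
  {M' : Type w₄} [Category.{t₄} M'] [MonoidalLeftAction P M']
  {N : Type w₅} [Category.{t₅} N] [MonoidalLeftAction P N]

namespace TorsorHom

lemma add_map_inj (F : TorsorHom P L L') (G : TorsorHom P M M') {v v' : L} {w w' : M}
    (f : v ⟶ v') (g : w ⟶ w') :
    (F.add G).functor.map (TSum.inj P f g) = TSum.inj P (F.functor.map f) (G.functor.map g) :=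
  Balanced.desc_inj _ _ _

lemma add_map_slide (F : TorsorHom P L L') (G : TorsorHom P M M') (x : P) (v : L) (w : M) :
    (F.add G).functor.map (TSum.slide x v w) = TSum.inj P (F.lin x v).hom (𝟙 _) ≫
      TSum.slide x _ _ ≫ TSum.inj P (𝟙 _) (G.lin x w).inv :=
  Balanced.desc_slide _ _ _ _

lemma add_tw_twR (F : TorsorHom P L L') (G : TorsorHom P M M') {x : P} {v v' : L}
    (φ : x ⊙ₗ v ⟶ v') (w : M) :
    (F.add G).tw (TSum.twR φ w) = TSum.twR (F.tw φ) (G.functor.obj w) := by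
  refine (congrArg (TSum.inj P (F.lin x v).inv (𝟙 (G.functor.obj w)) ≫ ·)
    (add_map_inj F G φ (𝟙 w))).trans ?_
  rw [G.functor.map_id]
  exact TSum.inj_comp_id _ _ _

lemma add_tw_twL (F : TorsorHom P L L') (G : TorsorHom P M M') {x : P} (v : L) {w w' : M}
    (φ : x ⊙ₗ w ⟶ w') :
    (F.add G).tw (TSum.twL v φ) = TSum.twL (F.functor.obj v) (G.tw φ) := by
  have h : (F.add G).functor.map (TSum.slide x v w ≫ TSum.inj P (𝟙 v) φ) =
      TSum.inj P (F.lin x v).hom (𝟙 _) ≫ TSum.slide x _ _ ≫ TSum.inj P (𝟙 _) (G.tw φ) := by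
    rw [Functor.map_comp, add_map_slide, add_map_inj]
    refine (Category.assoc _ _ _).trans ?_
    congr 1
    refine (Category.assoc _ _ _).trans ?_
    congr 1
    refine (TSum.inj_comp _ _ _ _).trans ?_
    rw [F.functor.map_id, Category.comp_id]
    rfl
  rw [TSum.twL_eq, TSum.twL_eq]
  refine (congrArg (TSum.inj P (F.lin x v).inv (𝟙 (G.functor.obj w)) ≫ ·) h).trans ?_
  refine (TSum.inj_comp' _ _ _ _ _).trans ?_
  rw [Iso.inv_hom_id, Category.comp_id, TSum.inj_id]
  exact Category.id_comp _

lemma asc_map_inj {a b : TSum P L M} (χ : a ⟶ b) {u u' : N} (h : u ⟶ u') :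
    (assoc P L M N).functor.map (TSum.inj P χ h) =
      assocMap χ u ≫ TSum.inj P (𝟙 b.fst) (TSum.inj P (𝟙 b.snd) h) :=
  Balanced.desc_inj _ _ _

lemma asc_map_inj_inj {v v' : L} {w w' : M} (f : v ⟶ v') (g : w ⟶ w') {u u' : N} (h : u ⟶ u') :
    (assoc P L M N).functor.map (TSum.inj P (TSum.inj P f g) h) =
      TSum.inj P f (TSum.inj P g h) :=
  (asc_map_inj _ _).trans (assocMap_pure _ _ _)

lemma asc_map_slide (x : P) (a : TSum P L M) (u : N) :
    (assoc P L M N).functor.map (TSum.slide x a u) = slide₂ x a.fst a.snd u :=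
  Balanced.desc_slide _ _ _ _

lemma asc_map_inj_slide (x : P) (v : L) (w : M) (u : N) :
    (assoc P L M N).functor.map (TSum.inj P (TSum.slide x v w) (𝟙 u)) =
      TSum.slide x v (⟨w, u⟩ : TSum P M N) := by
  refine (asc_map_inj _ _).trans ?_
  rw [assocMap_slide, TSum.inj_id, TSum.inj_id, Category.comp_id]

lemma asc_tw {x : P} {a b : TSum P (TSum P L M) N} (χ : x ⊙ₗ a ⟶ b) :
    (assoc P L M N).tw χ = (assoc P L M N).functor.map χ :=
  Category.id_comp _

lemma asc_tw_twR_twR {x : P} {v v' : L} (φ : x ⊙ₗ v ⟶ v') (w : M) (u : N) :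
    (assoc P L M N).tw (TSum.twR (TSum.twR φ w) u) = TSum.twR φ (⟨w, u⟩ : TSum P M N) :=
  (asc_tw _).trans ((asc_map_inj_inj _ _ _).trans (by rw [TSum.inj_id]; rfl))

lemma asc_tw_twR_twL {x : P} (v : L) {w w' : M} (φ : x ⊙ₗ w ⟶ w') (u : N) :
    (assoc P L M N).tw (TSum.twR (TSum.twL v φ) u) = TSum.twL v (TSum.twR φ u) := by
  rw [asc_tw, TSum.twL_eq, TSum.twL_eq]
  refine (congrArg (assoc P L M N).functor.map (TSum.inj_comp_id _ _ _).symm).trans ?_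
  refine (Functor.map_comp _ _ _).trans ?_
  rw [asc_map_inj_slide, asc_map_inj_inj]
  rfl

lemma asc_tw_twL {x : P} (v : L) (w : M) {u u' : N} (φ : x ⊙ₗ u ⟶ u') :
    (assoc P L M N).tw (TSum.twL (⟨v, w⟩ : TSum P L M) φ) = TSum.twL v (TSum.twL w φ) := by
  rw [asc_tw, TSum.twL_eq, TSum.twL_eq, TSum.twL_eq]
  refine (Functor.map_comp _ _ _).trans ?_
  rw [asc_map_slide, ← TSum.inj_id, asc_map_inj_inj]
  refine (Category.assoc _ _ _).trans ?_
  congr 1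
  refine (TSum.inj_comp _ _ _ _).trans ?_
  rw [Category.comp_id]

variable [PicardGroupoid P]

lemma comm_map_inj {v v' : L} {w w' : M} (f : v ⟶ v') (g : w ⟶ w') :
    (comm P L M).functor.map (TSum.inj P f g) = TSum.inj P g f :=
  Balanced.desc_inj _ _ _

lemma comm_map_slide (x : P) (v : L) (w : M) :
    (comm P L M).functor.map (TSum.slide x v w) = (slideIso x w v).inv :=
  Balanced.desc_slide _ _ _ _

lemma comm_tw_twR {x : P} {v v' : L} (φ : x ⊙ₗ v ⟶ v') (w : M) :
    (comm P L M).tw (TSum.twR φ w) = TSum.twL w φ := by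
  rw [TSum.twL_eq]
  exact congrArg (TSum.slide x w v ≫ ·) (comm_map_inj φ (𝟙 w))

/-- `C` sends the slide contained in `twL` to the inverse of a slide, and its structure isomorphism
is that slide, so that both cancel. -/
lemma comm_tw_twL {x : P} (v : L) {w w' : M} (φ : x ⊙ₗ w ⟶ w') :
    (comm P L M).tw (TSum.twL v φ) = TSum.twR φ v := by
  have h : (comm P L M).functor.map (TSum.slide x v w ≫ TSum.inj P (𝟙 v) φ) =
      (slideIso x w v).inv ≫ TSum.inj P φ (𝟙 v) := by
    rw [Functor.map_comp, comm_map_slide, comm_map_inj]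
    rfl
  rw [TSum.twL_eq]
  refine (congrArg (TSum.slide x w v ≫ ·) h).trans ?_
  exact (slideIso x w v).hom_inv_id_assoc _

lemma comm_map_comm_map {a b : TSum P L M} (χ : a ⟶ b) :
    (comm P M L).functor.map ((comm P L M).functor.map χ) = χ := by
  induction χ using TSum.hom_ind with
  | h₁ f g => rw [comm_map_inj]; exact comm_map_inj g f
  | h₂ x v w =>
    rw [comm_map_slide]
    -- `C` is known on slides only, and here it is applied to the inverse of one. It therefore gives
    -- the inverse of the image of the slide, which is an inverse slide itself.
    have h := (comm P M L).functor.map_comp (slideIso x w v).inv (slideIso x w v).hom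
    rw [Iso.inv_hom_id, slideIso_hom, comm_map_slide] at h
    refine (cancel_mono (slideIso x v w).inv).1 (h.symm.trans ?_)
    refine (((comm P M L).functor.map_id _).trans ?_)
    exact (slideIso x v w).hom_inv_id.symm
  | h₃ φ ψ hφ hψ =>
    rw [Functor.map_comp, Functor.map_comp]
    exact congrArg₂ (· ≫ ·) hφ hψ

end TorsorHom
end TwistedHoms

end PicardTorsor

namespace PicardTorsor

/-! ### Natural families of morphisms between `1`-morphisms. -/

section Naturality

variable {P : Type u} [Category.{v} P] [MonoidalCategory P] [SymmetricCategory P]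
  {L : Type w₁} [Category.{t₁} L] [MonoidalLeftAction P L]
  {M : Type w₂} [Category.{t₂} M] [MonoidalLeftAction P M]
  {N : Type w₃} [Category.{t₃} N] [MonoidalLeftAction P N]

/-- A family of morphisms `F v ⟶ G v` that is natural with respect to the morphisms
`x + v ⟶ w`. -/
structure TorsorHom.Natural (F G : TorsorHom P L M) (θ : ∀ v, F.functor.obj v ⟶ G.functor.obj v) :
    Prop where
  nat {x : P} {v w : L} (κ : x ⊙ₗ v ⟶ w) : x ⊴ₗ θ v ≫ G.tw κ = F.tw κ ≫ θ w

namespace TorsorHom.Natural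

lemma comp {F G H : TorsorHom P L M} {θ : ∀ v, F.functor.obj v ⟶ G.functor.obj v}
    {η : ∀ v, G.functor.obj v ⟶ H.functor.obj v} (hθ : Natural F G θ) (hη : Natural G H η) :
    Natural F H (fun v => θ v ≫ η v) where
  nat κ := by rw [actionHomRight_comp, Category.assoc, hη.nat κ, reassoc_of% (hθ.nat κ)]

lemma map {F G : TorsorHom P L M} {θ : ∀ v, F.functor.obj v ⟶ G.functor.obj v} (hθ : Natural F G θ)
    (H : TorsorHom P M N) : Natural (F.comp H) (G.comp H) (fun v => H.functor.map (θ v)) := by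
  refine ⟨fun {x v w} κ => ?_⟩
  rw [comp_tw, comp_tw]
  refine (act_map_tw H _ _).trans ?_
  rw [hθ.nat κ]
  exact tw_map H _ _

lemma pre {F G : TorsorHom P M N} {θ : ∀ v, F.functor.obj v ⟶ G.functor.obj v} (hθ : Natural F G θ)
    (K : TorsorHom P L M) : Natural (K.comp F) (K.comp G) (fun v => θ (K.functor.obj v)) := by
  refine ⟨fun {x v w} κ => ?_⟩
  rw [comp_tw, comp_tw]
  exact hθ.nat (K.tw κ)

lemma of_iso₂ {F G : TorsorHom P L M} (τ : TorsorHom.Iso₂ F G) :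
    Natural F G (fun v => τ.iso.hom.app v) := ⟨fun κ => τ.tw_app κ⟩

lemma of_iso₂_inv {F G : TorsorHom P L M} (τ : TorsorHom.Iso₂ F G) :
    Natural G F (fun v => τ.iso.inv.app v) := ⟨fun κ => τ.tw_app_inv κ⟩

lemma map_eq {F G : TorsorHom P L M} {θ : ∀ v, F.functor.obj v ⟶ G.functor.obj v}
    (h : Natural F G θ) {v w : L} (f : v ⟶ w) :
    F.functor.map f ≫ θ w = θ v ≫ G.functor.map f := by
  have := h.nat ((λₗ[P] v).hom ≫ f)
  rw [TorsorHom.tw_unit, TorsorHom.tw_unit, ← reassoc_of% (actionUnitIso_hom_naturality (θ v)),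
    Category.assoc, cancel_epi] at this
  exact this.symm

/-- Any `v` receives an isomorphism `c : p + v₀ ⟶ v`, and naturality along `c` determines the
component at `v`. All later equations between `2`-morphisms are reduced to one object in this way.
-/
lemma eq_of_eq [PicardGroupoid P] [IsTorsor P L] [IsTorsor P M] {F G : TorsorHom P L M}
    {θ η : ∀ v, F.functor.obj v ⟶ G.functor.obj v}
    (hθ : Natural F G θ) (hη : Natural F G η) {v₀ : L} (h : θ v₀ = η v₀) (v : L) : θ v = η v := by
  have := IsTorsor.isGroupoid P M
  obtain ⟨p, ⟨c⟩⟩ := IsTorsor.exists_act (P := P) v₀ v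
  rw [← cancel_epi (F.tw c.hom), ← hθ.nat c.hom, ← hη.nat c.hom, h]

end TorsorHom.Natural

/-- The `1`-morphism `v ↦ (v, w)`. -/
def TorsorHom.pairRight (L : Type w₁) [Category.{t₁} L] [MonoidalLeftAction P L] (w : M) :
    TorsorHom P L (TSum P L M) where
  functor :=
    { obj v := ⟨v, w⟩
      map f := TSum.inj P f (𝟙 w)
      map_id v := TSum.inj_id v w
      map_comp f g := (TSum.inj_comp_id f g w).symm }
  lin x v := Iso.refl _
  lin_nat_left f v := (Category.comp_id _).trans (Category.id_comp _).symm
  lin_nat_right x v v' f := ((Category.comp_id _).trans (TSum.act_inj x f (𝟙 w)).symm).trans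
    (Category.id_comp _).symm
  lin_assoc x y v := by
    refine (Category.id_comp _).trans (((Category.comp_id _).symm).trans ?_)
    refine congrArg (TSum.inj P (αₗ x y v).hom (𝟙 w) ≫ ·) ?_
    exact ((Category.id_comp _).trans (actionHomRight_id _ _)).symm

lemma TorsorHom.pairRight_tw {x : P} {v v' : L} (φ : x ⊙ₗ v ⟶ v') (w : M) :
    (pairRight L w).tw φ = TSum.twR φ w := Category.id_comp _

lemma TSum.twR_id (x : P) (v : L) (w : M) : twR (𝟙 (x ⊙ₗ v)) w = 𝟙 _ := TSum.inj_id _ _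

/-- Every twisted morphism of a sum is, up to the structure isomorphism of the action, a `twR`
followed by a `twL`. -/
lemma TorsorHom.Natural.of_sum {F G : TorsorHom P (TSum P L M) N}
    {θ : ∀ a, F.functor.obj a ⟶ G.functor.obj a}
    (hR : ∀ {x : P} {v v' : L} (φ : x ⊙ₗ v ⟶ v') (w : M),
      x ⊴ₗ θ ⟨v, w⟩ ≫ G.tw (TSum.twR φ w) = F.tw (TSum.twR φ w) ≫ θ ⟨v', w⟩)
    (hL : ∀ {x : P} (v : L) {w w' : M} (φ : x ⊙ₗ w ⟶ w'),
      x ⊴ₗ θ ⟨v, w⟩ ≫ G.tw (TSum.twL v φ) = F.tw (TSum.twL v φ) ≫ θ ⟨v, w'⟩) :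
    Natural F G θ := by
  refine ⟨fun {y a b} κ => ?_⟩
  obtain ⟨v, w⟩ := a
  obtain ⟨v', w'⟩ := b
  -- As the action on a sum is the action on the first entry, the compatibility with `lin` is the
  -- case of an identity in `hR`.
  have hl : ∀ (x : P) (v : L) (w : M), θ (x ⊙ₗ ⟨v, w⟩) ≫ (G.lin x ⟨v, w⟩).hom =
      (F.lin x ⟨v, w⟩).hom ≫ x ⊴ₗ θ ⟨v, w⟩ := by
    intro x v w
    have := hR (𝟙 (x ⊙ₗ v)) w
    rw [TSum.twR_id] at this
    erw [TorsorHom.tw_id, TorsorHom.tw_id] at this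
    rw [Iso.comp_inv_eq, Category.assoc, Iso.eq_inv_comp] at this
    exact this.symm
  obtain ⟨x, φ, ψ, rfl⟩ := TSum.homMk_surjective (P := P) κ
  have e : TSum.homMk x φ ψ = TSum.twR φ w ≫ TSum.twL v' ψ := by
    refine Eq.trans ?_ (TSum.inj_homMk _ _ _ _ _).symm
    rw [Category.comp_id, actionHomRight_id, Category.id_comp]
  change y ⊴ₗ θ ⟨v, w⟩ ≫ G.tw _ = F.tw _ ≫ θ ⟨v', w'⟩
  rw [e, TorsorHom.tw_map, TorsorHom.tw_map, reassoc_of% (hR φ w), Category.assoc,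
    ← F.lin_tw, ← G.lin_tw, Category.assoc, ← hL v' ψ]
  exact congrArg (F.tw (TSum.twR φ w) ≫ ·) 
    (((Category.assoc _ _ _).symm.trans (congrArg (· ≫ G.tw (TSum.twL v' ψ)) (hl x v' w))).trans
      (Category.assoc _ _ _))

end Naturality

end PicardTorsor

namespace PicardTorsor

/-! ### Comparison of `1`-morphisms on generators. -/

section Sends

variable {P : Type u} [Category.{v} P] [MonoidalCategory P] [SymmetricCategory P]
  {L : Type w₁} [Category.{t₁} L] [MonoidalLeftAction P L]
  {M : Type w₂} [Category.{t₂} M] [MonoidalLeftAction P M]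
  {N : Type w₃} [Category.{t₃} N] [MonoidalLeftAction P N]
  {L' : Type w₄} [Category.{t₄} L'] [MonoidalLeftAction P L']
  {M' : Type w₅} [Category.{t₅} M'] [MonoidalLeftAction P M']
  {N' : Type w₆} [Category.{t₆} N'] [MonoidalLeftAction P N']

/-- `F` carries `κ : x + v ⟶ w` to `κ' : x + v' ⟶ w'`. -/
structure TorsorHom.Sends (F : TorsorHom P L M) {x : P} {v w : L} (κ : x ⊙ₗ v ⟶ w) {v' w' : M}
    (κ' : x ⊙ₗ v' ⟶ w') : Prop where
  left : F.functor.obj v = v'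
  right : F.functor.obj w = w'
  heq : F.tw κ ≍ κ'

namespace TorsorHom.Sends

lemma of_tw (F : TorsorHom P L M) {x : P} {v w : L} (κ : x ⊙ₗ v ⟶ w) : F.Sends κ (F.tw κ) :=
  ⟨rfl, rfl, HEq.rfl⟩

lemma of_eq {F : TorsorHom P L M} {x : P} {v w : L} {κ : x ⊙ₗ v ⟶ w}
    {κ' : x ⊙ₗ F.functor.obj v ⟶ F.functor.obj w} (h : F.tw κ = κ') : F.Sends κ κ' :=
  ⟨rfl, rfl, heq_of_eq h⟩

lemma comp {F : TorsorHom P L M} {G : TorsorHom P M N} {x : P} {v w : L} {κ : x ⊙ₗ v ⟶ w}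
    {v' w' : M} {κ' : x ⊙ₗ v' ⟶ w'} {v'' w'' : N} {κ'' : x ⊙ₗ v'' ⟶ w''}
    (hF : F.Sends κ κ') (hG : G.Sends κ' κ'') : (F.comp G).Sends κ κ'' := by
  obtain ⟨rfl, rfl, hF⟩ := hF
  obtain ⟨rfl, rfl, hG⟩ := hG
  obtain rfl := eq_of_heq hF
  obtain rfl := eq_of_heq hG
  exact of_eq (comp_tw F G κ)

lemma of_id {x : P} {v w : L} (κ : x ⊙ₗ v ⟶ w) : (TorsorHom.id P L).Sends κ κ := of_eq (id_tw κ)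

lemma add_twR {F : TorsorHom P L L'} (G : TorsorHom P M M') {x : P} {v v' : L} {φ : x ⊙ₗ v ⟶ v'}
    {a b : L'} {φ' : x ⊙ₗ a ⟶ b} (h : F.Sends φ φ') (w : M) :
    (F.add G).Sends (TSum.twR φ w) (TSum.twR φ' (G.functor.obj w)) := by
  obtain ⟨rfl, rfl, h⟩ := h
  obtain rfl := eq_of_heq h
  exact of_eq (add_tw_twR F G φ w)

lemma add_twL (F : TorsorHom P L L') {G : TorsorHom P M M'} {x : P} (v : L) {w w' : M}
    {φ : x ⊙ₗ w ⟶ w'} {a b : M'} {φ' : x ⊙ₗ a ⟶ b} (h : G.Sends φ φ') :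
    (F.add G).Sends (TSum.twL v φ) (TSum.twL (F.functor.obj v) φ') := by
  obtain ⟨rfl, rfl, h⟩ := h
  obtain rfl := eq_of_heq h
  exact of_eq (add_tw_twL F G v φ)

lemma asc_twR_twR {x : P} {v v' : L} (φ : x ⊙ₗ v ⟶ v') (w : M) (u : N) :
    (assoc P L M N).Sends (TSum.twR (TSum.twR φ w) u) (TSum.twR φ (⟨w, u⟩ : TSum P M N)) :=
  of_eq (asc_tw_twR_twR φ w u)

lemma asc_twR_twL {x : P} (v : L) {w w' : M} (φ : x ⊙ₗ w ⟶ w') (u : N) :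
    (assoc P L M N).Sends (TSum.twR (TSum.twL v φ) u) (TSum.twL v (TSum.twR φ u)) :=
  of_eq (asc_tw_twR_twL v φ u)

lemma asc_twL {x : P} (v : L) (w : M) {u u' : N} (φ : x ⊙ₗ u ⟶ u') :
    (assoc P L M N).Sends (TSum.twL (⟨v, w⟩ : TSum P L M) φ) (TSum.twL v (TSum.twL w φ)) :=
  of_eq (asc_tw_twL v w φ)

lemma comm_twR [PicardGroupoid P] {x : P} {v v' : L} (φ : x ⊙ₗ v ⟶ v') (w : M) :
    (comm P L M).Sends (TSum.twR φ w) (TSum.twL w φ) := of_eq (comm_tw_twR φ w)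

lemma comm_twL [PicardGroupoid P] {x : P} (v : L) {w w' : M} (φ : x ⊙ₗ w ⟶ w') :
    (comm P L M).Sends (TSum.twL v φ) (TSum.twR φ v) := of_eq (comm_tw_twL v φ)

lemma heq_tw {F G : TorsorHom P L M} {x : P} {v w : L} {κ : x ⊙ₗ v ⟶ w} {v' w' : M}
    {κ' : x ⊙ₗ v' ⟶ w'} (hF : F.Sends κ κ') (hG : G.Sends κ κ') : F.tw κ ≍ G.tw κ :=
  hF.heq.trans hG.heq.symm

end TorsorHom.Sends

/-- Two `1`-morphisms that agree on objects and on the morphisms `x + v ⟶ w`. -/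
structure TorsorHom.Agree (F G : TorsorHom P L M) : Prop where
  obj (v : L) : F.functor.obj v = G.functor.obj v
  tw {x : P} {v w : L} (κ : x ⊙ₗ v ⟶ w) : F.tw κ ≍ G.tw κ

namespace TorsorHom.Agree

/-- Ordinary morphisms are the morphisms twisted by the unit, up to the unit constraint. -/
lemma heq_map {F G : TorsorHom P L M} (h : F.Agree G) {v w : L} (f : v ⟶ w) :
    F.functor.map f ≍ G.functor.map f := by
  have e : ∀ F : TorsorHom P L M, F.functor.map f =
      (λₗ[P] (F.functor.obj v)).inv ≫ F.tw ((λₗ[P] v).hom ≫ f) := by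
    intro F
    rw [tw_unit, Iso.inv_hom_id_assoc]
  rw [e F, e G]
  have h1 := h.obj v
  have h2 := h.obj w
  have h3 := h.tw ((λₗ[P] v).hom ≫ f)
  revert h3
  generalize F.tw ((λₗ[P] v).hom ≫ f) = a, G.tw ((λₗ[P] v).hom ≫ f) = b
  revert a b
  rw [h1, h2]
  intro a b h3
  rw [eq_of_heq h3]

/-- It is enough to compare two `1`-morphisms on generators. -/
lemma of_sum {F G : TorsorHom P (TSum P L M) N} (h : ∀ a, F.functor.obj a = G.functor.obj a)
    (hR : ∀ {x : P} {v v' : L} (φ : x ⊙ₗ v ⟶ v') (w : M),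
      F.tw (TSum.twR φ w) ≍ G.tw (TSum.twR φ w))
    (hL : ∀ {x : P} (v : L) {w w' : M} (φ : x ⊙ₗ w ⟶ w'),
      F.tw (TSum.twL v φ) ≍ G.tw (TSum.twL v φ)) : F.Agree G := by
  -- Heterogeneous equality of twisted morphisms is naturality of the family of `eqToHom`s. Thus
  -- agreement on generators extends to all morphisms by `Natural.of_sum`.
  have aux : ∀ {x : P} {a a' b b' : N} (ha : a = a') (hb : b = b') (f : x ⊙ₗ a ⟶ b)
      (g : x ⊙ₗ a' ⟶ b'), x ⊴ₗ eqToHom ha ≫ g = f ≫ eqToHom hb ↔ f ≍ g := by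
    rintro x a _ b _ rfl rfl f g
    simp [eq_comm]
  have key : Natural F G (fun a => eqToHom (h a)) :=
    Natural.of_sum (fun φ w => (aux _ _ _ _).2 (hR φ w)) (fun v _ _ φ => (aux _ _ _ _).2 (hL v φ))
  exact ⟨h, fun κ => (aux _ _ _ _).1 (key.nat κ)⟩

/-- A morphism in the first entry is a morphism of the inner sum. Precomposition with the
`1`-morphism `a ↦ (a, u)` allows it to be decomposed once more. -/
lemma of_sum₃ {F G : TorsorHom P (TSum P (TSum P L M) N) L'}
    (h : ∀ a, F.functor.obj a = G.functor.obj a)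
    (hRR : ∀ {x : P} {v v' : L} (φ : x ⊙ₗ v ⟶ v') (w : M) (u : N),
      F.tw (TSum.twR (TSum.twR φ w) u) ≍ G.tw (TSum.twR (TSum.twR φ w) u))
    (hRL : ∀ {x : P} (v : L) {w w' : M} (φ : x ⊙ₗ w ⟶ w') (u : N),
      F.tw (TSum.twR (TSum.twL v φ) u) ≍ G.tw (TSum.twR (TSum.twL v φ) u))
    (hL : ∀ {x : P} (v : L) (w : M) {u u' : N} (φ : x ⊙ₗ u ⟶ u'),
      F.tw (TSum.twL (⟨v, w⟩ : TSum P L M) φ) ≍ G.tw (TSum.twL (⟨v, w⟩ : TSum P L M) φ)) :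
    F.Agree G := by
  refine of_sum h (fun {x a b} φ u => ?_) (fun a => hL a.fst a.snd)
  have key : ((TorsorHom.pairRight (TSum P L M) u).comp F).Agree
      ((TorsorHom.pairRight (TSum P L M) u).comp G) := by
    refine of_sum (fun a => h _) (fun φ w => ?_) (fun v w w' φ => ?_)
    · rw [TorsorHom.comp_tw, TorsorHom.comp_tw, TorsorHom.pairRight_tw]
      exact hRR φ w u
    · rw [TorsorHom.comp_tw, TorsorHom.comp_tw, TorsorHom.pairRight_tw]
      exact hRL v φ u
  have := key.tw φ
  rw [TorsorHom.comp_tw, TorsorHom.comp_tw, TorsorHom.pairRight_tw] at this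
  exact this

end TorsorHom.Agree

end Sends

end PicardTorsor

namespace PicardTorsor

/-! ### Naturality, pentagon and hexagons for the constraints of sums. -/

section Identities

variable {P : Type u} [Category.{v} P] [MonoidalCategory P] [SymmetricCategory P]
  {L : Type w₁} [Category.{t₁} L] [MonoidalLeftAction P L]
  {M : Type w₂} [Category.{t₂} M] [MonoidalLeftAction P M]
  {N : Type w₃} [Category.{t₃} N] [MonoidalLeftAction P N]
  {L' : Type w₄} [Category.{t₄} L'] [MonoidalLeftAction P L']
  {M' : Type w₅} [Category.{t₅} M'] [MonoidalLeftAction P M']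
  {N' : Type w₆} [Category.{t₆} N'] [MonoidalLeftAction P N']

namespace TorsorHom

-- As in the identities below, both sides have the same values on objects by definition, so only the
-- three kinds of generators need to be followed.
set_option linter.unusedVariables false in
open Sends in
lemma agree_assoc (F : TorsorHom P L L') (G : TorsorHom P M M') (H : TorsorHom P N N') :
    (((F.add G).add H).comp (assoc P L' M' N')).Agree
      ((assoc P L M N).comp (F.add (G.add H))) :=
  .of_sum₃ (fun _ => rfl)
    (fun φ w u => ((add_twR H (add_twR G (of_tw F φ) w) u).comp (asc_twR_twR _ _ _)).heq_tw
      ((asc_twR_twR _ _ _).comp (add_twR (G.add H) (of_tw F φ) ⟨w, u⟩)))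
    (fun v w w' φ u => ((add_twR H (add_twL F v (of_tw G φ)) u).comp (asc_twR_twL _ _ _)).heq_tw
      ((asc_twR_twL _ _ _).comp (add_twL F v (add_twR H (of_tw G φ) u))))
    (fun v w u u' φ => ((add_twL (F.add G) ⟨v, w⟩ (of_tw H φ)).comp (asc_twL _ _ _)).heq_tw
      ((asc_twL _ _ _).comp (add_twL F v (add_twL G w (of_tw H φ)))))

set_option linter.unusedVariables false in
open Sends in
lemma agree_add_left (F : TorsorHom P L L') (G : TorsorHom P M M') :
    ((F.add (id P M)).comp ((id P L').add G)).Agree (F.add G) :=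
  .of_sum (fun _ => rfl)
    (fun φ w => ((add_twR (id P M) (of_tw F φ) w).comp (add_twR G (of_id _) _)).heq_tw
      (add_twR G (of_tw F φ) w))
    (fun v w w' φ => ((add_twL F v (of_id φ)).comp (add_twL (id P L') _ (of_tw G φ))).heq_tw
      (add_twL F v (of_tw G φ)))

set_option linter.unusedVariables false in
open Sends in
lemma agree_add_right (F : TorsorHom P L L') (G : TorsorHom P M M') :
    (((id P L).add G).comp (F.add (id P M'))).Agree (F.add G) :=
  .of_sum (fun _ => rfl)
    (fun φ w => ((add_twR G (of_id φ) w).comp (add_twR (id P M') (of_tw F _) _)).heq_tw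
      (add_twR G (of_tw F φ) w))
    (fun v w w' φ => ((add_twL (id P L) v (of_tw G φ)).comp (add_twL F _ (of_id _))).heq_tw
      (add_twL F v (of_tw G φ)))

set_option linter.unusedVariables false in
open Sends in
lemma agree_id_add_comp (F : TorsorHom P L L') (G : TorsorHom P L' M') :
    (((id P M).add F).comp ((id P M).add G)).Agree ((id P M).add (F.comp G)) :=
  .of_sum (fun _ => rfl)
    (fun φ w => ((add_twR F (of_id φ) w).comp (add_twR G (of_id _) _)).heq_tw
      (add_twR (F.comp G) (of_id φ) w))
    (fun v w w' φ => ((add_twL (id P M) v (of_tw F φ)).comp (add_twL (id P M) _ (of_tw G _))).heq_tw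
      (add_twL (id P M) v ((of_tw F φ).comp (of_tw G _))))

set_option linter.unusedVariables false in
open Sends in
lemma agree_add_id_comp (F : TorsorHom P L L') (G : TorsorHom P L' M') :
    ((F.add (id P M)).comp (G.add (id P M))).Agree ((F.comp G).add (id P M)) :=
  .of_sum (fun _ => rfl)
    (fun φ w => ((add_twR (id P M) (of_tw F φ) w).comp (add_twR (id P M) (of_tw G _) _)).heq_tw
      (add_twR (id P M) ((of_tw F φ).comp (of_tw G _)) w))
    (fun v w w' φ => ((add_twL F v (of_id φ)).comp (add_twL G _ (of_id _))).heq_tw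
      (add_twL (F.comp G) v (of_id φ)))

set_option linter.unusedVariables false in
open Sends in
lemma agree_pentagon :
    ((((assoc P L M N).add (id P L')).comp (assoc P L (TSum P M N) L')).comp
        ((id P L).add (assoc P M N L'))).Agree
      ((assoc P (TSum P L M) N L').comp (assoc P L M (TSum P N L'))) := by
  refine .of_sum₃ (fun _ => rfl) (fun {x a b} φ w u => ?_) (fun v w w' φ u => ?_)
    (fun v w u u' φ => ?_)
  -- There are four summands, so a morphism in the innermost sum `L + M` still has to be decomposed.
  -- The composition of two `pairRight`s puts it in place.
  · have hK : ∀ {x : P} {a b : TSum P L M} (φ : x ⊙ₗ a ⟶ b),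
        ((pairRight (TSum P L M) w).comp (pairRight (TSum P (TSum P L M) N) u)).Sends φ
          (TSum.twR (TSum.twR φ w) u) :=
      fun φ => (of_eq (pairRight_tw φ w)).comp (of_eq (pairRight_tw _ u))
    have key : (((pairRight (TSum P L M) w).comp (pairRight (TSum P (TSum P L M) N) u)).comp
        ((((assoc P L M N).add (id P L')).comp (assoc P L (TSum P M N) L')).comp
        ((id P L).add (assoc P M N L')))).Agree
        (((pairRight (TSum P L M) w).comp (pairRight (TSum P (TSum P L M) N) u)).comp
          ((assoc P (TSum P L M) N L').comp (assoc P L M (TSum P N L')))) := by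
      refine .of_sum (fun _ => rfl) (fun φ w' => ?_) (fun v w' w'' φ => ?_)
      · exact ((hK _).comp (((add_twR (id P L') (asc_twR_twR _ _ _) u).comp
          (asc_twR_twR _ _ _)).comp (add_twR (assoc P M N L') (of_id _) _))).heq_tw
          ((hK _).comp ((asc_twR_twR _ _ _).comp (asc_twR_twR _ _ _)))
      · exact ((hK _).comp (((add_twR (id P L') (asc_twR_twL _ _ _) u).comp
          (asc_twR_twL _ _ _)).comp (add_twL (id P L) _ (asc_twR_twR _ _ _)))).heq_tw
          ((hK _).comp ((asc_twR_twR _ _ _).comp (asc_twR_twL _ _ _)))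
    exact (((hK φ).comp (of_tw _ _)).heq.symm.trans (key.tw φ)).trans
      ((hK φ).comp (of_tw _ _)).heq
  · exact (((add_twR (id P L') (asc_twL _ _ _) u).comp (asc_twR_twL _ _ _)).comp
      (add_twL (id P L) _ (asc_twR_twL _ _ _))).heq_tw
      ((asc_twR_twL _ _ _).comp (asc_twL _ _ _))
  · exact (((add_twL (assoc P L M N) _ (of_id _)).comp (asc_twL _ _ _)).comp
      (add_twL (id P L) _ (asc_twL _ _ _))).heq_tw ((asc_twL _ _ _).comp (asc_twL _ _ _))

variable [PicardGroupoid P]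

set_option linter.unusedVariables false in
open Sends in
lemma agree_comm (F : TorsorHom P L L') (G : TorsorHom P M M') :
    ((F.add G).comp (comm P L' M')).Agree ((comm P L M).comp (G.add F)) :=
  .of_sum (fun _ => rfl)
    (fun φ w => ((add_twR G (of_tw F φ) w).comp (comm_twR _ _)).heq_tw
      ((comm_twR _ _).comp (add_twL G w (of_tw F φ))))
    (fun v w w' φ => ((add_twL F v (of_tw G φ)).comp (comm_twL _ _)).heq_tw
      ((comm_twL _ _).comp (add_twR F (of_tw G φ) v)))

set_option linter.unusedVariables false in
open Sends in
lemma agree_comm_comm : ((comm P L M).comp (comm P M L)).Agree (id P (TSum P L M)) :=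
  .of_sum (fun _ => rfl)
    (fun φ w => ((comm_twR φ w).comp (comm_twL _ _)).heq_tw (of_id _))
    (fun v w w' φ => ((comm_twL v φ).comp (comm_twR _ _)).heq_tw (of_id _))

set_option linter.unusedVariables false in
open Sends in
lemma agree_hexagon_right : ((assoc P L M N).comp ((comm P L (TSum P M N)).comp
      (assoc P M N L))).Agree ((((comm P L M).add (id P N)).comp (assoc P M L N)).comp
        ((id P M).add (comm P L N))) :=
  .of_sum₃ (fun _ => rfl)
    (fun φ w u => ((asc_twR_twR _ _ _).comp ((comm_twR _ _).comp (asc_twL _ _ _))).heq_tw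
      (((add_twR (id P N) (comm_twR _ _) _).comp (asc_twR_twL _ _ _)).comp
        (add_twL (id P M) _ (comm_twR _ _))))
    (fun v w w' φ u => ((asc_twR_twL _ _ _).comp ((comm_twL _ _).comp (asc_twR_twR _ _ _))).heq_tw
      (((add_twR (id P N) (comm_twL _ _) _).comp (asc_twR_twR _ _ _)).comp
        (add_twR (comm P L N) (of_id _) _)))
    (fun v w u u' φ => ((asc_twL _ _ _).comp ((comm_twL _ _).comp (asc_twR_twL _ _ _))).heq_tw
      (((add_twL (comm P L M) _ (of_id _)).comp (asc_twL _ _ _)).comp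
        (add_twL (id P M) _ (comm_twL _ _))))

set_option linter.unusedVariables false in
open Sends in
lemma agree_hexagon_left_comm : ((assoc P L M N).comp
      (((comm P L (TSum P M N)).comp (assoc P M N L)).comp ((id P M).add (comm P N L)))).Agree
      (((comm P L M).add (id P N)).comp (assoc P M L N)) :=
  .of_sum₃ (fun _ => rfl)
    (fun φ w u => ((asc_twR_twR _ _ _).comp (((comm_twR _ _).comp (asc_twL _ _ _)).comp
      (add_twL (id P M) _ (comm_twL _ _)))).heq_tw
      ((add_twR (id P N) (comm_twR _ _) _).comp (asc_twR_twL _ _ _)))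
    (fun v w w' φ u => ((asc_twR_twL _ _ _).comp (((comm_twL _ _).comp (asc_twR_twR _ _ _)).comp
      (add_twR (comm P N L) (of_id _) _))).heq_tw
      ((add_twR (id P N) (comm_twL _ _) _).comp (asc_twR_twR _ _ _)))
    (fun v w u u' φ => ((asc_twL _ _ _).comp (((comm_twL _ _).comp (asc_twR_twL _ _ _)).comp
      (add_twL (id P M) _ (comm_twR _ _)))).heq_tw
      ((add_twL (comm P L M) _ (of_id _)).comp (asc_twL _ _ _)))

-- This writes the commutation of `L + M` past `N` as two successive commutations. The last `C` only
-- restores the order of `L` and `M`.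
set_option linter.unusedVariables false in
open Sends in
lemma agree_hexagon_left : ((assoc P L M N).comp (((id P L).add (comm P M N)).comp
      (((comm P L (TSum P N M)).comp (assoc P N M L)).comp ((id P N).add (comm P M L))))).Agree
      (comm P (TSum P L M) N) :=
  .of_sum₃ (fun _ => rfl)
    (fun φ w u => ((asc_twR_twR _ _ _).comp ((add_twR (comm P M N) (of_id _) _).comp
      (((comm_twR _ _).comp (asc_twL _ _ _)).comp (add_twL (id P N) _ (comm_twL _ _))))).heq_tw
      (comm_twR _ _))
    (fun v w w' φ u => ((asc_twR_twL _ _ _).comp ((add_twL (id P L) _ (comm_twR _ _)).comp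
      (((comm_twL _ _).comp (asc_twR_twL _ _ _)).comp (add_twL (id P N) _ (comm_twR _ _))))).heq_tw
      (comm_twR _ _))
    (fun v w u u' φ => ((asc_twL _ _ _).comp ((add_twL (id P L) _ (comm_twL _ _)).comp
      (((comm_twL _ _).comp (asc_twR_twR _ _ _)).comp (add_twR (comm P M L) (of_id _) _)))).heq_tw
      (comm_twL _ _))

end TorsorHom

lemma TSum.act_twL (y : P) {x : P} (v : L) {w w' : M} (φ : x ⊙ₗ w ⟶ w') :
    y ⊴ₗ (twL v φ : x ⊙ₗ (⟨v, w⟩ : TSum P L M) ⟶ _) =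
      inj P (swap y x v).hom (𝟙 w) ≫ twL (y ⊙ₗ v) φ := by
  rw [twL_eq, twL_eq]
  refine (actMap_comp y (slide x v w) (inj P (𝟙 v) φ)).trans ?_
  rw [actMap_slide, actMap_inj, Category.assoc, actionHomRight_id]

/-- The translation of `L + M` is the translation of `L`. -/
lemma TorsorHom.agree_translation_add (z : P) : ((translation z).add (id P M)).Agree
    (translation (L := TSum P L M) z) := by
  refine .of_sum (fun _ => rfl) (fun {x v v'} φ w => heq_of_eq ?_) (fun {x} v w w' φ => heq_of_eq ?_)
  · rw [translation_tw, swap_tsum]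
    refine (add_tw_twR _ _ _ _).trans ?_
    rw [translation_tw]
    refine ((congrArg (TSum.inj P (swap x z v).hom (𝟙 w) ≫ ·)
      (TSum.act_inj z φ (𝟙 w))).trans (TSum.inj_comp_id _ _ _)).symm
  · rw [translation_tw, swap_tsum, TSum.act_twL]
    refine (add_tw_twL _ _ _ _).trans ?_
    rw [id_tw]
    refine Eq.symm ((Category.assoc _ _ _).symm.trans ?_)
    refine (congrArg (· ≫ TSum.twL (z ⊙ₗ v) φ) (TSum.inj_comp_id _ _ _)).trans ?_
    rw [swap_swap, TSum.inj_id]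
    exact Category.id_comp _

end Identities

end PicardTorsor

namespace PicardTorsor

/-! ### Strict equality of `1`-morphisms, and the basic natural families. -/

section Equations

variable {P : Type u} [Category.{v} P] [MonoidalCategory P] [SymmetricCategory P]
  {L : Type w₁} [Category.{t₁} L] [MonoidalLeftAction P L]
  {M : Type w₂} [Category.{t₂} M] [MonoidalLeftAction P M]
  {N : Type w₃} [Category.{t₃} N] [MonoidalLeftAction P N]
  {L' : Type w₄} [Category.{t₄} L'] [MonoidalLeftAction P L']
  {M' : Type w₅} [Category.{t₅} M'] [MonoidalLeftAction P M']
  {N' : Type w₆} [Category.{t₆} N'] [MonoidalLeftAction P N']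

namespace TorsorHom

/-- The structure isomorphisms are the inverses of `tw` of identities, so agreement on twisted
morphisms determines the whole `1`-morphism. The coherence identities become rewriting rules for
composites. -/
lemma Agree.eq {F G : TorsorHom P L M} (h : F.Agree G) : F = G := by
  have h1 : F.functor = G.functor := by
    refine Functor.hext h.obj fun v w f => h.heq_map f
  have h2 : ∀ (x : P) (v : L), (F.lin x v).inv ≍ (G.lin x v).inv := by
    intro x v
    have := h.tw (𝟙 (x ⊙ₗ v))
    rwa [tw_id, tw_id] at this
  obtain ⟨F, lF, _, _, _⟩ := F
  obtain ⟨G, lG, _, _, _⟩ := G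
  dsimp only at h1 h2
  subst h1
  congr 1
  funext x v
  exact Iso.ext_inv (eq_of_heq (h2 x v))

lemma comp_assoc (F : TorsorHom P L M) (G : TorsorHom P M N) (H : TorsorHom P N L') :
    (F.comp G).comp H = F.comp (G.comp H) :=
  Agree.eq ⟨fun _ => rfl, fun κ => (((Sends.of_tw F κ).comp (Sends.of_tw G _)).comp
    (Sends.of_tw H _)).heq_tw ((Sends.of_tw F κ).comp ((Sends.of_tw G _).comp (Sends.of_tw H _)))⟩

lemma comp_id (F : TorsorHom P L M) : F.comp (TorsorHom.id P M) = F :=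
  Agree.eq ⟨fun _ => rfl, fun κ => ((Sends.of_tw F κ).comp (Sends.of_id _)).heq_tw
    (Sends.of_tw F κ)⟩

lemma id_comp (F : TorsorHom P L M) : (TorsorHom.id P L).comp F = F :=
  Agree.eq ⟨fun _ => rfl, fun κ => ((Sends.of_id κ).comp (Sends.of_tw F _)).heq_tw
    (Sends.of_tw F κ)⟩

/-- This is used when source or target is rewritten by a coherence identity: the components agree by
definition although the `1`-morphisms are only propositionally equal. -/
lemma Natural.of_eq {F F' G G' : TorsorHom P L M} (hF : F = F') (hG : G = G')
    {θ : ∀ v, F.functor.obj v ⟶ G.functor.obj v} (h : Natural F G θ)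
    {θ' : ∀ v, F'.functor.obj v ⟶ G'.functor.obj v} (hθ : ∀ v, θ v ≍ θ' v) : Natural F' G' θ' := by
  subst hF hG
  obtain rfl : θ = θ' := funext fun v => eq_of_heq (hθ v)
  exact h

/-- The structure isomorphism `F (y + v) ≃ y + F v` is itself a `2`-morphism, because `F` respects
the commutativity constraint (`lin_swap`). -/
lemma Natural.lin (F : TorsorHom P L M) (y : P) :
    Natural ((translation y).comp F) (F.comp (translation y)) (fun v => (F.lin y v).hom) := by
  refine ⟨fun {x v w} κ => ?_⟩
  rw [comp_tw, comp_tw, translation_tw, translation_tw]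
  have h := F.lin_swap x y v
  have h2 : y ⊴ₗ F.functor.map κ = y ⊴ₗ (F.lin x v).hom ≫ y ⊴ₗ F.tw κ := by
    rw [← actionHomRight_comp, lin_tw]
  have key : x ⊴ₗ (F.lin y v).hom ≫ (swap x y (F.functor.obj v)).hom ≫ y ⊴ₗ F.tw κ =
      F.tw ((swap x y v).hom ≫ y ⊴ₗ κ) ≫ (F.lin y w).hom := by
    rw [← cancel_epi (F.lin x (y ⊙ₗ v)).hom, ← reassoc_of% h, ← h2, ← F.lin_nat_right y κ,
      reassoc_of% (F.lin_tw ((swap x y v).hom ≫ y ⊴ₗ κ)), Functor.map_comp, Category.assoc]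
  exact key

/-- The linear structures of the translations come from the commutativity constraint. The hexagon
`swap_mul` makes them compatible with `x ⊗ y`. -/
lemma Natural.merge {x y z : P} (k : x ⊗ y ⟶ z) :
    Natural ((translation y).comp (translation x)) (translation (L := L) z)
      (fun v => merge k v) := by
  refine ⟨fun {p v w} κ => ?_⟩
  rw [comp_tw, translation_tw, translation_tw, translation_tw]
  have h : p ⊴ₗ PicardTorsor.merge k v ≫ (swap p z v).hom =
      (swap p x (y ⊙ₗ v)).hom ≫ x ⊴ₗ (swap p y v).hom ≫ PicardTorsor.merge k (p ⊙ₗ v) := by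
    rw [PicardTorsor.merge, PicardTorsor.merge, actionHomRight_comp, Category.assoc,
      swap_nat_mid, ← cancel_epi (p ⊴ₗ (αₗ x y v).hom), ← reassoc_of% (swap_mul p x y v)]
    simp
  have h2 := merge_nat k κ
  have key : p ⊴ₗ PicardTorsor.merge k v ≫ (swap p z v).hom ≫ z ⊴ₗ κ =
      ((swap p x (y ⊙ₗ v)).hom ≫ x ⊴ₗ ((swap p y v).hom ≫ y ⊴ₗ κ)) ≫
        PicardTorsor.merge k w := by
    rw [reassoc_of% h, ← h2, actionHomRight_comp]
    simp only [Category.assoc]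
  exact key

lemma Natural.unit : Natural (translation (𝟙_ P)) (TorsorHom.id P L)
    (fun v => (λₗ[P] v).hom) := by
  refine ⟨fun {x v w} κ => ?_⟩
  rw [translation_tw, id_tw]
  have key : x ⊴ₗ (λₗ[P] v).hom ≫ κ = ((swap x (𝟙_ P) v).hom ≫ 𝟙_ P ⊴ₗ κ) ≫ (λₗ[P] w).hom := by
    rw [swap_unit, Category.assoc, ← actionUnitIso_hom_naturality]
    simp
  exact key

lemma Natural.add {F F' : TorsorHom P L L'} {G G' : TorsorHom P M M'}
    {θ : ∀ v, F.functor.obj v ⟶ F'.functor.obj v} {η : ∀ v, G.functor.obj v ⟶ G'.functor.obj v}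
    (hθ : Natural F F' θ) (hη : Natural G G' η) :
    Natural (F.add G) (F'.add G') (fun a => TSum.inj P (θ a.fst) (η a.snd)) := by
  refine Natural.of_sum (fun {x v v'} φ w => ?_) (fun {x} v w w' φ => ?_)
  · rw [add_tw_twR, add_tw_twR]
    refine (TSum.act_inj_twR _ _ _).trans ?_
    rw [hθ.nat φ]
    refine (TSum.inj_comp _ _ _ _).trans (Eq.trans ?_ (TSum.inj_comp _ _ _ _).symm)
    rw [Category.comp_id, Category.id_comp]
  · rw [add_tw_twL, add_tw_twL]
    refine (TSum.act_inj_twL _ _ _).trans ?_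
    rw [hη.nat φ]
    refine (TSum.homMk_inj _ _ _ _ _).trans (Eq.trans ?_ (TSum.homMk_inj _ _ _ _ _).symm)
    rw [Category.comp_id]
    rfl

lemma Natural.id (F : TorsorHom P L M) : Natural F F (fun _ => 𝟙 _) := ⟨fun κ => by simp⟩

/-- Moving a translation from the first to the second summand is a `2`-morphism. On morphisms of the
second summand two slides meet, and `slide_swap` interchanges them. -/
lemma Natural.slide (z : P) :
    Natural (translation (L := TSum P L M) z) ((TorsorHom.id P L).add (translation z))
      (fun a => TSum.slide z a.fst a.snd) := by
  refine Natural.of_sum (fun {x v v'} φ w => ?_) (fun {x} v w w' φ => ?_)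
  · rw [translation_tw, swap_tsum, add_tw_twR, id_tw]
    have h := TSum.slide_nat z φ (𝟙 w)
    rw [actionHomRight_id] at h
    refine (congrArg (· ≫ TSum.inj P φ (𝟙 (z ⊙ₗ w))) (TSum.actMap_slide x z v w)).trans ?_
    refine (Category.assoc _ _ _).trans ((congrArg (TSum.inj P (swap x z v).hom (𝟙 w) ≫ ·)
      h.symm).trans ?_)
    refine ((congrArg (TSum.inj P (swap x z v).hom (𝟙 w) ≫ · ≫ TSum.slide z v' w)
      (TSum.act_inj z φ (𝟙 w)).symm).trans (Category.assoc _ _ _).symm)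
  · rw [translation_tw, swap_tsum, add_tw_twL, translation_tw, TSum.act_twL]
    have h : TSum.inj P (swap x z v).hom (𝟙 w) ≫ TSum.slide z (x ⊙ₗ v) w ≫ TSum.slide x v (z ⊙ₗ w) ≫
        TSum.inj P (𝟙 v) ((swap x z w).hom ≫ z ⊴ₗ φ) = TSum.slide x (z ⊙ₗ v) w ≫
          TSum.slide z v (x ⊙ₗ w) ≫ TSum.inj P (𝟙 v) (z ⊴ₗ φ) := by
      rw [reassoc_of% (slide_swap x z v w), TSum.inj_comp]
      simp [reassoc_of% (swap_swap z x w)]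
    have h1 : TSum.inj P (swap x z v).hom (𝟙 w) ≫ TSum.inj P (swap z x v).hom (𝟙 w) ≫
        TSum.twL (z ⊙ₗ v) φ = TSum.slide x (z ⊙ₗ v) w ≫ TSum.inj P (𝟙 _) φ := by
      rw [TSum.inj_comp', swap_swap, Category.id_comp, TSum.inj_id, Category.id_comp, TSum.twL_eq]
    have h3 := TSum.slide_nat z (𝟙 v) φ
    rw [actionHomRight_id] at h3
    refine (congrArg₂ (· ≫ ·) (TSum.actMap_slide x z v w) (TSum.twL_eq _ _)).trans ?_
    refine (Category.assoc _ _ _).trans (h.trans ?_)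
    refine (congrArg (TSum.slide x (z ⊙ₗ v) w ≫ ·) h3.symm).trans ?_
    refine (Category.assoc _ _ _).symm.trans ?_
    exact congrArg (· ≫ TSum.slide z v w') h1.symm

end TorsorHom

end Equations

end PicardTorsor

namespace PicardTorsor

/-! ### Both sides of the determining equations are natural families. -/

section CommutatorNaturality

variable {G : Type w₂} [Group G]
  {P : Type u} [Category.{v} P] [MonoidalCategory P] [SymmetricCategory P] [PicardGroupoid P]
  {L : CentralExtension.{u, v, w₁, t₁, w₂} G P}

open TorsorHom

lemma TorsorHom.Natural.counit {M : Type w₁} [Category.{t₁} M] [MonoidalLeftAction P M]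
    {N : Type w₃} [Category.{t₃} N] [MonoidalLeftAction P N]
    (F : TorsorHom P M N) [F.functor.IsEquivalence] :
    Natural (F.inv.comp F) (TorsorHom.id P N) (fun v => (F.counit v).hom) := by
  refine ⟨fun {x v w} κ => ?_⟩
  rw [comp_tw, id_tw]
  exact (tw_invTw F κ).symm

namespace CentralExtension.Commutator

variable (C : L.Commutator)

/-- It is the image of the defining `2`-isomorphism under `D`, followed by the counit of `D`. -/
lemma app_natural {g h k : G} (e : g * h = k) (e' : h * g = k) :
    Natural ((translation (C.obj g h (e.trans e'.symm))).comp (L.mul e'))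
      ((L.mul e).comp (L.com g h)) (fun x => (C.app e e' x).hom) :=
  ((Natural.of_iso₂ (C.iso e e')).map (L.mul e')).comp
    (((Natural.counit (L.mul e')).pre ((L.mul e).comp (L.com g h))).of_eq
      (comp_assoc _ _ _).symm (comp_id _) (fun _ => HEq.rfl))

lemma natural_mulLeft_left {a b c ab ac bc abc : G} (ab_eq : a * b = ab)
    (ca_eq : c * a = ac) (bc_eq : b * c = bc)
    (ab_c : ab * c = abc) (c_ab : c * ab = abc) (a_bc : a * bc = abc) (ac_b : ac * b = abc)
    {y z : P} (k : y ⊗ z ⟶ C.obj ab c (ab_c.trans c_ab.symm)) :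
    Natural (((translation z).comp (translation y)).comp
        (((L.mul ac_b).comp ((L.mul ca_eq).add (L.one b))).comp (L.asc c a b)))
      (((L.mul a_bc).comp ((L.one a).add (L.mul bc_eq))).comp
        (((L.one a).add (L.com b c)).comp (permLeft L a b c)))
      (fun x => (L.assocApp ca_eq ab_eq ac_b c_ab (y ⊙ₗ z ⊙ₗ x)).hom ≫
        ((L.mul c_ab).comp ((L.one c).add (L.mul ab_eq))).functor.map (PicardTorsor.merge k x) ≫
        ((L.one c).add (L.mul ab_eq)).functor.map (C.app ab_c c_ab x).hom ≫
        (((L.one a).add (L.com b c)).comp (permLeft L a b c)).functor.map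
          (L.assocApp ab_eq bc_eq ab_c a_bc x).hom) := by
  have h1 := (Natural.of_iso₂ (L.mulAssoc ca_eq ab_eq ac_b c_ab)).pre
    ((translation z).comp (translation y))
  have h2 := (Natural.merge (L := L.torsor abc) k).map ((L.mul c_ab).comp ((L.one c).add (L.mul ab_eq)))
  have h3 := (C.app_natural ab_c c_ab).map ((L.one c).add (L.mul ab_eq))
  have h4 := (Natural.of_iso₂ (L.mulAssoc ab_eq bc_eq ab_c a_bc)).map
    (((L.one a).add (L.com b c)).comp (permLeft L a b c))
  have e3 := comp_assoc (translation (C.obj ab c (ab_c.trans c_ab.symm))) (L.mul c_ab)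
    ((L.one c).add (L.mul ab_eq))
  -- The target of `C.app` for `a * b` and `c` has to be rewritten over `L a + (L b + L c)`. This
  -- takes the naturality of `C` in its first summand and the hexagon for `L a + L b` past `L c`.
  have e4 : ((L.mul ab_c).comp (L.com ab c)).comp ((L.one c).add (L.mul ab_eq)) =
      ((((L.mul ab_c).comp ((L.mul ab_eq).add (L.one c))).comp (L.asc a b c)).comp
        (((L.one a).add (L.com b c)).comp (permLeft L a b c))) := by
    have := (agree_comm (L.mul ab_eq) (L.one c)).eq
    have h := (agree_hexagon_left (P := P) (L := L.torsor a) (M := L.torsor b) (N := L.torsor c)).eq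
    rw [comp_assoc, ← this, comp_assoc, comp_assoc, permLeft, h]
  exact h1.comp (h2.comp ((h3.of_eq e3 rfl (θ' := fun x => ((L.one c).add (L.mul ab_eq)).functor.map
    (C.app ab_c c_ab x).hom) (fun _ => HEq.rfl)).comp (h4.of_eq e4.symm rfl (fun _ => HEq.rfl))))

/-- Source and target are literally those of `natural_mulLeft_left`, so the two families can be
compared by `Natural.eq_of_eq`. -/
lemma natural_mulLeft_right {a b c ac bc abc : G}
    (ac_eq : a * c = ac) (ca_eq : c * a = ac) (bc_eq : b * c = bc) (cb_eq : c * b = bc)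
    (a_bc : a * bc = abc) (ac_b : ac * b = abc) :
    letI y := C.obj a c (ac_eq.trans ca_eq.symm)
    letI z := C.obj b c (bc_eq.trans cb_eq.symm)
    Natural (((translation z).comp (translation y)).comp
        (((L.mul ac_b).comp ((L.mul ca_eq).add (L.one b))).comp (L.asc c a b)))
      (((L.mul a_bc).comp ((L.one a).add (L.mul bc_eq))).comp
        (((L.one a).add (L.com b c)).comp (permLeft L a b c)))
      (fun x : L.torsor abc => (((L.mul ca_eq).add (L.one b)).comp (L.asc c a b)).functor.map
          ((L.mul ac_b).lin y (z ⊙ₗ x)).hom ≫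
        (L.asc c a b).functor.map
          (TSum.inj P (C.app ac_eq ca_eq ((L.mul ac_b).functor.obj (z ⊙ₗ x)).fst).hom
            (𝟙 ((L.mul ac_b).functor.obj (z ⊙ₗ x)).snd)) ≫
        (permLeft L a b c).functor.map (L.assocApp ac_eq cb_eq ac_b a_bc (z ⊙ₗ x)).hom ≫
        (((L.one a).add (L.mul cb_eq)).comp (permLeft L a b c)).functor.map
          (((L.mul a_bc).lin z x).hom ≫
            TSum.slide z ((L.mul a_bc).functor.obj x).fst ((L.mul a_bc).functor.obj x).snd) ≫
        (permLeft L a b c).functor.map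
          (TSum.inj P (𝟙 ((L.mul a_bc).functor.obj x).fst)
            (C.app bc_eq cb_eq ((L.mul a_bc).functor.obj x).snd).hom)) := by
  set y := C.obj a c (ac_eq.trans ca_eq.symm)
  set z := C.obj b c (bc_eq.trans cb_eq.symm)
  have h1 := ((Natural.lin (L.mul ac_b) y).pre (translation z)).map
    (((L.mul ca_eq).add (L.one b)).comp (L.asc c a b))
  have h2 := (((C.app_natural ac_eq ca_eq).add (Natural.id (L.one b))).pre
    ((translation z).comp (L.mul ac_b))).map (L.asc c a b)
  have h3 := ((Natural.of_iso₂ (L.mulAssoc ac_eq cb_eq ac_b a_bc)).pre (translation z)).map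
    (permLeft L a b c)
  have h4 := ((Natural.lin (L.mul a_bc) z).comp ((Natural.slide z).pre (L.mul a_bc))).map
    (((L.one a).add (L.mul cb_eq)).comp (permLeft L a b c))
  have h5 := (((Natural.id (L.one a)).add (C.app_natural bc_eq cb_eq)).pre (L.mul a_bc)).map
    (permLeft L a b c)
  have e1 : ((translation z).comp ((translation y).comp (L.mul ac_b))).comp
      (((L.mul ca_eq).add (L.one b)).comp (L.asc c a b)) = ((translation z).comp (translation y)).comp
        (((L.mul ac_b).comp ((L.mul ca_eq).add (L.one b))).comp (L.asc c a b)) := by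
    simp only [comp_assoc]
  have e2 : (((translation z).comp (L.mul ac_b)).comp (((translation y).comp (L.mul ca_eq)).add
      (L.one b))).comp (L.asc c a b) = ((translation z).comp ((L.mul ac_b).comp (translation y))).comp
      (((L.mul ca_eq).add (L.one b)).comp (L.asc c a b)) := by
    have h := (agree_add_id_comp (M := L.torsor b) (translation y) (L.mul ca_eq)).eq
    rw [← h, (agree_translation_add y).eq]
    simp only [comp_assoc]
  -- After the commutation of `a` and `c`, the associativity constraint turns `permLeft` into the
  -- commutation of the first two summands; this is the other form of the hexagon.
  have e3 : ((translation z).comp (((L.mul ac_b).comp ((L.mul ac_eq).add (L.one b))).comp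
      (L.asc a c b))).comp (permLeft L a b c) = (((translation z).comp (L.mul ac_b)).comp
        (((L.mul ac_eq).comp (L.com a c)).add (L.one b))).comp (L.asc c a b) := by
    have h := (agree_add_id_comp (M := L.torsor b) (L.mul ac_eq) (L.com a c)).eq
    rw [← h, permLeft]
    simp only [comp_assoc]
    rw [← (agree_hexagon_left_comm (P := P) (L := L.torsor a) (M := L.torsor c)
      (N := L.torsor b)).eq]
    simp only [comp_assoc]
  have e4 : ((translation z).comp (L.mul a_bc)).comp (((L.one a).add (L.mul cb_eq)).comp
      (permLeft L a b c)) = ((translation z).comp ((L.mul a_bc).comp ((L.one a).add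
        (L.mul cb_eq)))).comp (permLeft L a b c) := by
    simp only [comp_assoc]
  have e5 : ((L.mul a_bc).comp ((L.one a).add ((translation z).comp (L.mul cb_eq)))).comp
      (permLeft L a b c) = ((L.mul a_bc).comp ((L.one a).add (translation z))).comp
        (((L.one a).add (L.mul cb_eq)).comp (permLeft L a b c)) := by
    have h := (agree_id_add_comp (M := L.torsor a) (translation z) (L.mul cb_eq)).eq
    rw [← h]
    simp only [comp_assoc]
  have e6 : ((L.mul a_bc).comp ((L.one a).add ((L.mul bc_eq).comp (L.com b c)))).comp
      (permLeft L a b c) = ((L.mul a_bc).comp ((L.one a).add (L.mul bc_eq))).comp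
        (((L.one a).add (L.com b c)).comp (permLeft L a b c)) := by
    have h := (agree_id_add_comp (M := L.torsor a) (L.mul bc_eq) (L.com b c)).eq
    rw [← h]
    simp only [comp_assoc]
  exact (h1.of_eq e1 rfl (fun _ => HEq.rfl)).comp ((h2.of_eq e2 rfl (fun _ => HEq.rfl)).comp
    ((h3.of_eq e3 rfl (fun _ => HEq.rfl)).comp ((h4.of_eq e4 rfl (fun _ => HEq.rfl)).comp
      (h5.of_eq e5 e6 (fun _ => HEq.rfl)))))

lemma natural_mulRight_left {a b c bc abc : G} (bc_eq : b * c = bc) (a_bc : a * bc = abc)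
    (bc_a : bc * a = abc) {y z : P} (k : z ⊗ y ⟶ C.obj a bc (a_bc.trans bc_a.symm)) :
    Natural (((translation y).comp (translation z)).comp
        (((L.mul bc_a).comp ((L.mul bc_eq).add (L.one a))).comp (L.asc b c a)))
      (((L.mul a_bc).comp ((L.one a).add (L.mul bc_eq))).comp (permRight L a b c))
      (fun x => (((L.mul bc_a).comp ((L.mul bc_eq).add (L.one a))).comp (L.asc b c a)).functor.map
          (PicardTorsor.merge k x) ≫
        (((L.mul bc_eq).add (L.one a)).comp (L.asc b c a)).functor.map
          (C.app a_bc bc_a x).hom) := by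
  have h1 := (Natural.merge (L := L.torsor abc) k).map
    (((L.mul bc_a).comp ((L.mul bc_eq).add (L.one a))).comp (L.asc b c a))
  have h2 := (C.app_natural a_bc bc_a).map (((L.mul bc_eq).add (L.one a)).comp (L.asc b c a))
  have e1 : ((translation (C.obj a bc (a_bc.trans bc_a.symm))).comp (L.mul bc_a)).comp
      (((L.mul bc_eq).add (L.one a)).comp (L.asc b c a)) =
      (translation (C.obj a bc (a_bc.trans bc_a.symm))).comp
        (((L.mul bc_a).comp ((L.mul bc_eq).add (L.one a))).comp (L.asc b c a)) := by
    simp only [comp_assoc]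
  have e2 : ((L.mul a_bc).comp (L.com a bc)).comp (((L.mul bc_eq).add (L.one a)).comp
      (L.asc b c a)) = ((L.mul a_bc).comp ((L.one a).add (L.mul bc_eq))).comp
        (permRight L a b c) := by
    have := (agree_comm (L.one a) (L.mul bc_eq)).eq
    rw [permRight, comp_assoc, ← comp_assoc (L.com a bc), ← this]
    simp only [comp_assoc]
  exact h1.comp (h2.of_eq e1 e2 (fun _ => HEq.rfl))

lemma natural_mulRight_right {a b c ab ac bc abc : G} (ab_eq : a * b = ab) (ba_eq : b * a = ab)
    (ac_eq : a * c = ac) (ca_eq : c * a = ac) (bc_eq : b * c = bc) (ab_c : ab * c = abc)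
    (a_bc : a * bc = abc) (bc_a : bc * a = abc) (b_ac : b * ac = abc) :
    letI y := C.obj a b (ab_eq.trans ba_eq.symm)
    letI z := C.obj a c (ac_eq.trans ca_eq.symm)
    Natural (((translation y).comp (translation z)).comp
        (((L.mul bc_a).comp ((L.mul bc_eq).add (L.one a))).comp (L.asc b c a)))
      (((L.mul a_bc).comp ((L.one a).add (L.mul bc_eq))).comp (permRight L a b c))
      (fun x => (L.assocApp bc_eq ca_eq bc_a b_ac (z ⊙ₗ y ⊙ₗ x)).hom ≫
        ((L.one b).add (L.mul ca_eq)).functor.map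
          (((L.mul b_ac).lin z (y ⊙ₗ x)).hom ≫
            TSum.slide z ((L.mul b_ac).functor.obj (y ⊙ₗ x)).fst
              ((L.mul b_ac).functor.obj (y ⊙ₗ x)).snd) ≫
        TSum.inj P (𝟙 ((L.mul b_ac).functor.obj (y ⊙ₗ x)).fst)
          (C.app ac_eq ca_eq ((L.mul b_ac).functor.obj (y ⊙ₗ x)).snd).hom ≫
        ((L.one b).add (L.com a c)).functor.map
          (L.assocApp ba_eq ac_eq ab_c b_ac (y ⊙ₗ x)).inv ≫
        ((L.asc b a c).comp ((L.one b).add (L.com a c))).functor.map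
          (((L.mul ba_eq).add (L.one c)).functor.map ((L.mul ab_c).lin y x).hom ≫
            TSum.inj P (C.app ab_eq ba_eq ((L.mul ab_c).functor.obj x).fst).hom
              (𝟙 ((L.mul ab_c).functor.obj x).snd)) ≫
        (permRight L a b c).functor.map (L.assocApp ab_eq bc_eq ab_c a_bc x).hom) := by
  set y := C.obj a b (ab_eq.trans ba_eq.symm)
  set z := C.obj a c (ac_eq.trans ca_eq.symm)
  have h1 := (Natural.of_iso₂ (L.mulAssoc bc_eq ca_eq bc_a b_ac)).pre
    ((translation y).comp (translation z))
  have h2 := (((Natural.lin (L.mul b_ac) z).comp ((Natural.slide z).pre (L.mul b_ac))).pre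
    (translation y)).map ((L.one b).add (L.mul ca_eq))
  have h3 := ((Natural.id (L.one b)).add (C.app_natural ac_eq ca_eq)).pre
    ((translation y).comp (L.mul b_ac))
  have h4 := ((Natural.of_iso₂_inv (L.mulAssoc ba_eq ac_eq ab_c b_ac)).pre (translation y)).map
    ((L.one b).add (L.com a c))
  have h5 := (Natural.lin (L.mul ab_c) y).map ((L.mul ba_eq).add (L.one c))
  have h6 := ((C.app_natural ab_eq ba_eq).add (Natural.id (L.one c))).pre (L.mul ab_c)
  have h7 := (Natural.of_iso₂ (L.mulAssoc ab_eq bc_eq ab_c a_bc)).map (permRight L a b c)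
  have e2 : ((translation y).comp ((translation z).comp (L.mul b_ac))).comp
      ((L.one b).add (L.mul ca_eq)) = ((translation y).comp (translation z)).comp
        ((L.mul b_ac).comp ((L.one b).add (L.mul ca_eq))) := by
    simp only [comp_assoc]
  have e3 : ((translation y).comp (L.mul b_ac)).comp
      ((L.one b).add ((translation z).comp (L.mul ca_eq))) =
      ((translation y).comp ((L.mul b_ac).comp ((L.one b).add (translation z)))).comp
        ((L.one b).add (L.mul ca_eq)) := by
    have h := (agree_id_add_comp (M := L.torsor b) (translation z) (L.mul ca_eq)).eq
    rw [← h]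
    simp only [comp_assoc]
  have e4 : ((translation y).comp ((L.mul b_ac).comp ((L.one b).add (L.mul ac_eq)))).comp
      ((L.one b).add (L.com a c)) = ((translation y).comp (L.mul b_ac)).comp
        ((L.one b).add ((L.mul ac_eq).comp (L.com a c))) := by
    have h := (agree_id_add_comp (M := L.torsor b) (L.mul ac_eq) (L.com a c)).eq
    rw [← h]
    simp only [comp_assoc]
  have e6 : (L.mul ab_c).comp (((translation y).comp (L.mul ba_eq)).add (L.one c)) =
      ((L.mul ab_c).comp (translation y)).comp ((L.mul ba_eq).add (L.one c)) := by
    have h := (agree_add_id_comp (M := L.torsor c) (translation y) (L.mul ba_eq)).eq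
    rw [← h, (agree_translation_add y).eq]
    simp only [comp_assoc]
  have h56 := (h5.comp (h6.of_eq e6 rfl (fun _ => HEq.rfl))).map
    ((L.asc b a c).comp ((L.one b).add (L.com a c)))
  have e5 : (((translation y).comp (L.mul ab_c)).comp ((L.mul ba_eq).add (L.one c))).comp
      ((L.asc b a c).comp ((L.one b).add (L.com a c))) = ((translation y).comp
        (((L.mul ab_c).comp ((L.mul ba_eq).add (L.one c))).comp (L.asc b a c))).comp
          ((L.one b).add (L.com a c)) := by
    simp only [comp_assoc]
  -- The hexagon splits the commutation of `L a` past `L b + L c` into two steps; the first one is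
  -- absorbed in the target of `C.app` for `a` and `b`.
  have e7 : (((L.mul ab_c).comp ((L.mul ab_eq).add (L.one c))).comp (L.asc a b c)).comp
      (permRight L a b c) = ((L.mul ab_c).comp (((L.mul ab_eq).comp (L.com a b)).add
        (L.one c))).comp ((L.asc b a c).comp ((L.one b).add (L.com a c))) := by
    have h := (agree_add_id_comp (M := L.torsor c) (L.mul ab_eq) (L.com a b)).eq
    have h' := (agree_hexagon_right (P := P) (L := L.torsor a) (M := L.torsor b)
      (N := L.torsor c)).eq
    rw [permRight, comp_assoc _ _ ((PicardTorsor.comm P _ _).comp (L.asc b c a)), h', ← h]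
    simp only [comp_assoc]
  exact h1.comp ((h2.of_eq e2 rfl (fun _ => HEq.rfl)).comp ((h3.of_eq e3 rfl (fun _ => HEq.rfl)).comp
    ((h4.of_eq e4 rfl (fun _ => HEq.rfl)).comp ((h56.of_eq e5 rfl (fun _ => HEq.rfl)).comp
      (h7.of_eq e7 rfl (fun _ => HEq.rfl))))))

lemma natural_antisymm_left {g h k : G} (e : g * h = k) {y z : P} (f : y ⊗ z ⟶ 𝟙_ P) :
    Natural (((translation z).comp (translation y)).comp (L.mul e)) (L.mul e)
      (fun x => (L.mul e).functor.map (PicardTorsor.merge f x ≫ (λₗ[P] x).hom)) :=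
  (((Natural.merge f).comp Natural.unit).map (L.mul e)).of_eq rfl (id_comp _) (fun _ => HEq.rfl)

lemma natural_antisymm_right {g h k : G} (e : g * h = k) (e' : h * g = k) :
    letI y := C.obj h g (e'.trans e.symm)
    letI z := C.obj g h (e.trans e'.symm)
    Natural (((translation z).comp (translation y)).comp (L.mul e)) (L.mul e)
      (fun x => (C.app e' e (z ⊙ₗ x)).hom ≫ (L.com h g).functor.map (C.app e e' x).hom) := by
  set y := C.obj h g (e'.trans e.symm)
  set z := C.obj g h (e.trans e'.symm)
  have h1 := (C.app_natural e' e).pre (translation z)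
  have h2 := (C.app_natural e e').map (L.com h g)
  have e2 : ((translation z).comp (L.mul e')).comp (L.com h g) =
      (translation z).comp ((L.mul e').comp (L.com h g)) := comp_assoc _ _ _
  -- This is where `C ∘ C = id` enters: both families of the anti-symmetry equation end at `D`.
  have e3 : ((L.mul e).comp (L.com g h)).comp (L.com h g) = L.mul e := by
    rw [comp_assoc, (agree_comm_comm (P := P) (L := L.torsor g) (M := L.torsor h)).eq, comp_id]
  exact (h1.of_eq (comp_assoc _ _ _).symm rfl (fun _ => HEq.rfl)).comp
    (h2.of_eq e2 e3 (fun _ => HEq.rfl))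

end CentralExtension.Commutator

end CommutatorNaturality

end PicardTorsor

namespace PicardTorsor

/-! ### Solving for an unknown morphism of `P` at one object. -/

section Solve

variable {P : Type u} [Category.{v} P] [MonoidalCategory P] [SymmetricCategory P] [PicardGroupoid P]
  {L : Type w₁} [Category.{t₁} L] [MonoidalLeftAction P L] [IsTorsor P L]
  {M : Type w₂} [Category.{t₂} M] [MonoidalLeftAction P M] [IsTorsor P M]

lemma exists_merge_eq {x y z : P} {v : L} (f : x ⊙ₗ y ⊙ₗ v ⟶ z ⊙ₗ v) :
    ∃ k : x ⊗ y ⟶ z, merge k v = f := by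
  obtain ⟨k, hk⟩ := IsTorsor.whisker_surjective ((αₗ x y v).hom ≫ f)
  exact ⟨k, by rw [merge, hk, Iso.inv_hom_id_assoc]⟩

lemma merge_injective {x y z : P} {v : L} {k k' : x ⊗ y ⟶ z} (h : merge k v = merge k' v) :
    k = k' := by
  rw [merge, merge, cancel_epi] at h
  exact IsTorsor.whisker_injective h

/-- All other factors are invertible and `F` is full, so the middle factor may be prescribed. Since
the action is full, it comes from a morphism of `P`. -/
lemma TorsorHom.exists_map_merge_eq (F : TorsorHom P L M) {x y z : P} {v : L} {a b : M}
    (f : a ⟶ F.functor.obj (x ⊙ₗ y ⊙ₗ v)) (g : F.functor.obj (z ⊙ₗ v) ⟶ b) (h : a ⟶ b) :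
    ∃ k : x ⊗ y ⟶ z, f ≫ F.functor.map (merge k v) ≫ g = h := by
  have := IsTorsor.isGroupoid P M
  have := F.isEquivalence
  obtain ⟨m, hm⟩ := F.functor.map_surjective (CategoryTheory.inv f ≫ h ≫ CategoryTheory.inv g)
  obtain ⟨k, rfl⟩ := exists_merge_eq m
  exact ⟨k, by rw [hm]; simp⟩

lemma TorsorHom.map_merge_injective (F : TorsorHom P L M) {x y z : P} {v : L} {a b : M}
    {f : a ⟶ F.functor.obj (x ⊙ₗ y ⊙ₗ v)} {g : F.functor.obj (z ⊙ₗ v) ⟶ b} {k k' : x ⊗ y ⟶ z}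
    (h : f ≫ F.functor.map (merge k v) ≫ g = f ≫ F.functor.map (merge k' v) ≫ g) : k = k' := by
  have := IsTorsor.isGroupoid P M
  have := F.isEquivalence
  rw [cancel_epi, cancel_mono] at h
  exact merge_injective (F.functor.map_injective h)

lemma TorsorHom.map_merge_comp_injective (F : TorsorHom P L M) {x y z : P} {v : L} {b : M}
    {g : F.functor.obj (z ⊙ₗ v) ⟶ b} {k k' : x ⊗ y ⟶ z}
    (h : F.functor.map (merge k v) ≫ g = F.functor.map (merge k' v) ≫ g) : k = k' :=
  F.map_merge_injective (f := 𝟙 _) (g := g) (congrArg (𝟙 _ ≫ ·) h)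

end Solve

/-! ### Unique solvability of the equations (2a), (2b) and (3). -/

section Solutions

variable {G : Type w₂} [Group G]
  {P : Type u} [Category.{v} P] [MonoidalCategory P] [SymmetricCategory P] [PicardGroupoid P]
  {L : CentralExtension.{u, v, w₁, t₁, w₂} G P}

namespace CentralExtension.Commutator

variable (C : L.Commutator)

/-- The equation in `IsMulLeft`, for a morphism `k : C (a, c) + C (b, c) ⟶ C (a * b, c)`. -/
def MulLeftEq {a b c ab ac bc abc : G} (ab_eq : a * b = ab) (ac_eq : a * c = ac) (ca_eq : c * a = ac)
    (bc_eq : b * c = bc) (cb_eq : c * b = bc) (ab_c : ab * c = abc) (c_ab : c * ab = abc)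
    (a_bc : a * bc = abc) (ac_b : ac * b = abc)
    (k : C.obj a c (ac_eq.trans ca_eq.symm) ⊗ C.obj b c (bc_eq.trans cb_eq.symm) ⟶
      C.obj ab c (ab_c.trans c_ab.symm)) (x : L.torsor abc) : Prop :=
  letI y := C.obj a c (ac_eq.trans ca_eq.symm)
  letI z := C.obj b c (bc_eq.trans cb_eq.symm)
  (L.assocApp ca_eq ab_eq ac_b c_ab (y ⊙ₗ z ⊙ₗ x)).hom ≫
    ((L.mul c_ab).comp ((L.one c).add (L.mul ab_eq))).functor.map (merge k x) ≫
    ((L.one c).add (L.mul ab_eq)).functor.map (C.app ab_c c_ab x).hom ≫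
    (((L.one a).add (L.com b c)).comp (permLeft L a b c)).functor.map
      (L.assocApp ab_eq bc_eq ab_c a_bc x).hom =
  (((L.mul ca_eq).add (L.one b)).comp (L.asc c a b)).functor.map
      ((L.mul ac_b).lin y (z ⊙ₗ x)).hom ≫
    (L.asc c a b).functor.map
      (TSum.inj P (C.app ac_eq ca_eq ((L.mul ac_b).functor.obj (z ⊙ₗ x)).fst).hom
        (𝟙 ((L.mul ac_b).functor.obj (z ⊙ₗ x)).snd)) ≫
    (permLeft L a b c).functor.map (L.assocApp ac_eq cb_eq ac_b a_bc (z ⊙ₗ x)).hom ≫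
    (((L.one a).add (L.mul cb_eq)).comp (permLeft L a b c)).functor.map
      (((L.mul a_bc).lin z x).hom ≫
        TSum.slide z ((L.mul a_bc).functor.obj x).fst ((L.mul a_bc).functor.obj x).snd) ≫
    (permLeft L a b c).functor.map
      (TSum.inj P (𝟙 ((L.mul a_bc).functor.obj x).fst)
        (C.app bc_eq cb_eq ((L.mul a_bc).functor.obj x).snd).hom)

/-- The equation is solved at an arbitrary `x₀`. As both sides are natural between the same
`1`-morphisms, the solution is valid at all `x`; uniqueness is already visible at `x₀`. -/
lemma existsUnique_mulLeftEq {a b c ab ac bc abc : G} (ab_eq : a * b = ab) (ac_eq : a * c = ac)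
    (ca_eq : c * a = ac) (bc_eq : b * c = bc) (cb_eq : c * b = bc) (ab_c : ab * c = abc)
    (c_ab : c * ab = abc) (a_bc : a * bc = abc) (ac_b : ac * b = abc) :
    ∃! k, ∀ x, C.MulLeftEq ab_eq ac_eq ca_eq bc_eq cb_eq ab_c c_ab a_bc ac_b k x := by
  obtain ⟨x₀⟩ := IsTorsor.nonempty (P := P) (L := L.torsor abc)
  obtain ⟨k, hk⟩ := TorsorHom.exists_map_merge_eq
    ((L.mul c_ab).comp ((L.one c).add (L.mul ab_eq))) (v := x₀) _ _ _
  refine ⟨k, fun x => ?_, fun k' hk' => ?_⟩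
  · exact (C.natural_mulLeft_left ab_eq ca_eq bc_eq ab_c c_ab a_bc ac_b k).eq_of_eq
      (C.natural_mulLeft_right ac_eq ca_eq bc_eq cb_eq a_bc ac_b) hk x
  · exact TorsorHom.map_merge_injective _ ((hk' x₀).trans hk.symm)

/-- The equation in `IsMulRight`, for a morphism `k : C (a, c) + C (a, b) ⟶ C (a, b * c)`. -/
def MulRightEq {a b c ab ac bc abc : G} (ab_eq : a * b = ab) (ba_eq : b * a = ab)
    (ac_eq : a * c = ac) (ca_eq : c * a = ac) (bc_eq : b * c = bc) (ab_c : ab * c = abc)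
    (a_bc : a * bc = abc) (bc_a : bc * a = abc) (b_ac : b * ac = abc)
    (k : C.obj a c (ac_eq.trans ca_eq.symm) ⊗ C.obj a b (ab_eq.trans ba_eq.symm) ⟶
      C.obj a bc (a_bc.trans bc_a.symm)) (x : L.torsor abc) : Prop :=
  letI y := C.obj a b (ab_eq.trans ba_eq.symm)
  letI z := C.obj a c (ac_eq.trans ca_eq.symm)
  (((L.mul bc_a).comp ((L.mul bc_eq).add (L.one a))).comp (L.asc b c a)).functor.map
      (merge k x) ≫
    (((L.mul bc_eq).add (L.one a)).comp (L.asc b c a)).functor.map (C.app a_bc bc_a x).hom =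
  (L.assocApp bc_eq ca_eq bc_a b_ac (z ⊙ₗ y ⊙ₗ x)).hom ≫
    ((L.one b).add (L.mul ca_eq)).functor.map
      (((L.mul b_ac).lin z (y ⊙ₗ x)).hom ≫
        TSum.slide z ((L.mul b_ac).functor.obj (y ⊙ₗ x)).fst
          ((L.mul b_ac).functor.obj (y ⊙ₗ x)).snd) ≫
    TSum.inj P (𝟙 ((L.mul b_ac).functor.obj (y ⊙ₗ x)).fst)
      (C.app ac_eq ca_eq ((L.mul b_ac).functor.obj (y ⊙ₗ x)).snd).hom ≫
    ((L.one b).add (L.com a c)).functor.map (L.assocApp ba_eq ac_eq ab_c b_ac (y ⊙ₗ x)).inv ≫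
    ((L.asc b a c).comp ((L.one b).add (L.com a c))).functor.map
      (((L.mul ba_eq).add (L.one c)).functor.map ((L.mul ab_c).lin y x).hom ≫
        TSum.inj P (C.app ab_eq ba_eq ((L.mul ab_c).functor.obj x).fst).hom
          (𝟙 ((L.mul ab_c).functor.obj x).snd)) ≫
    (permRight L a b c).functor.map (L.assocApp ab_eq bc_eq ab_c a_bc x).hom

lemma existsUnique_mulRightEq {a b c ab ac bc abc : G} (ab_eq : a * b = ab) (ba_eq : b * a = ab)
    (ac_eq : a * c = ac) (ca_eq : c * a = ac) (bc_eq : b * c = bc) (ab_c : ab * c = abc)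
    (a_bc : a * bc = abc) (bc_a : bc * a = abc) (b_ac : b * ac = abc) :
    ∃! k, ∀ x, C.MulRightEq ab_eq ba_eq ac_eq ca_eq bc_eq ab_c a_bc bc_a b_ac k x := by
  obtain ⟨x₀⟩ := IsTorsor.nonempty (P := P) (L := L.torsor abc)
  obtain ⟨k, hk⟩ := TorsorHom.exists_map_merge_eq
    (((L.mul bc_a).comp ((L.mul bc_eq).add (L.one a))).comp (L.asc b c a)) (v := x₀) (𝟙 _) _ _
  rw [Category.id_comp] at hk
  refine ⟨k, fun x => ?_, fun k' hk' => ?_⟩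
  · exact (C.natural_mulRight_left bc_eq a_bc bc_a k).eq_of_eq
      (C.natural_mulRight_right ab_eq ba_eq ac_eq ca_eq bc_eq ab_c a_bc bc_a b_ac) hk x
  · exact TorsorHom.map_merge_comp_injective _ ((hk' x₀).trans hk.symm)

/-- The equation in `IsAntisymm`, for a morphism `f : C (h, g) + C (g, h) ⟶ e`. -/
def AntisymmEq {g h k : G} (e : g * h = k) (e' : h * g = k)
    (f : C.obj h g (e'.trans e.symm) ⊗ C.obj g h (e.trans e'.symm) ⟶ 𝟙_ P) (x : L.torsor k) : Prop :=
  (L.mul e).functor.map (merge f x ≫ (λₗ[P] x).hom) =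
    (C.app e' e (C.obj g h (e.trans e'.symm) ⊙ₗ x)).hom ≫ (L.com h g).functor.map (C.app e e' x).hom

lemma existsUnique_antisymmEq {g h k : G} (e : g * h = k) (e' : h * g = k) :
    ∃! f, ∀ x, C.AntisymmEq e e' f x := by
  have := IsTorsor.isGroupoid P (TSum P (L.torsor g) (L.torsor h))
  obtain ⟨x₀⟩ := IsTorsor.nonempty (P := P) (L := L.torsor k)
  -- The unit isomorphism is treated as the known right factor of the unknown morphism.
  obtain ⟨m, hm⟩ := TorsorHom.exists_map_merge_eq (L.mul e) (v := x₀) (𝟙 _)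
    ((L.mul e).functor.map (λₗ[P] x₀).hom) ((C.app e' e (C.obj g h (e.trans e'.symm) ⊙ₗ x₀)).hom ≫
      (L.com h g).functor.map (C.app e e' x₀).hom)
  rw [Category.id_comp] at hm
  have key : ∀ f, C.AntisymmEq e e' f x₀ ↔ (L.mul e).functor.map (merge f x₀) ≫
    (L.mul e).functor.map (λₗ[P] x₀).hom = (C.app e' e (C.obj g h (e.trans e'.symm) ⊙ₗ x₀)).hom ≫
      (L.com h g).functor.map (C.app e e' x₀).hom := by
    intro f
    rw [AntisymmEq, Functor.map_comp]
  refine ⟨m, fun x => ?_, fun k' hk' => ?_⟩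
  · exact (natural_antisymm_left e m).eq_of_eq (C.natural_antisymm_right e e') ((key m).2 hm) x
  · exact TorsorHom.map_merge_comp_injective _ (((key k').1 (hk' x₀)).trans hm.symm)

end CentralExtension.Commutator

end Solutions

end PicardTorsor

namespace PicardTorsor

/-! ### Twisted morphisms relative to evaluations `F p ⟶ t`. -/

section Over

variable {P : Type u} [Category.{v} P] [MonoidalCategory P] [SymmetricCategory P]
  {L : Type w₁} [Category.{t₁} L] [MonoidalLeftAction P L]
  {A : Type w₂} [Category.{t₂} A] [MonoidalLeftAction P A]
  {B : Type w₃} [Category.{t₃} B] [MonoidalLeftAction P B]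
  {E : Type w₄} [Category.{t₄} E] [MonoidalLeftAction P E]

/-- With respect to the morphisms `c : F p ⟶ t` and `c' : F p' ⟶ t'`, the `1`-morphism `F` carries
`κ : x + p ⟶ p'` to `χ : x + t ⟶ t'`. -/
def TorsorHom.Over (F : TorsorHom P L A) {x : P} {p p' : L} {t t' : A} (c : F.functor.obj p ⟶ t)
    (c' : F.functor.obj p' ⟶ t') (κ : x ⊙ₗ p ⟶ p') (χ : x ⊙ₗ t ⟶ t') : Prop :=
  F.tw κ ≫ c' = x ⊴ₗ c ≫ χ

namespace TorsorHom

/-- Evaluation of `F` followed by `1 + K`. -/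
def evL (F : TorsorHom P L (TSum P A B)) (K : TorsorHom P B E) {p : L} {a : A} {b : B} {b' : E}
    (c : F.functor.obj p ⟶ ⟨a, b⟩) (d : K.functor.obj b ⟶ b') :
    (F.comp ((id P A).add K)).functor.obj p ⟶ (⟨a, b'⟩ : TSum P A E) :=
  ((id P A).add K).functor.map c ≫ (TSum.inj P (𝟙 a) d : (⟨a, K.functor.obj b⟩ : TSum P A E) ⟶ ⟨a, b'⟩)

/-- Evaluation of `F` followed by `K + 1`. -/
def evR (F : TorsorHom P L (TSum P A B)) (K : TorsorHom P A E) {p : L} {a : A} {b : B} {a' : E}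
    (c : F.functor.obj p ⟶ ⟨a, b⟩) (d : K.functor.obj a ⟶ a') :
    (F.comp (K.add (id P B))).functor.obj p ⟶ (⟨a', b⟩ : TSum P E B) :=
  (K.add (id P B)).functor.map c ≫ (TSum.inj P d (𝟙 b) : (⟨K.functor.obj a, b⟩ : TSum P E B) ⟶ ⟨a', b⟩)

namespace Over

lemma map {F : TorsorHom P L A} (K : TorsorHom P A B) {x : P} {p p' : L} {t t' : A}
    {c : F.functor.obj p ⟶ t} {c' : F.functor.obj p' ⟶ t'} {κ : x ⊙ₗ p ⟶ p'} {χ : x ⊙ₗ t ⟶ t'}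
    (h : F.Over c c' κ χ) : (F.comp K).Over (K.functor.map c) (K.functor.map c') κ (K.tw χ) := by
  have h1 : K.tw (F.tw κ) ≫ K.functor.map c' = x ⊴ₗ K.functor.map c ≫ K.tw χ := by
    rw [← tw_map, h, act_map_tw]
  exact (congrArg (· ≫ K.functor.map c') (comp_tw F K κ)).trans h1

lemma post {F : TorsorHom P L A} {x : P} {p p' : L} {t t' s s' : A}
    {c : F.functor.obj p ⟶ t} {c' : F.functor.obj p' ⟶ t'} {κ : x ⊙ₗ p ⟶ p'} {χ : x ⊙ₗ t ⟶ t'}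
    (h : F.Over c c' κ χ) {d : t ⟶ s} {d' : t' ⟶ s'} {χ' : x ⊙ₗ s ⟶ s'}
    (hd : x ⊴ₗ d ≫ χ' = χ ≫ d') : F.Over (c ≫ d) (c' ≫ d') κ χ' := by
  rw [Over, actionHomRight_comp, Category.assoc, hd, ← Category.assoc, h, Category.assoc]

/-- `evL` changes only the second entry, so a morphism of the first entry passes through unchanged.
The other three lemmas on `evL` and `evR` treat the remaining combinations. -/
lemma evL_twR {F : TorsorHom P L (TSum P A B)} (K : TorsorHom P B E) {x : P} {p p' : L} {a a' : A}
    {b : B} {b' : E} {c : F.functor.obj p ⟶ ⟨a, b⟩} {c' : F.functor.obj p' ⟶ ⟨a', b⟩}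
    {κ : x ⊙ₗ p ⟶ p'} {φ : x ⊙ₗ a ⟶ a'} (h : F.Over c c' κ (TSum.twR φ b))
    (d : K.functor.obj b ⟶ b') :
    (F.comp ((id P A).add K)).Over (F.evL K c d) (F.evL K c' d) κ (TSum.twR φ b') := by
  unfold evL
  refine (h.map ((id P A).add K)).post ?_
  refine (TSum.act_inj_twR (𝟙 a) d φ).trans ?_
  rw [actionHomRight_id, Category.id_comp]
  refine (congrArg (· ≫ _) ((add_tw_twR (id P A) K φ b).trans ?_)).symm
  rw [id_tw]
  rfl

lemma evL_twL {F : TorsorHom P L (TSum P A B)} {K : TorsorHom P B E} {x : P} {p p' : L} {a : A}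
    {b₁ b₂ : B} {b₁' b₂' : E} {c : F.functor.obj p ⟶ ⟨a, b₁⟩} {c' : F.functor.obj p' ⟶ ⟨a, b₂⟩}
    {κ : x ⊙ₗ p ⟶ p'} {φ : x ⊙ₗ b₁ ⟶ b₂} (h : F.Over c c' κ (TSum.twL a φ))
    {d : K.functor.obj b₁ ⟶ b₁'} {d' : K.functor.obj b₂ ⟶ b₂'} {χ : x ⊙ₗ b₁' ⟶ b₂'}
    (hd : K.Over d d' φ χ) :
    (F.comp ((id P A).add K)).Over (F.evL K c d) (F.evL K c' d') κ (TSum.twL a χ) := by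
  unfold evL
  refine (h.map ((id P A).add K)).post ?_
  refine (TSum.act_inj_twL (𝟙 a) d χ).trans ?_
  refine Eq.symm ((congrArg (· ≫ _) (add_tw_twL (id P A) K a φ)).trans ?_)
  refine (TSum.twL_inj _ _ _).trans ?_
  rw [hd]
  exact (((congrArg (_ ≫ ·) (TSum.inj_id _ _)).trans (Category.comp_id _))).symm

lemma evR_twL {F : TorsorHom P L (TSum P A B)} (K : TorsorHom P A E) {x : P} {p p' : L} {a : A}
    {b b' : B} {a' : E} {c : F.functor.obj p ⟶ ⟨a, b⟩} {c' : F.functor.obj p' ⟶ ⟨a, b'⟩}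
    {κ : x ⊙ₗ p ⟶ p'} {φ : x ⊙ₗ b ⟶ b'} (h : F.Over c c' κ (TSum.twL a φ))
    (d : K.functor.obj a ⟶ a') :
    (F.comp (K.add (id P B))).Over (F.evR K c d) (F.evR K c' d) κ (TSum.twL a' φ) := by
  unfold evR
  refine (h.map (K.add (id P B))).post ?_
  refine (TSum.act_inj_twL d (𝟙 b) φ).trans ?_
  rw [actionHomRight_id, Category.id_comp]
  refine (congrArg (· ≫ _) ((add_tw_twL K (id P B) a φ).trans ?_)).symm
  rw [id_tw]
  rfl

lemma evR_twR {F : TorsorHom P L (TSum P A B)} {K : TorsorHom P A E} {x : P} {p p' : L}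
    {a₁ a₂ : A} {b : B} {a₁' a₂' : E} {c : F.functor.obj p ⟶ ⟨a₁, b⟩}
    {c' : F.functor.obj p' ⟶ ⟨a₂, b⟩} {κ : x ⊙ₗ p ⟶ p'} {φ : x ⊙ₗ a₁ ⟶ a₂}
    (h : F.Over c c' κ (TSum.twR φ b)) {d : K.functor.obj a₁ ⟶ a₁'} {d' : K.functor.obj a₂ ⟶ a₂'}
    {χ : x ⊙ₗ a₁' ⟶ a₂'} (hd : K.Over d d' φ χ) :
    (F.comp (K.add (id P B))).Over (F.evR K c d) (F.evR K c' d') κ (TSum.twR χ b) := by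
  unfold evR
  refine (h.map (K.add (id P B))).post ?_
  refine (TSum.act_inj_twR d (𝟙 b) χ).trans ?_
  refine Eq.symm ((congrArg (· ≫ _) (add_tw_twR K (id P B) φ b)).trans ?_)
  refine (TSum.twR_inj _ _ _).trans ?_
  rw [hd]
  exact (((congrArg (_ ≫ ·) (TSum.inj_id _ _)).trans (Category.comp_id _))).symm

lemma ext {F : TorsorHom P L A} [F.functor.Faithful] {x : P} {p p' : L} {t t' : A}
    {c : F.functor.obj p ⟶ t} {c' : F.functor.obj p' ⟶ t'} [Mono c'] {κ κ' : x ⊙ₗ p ⟶ p'}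
    {χ : x ⊙ₗ t ⟶ t'} (h : F.Over c c' κ χ) (h' : F.Over c c' κ' χ) : κ = κ' := by
  have h1 : F.tw κ = F.tw κ' := (cancel_mono c').1 (h.trans h'.symm)
  rw [tw, tw, cancel_epi] at h1
  exact F.functor.map_injective h1

/-- Twisted morphisms over the same `χ` for two sets of evaluations correspond under morphisms that
respect the evaluations. With `F` the equivalence to a triple sum, this gives the naturality of the
associativity isomorphisms. -/
lemma pre {F : TorsorHom P L A} {x : P} {p p' q q' : L} {t t' : A} {c : F.functor.obj p ⟶ t}
    {c' : F.functor.obj p' ⟶ t'} {d : F.functor.obj q ⟶ t} {d' : F.functor.obj q' ⟶ t'}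
    {κ : x ⊙ₗ p ⟶ p'} {κ' : x ⊙ₗ q ⟶ q'} {χ : x ⊙ₗ t ⟶ t'} [F.functor.Faithful] [Mono d']
    {f : p ⟶ q} {f' : p' ⟶ q'} (hf : F.functor.map f ≫ d = c) (hf' : F.functor.map f' ≫ d' = c')
    (h : F.Over c c' κ χ) (h' : F.Over d d' κ' χ) : x ⊴ₗ f ≫ κ' = κ ≫ f' := by
  refine Over.ext (F := F) (c := c) (c' := d') (χ := χ) ?_ ?_
  · rw [Over, ← act_map_tw, Category.assoc, h', ← hf, actionHomRight_comp, Category.assoc]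
  · rw [Over, tw_map, Category.assoc, hf', h]

lemma natural {F G : TorsorHom P L A} {θ : ∀ v, F.functor.obj v ⟶ G.functor.obj v}
    (hθ : Natural F G θ) {x : P} {p p' : L} {t t' : A} {c : G.functor.obj p ⟶ t}
    {c' : G.functor.obj p' ⟶ t'} {κ : x ⊙ₗ p ⟶ p'} {χ : x ⊙ₗ t ⟶ t'} (h : G.Over c c' κ χ) :
    F.Over (θ p ≫ c) (θ p' ≫ c') κ χ := by
  rw [Over, actionHomRight_comp, Category.assoc, ← h, ← Category.assoc, ← hθ.nat κ, Category.assoc]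


end Over

end TorsorHom

end Over

end PicardTorsor

namespace PicardTorsor

/-! ### Products of objects, and their associativity isomorphisms. -/

section Products

variable {G : Type w₂} [Group G]
  {P : Type u} [Category.{v} P] [MonoidalCategory P] [SymmetricCategory P] [PicardGroupoid P]

open TorsorHom

namespace CentralExtension

variable (L : CentralExtension.{u, v, w₁, t₁, w₂} G P)

/-- The product of `v : L g` and `w : L h`. -/
noncomputable def pr {g h k : G} (e : g * h = k) (v : L.torsor g) (w : L.torsor h) : L.torsor k :=
  (L.mul e).functor.inv.obj ⟨v, w⟩

/-- The defining isomorphism of the product. -/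
noncomputable def ct {g h k : G} (e : g * h = k) (v : L.torsor g) (w : L.torsor h) :
    (L.mul e).functor.obj (L.pr e v w) ⟶ (⟨v, w⟩ : TSum P (L.torsor g) (L.torsor h)) :=
  ((L.mul e).counit ⟨v, w⟩).hom

instance {g h k : G} (e : g * h = k) (v : L.torsor g) (w : L.torsor h) : IsIso (L.ct e v w) :=
  inferInstanceAs (IsIso ((L.mul e).counit ⟨v, w⟩).hom)

/-- The product of `v` with a morphism `x + w ⟶ w'`. -/
noncomputable def wl {g h k : G} (e : g * h = k) {x : P} (v : L.torsor g) {w w' : L.torsor h}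
    (φ : x ⊙ₗ w ⟶ w') : x ⊙ₗ L.pr e v w ⟶ L.pr e v w' := (L.mul e).invTw (TSum.twL v φ)

/-- The product of a morphism `x + v ⟶ v'` with `w`. -/
noncomputable def wr {g h k : G} (e : g * h = k) {x : P} {v v' : L.torsor g} (φ : x ⊙ₗ v ⟶ v')
    (w : L.torsor h) : x ⊙ₗ L.pr e v w ⟶ L.pr e v' w := (L.mul e).invTw (TSum.twR φ w)

/-- The product of two morphisms. -/
noncomputable def mp {g h k : G} (e : g * h = k) {v v' : L.torsor g} {w w' : L.torsor h}
    (f : v ⟶ v') (f' : w ⟶ w') : L.pr e v w ⟶ L.pr e v' w' :=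
  (L.mul e).functor.inv.map (TSum.inj P f f')

variable {L}

lemma over_wl {g h k : G} (e : g * h = k) {x : P} (v : L.torsor g) {w w' : L.torsor h}
    (φ : x ⊙ₗ w ⟶ w') : (L.mul e).Over (L.ct e v w) (L.ct e v w') (L.wl e v φ) (TSum.twL v φ) :=
  (L.mul e).tw_invTw _

lemma over_wr {g h k : G} (e : g * h = k) {x : P} {v v' : L.torsor g} (φ : x ⊙ₗ v ⟶ v')
    (w : L.torsor h) : (L.mul e).Over (L.ct e v w) (L.ct e v' w) (L.wr e φ w) (TSum.twR φ w) :=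
  (L.mul e).tw_invTw _

lemma map_mp {g h k : G} (e : g * h = k) {v v' : L.torsor g} {w w' : L.torsor h}
    (f : v ⟶ v') (f' : w ⟶ w') : (L.mul e).functor.map (L.mp e f f') ≫ L.ct e v' w' =
      L.ct e v w ≫ TSum.inj P f f' := (L.mul e).counit_nat _

lemma mp_id {g h k : G} (e : g * h = k) (v : L.torsor g) (w : L.torsor h) :
    L.mp e (𝟙 v) (𝟙 w) = 𝟙 _ :=
  (congrArg (L.mul e).functor.inv.map (TSum.inj_id _ _)).trans ((L.mul e).functor.inv.map_id _)

lemma merge_wl {g h k : G} (e : g * h = k) {x y z : P} (m : x ⊗ y ⟶ z) (v : L.torsor g)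
    {w w' w'' : L.torsor h} {κ : z ⊙ₗ w ⟶ w''} {κ₁ : y ⊙ₗ w ⟶ w'} {κ₂ : x ⊙ₗ w' ⟶ w''}
    (H : merge m w ≫ κ = x ⊴ₗ κ₁ ≫ κ₂) :
    merge m (L.pr e v w) ≫ L.wl e v κ = x ⊴ₗ L.wl e v κ₁ ≫ L.wl e v κ₂ :=
  (L.mul e).inv.merge_tw m (TSum.merge_twL m v H)

lemma merge_wr {g h k : G} (e : g * h = k) {x y z : P} (m : x ⊗ y ⟶ z)
    {v v' v'' : L.torsor g} (w : L.torsor h) {κ : z ⊙ₗ v ⟶ v''} {κ₁ : y ⊙ₗ v ⟶ v'}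
    {κ₂ : x ⊙ₗ v' ⟶ v''} (H : merge m v ≫ κ = x ⊴ₗ κ₁ ≫ κ₂) :
    merge m (L.pr e v w) ≫ L.wr e κ w = x ⊴ₗ L.wr e κ₁ w ≫ L.wr e κ₂ w :=
  (L.mul e).inv.merge_tw m (TSum.merge_twR m w H)

/-- The inverse of `D` is a `1`-morphism and therefore transports the exchange rule of the sum to
products; the preceding rules for `merge` are obtained in the same way. -/
lemma wl_wr_exchange {g h k : G} (e : g * h = k) {x y : P} {v v' : L.torsor g} {w w' : L.torsor h}
    (φ : x ⊙ₗ v ⟶ v') (ψ : y ⊙ₗ w ⟶ w') :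
    x ⊴ₗ L.wl e v ψ ≫ L.wr e φ w' =
      (swap x y (L.pr e v w)).hom ≫ y ⊴ₗ L.wr e φ w ≫ L.wl e v' ψ :=
  (L.mul e).inv.tw_exchange (TSum.twL_twR_exchange φ ψ)

lemma act_mp_wl {g h k : G} (e : g * h = k) {x : P} {v v' : L.torsor g} {w w' w'' : L.torsor h}
    (f : v ⟶ v') (f' : w ⟶ w') (φ : x ⊙ₗ w' ⟶ w'') :
    x ⊴ₗ L.mp e f f' ≫ L.wl e v' φ = L.wl e v (x ⊴ₗ f' ≫ φ) ≫ L.mp e f (𝟙 w'') :=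
  ((L.mul e).inv.act_map_tw _ _).trans ((congrArg (L.mul e).inv.tw (TSum.act_inj_twL f f' φ)).trans
    ((L.mul e).inv.tw_map _ _))

lemma act_mp_wr {g h k : G} (e : g * h = k) {x : P} {v v' v'' : L.torsor g} {w w' : L.torsor h}
    (f : v ⟶ v') (f' : w ⟶ w') (φ : x ⊙ₗ v' ⟶ v'') :
    x ⊴ₗ L.mp e f f' ≫ L.wr e φ w' = L.wr e (x ⊴ₗ f ≫ φ) w ≫ L.mp e (𝟙 v'') f' :=
  ((L.mul e).inv.act_map_tw _ _).trans ((congrArg (L.mul e).inv.tw (TSum.act_inj_twR f f' φ)).trans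
    ((L.mul e).inv.tw_map _ _))

lemma wl_mp {g h k : G} (e : g * h = k) {x : P} (v : L.torsor g) {w w' w'' : L.torsor h}
    (φ : x ⊙ₗ w ⟶ w') (f : w' ⟶ w'') : L.wl e v φ ≫ L.mp e (𝟙 v) f = L.wl e v (φ ≫ f) :=
  ((L.mul e).inv.tw_map _ _).symm.trans (congrArg (L.mul e).inv.tw (TSum.twL_inj v φ f))

lemma wr_mp {g h k : G} (e : g * h = k) {x : P} {v v' v'' : L.torsor g} (φ : x ⊙ₗ v ⟶ v')
    (w : L.torsor h) (f : v' ⟶ v'') : L.wr e φ w ≫ L.mp e f (𝟙 w) = L.wr e (φ ≫ f) w :=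
  ((L.mul e).inv.tw_map _ _).symm.trans (congrArg (L.mul e).inv.tw (TSum.twR_inj φ w f))

variable (L)

/-- The evaluation of the product `v * (w * u)`. -/
noncomputable def ctL {a b c bc abc : G} (e₂ : b * c = bc) (e₄ : a * bc = abc) (v : L.torsor a)
    (w : L.torsor b) (u : L.torsor c) :
    ((L.mul e₄).comp ((L.one a).add (L.mul e₂))).functor.obj (L.pr e₄ v (L.pr e₂ w u)) ⟶
      (⟨v, ⟨w, u⟩⟩ : TSum P (L.torsor a) (TSum P (L.torsor b) (L.torsor c))) :=
  (L.mul e₄).evL (L.mul e₂) (L.ct e₄ v (L.pr e₂ w u)) (L.ct e₂ w u)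

/-- The evaluation of the product `(v * w) * u`. -/
noncomputable def ctR {a b c ab abc : G} (e₁ : a * b = ab) (e₃ : ab * c = abc) (v : L.torsor a)
    (w : L.torsor b) (u : L.torsor c) :
    (((L.mul e₃).comp ((L.mul e₁).add (L.one c))).comp (L.asc a b c)).functor.obj
      (L.pr e₃ (L.pr e₁ v w) u) ⟶
      (⟨v, ⟨w, u⟩⟩ : TSum P (L.torsor a) (TSum P (L.torsor b) (L.torsor c))) :=
  (L.asc a b c).functor.map ((L.mul e₃).evR (L.mul e₁) (L.ct e₃ (L.pr e₁ v w) u) (L.ct e₁ v w))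

instance {a b c bc abc : G} (e₂ : b * c = bc) (e₄ : a * bc = abc) (v : L.torsor a)
    (w : L.torsor b) (u : L.torsor c) : IsIso (L.ctL e₂ e₄ v w u) := by
  have := IsTorsor.isGroupoid P (TSum P (L.torsor a) (TSum P (L.torsor b) (L.torsor c)))
  infer_instance

variable {L}

/-- The required morphism is prescribed by its image in `L a + (L b + L c)`, where the two products
are evaluated and compared by the associativity `2`-isomorphism. -/
lemma exists_ass {a b c ab bc abc : G} (e₁ : a * b = ab) (e₂ : b * c = bc) (e₃ : ab * c = abc)
    (e₄ : a * bc = abc) (v : L.torsor a) (w : L.torsor b) (u : L.torsor c) :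
    ∃ α : L.pr e₃ (L.pr e₁ v w) u ⟶ L.pr e₄ v (L.pr e₂ w u),
      ((L.mul e₄).comp ((L.one a).add (L.mul e₂))).functor.map α ≫ L.ctL e₂ e₄ v w u =
        (L.assocApp e₁ e₂ e₃ e₄ _).inv ≫ L.ctR e₁ e₃ v w u := by
  have := ((L.mul e₄).comp ((L.one a).add (L.mul e₂))).isEquivalence
  obtain ⟨α, hα⟩ := ((L.mul e₄).comp ((L.one a).add (L.mul e₂))).functor.map_surjective
    (((L.assocApp e₁ e₂ e₃ e₄ _).inv ≫ L.ctR e₁ e₃ v w u) ≫ CategoryTheory.inv (L.ctL e₂ e₄ v w u))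
  exact ⟨α, by rw [hα, Category.assoc, IsIso.inv_hom_id, Category.comp_id]; rfl⟩

variable (L)

/-- The associativity isomorphism `(v * w) * u ⟶ v * (w * u)`. -/
noncomputable def ass {a b c ab bc abc : G} (e₁ : a * b = ab) (e₂ : b * c = bc) (e₃ : ab * c = abc)
    (e₄ : a * bc = abc) (v : L.torsor a) (w : L.torsor b) (u : L.torsor c) :
    L.pr e₃ (L.pr e₁ v w) u ⟶ L.pr e₄ v (L.pr e₂ w u) := (exists_ass e₁ e₂ e₃ e₄ v w u).choose

lemma map_ass {a b c ab bc abc : G} (e₁ : a * b = ab) (e₂ : b * c = bc) (e₃ : ab * c = abc)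
    (e₄ : a * bc = abc) (v : L.torsor a) (w : L.torsor b) (u : L.torsor c) :
    ((L.mul e₄).comp ((L.one a).add (L.mul e₂))).functor.map (L.ass e₁ e₂ e₃ e₄ v w u) ≫
        L.ctL e₂ e₄ v w u = (L.assocApp e₁ e₂ e₃ e₄ _).inv ≫ L.ctR e₁ e₃ v w u :=
  (exists_ass e₁ e₂ e₃ e₄ v w u).choose_spec

variable {L}

section

variable {a b c ab bc abc : G} (e₁ : a * b = ab) (e₂ : b * c = bc) (e₃ : ab * c = abc)
  (e₄ : a * bc = abc)

/-- In `L a + (L b + L c)` both products evaluate to the same triple and both twisted morphisms to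
the same generator, so `Over.pre` applies. The other two entries are treated alike. -/
lemma ass_nat₁ {x : P} {v v' : L.torsor a} (φ : x ⊙ₗ v ⟶ v') (w : L.torsor b) (u : L.torsor c) :
    x ⊴ₗ L.ass e₁ e₂ e₃ e₄ v w u ≫ L.wr e₄ φ (L.pr e₂ w u) =
      L.wr e₃ (L.wr e₁ φ w) u ≫ L.ass e₁ e₂ e₃ e₄ v' w u := by
  have := ((L.mul e₄).comp ((L.one a).add (L.mul e₂))).isEquivalence
  have h := ((over_wr e₃ (L.wr e₁ φ w) u).evR_twR (over_wr e₁ φ w)).map (L.asc a b c)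
  rw [asc_tw_twR_twR] at h
  exact Over.pre (L.map_ass e₁ e₂ e₃ e₄ v w u) (L.map_ass e₁ e₂ e₃ e₄ v' w u)
    (h.natural (Natural.of_iso₂_inv (L.mulAssoc e₁ e₂ e₃ e₄)))
    ((over_wr e₄ φ (L.pr e₂ w u)).evL_twR _ _)

lemma ass_nat₂ {x : P} (v : L.torsor a) {w w' : L.torsor b} (φ : x ⊙ₗ w ⟶ w') (u : L.torsor c) :
    x ⊴ₗ L.ass e₁ e₂ e₃ e₄ v w u ≫ L.wl e₄ v (L.wr e₂ φ u) =
      L.wr e₃ (L.wl e₁ v φ) u ≫ L.ass e₁ e₂ e₃ e₄ v w' u := by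
  have := ((L.mul e₄).comp ((L.one a).add (L.mul e₂))).isEquivalence
  have h := ((over_wr e₃ (L.wl e₁ v φ) u).evR_twR (over_wl e₁ v φ)).map (L.asc a b c)
  rw [asc_tw_twR_twL] at h
  exact Over.pre (L.map_ass e₁ e₂ e₃ e₄ v w u) (L.map_ass e₁ e₂ e₃ e₄ v w' u)
    (h.natural (Natural.of_iso₂_inv (L.mulAssoc e₁ e₂ e₃ e₄)))
    ((over_wl e₄ v (L.wr e₂ φ u)).evL_twL (over_wr e₂ φ u))

lemma ass_nat₃ {x : P} (v : L.torsor a) (w : L.torsor b) {u u' : L.torsor c} (φ : x ⊙ₗ u ⟶ u') :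
    x ⊴ₗ L.ass e₁ e₂ e₃ e₄ v w u ≫ L.wl e₄ v (L.wl e₂ w φ) =
      L.wl e₃ (L.pr e₁ v w) φ ≫ L.ass e₁ e₂ e₃ e₄ v w u' := by
  have := ((L.mul e₄).comp ((L.one a).add (L.mul e₂))).isEquivalence
  have h := ((over_wl e₃ (L.pr e₁ v w) φ).evR_twL (L.mul e₁) (L.ct e₁ v w)).map (L.asc a b c)
  have h2 : (L.asc a b c).tw (TSum.twL (⟨v, w⟩ : TSum P (L.torsor a) (L.torsor b)) φ) = _ :=
    asc_tw_twL v w φ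
  rw [h2] at h
  exact Over.pre (L.map_ass e₁ e₂ e₃ e₄ v w u) (L.map_ass e₁ e₂ e₃ e₄ v w u')
    (h.natural (Natural.of_iso₂_inv (L.mulAssoc e₁ e₂ e₃ e₄)))
    ((over_wl e₄ v (L.wl e₂ w φ)).evL_twL (over_wl e₂ w φ))

end

end CentralExtension

end Products

end PicardTorsor

namespace PicardTorsor

/-! ### The exchange `sig` of two factors, and its effect inside a product. -/

section Hexagon

lemma TorsorHom.map_heq {P : Type u} [Category.{v} P] [MonoidalCategory P]
    {L : Type w₁} [Category.{t₁} L] [MonoidalLeftAction P L]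
    {M : Type w₂} [Category.{t₂} M] [MonoidalLeftAction P M] {F F' : TorsorHom P L M} (h : F = F')
    {v w : L} (f : v ⟶ w) : F.functor.map f ≍ F'.functor.map f := by rw [h]

lemma TorsorHom.Over.map_eq {P : Type u} [Category.{v} P] [MonoidalCategory P]
    [SymmetricCategory P] {L : Type w₁} [Category.{t₁} L] [MonoidalLeftAction P L]
    {M : Type w₂} [Category.{t₂} M] [MonoidalLeftAction P M] {F : TorsorHom P L M} {x : P} {p p' : L}
    {t t' : M} {c : F.functor.obj p ⟶ t} {c' : F.functor.obj p' ⟶ t'} {κ : x ⊙ₗ p ⟶ p'}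
    {χ : x ⊙ₗ t ⟶ t'} (h : F.Over c c' κ χ) :
    F.functor.map κ ≫ c' = (F.lin x p).hom ≫ x ⊴ₗ c ≫ χ := by
  rw [← h, ← Category.assoc, lin_tw]

lemma map_comp_eq {L : Type w₁} [Category.{t₁} L] {M : Type w₂} [Category.{t₂} M] (F : L ⥤ M)
    {a b c : L} {t : M} {f : a ⟶ b} {g : b ⟶ c} {m : F.obj c ⟶ t} {n : F.obj b ⟶ t}
    (h : F.map g ≫ m = n) : F.map (f ≫ g) ≫ m = F.map f ≫ n := by
  rw [F.map_comp, Category.assoc, h]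

lemma map_injective_of_comp {L : Type w₁} [Category.{t₁} L] {M : Type w₂} [Category.{t₂} M]
    (F : L ⥤ M) [F.Faithful] {a b : L} {t : M} {f g : a ⟶ b} (m : F.obj b ⟶ t) [IsIso m]
    (h : F.map f ≫ m = F.map g ≫ m) : f = g :=
  F.map_injective ((cancel_mono m).1 h)

lemma exists_map_comp_eq {L : Type w₁} [Category.{t₁} L] {M : Type w₂} [Category.{t₂} M]
    (F : L ⥤ M) [F.Full] {a b : L} {t : M} (m : F.obj b ⟶ t) [IsIso m] (n : F.obj a ⟶ t) :
    ∃ f : a ⟶ b, F.map f ≫ m = n := by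
  obtain ⟨f, hf⟩ := F.map_surjective (n ≫ CategoryTheory.inv m)
  exact ⟨f, by rw [hf, Category.assoc, IsIso.inv_hom_id, Category.comp_id]⟩

variable {G : Type w₂} [Group G]
  {P : Type u} [Category.{v} P] [MonoidalCategory P] [SymmetricCategory P] [PicardGroupoid P]
  {L : CentralExtension.{u, v, w₁, t₁, w₂} G P}

open TorsorHom

namespace CentralExtension.Commutator

variable (C : L.Commutator)

/-- The functor of `D` is full, and after evaluation of the products the `2`-isomorphism of the
commutator prescribes the image. -/
lemma exists_sig {g h k : G} (e : g * h = k) (e' : h * g = k) (v : L.torsor g) (w : L.torsor h) :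
    ∃ σ : C.obj g h (e.trans e'.symm) ⊙ₗ L.pr e v w ⟶ L.pr e' w v,
      (L.mul e').functor.map σ ≫ L.ct e' w v =
        (C.app e e' (L.pr e v w)).hom ≫ (L.com g h).functor.map (L.ct e v w) :=
  exists_map_comp_eq (L.mul e').functor (L.ct e' w v) _

/-- The isomorphism `C (g, h) + v * w ⟶ w * v`. -/
noncomputable def sig {g h k : G} (e : g * h = k) (e' : h * g = k) (v : L.torsor g)
    (w : L.torsor h) : C.obj g h (e.trans e'.symm) ⊙ₗ L.pr e v w ⟶ L.pr e' w v :=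
  (C.exists_sig e e' v w).choose

lemma map_sig {g h k : G} (e : g * h = k) (e' : h * g = k) (v : L.torsor g) (w : L.torsor h) :
    (L.mul e').functor.map (C.sig e e' v w) ≫ L.ct e' w v =
      (C.app e e' (L.pr e v w)).hom ≫ (L.com g h).functor.map (L.ct e v w) :=
  (C.exists_sig e e' v w).choose_spec

lemma sig_nat {g h k : G} (e : g * h = k) (e' : h * g = k) {v v' : L.torsor g} {w w' : L.torsor h}
    (f : v ⟶ v') (f' : w ⟶ w') :
    C.obj g h (e.trans e'.symm) ⊴ₗ L.mp e f f' ≫ C.sig e e' v' w' =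
      C.sig e e' v w ≫ L.mp e' f' f := by
  have h1 : (L.mul e').functor.map (C.obj g h (e.trans e'.symm) ⊴ₗ L.mp e f f') ≫
      (C.app e e' (L.pr e v' w')).hom = (C.app e e' (L.pr e v w)).hom ≫
        (L.com g h).functor.map ((L.mul e).functor.map (L.mp e f f')) :=
    (C.app_natural e e').map_eq (L.mp e f f')
  have h2 : (L.com g h).functor.map ((L.mul e).functor.map (L.mp e f f')) ≫
      (L.com g h).functor.map (L.ct e v' w') =
        (L.com g h).functor.map (L.ct e v w) ≫ TSum.inj P f' f :=
    ((Functor.map_comp _ _ _).symm.trans (congrArg _ (map_mp e f f'))).trans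
      ((Functor.map_comp _ _ _).trans (congrArg (_ ≫ ·) (comm_map_inj _ _)))
  refine map_injective_of_comp (L.mul e').functor (L.ct e' w' v') ?_
  refine (map_comp_eq _ (C.map_sig e e' v' w')).trans ?_
  refine Eq.trans ?_ (map_comp_eq _ (map_mp e' f' f)).symm
  refine (Category.assoc _ _ _).symm.trans ((congrArg (· ≫ _) h1).trans ?_)
  refine Eq.trans ?_ (Category.assoc _ _ _)
  refine Eq.trans ?_ (congrArg (· ≫ _) (C.map_sig e e' v w).symm)
  refine (Category.assoc _ _ _).trans (Eq.trans ?_ (Category.assoc _ _ _).symm)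
  exact congrArg (_ ≫ ·) h2

variable {a b c ab ac bc abc : G} (ab_eq : a * b = ab) (ac_eq : a * c = ac) (ca_eq : c * a = ac)
    (bc_eq : b * c = bc) (cb_eq : c * b = bc) (ab_c : ab * c = abc)
    (c_ab : c * ab = abc) (a_bc : a * bc = abc) (ac_b : ac * b = abc)

/-- The effect on a product of applying the commutator to the first factor. -/
lemma map_wr_sig (v : L.torsor a) (w : L.torsor b) (u : L.torsor c) :
    letI y := C.obj a c (ac_eq.trans ca_eq.symm)
    ((L.mul ac_b).comp ((L.mul ca_eq).add (L.one b))).functor.map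
        (L.wr ac_b (C.sig ac_eq ca_eq v u) w) ≫
      (L.mul ac_b).evR (L.mul ca_eq) (L.ct ac_b (L.pr ca_eq u v) w) (L.ct ca_eq u v) =
    ((L.mul ca_eq).add (L.one b)).functor.map ((L.mul ac_b).lin y (L.pr ac_b (L.pr ac_eq v u) w)).hom ≫
      TSum.inj P (C.app ac_eq ca_eq ((L.mul ac_b).functor.obj (L.pr ac_b (L.pr ac_eq v u) w)).fst).hom
        (𝟙 ((L.mul ac_b).functor.obj (L.pr ac_b (L.pr ac_eq v u) w)).snd) ≫
      ((L.com a c).add (L.one b)).functor.map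
        ((L.mul ac_b).evR (L.mul ac_eq) (L.ct ac_b (L.pr ac_eq v u) w) (L.ct ac_eq v u)) := by
  set y := C.obj a c (ac_eq.trans ca_eq.symm)
  have h1 := (over_wr ac_b (C.sig ac_eq ca_eq v u) w).map_eq
  have h2 : TSum.inj P ((L.mul ca_eq).functor.map (C.sig ac_eq ca_eq v u) ≫ L.ct ca_eq u v) (𝟙 w) =
      TSum.inj P (C.app ac_eq ca_eq (L.pr ac_eq v u)).hom (𝟙 w) ≫
        TSum.inj P ((L.com a c).functor.map (L.ct ac_eq v u)) (𝟙 w) := by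
    rw [map_sig]
    exact (TSum.inj_comp_id _ _ _).symm
  have h3 : ((L.mul ca_eq).add (L.one b)).functor.map (y ⊴ₗ L.ct ac_b (L.pr ac_eq v u) w) ≫
      TSum.inj P (C.app ac_eq ca_eq (L.pr ac_eq v u)).hom (𝟙 w) =
      TSum.inj P (C.app ac_eq ca_eq ((L.mul ac_b).functor.obj (L.pr ac_b (L.pr ac_eq v u) w)).fst).hom
        (𝟙 ((L.mul ac_b).functor.obj (L.pr ac_b (L.pr ac_eq v u) w)).snd) ≫
      ((L.com a c).add (L.one b)).functor.map
        (((L.mul ac_eq).add (L.one b)).functor.map (L.ct ac_b (L.pr ac_eq v u) w)) := by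
    -- The evaluation of the outer product is moved past the commutator by naturality. The two
    -- strict equalities that follow identify `(F + 1)` and `(G + 1)` in succession with their
    -- composite plus `1`.
    have h := ((C.app_natural ac_eq ca_eq).add (Natural.id (L.one b))).map_eq
      (L.ct ac_b (L.pr ac_eq v u) w)
    have e1 := agree_add_id_comp (M := L.torsor b) (translation y) (L.mul ca_eq)
    have e2 := agree_add_id_comp (M := L.torsor b) (L.mul ac_eq) (L.com a c)
    have e3 := agree_translation_add (L := L.torsor ac) (M := L.torsor b) y
    have e4 : (((translation y).comp (L.mul ca_eq)).add (L.one b)) =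
        (translation y).comp ((L.mul ca_eq).add (L.one b)) := by rw [← e1.eq, e3.eq]
    have k1 := eq_of_heq (map_heq e4 (L.ct ac_b (L.pr ac_eq v u) w))
    have k2 := eq_of_heq (map_heq e2.eq (L.ct ac_b (L.pr ac_eq v u) w))
    exact ((congrArg (· ≫ TSum.inj P (C.app ac_eq ca_eq (L.pr ac_eq v u)).hom (𝟙 w)) k1.symm).trans
      h).trans (congrArg (TSum.inj P (C.app ac_eq ca_eq _).hom (𝟙 _) ≫ ·) k2.symm)
  have h4 : ((L.mul ca_eq).add (L.one b)).functor.map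
        (TSum.twR (C.sig ac_eq ca_eq v u) w) ≫
        (TSum.inj P (L.ct ca_eq u v) (𝟙 w) : (⟨_, w⟩ : TSum P _ _) ⟶ ⟨_, w⟩) =
      TSum.inj P (C.app ac_eq ca_eq (L.pr ac_eq v u)).hom (𝟙 w) ≫
        ((L.com a c).add (L.one b)).functor.map (TSum.inj P (L.ct ac_eq v u) (𝟙 w)) := by
    refine (congrArg (· ≫ _) (add_map_inj _ _ _ _)).trans ((TSum.inj_comp _ _ _ _).trans ?_)
    refine Eq.trans ?_ (h2.trans (congrArg (_ ≫ ·)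
      (add_map_inj (L.com a c) (L.one b) (L.ct ac_eq v u) (𝟙 w)).symm))
    exact congrArg (TSum.inj P _) (Category.id_comp (𝟙 w))
  have h5 : ((L.mul ca_eq).add (L.one b)).functor.map (y ⊴ₗ L.ct ac_b (L.pr ac_eq v u) w ≫
      TSum.twR (C.sig ac_eq ca_eq v u) w) ≫
        (TSum.inj P (L.ct ca_eq u v) (𝟙 w) : (⟨_, w⟩ : TSum P _ _) ⟶ ⟨_, w⟩) =
      TSum.inj P (C.app ac_eq ca_eq ((L.mul ac_b).functor.obj (L.pr ac_b (L.pr ac_eq v u) w)).fst).hom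
        (𝟙 ((L.mul ac_b).functor.obj (L.pr ac_b (L.pr ac_eq v u) w)).snd) ≫
      ((L.com a c).add (L.one b)).functor.map
        ((L.mul ac_b).evR (L.mul ac_eq) (L.ct ac_b (L.pr ac_eq v u) w) (L.ct ac_eq v u)) := by
    refine (map_comp_eq _ h4).trans ?_
    refine (Category.assoc _ _ _).symm.trans ((congrArg (· ≫ _) h3).trans ?_)
    exact (Category.assoc _ _ _).trans (congrArg (_ ≫ ·) (Functor.map_comp _ _ _).symm)
  refine (Category.assoc _ _ _).symm.trans ?_
  refine (congrArg (· ≫ _) ((Functor.map_comp _ _ _).symm.trans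
    (congrArg ((L.mul ca_eq).add (L.one b)).functor.map h1))).trans ?_
  exact map_comp_eq _ h5

/-- The effect on a product of applying the commutator to the second factor. -/
lemma map_wl_sig (v : L.torsor a) (w : L.torsor b) (u : L.torsor c) :
    letI z := C.obj b c (bc_eq.trans cb_eq.symm)
    letI X := (L.mul a_bc).functor.obj (L.pr a_bc v (L.pr bc_eq w u))
    ((L.mul a_bc).comp ((L.one a).add (L.mul cb_eq))).functor.map
        (L.wl a_bc v (C.sig bc_eq cb_eq w u)) ≫ L.ctL cb_eq a_bc v u w =
    ((L.one a).add (L.mul cb_eq)).functor.map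
        (((L.mul a_bc).lin z (L.pr a_bc v (L.pr bc_eq w u))).hom ≫ TSum.slide z X.fst X.snd) ≫
      TSum.inj P (𝟙 X.fst) (C.app bc_eq cb_eq X.snd).hom ≫
      ((L.one a).add (L.com b c)).functor.map (L.ctL bc_eq a_bc v w u) := by
  set z := C.obj b c (bc_eq.trans cb_eq.symm)
  have h1 := (over_wl a_bc v (C.sig bc_eq cb_eq w u)).map_eq
  have h2 : ((L.one a).add (L.mul cb_eq)).functor.map
        (TSum.inj P (𝟙 v) (C.sig bc_eq cb_eq w u)) ≫
        (TSum.inj P (𝟙 v) (L.ct cb_eq u w) : (⟨v, _⟩ : TSum P _ _) ⟶ ⟨v, _⟩) =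
      TSum.inj P (𝟙 v) (C.app bc_eq cb_eq (L.pr bc_eq w u)).hom ≫
        ((L.one a).add (L.com b c)).functor.map (TSum.inj P (𝟙 v) (L.ct bc_eq w u)) := by
    refine (congrArg (· ≫ _) (add_map_inj _ _ _ _)).trans ((TSum.inj_comp _ _ _ _).trans ?_)
    refine Eq.trans ?_ (congrArg (_ ≫ ·)
      (add_map_inj (L.one a) (L.com b c) (𝟙 v) (L.ct bc_eq w u)).symm)
    refine Eq.trans ?_ (TSum.inj_comp _ _ _ _).symm
    refine congrArg₂ (TSum.inj P) rfl ?_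
    exact C.map_sig bc_eq cb_eq w u
  have h3 : ((L.one a).add (L.mul cb_eq)).functor.map
        (((L.one a).add (translation z)).functor.map (L.ct a_bc v (L.pr bc_eq w u))) ≫
      TSum.inj P (𝟙 v) (C.app bc_eq cb_eq (L.pr bc_eq w u)).hom =
      TSum.inj P (𝟙 ((L.mul a_bc).functor.obj (L.pr a_bc v (L.pr bc_eq w u))).fst)
        (C.app bc_eq cb_eq ((L.mul a_bc).functor.obj (L.pr a_bc v (L.pr bc_eq w u))).snd).hom ≫
      ((L.one a).add (L.com b c)).functor.map
        (((L.one a).add (L.mul bc_eq)).functor.map (L.ct a_bc v (L.pr bc_eq w u))) := by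
    have h := ((Natural.id (L.one a)).add (C.app_natural bc_eq cb_eq)).map_eq
      (L.ct a_bc v (L.pr bc_eq w u))
    have e1 := agree_id_add_comp (M := L.torsor a) (translation z) (L.mul cb_eq)
    have e2 := agree_id_add_comp (M := L.torsor a) (L.mul bc_eq) (L.com b c)
    have k1 := eq_of_heq (map_heq e1.eq (L.ct a_bc v (L.pr bc_eq w u)))
    have k2 := eq_of_heq (map_heq e2.eq (L.ct a_bc v (L.pr bc_eq w u)))
    exact ((congrArg (· ≫ TSum.inj P (𝟙 v) (C.app bc_eq cb_eq (L.pr bc_eq w u)).hom) k1).trans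
      h).trans (congrArg (TSum.inj P (𝟙 _) (C.app bc_eq cb_eq _).hom ≫ ·) k2.symm)
  have h4 : z ⊴ₗ L.ct a_bc v (L.pr bc_eq w u) ≫ TSum.twL v (C.sig bc_eq cb_eq w u) =
      TSum.slide z ((L.mul a_bc).functor.obj (L.pr a_bc v (L.pr bc_eq w u))).fst
          ((L.mul a_bc).functor.obj (L.pr a_bc v (L.pr bc_eq w u))).snd ≫
        ((L.one a).add (translation z)).functor.map (L.ct a_bc v (L.pr bc_eq w u)) ≫
          TSum.inj P (𝟙 v) (C.sig bc_eq cb_eq w u) := by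
    rw [TSum.twL_eq]
    refine (Category.assoc _ _ _).symm.trans (Eq.trans ?_ (Category.assoc _ _ _))
    exact congrArg (· ≫ TSum.inj P (𝟙 v) (C.sig bc_eq cb_eq w u))
      ((Natural.slide z).map_eq (L.ct a_bc v (L.pr bc_eq w u)))
  have h5 : ((L.one a).add (L.mul cb_eq)).functor.map
        (((L.one a).add (translation z)).functor.map (L.ct a_bc v (L.pr bc_eq w u)) ≫
          TSum.inj P (𝟙 v) (C.sig bc_eq cb_eq w u)) ≫
        (TSum.inj P (𝟙 v) (L.ct cb_eq u w) : (⟨v, _⟩ : TSum P _ _) ⟶ ⟨v, _⟩) =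
      TSum.inj P (𝟙 ((L.mul a_bc).functor.obj (L.pr a_bc v (L.pr bc_eq w u))).fst)
        (C.app bc_eq cb_eq ((L.mul a_bc).functor.obj (L.pr a_bc v (L.pr bc_eq w u))).snd).hom ≫
      ((L.one a).add (L.com b c)).functor.map (L.ctL bc_eq a_bc v w u) := by
    refine (map_comp_eq _ h2).trans ?_
    refine (Category.assoc _ _ _).symm.trans ((congrArg (· ≫ _) h3).trans ?_)
    exact (Category.assoc _ _ _).trans (congrArg (_ ≫ ·) (Functor.map_comp _ _ _).symm)
  refine (Category.assoc _ _ _).symm.trans ?_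
  refine (congrArg (· ≫ _) ((Functor.map_comp _ _ _).symm.trans
    (congrArg ((L.one a).add (L.mul cb_eq)).functor.map
      (h1.trans ((congrArg (_ ≫ ·) h4).trans (Category.assoc _ _ _).symm))))).trans ?_
  exact map_comp_eq _ h5

end CentralExtension.Commutator

end Hexagon

end PicardTorsor

namespace PicardTorsor

/-! ### The first hexagon for products. -/

section HexagonLeft

variable {G : Type w₂} [Group G]
  {P : Type u} [Category.{v} P] [MonoidalCategory P] [SymmetricCategory P] [PicardGroupoid P]
  {L : CentralExtension.{u, v, w₁, t₁, w₂} G P}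

open TorsorHom

/-- The bare diagram of the proof of `merge_sig_left`: the equation `h` for `k` is extended by `F₁`,
the evaluation of the target, and its right hand side is rewritten from the end. -/
lemma hexagon_chase {K : Type w₁} [Category.{t₁} K] {o₁ o₂ o₃ o₄ o₅ o₆ o₇ o₈ o₉ o₁₀ : K}
    {A : o₁ ⟶ o₂} {B : o₂ ⟶ o₃} {D : o₃ ⟶ o₄} {E : o₄ ⟶ o₅} {a : o₁ ⟶ o₆} {b : o₆ ⟶ o₇}
    {c : o₇ ⟶ o₈} {d : o₈ ⟶ o₉} {e : o₉ ⟶ o₅} (h : A ≫ B ≫ D ≫ E = a ≫ b ≫ c ≫ d ≫ e)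
    {F₁ : o₅ ⟶ o₁₀} {K₁ : o₄ ⟶ o₁₀} {R₁ : o₇ ⟶ o₁₀} {R₂ : o₈ ⟶ o₁₀} (h₁ : K₁ = E ≫ F₁)
    (h₂ : R₁ = c ≫ R₂) (h₃ : R₂ = d ≫ e ≫ F₁) : A ≫ B ≫ D ≫ K₁ = (a ≫ b) ≫ R₁ := by
  subst h₁ h₂ h₃
  simpa using congrArg (· ≫ F₁) h

namespace CentralExtension

section

variable {a b c ab bc abc : G} (e₁ : a * b = ab) (e₂ : b * c = bc) (e₃ : ab * c = abc)
    (e₄ : a * bc = abc)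

lemma assocApp_nat {x y : L.torsor abc} (f : x ⟶ y) :
    (((L.mul e₃).comp ((L.mul e₁).add (L.one c))).comp (L.asc a b c)).functor.map f ≫
      (L.assocApp e₁ e₂ e₃ e₄ y).hom = (L.assocApp e₁ e₂ e₃ e₄ x).hom ≫
        ((L.mul e₄).comp ((L.one a).add (L.mul e₂))).functor.map f :=
  (L.mulAssoc e₁ e₂ e₃ e₄).iso.hom.naturality f

/-- This absorbs an associativity `2`-isomorphism of the extension into the evaluation of a product,
where it becomes `ass`. -/
lemma map_ctR {x : L.torsor abc} (v : L.torsor a) (w : L.torsor b) (u : L.torsor c)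
    (f : x ⟶ L.pr e₃ (L.pr e₁ v w) u) :
    (((L.mul e₃).comp ((L.mul e₁).add (L.one c))).comp (L.asc a b c)).functor.map f ≫
        L.ctR e₁ e₃ v w u =
      (L.assocApp e₁ e₂ e₃ e₄ x).hom ≫ ((L.mul e₄).comp ((L.one a).add (L.mul e₂))).functor.map
        (f ≫ L.ass e₁ e₂ e₃ e₄ v w u) ≫ L.ctL e₂ e₄ v w u := by
  have h1 := map_comp_eq _ (L.map_ass e₁ e₂ e₃ e₄ v w u) (f := f)
  have h2 := assocApp_nat e₁ e₂ e₃ e₄ f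
  refine Eq.trans ?_ (congrArg (_ ≫ ·) h1).symm
  refine Eq.trans ?_ (Category.assoc _ _ _)
  refine Eq.trans ?_ (congrArg (· ≫ _) h2)
  refine (Category.assoc _ _ _).trans ?_ |>.symm
  exact congrArg (_ ≫ ·) (Iso.hom_inv_id_assoc _ _)

end

namespace Commutator

variable (C : L.Commutator)
variable {a b c ab ac bc abc : G} (ab_eq : a * b = ab) (ac_eq : a * c = ac) (ca_eq : c * a = ac)
    (bc_eq : b * c = bc) (cb_eq : c * b = bc) (ab_c : ab * c = abc)
    (c_ab : c * ab = abc) (a_bc : a * bc = abc) (ac_b : ac * b = abc)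

/-- In the triple sum, exchanging `v * w` with `u` is the commutation of `L (a * b)` past `L c`. The
naturality of `C` and the hexagon express it by the commutations of `L b` and `L a` past `L c`. -/
lemma map_sig_left (v : L.torsor a) (w : L.torsor b) (u : L.torsor c) :
    ((L.mul c_ab).comp ((L.one c).add (L.mul ab_eq))).functor.map
        (C.sig ab_c c_ab (L.pr ab_eq v w) u) ≫ L.ctL ab_eq c_ab u v w =
      ((L.one c).add (L.mul ab_eq)).functor.map
        (C.app ab_c c_ab (L.pr ab_c (L.pr ab_eq v w) u)).hom ≫
      (((L.one a).add (L.com b c)).comp (permLeft L a b c)).functor.map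
        (L.ctR ab_eq ab_c v w u) := by
  have h1 := C.map_sig ab_c c_ab (L.pr ab_eq v w) u
  have h2 : ((L.one c).add (L.mul ab_eq)).functor.map ((L.com ab c).functor.map
      (L.ct ab_c (L.pr ab_eq v w) u)) ≫
        (TSum.inj P (𝟙 u) (L.ct ab_eq v w) : (⟨u, _⟩ : TSum P _ _) ⟶ ⟨u, _⟩) =
      (((L.one a).add (L.com b c)).comp (permLeft L a b c)).functor.map
        (L.ctR ab_eq ab_c v w u) := by
    have e1 := (agree_comm (L.mul ab_eq) (L.one c)).eq
    have e2 := (agree_hexagon_left (P := P) (L := L.torsor a) (M := L.torsor b)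
      (N := L.torsor c)).eq
    have k1 := eq_of_heq (map_heq e1 (L.ct ab_c (L.pr ab_eq v w) u))
    have k2 := eq_of_heq (map_heq e2
      ((L.mul ab_c).evR (L.mul ab_eq) (L.ct ab_c (L.pr ab_eq v w) u) (L.ct ab_eq v w)))
    refine Eq.trans ?_ k2.symm
    have k3 := (PicardTorsor.comm P (TSum P (L.torsor a) (L.torsor b)) (L.torsor c)).functor.map_comp
      (((L.mul ab_eq).add (L.one c)).functor.map (L.ct ab_c (L.pr ab_eq v w) u))
      (TSum.inj P (L.ct ab_eq v w) (𝟙 u) : (⟨_, u⟩ : TSum P _ _) ⟶ ⟨_, u⟩)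
    refine Eq.trans ?_ k3.symm
    refine Eq.trans (congrArg (_ ≫ ·) (comm_map_inj (L.ct ab_eq v w) (𝟙 u)).symm) ?_
    exact congrArg (· ≫ _) k1.symm
  refine (Category.assoc _ _ _).symm.trans ?_
  refine (congrArg (· ≫ _) ((Functor.map_comp _ _ _).symm.trans
    (congrArg ((L.one c).add (L.mul ab_eq)).functor.map h1))).trans ?_
  exact map_comp_eq _ h2

/-- The case of `f` an identity is `map_wr_sig`. A general `f` is moved past the commutator by
naturality, so that it remains available for the next associativity step. -/
lemma map_act_wr_sig {q : L.torsor abc} (v : L.torsor a) (w : L.torsor b) (u : L.torsor c)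
    (f : q ⟶ L.pr ac_b (L.pr ac_eq v u) w) :
    letI y := C.obj a c (ac_eq.trans ca_eq.symm)
    (((L.mul ac_b).comp ((L.mul ca_eq).add (L.one b))).comp (L.asc c a b)).functor.map
      (y ⊴ₗ f ≫ L.wr ac_b (C.sig ac_eq ca_eq v u) w) ≫ L.ctR ca_eq ac_b u v w =
    ((((L.mul ca_eq).add (L.one b)).comp (L.asc c a b)).functor.map ((L.mul ac_b).lin y q).hom ≫
      (L.asc c a b).functor.map
        (TSum.inj P (C.app ac_eq ca_eq ((L.mul ac_b).functor.obj q).fst).hom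
          (𝟙 ((L.mul ac_b).functor.obj q).snd))) ≫
      (permLeft L a b c).functor.map
        ((((L.mul ac_b).comp ((L.mul ac_eq).add (L.one b))).comp (L.asc a c b)).functor.map f ≫
          L.ctR ac_eq ac_b v u w) := by
  set y := C.obj a c (ac_eq.trans ca_eq.symm)
  have h1 := (Natural.lin (L.mul ac_b) y).map (((L.mul ca_eq).add (L.one b)).comp (L.asc c a b))
  have h2 := (((C.app_natural ac_eq ca_eq).add (Natural.id (L.one b))).pre (L.mul ac_b)).map
    (L.asc c a b)
  have e2 : ((L.mul ac_b).comp (((translation y).comp (L.mul ca_eq)).add (L.one b))).comp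
      (L.asc c a b) = ((L.mul ac_b).comp (translation y)).comp
        (((L.mul ca_eq).add (L.one b)).comp (L.asc c a b)) := by
    have h := (agree_add_id_comp (M := L.torsor b) (translation y) (L.mul ca_eq)).eq
    rw [← h, (agree_translation_add y).eq]
    simp only [comp_assoc]
  have e0 : ((L.com a c).add (L.one b)).comp (L.asc c a b) =
      (L.asc a c b).comp (permLeft L a b c) :=
    (agree_hexagon_left_comm (P := P) (L := L.torsor a) (M := L.torsor c)
      (N := L.torsor b)).eq.symm
  have e3 : ((L.mul ac_b).comp (((L.mul ac_eq).comp (L.com a c)).add (L.one b))).comp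
      (L.asc c a b) = (((L.mul ac_b).comp ((L.mul ac_eq).add (L.one b))).comp
      (L.asc a c b)).comp (permLeft L a b c) := by
    have h := (agree_add_id_comp (M := L.torsor b) (L.mul ac_eq) (L.com a c)).eq
    rw [← h]
    simp only [comp_assoc]
    rw [e0]
  have N := (h1.comp (h2.of_eq e2 e3 (fun _ => HEq.rfl))).map_eq f
  have h3 := (L.asc c a b).functor.congr_map (C.map_wr_sig ac_eq ca_eq ac_b v w u)
  have k := eq_of_heq (map_heq e0 ((L.mul ac_b).evR (L.mul ac_eq)
    (L.ct ac_b (L.pr ac_eq v u) w) (L.ct ac_eq v u)))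
  have h4 : (((L.mul ac_b).comp ((L.mul ca_eq).add (L.one b))).comp (L.asc c a b)).functor.map
      (L.wr ac_b (C.sig ac_eq ca_eq v u) w) ≫ L.ctR ca_eq ac_b u v w =
    ((((L.mul ca_eq).add (L.one b)).comp (L.asc c a b)).functor.map
        ((L.mul ac_b).lin y (L.pr ac_b (L.pr ac_eq v u) w)).hom ≫
      (L.asc c a b).functor.map
        (TSum.inj P (C.app ac_eq ca_eq ((L.mul ac_b).functor.obj _).fst).hom
          (𝟙 ((L.mul ac_b).functor.obj _).snd))) ≫
      (permLeft L a b c).functor.map (L.ctR ac_eq ac_b v u w) := by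
    refine ((L.asc c a b).functor.map_comp _ _).symm.trans (h3.trans ?_)
    refine ((L.asc c a b).functor.map_comp _ _).trans ?_
    refine Eq.trans (congrArg (_ ≫ ·) ((L.asc c a b).functor.map_comp _ _)) ?_
    refine Eq.trans (Category.assoc _ _ _).symm (congrArg (_ ≫ ·) k)
  refine (map_comp_eq _ h4).trans ?_
  refine (Category.assoc _ _ _).symm.trans ((congrArg (· ≫ _) N).trans ?_)
  exact (Category.assoc _ _ _).trans (congrArg (_ ≫ ·) ((permLeft L a b c).functor.map_comp
    ((((L.mul ac_b).comp ((L.mul ac_eq).add (L.one b))).comp (L.asc a c b)).functor.map f)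
    (L.ctR ac_eq ac_b v u w)).symm)

lemma map_act_wl_sig {q : L.torsor abc} (v : L.torsor a) (w : L.torsor b) (u : L.torsor c)
    (f : q ⟶ L.pr a_bc v (L.pr bc_eq w u)) :
    letI z := C.obj b c (bc_eq.trans cb_eq.symm)
    ((L.mul a_bc).comp ((L.one a).add (L.mul cb_eq))).functor.map
      (z ⊴ₗ f ≫ L.wl a_bc v (C.sig bc_eq cb_eq w u)) ≫ L.ctL cb_eq a_bc v u w =
    (((L.one a).add (L.mul cb_eq)).functor.map
        (((L.mul a_bc).lin z q).hom ≫
          TSum.slide z ((L.mul a_bc).functor.obj q).fst ((L.mul a_bc).functor.obj q).snd) ≫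
      TSum.inj P (𝟙 ((L.mul a_bc).functor.obj q).fst)
        (C.app bc_eq cb_eq ((L.mul a_bc).functor.obj q).snd).hom) ≫
      ((L.one a).add (L.com b c)).functor.map
        (((L.mul a_bc).comp ((L.one a).add (L.mul bc_eq))).functor.map f ≫
          L.ctL bc_eq a_bc v w u) := by
  set z := C.obj b c (bc_eq.trans cb_eq.symm)
  have h4 := ((Natural.lin (L.mul a_bc) z).comp ((Natural.slide z).pre (L.mul a_bc))).map
    ((L.one a).add (L.mul cb_eq))
  have h5 := ((Natural.id (L.one a)).add (C.app_natural bc_eq cb_eq)).pre (L.mul a_bc)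
  have e5 : (L.mul a_bc).comp ((L.one a).add ((translation z).comp (L.mul cb_eq))) =
      ((L.mul a_bc).comp ((L.one a).add (translation z))).comp ((L.one a).add (L.mul cb_eq)) := by
    have h := (agree_id_add_comp (M := L.torsor a) (translation z) (L.mul cb_eq)).eq
    rw [← h]
    simp only [comp_assoc]
  have e6 : (L.mul a_bc).comp ((L.one a).add ((L.mul bc_eq).comp (L.com b c))) =
      ((L.mul a_bc).comp ((L.one a).add (L.mul bc_eq))).comp ((L.one a).add (L.com b c)) := by
    have h := (agree_id_add_comp (M := L.torsor a) (L.mul bc_eq) (L.com b c)).eq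
    rw [← h]
    simp only [comp_assoc]
  have N := (h4.comp (h5.of_eq e5 e6 (fun _ => HEq.rfl))).map_eq f
  refine (map_comp_eq _ (C.map_wl_sig bc_eq cb_eq a_bc v w u)).trans ?_
  refine (congrArg (_ ≫ ·) (Category.assoc _ _ _).symm).trans ?_
  refine (Category.assoc _ _ _).symm.trans ((congrArg (· ≫ _) N).trans ?_)
  exact (Category.assoc _ _ _).trans (congrArg (_ ≫ ·)
    (((L.one a).add (L.com b c)).functor.map_comp
      (((L.mul a_bc).comp ((L.one a).add (L.mul bc_eq))).functor.map f)
      (L.ctL bc_eq a_bc v w u)).symm)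

/-- The hexagon that expresses `σ (v * w, u)` by `σ (w, u)` and `σ (v, u)`. -/
lemma merge_sig_left (v : L.torsor a) (w : L.torsor b) (u : L.torsor c)
    {k : C.obj a c (ac_eq.trans ca_eq.symm) ⊗ C.obj b c (bc_eq.trans cb_eq.symm) ⟶
      C.obj ab c (ab_c.trans c_ab.symm)}
    (hk : C.MulLeftEq ab_eq ac_eq ca_eq bc_eq cb_eq ab_c c_ab a_bc ac_b k
      (L.pr ab_c (L.pr ab_eq v w) u))
    (f : C.obj b c (bc_eq.trans cb_eq.symm) ⊙ₗ L.pr ab_c (L.pr ab_eq v w) u ⟶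
      L.pr ac_b (L.pr ac_eq v u) w)
    (hf : f ≫ L.ass ac_eq cb_eq ac_b a_bc v u w =
      C.obj b c (bc_eq.trans cb_eq.symm) ⊴ₗ L.ass ab_eq bc_eq ab_c a_bc v w u ≫
        L.wl a_bc v (C.sig bc_eq cb_eq w u)) :
    merge k (L.pr ab_c (L.pr ab_eq v w) u) ≫ C.sig ab_c c_ab (L.pr ab_eq v w) u =
      (C.obj a c (ac_eq.trans ca_eq.symm) ⊴ₗ f ≫ L.wr ac_b (C.sig ac_eq ca_eq v u) w) ≫
        L.ass ca_eq ab_eq ac_b c_ab u v w := by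
  have := ((L.mul c_ab).comp ((L.one c).add (L.mul ab_eq))).isEquivalence
  refine map_injective_of_comp ((L.mul c_ab).comp ((L.one c).add (L.mul ab_eq))).functor
    (L.ctL ab_eq c_ab u v w) ?_
  refine (map_comp_eq _ (C.map_sig_left ab_eq ab_c c_ab v w u)).trans ?_
  -- With this factor in front, the left hand side begins like the equation satisfied by `k`, and
  -- the right hand side has the form of `map_ctR`.
  refine (cancel_epi (L.assocApp ca_eq ab_eq ac_b c_ab _).hom).1 ?_
  refine Eq.trans ?_ (map_ctR ca_eq ab_eq ac_b c_ab u v w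
    (C.obj a c (ac_eq.trans ca_eq.symm) ⊴ₗ f ≫ L.wr ac_b (C.sig ac_eq ca_eq v u) w))
  refine Eq.trans ?_ (C.map_act_wr_sig ac_eq ca_eq ac_b v w u f).symm
  refine hexagon_chase hk (F₁ := (((L.one a).add (L.com b c)).comp (permLeft L a b c)).functor.map
    (((L.mul a_bc).comp ((L.one a).add (L.mul bc_eq))).functor.map
      (L.ass ab_eq bc_eq ab_c a_bc v w u) ≫ L.ctL bc_eq a_bc v w u))
    (R₂ := (permLeft L a b c).functor.map
      (((L.mul a_bc).comp ((L.one a).add (L.mul cb_eq))).functor.map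
        (f ≫ L.ass ac_eq cb_eq ac_b a_bc v u w) ≫ L.ctL cb_eq a_bc v u w)) ?_ ?_ ?_
  · refine Eq.trans ?_ ((((L.one a).add (L.com b c)).comp (permLeft L a b c)).functor.map_comp
      (L.assocApp ab_eq bc_eq ab_c a_bc (L.pr ab_c (L.pr ab_eq v w) u)).hom
      (((L.mul a_bc).comp ((L.one a).add (L.mul bc_eq))).functor.map
        (L.ass ab_eq bc_eq ab_c a_bc v w u) ≫ L.ctL bc_eq a_bc v w u))
    refine congrArg (((L.one a).add (L.com b c)).comp (permLeft L a b c)).functor.map ?_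
    exact ((Iso.eq_inv_comp _).1 (L.map_ass ab_eq bc_eq ab_c a_bc v w u)).symm
  · exact (congrArg (permLeft L a b c).functor.map
      (map_ctR ac_eq cb_eq ac_b a_bc v u w f)).trans ((permLeft L a b c).functor.map_comp _ _)
  · rw [hf]
    refine (congrArg (permLeft L a b c).functor.map
      (C.map_act_wl_sig bc_eq cb_eq a_bc v w u (L.ass ab_eq bc_eq ab_c a_bc v w u))).trans ?_
    refine ((permLeft L a b c).functor.map_comp _ _).trans ?_
    refine (congrArg (· ≫ _) ((permLeft L a b c).functor.map_comp _ _)).trans ?_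
    exact Category.assoc _ _ _

end Commutator

end CentralExtension

end HexagonLeft

end PicardTorsor

namespace PicardTorsor

/-! ### The second hexagon for products. -/

section HexagonRight

variable {G : Type w₂} [Group G]
  {P : Type u} [Category.{v} P] [MonoidalCategory P] [SymmetricCategory P] [PicardGroupoid P]
  {L : CentralExtension.{u, v, w₁, t₁, w₂} G P}

open TorsorHom

lemma TorsorHom.agree_id_add_id {L : Type w₁} [Category.{t₁} L] [MonoidalLeftAction P L]
    [IsTorsor P L] {M : Type w₂} [Category.{t₂} M] [MonoidalLeftAction P M] [IsTorsor P M] :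
    ((TorsorHom.id P L).add (TorsorHom.id P M)).Agree (TorsorHom.id P (TSum P L M)) :=
  .of_sum (fun _ => rfl)
    (fun φ w => (Sends.add_twR (TorsorHom.id P M) (Sends.of_id φ) w).heq_tw (Sends.of_id _))
    (fun v _ _ φ => (Sends.add_twL (TorsorHom.id P L) v (Sends.of_id φ)).heq_tw (Sends.of_id _))

lemma hexagon_chase' {K : Type w₁} [Category.{t₁} K] {o₁ o₂ o₃ o₄ o₅ o₆ o₇ o₈ o₁₀ : K}
    {B : o₁ ⟶ o₂} {D : o₂ ⟶ o₃} {A : o₁ ⟶ o₄} {a : o₄ ⟶ o₅} {b : o₅ ⟶ o₆}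
    {c : o₆ ⟶ o₇} {d : o₇ ⟶ o₈} {e : o₈ ⟶ o₃} (h : B ≫ D = A ≫ a ≫ b ≫ c ≫ d ≫ e)
    {F₁ : o₃ ⟶ o₁₀} {R₁ : o₆ ⟶ o₁₀} {R₂ : o₇ ⟶ o₁₀} {R₃ : o₈ ⟶ o₁₀} {R : o₄ ⟶ o₁₀}
    (h₀ : R = (a ≫ b) ≫ R₁) (h₁ : R₁ = c ≫ R₂) (h₂ : R₂ = d ≫ R₃) (h₃ : R₃ = e ≫ F₁) :
    B ≫ D ≫ F₁ = A ≫ R := by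
  subst h₀ h₁ h₂ h₃
  simpa using congrArg (· ≫ F₁) h

namespace CentralExtension.Commutator

variable (C : L.Commutator)
variable {a b c ab ac bc abc : G} (ab_eq : a * b = ab) (ba_eq : b * a = ab) (ac_eq : a * c = ac)
    (ca_eq : c * a = ac) (bc_eq : b * c = bc) (ab_c : ab * c = abc) (a_bc : a * bc = abc)
    (bc_a : bc * a = abc) (b_ac : b * ac = abc)

/-- `permLeft` ends with the commutation of `L c` and `L a`, and this cancels against its inverse.
It lets the calculation for the first hexagon be reused for the second. -/
lemma permLeft_comp (L : CentralExtension.{u, v, w₁, t₁, w₂} G P) (a b c : G) :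
    (permLeft L a c b).comp ((L.one b).add (L.com a c)) = permRight L a b c := by
  rw [permLeft, permRight, comp_assoc _ ((L.one b).add (L.com c a)),
    (agree_id_add_comp (M := L.torsor b) (L.com c a) (L.com a c)).eq,
    (agree_comm_comm (P := P) (L := L.torsor c) (M := L.torsor a)).eq,
    (agree_id_add_id (P := P)).eq, comp_id]

/-- Naturality of `C` in its second summand is sufficient here: `permRight` is the commutation past
the whole of `L b + L c`, followed by `A`. -/
lemma map_sig_right (v : L.torsor a) (w : L.torsor b) (u : L.torsor c) :
    (((L.mul bc_a).comp ((L.mul bc_eq).add (L.one a))).comp (L.asc b c a)).functor.map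
        (C.sig a_bc bc_a v (L.pr bc_eq w u)) ≫ L.ctR bc_eq bc_a w u v =
      (((L.mul bc_eq).add (L.one a)).comp (L.asc b c a)).functor.map
        (C.app a_bc bc_a (L.pr a_bc v (L.pr bc_eq w u))).hom ≫
      (permRight L a b c).functor.map (L.ctL bc_eq a_bc v w u) := by
  have h1 := C.map_sig a_bc bc_a v (L.pr bc_eq w u)
  have h2 : ((L.mul bc_eq).add (L.one a)).functor.map ((L.com a bc).functor.map
      (L.ct a_bc v (L.pr bc_eq w u))) ≫
        (TSum.inj P (L.ct bc_eq w u) (𝟙 v) : (⟨_, v⟩ : TSum P _ _) ⟶ ⟨_, v⟩) =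
      (PicardTorsor.comm P (L.torsor a) (TSum P (L.torsor b) (L.torsor c))).functor.map
        (L.ctL bc_eq a_bc v w u) := by
    have e1 := (agree_comm (L.one a) (L.mul bc_eq)).eq
    have k1 := eq_of_heq (map_heq e1 (L.ct a_bc v (L.pr bc_eq w u)))
    have k3 := (PicardTorsor.comm P (L.torsor a) (TSum P (L.torsor b) (L.torsor c))).functor.map_comp
      (((L.one a).add (L.mul bc_eq)).functor.map (L.ct a_bc v (L.pr bc_eq w u)))
      (TSum.inj P (𝟙 v) (L.ct bc_eq w u) : (⟨v, _⟩ : TSum P _ _) ⟶ ⟨v, _⟩)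
    refine Eq.trans ?_ k3.symm
    refine Eq.trans (congrArg (_ ≫ ·) (comm_map_inj (𝟙 v) (L.ct bc_eq w u)).symm) ?_
    exact congrArg (· ≫ _) k1.symm
  have h3 : ((L.mul bc_a).comp ((L.mul bc_eq).add (L.one a))).functor.map
        (C.sig a_bc bc_a v (L.pr bc_eq w u)) ≫
          (L.mul bc_a).evR (L.mul bc_eq) (L.ct bc_a (L.pr bc_eq w u) v) (L.ct bc_eq w u) =
      ((L.mul bc_eq).add (L.one a)).functor.map
        (C.app a_bc bc_a (L.pr a_bc v (L.pr bc_eq w u))).hom ≫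
      (PicardTorsor.comm P (L.torsor a) (TSum P (L.torsor b) (L.torsor c))).functor.map
        (L.ctL bc_eq a_bc v w u) := by
    refine (Category.assoc _ _ _).symm.trans ?_
    refine (congrArg (· ≫ _) ((Functor.map_comp _ _ _).symm.trans
      (congrArg ((L.mul bc_eq).add (L.one a)).functor.map h1))).trans ?_
    exact map_comp_eq _ h2
  refine ((L.asc b c a).functor.map_comp _ _).symm.trans ?_
  exact (congrArg (L.asc b c a).functor.map h3).trans ((L.asc b c a).functor.map_comp _ _)

/-- The hexagon that expresses `σ (v, w * u)` by `σ (v, w)` and `σ (v, u)`. -/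
lemma merge_sig_right (v : L.torsor a) (w : L.torsor b) (u : L.torsor c)
    {k : C.obj a c (ac_eq.trans ca_eq.symm) ⊗ C.obj a b (ab_eq.trans ba_eq.symm) ⟶
      C.obj a bc (a_bc.trans bc_a.symm)}
    (hk : C.MulRightEq ab_eq ba_eq ac_eq ca_eq bc_eq ab_c a_bc bc_a b_ac k
      (L.pr a_bc v (L.pr bc_eq w u)))
    (f : L.pr a_bc v (L.pr bc_eq w u) ⟶ L.pr ab_c (L.pr ab_eq v w) u)
    (hf : f ≫ L.ass ab_eq bc_eq ab_c a_bc v w u = 𝟙 _) :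
    (merge k (L.pr a_bc v (L.pr bc_eq w u)) ≫ C.sig a_bc bc_a v (L.pr bc_eq w u)) ≫
        L.ass bc_eq ca_eq bc_a b_ac w u v =
      C.obj a c (ac_eq.trans ca_eq.symm) ⊴ₗ
          ((C.obj a b (ab_eq.trans ba_eq.symm) ⊴ₗ f ≫ L.wr ab_c (C.sig ab_eq ba_eq v w) u) ≫
            L.ass ba_eq ac_eq ab_c b_ac w v u) ≫
        L.wl b_ac w (C.sig ac_eq ca_eq v u) := by
  have := ((L.mul b_ac).comp ((L.one b).add (L.mul ca_eq))).isEquivalence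
  refine map_injective_of_comp ((L.mul b_ac).comp ((L.one b).add (L.mul ca_eq))).functor
    (L.ctL ca_eq b_ac w u v) ?_
  refine (cancel_epi (L.assocApp bc_eq ca_eq bc_a b_ac _).hom).1 ?_
  refine (map_ctR bc_eq ca_eq bc_a b_ac w u v (merge k (L.pr a_bc v (L.pr bc_eq w u)) ≫
    C.sig a_bc bc_a v (L.pr bc_eq w u))).symm.trans ?_
  refine (map_comp_eq _ (C.map_sig_right bc_eq a_bc bc_a v w u)).trans ?_
  refine hexagon_chase' hk (R₁ := ((L.one b).add (L.com a c)).functor.map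
      (((L.mul b_ac).comp ((L.one b).add (L.mul ac_eq))).functor.map
        ((C.obj a b (ab_eq.trans ba_eq.symm) ⊴ₗ f ≫ L.wr ab_c (C.sig ab_eq ba_eq v w) u) ≫
          L.ass ba_eq ac_eq ab_c b_ac w v u) ≫ L.ctL ac_eq b_ac w v u))
    (R₂ := ((L.one b).add (L.com a c)).functor.map
      ((((L.mul ab_c).comp ((L.mul ba_eq).add (L.one c))).comp (L.asc b a c)).functor.map
        (C.obj a b (ab_eq.trans ba_eq.symm) ⊴ₗ f ≫ L.wr ab_c (C.sig ab_eq ba_eq v w) u) ≫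
        L.ctR ba_eq ab_c w v u))
    (R₃ := (permRight L a b c).functor.map
      ((((L.mul ab_c).comp ((L.mul ab_eq).add (L.one c))).comp (L.asc a b c)).functor.map f ≫
        L.ctR ab_eq ab_c v w u)) ?_ ?_ ?_ ?_
  · exact C.map_act_wl_sig ac_eq ca_eq b_ac w v u _
  · refine Eq.trans ?_ (((L.one b).add (L.com a c)).functor.map_comp
      (L.assocApp ba_eq ac_eq ab_c b_ac _).inv
      ((((L.mul ab_c).comp ((L.mul ba_eq).add (L.one c))).comp (L.asc b a c)).functor.map
        (C.obj a b (ab_eq.trans ba_eq.symm) ⊴ₗ f ≫ L.wr ab_c (C.sig ab_eq ba_eq v w) u) ≫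
        L.ctR ba_eq ab_c w v u))
    refine congrArg ((L.one b).add (L.com a c)).functor.map ?_
    exact (Iso.eq_inv_comp _).2 (map_ctR ba_eq ac_eq ab_c b_ac w v u _).symm
  · have h1 := C.map_act_wr_sig ab_eq ba_eq ab_c v u w f
    have k := eq_of_heq (map_heq (permLeft_comp L a b c)
      ((((L.mul ab_c).comp ((L.mul ab_eq).add (L.one c))).comp (L.asc a b c)).functor.map f ≫
        L.ctR ab_eq ab_c v w u))
    refine (congrArg ((L.one b).add (L.com a c)).functor.map h1).trans ?_
    refine (((L.one b).add (L.com a c)).functor.map_comp _ _).trans ?_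
    refine (congrArg (_ ≫ ·) k).trans (congrArg (· ≫ _) ?_)
    refine congrArg ((L.one b).add (L.com a c)).functor.map ?_
    exact ((L.asc b a c).functor.map_comp _ _).symm
  · refine (congrArg (permRight L a b c).functor.map
      (map_ctR ab_eq bc_eq ab_c a_bc v w u f)).trans ?_
    rw [hf]
    refine Eq.trans ?_ ((permRight L a b c).functor.map_comp _ _)
    refine congrArg (permRight L a b c).functor.map ?_
    exact congrArg (_ ≫ ·) ((congrArg (· ≫ _) (CategoryTheory.Functor.map_id _ _)).trans (Category.id_comp _))

end CentralExtension.Commutator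

end HexagonRight

end PicardTorsor

namespace PicardTorsor

/-! ### Evaluation of iterated products. -/

section Presentations

variable {P : Type u} [Category.{v} P] [MonoidalCategory P] [SymmetricCategory P] [PicardGroupoid P]
  {L : Type w₁} [Category.{t₁} L] [MonoidalLeftAction P L] [IsTorsor P L]
  {M : Type w₂} [Category.{t₂} M] [MonoidalLeftAction P M] [IsTorsor P M]
  {N : Type w₃} [Category.{t₃} N] [MonoidalLeftAction P N] [IsTorsor P N]
  {K : Type w₄} [Category.{t₄} K] [MonoidalLeftAction P K] [IsTorsor P K]
  {K' : Type w₅} [Category.{t₅} K'] [MonoidalLeftAction P K'] [IsTorsor P K']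

/-- The morphism `(v, w) ⟶ (v, w')` induced by `w ⟶ w'`. -/
abbrev TSum.injL (v : L) {w w' : M} (e : w ⟶ w') : (⟨v, w⟩ : TSum P L M) ⟶ ⟨v, w'⟩ :=
  TSum.inj P (𝟙 v) e

/-- The morphism `(v, w) ⟶ (v', w)` induced by `v ⟶ v'`. -/
abbrev TSum.injR {v v' : L} (d : v ⟶ v') (w : M) : (⟨v, w⟩ : TSum P L M) ⟶ ⟨v', w⟩ :=
  TSum.inj P d (𝟙 w)

namespace TorsorHom

lemma evR_pre (F : TorsorHom P K (TSum P L M)) (H : TorsorHom P L N) {q p : K} {v : L} {w : M}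
    {v' : N} (f : q ⟶ p) (c : F.functor.obj p ⟶ ⟨v, w⟩) (d : H.functor.obj v ⟶ v') :
    (F.comp (H.add (TorsorHom.id P M))).functor.map f ≫ F.evR H c d =
      F.evR H (F.functor.map f ≫ c) d :=
  (map_comp_eq (H.add (TorsorHom.id P M)).functor rfl).symm

lemma evL_pre (F : TorsorHom P K (TSum P L M)) (H : TorsorHom P M N) {q p : K} {v : L} {w : M}
    {w' : N} (f : q ⟶ p) (c : F.functor.obj p ⟶ ⟨v, w⟩) (d : H.functor.obj w ⟶ w') :
    (F.comp ((TorsorHom.id P L).add H)).functor.map f ≫ F.evL H c d =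
      F.evL H (F.functor.map f ≫ c) d :=
  (map_comp_eq ((TorsorHom.id P L).add H).functor rfl).symm

lemma add_map_injL (F : TorsorHom P L K) (H : TorsorHom P M N) (v : L) {w w' : M} (e : w ⟶ w') :
    (F.add H).functor.map (TSum.injL v e) = TSum.injL (F.functor.obj v) (H.functor.map e) :=
  (add_map_inj _ _ _ _).trans (congrArg (TSum.inj P · _) (F.functor.map_id v))

lemma add_map_injR (F : TorsorHom P L K) (H : TorsorHom P M N) {v v' : L} (d : v ⟶ v') (w : M) :
    (F.add H).functor.map (TSum.injR d w) = TSum.injR (F.functor.map d) (H.functor.obj w) :=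
  (add_map_inj _ _ _ _).trans (congrArg (TSum.inj P _) (H.functor.map_id w))

lemma _root_.PicardTorsor.TSum.injL_comp (v : L) {w w' w'' : M} (e : w ⟶ w') (e' : w' ⟶ w'') :
    (TSum.injL v e : (⟨v, w⟩ : TSum P L M) ⟶ _) ≫ TSum.injL v e' = TSum.injL v (e ≫ e') :=
  (TSum.inj_comp _ _ _ _).trans (congrArg (TSum.inj P · _) (Category.comp_id (𝟙 v)))

lemma _root_.PicardTorsor.TSum.injR_comp {v v' v'' : L} (d : v ⟶ v') (d' : v' ⟶ v'') (w : M) :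
    (TSum.injR d w : (⟨v, w⟩ : TSum P L M) ⟶ _) ≫ TSum.injR d' w = TSum.injR (d ≫ d') w :=
  (TSum.inj_comp _ _ _ _).trans (congrArg (TSum.inj P _) (Category.comp_id (𝟙 w)))

/-- Naturality of `A` in its first summand, the identities of the other two being combined to the
identity of their sum. -/
lemma asc_map_first (F : TorsorHom P L K) {x y : TSum P (TSum P L M) N} (f : x ⟶ y) :
    (F.add (TorsorHom.id P (TSum P M N))).functor.map ((assoc P L M N).functor.map f) =
      (assoc P K M N).functor.map (((F.add (TorsorHom.id P M)).add (TorsorHom.id P N)).functor.map f) := by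
  have h := (agree_assoc F (TorsorHom.id P M) (TorsorHom.id P N)).eq
  rw [agree_id_add_id.eq] at h
  exact (eq_of_heq (map_heq h f)).symm

lemma asc_map_second (F : TorsorHom P M K) {x y : TSum P (TSum P L M) N} (f : x ⟶ y) :
    ((TorsorHom.id P L).add (F.add (TorsorHom.id P N))).functor.map ((assoc P L M N).functor.map f) =
      (assoc P L K N).functor.map (((TorsorHom.id P L).add F).add (TorsorHom.id P N) |>.functor.map f) :=
  (eq_of_heq (map_heq (agree_assoc (TorsorHom.id P L) F (TorsorHom.id P N)).eq f)).symm

lemma asc_map_third (F : TorsorHom P N K) {x y : TSum P (TSum P L M) N} (f : x ⟶ y) :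
    ((TorsorHom.id P L).add ((TorsorHom.id P M).add F)).functor.map ((assoc P L M N).functor.map f) =
      (assoc P L M K).functor.map (((TorsorHom.id P (TSum P L M)).add F).functor.map f) := by
  have h := (agree_assoc (TorsorHom.id P L) (TorsorHom.id P M) F).eq
  rw [agree_id_add_id.eq] at h
  exact (eq_of_heq (map_heq h f)).symm

/-- Both orders of evaluation are evaluations of `F + G`. -/
lemma ev_exchange (F : TorsorHom P L K) (G : TorsorHom P M K') {x : TSum P L M} {v : L} {w : M}
    (c : x ⟶ ⟨v, w⟩) {v' : K} {w' : K'} (d : F.functor.obj v ⟶ v') (e : G.functor.obj w ⟶ w') :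
    ((TorsorHom.id P K).add G).functor.map ((F.add (TorsorHom.id P M)).functor.map c ≫
        TSum.injR d w) ≫ TSum.injL v' e =
    (F.add (TorsorHom.id P K')).functor.map (((TorsorHom.id P L).add G).functor.map c ≫
        TSum.injL v e) ≫ TSum.injR d w' := by
  have h : ((F.add (TorsorHom.id P M)).comp ((TorsorHom.id P K).add G)).functor.map c =
      (((TorsorHom.id P L).add G).comp (F.add (TorsorHom.id P K'))).functor.map c :=
    eq_of_heq (map_heq ((agree_add_left F G).eq.trans (agree_add_right F G).eq.symm) c)
  have h1 : ((TorsorHom.id P K).add G).functor.map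
      (TSum.injR d w) ≫ TSum.injL v' e = TSum.inj P d e :=
    (congrArg (· ≫ _) (add_map_injR _ _ _ _)).trans ((TSum.inj_comp _ _ _ _).trans
      (congrArg₂ (TSum.inj P) (Category.comp_id d) (Category.id_comp e)))
  have h2 : (F.add (TorsorHom.id P K')).functor.map
      (TSum.injL v e) ≫ TSum.injR d w' = TSum.inj P d e :=
    (congrArg (· ≫ _) (add_map_injL _ _ _ _)).trans ((TSum.inj_comp _ _ _ _).trans
      (congrArg₂ (TSum.inj P) (Category.id_comp d) (Category.comp_id e)))
  refine (map_comp_eq _ h1).trans ((congrArg (· ≫ _) h).trans ?_)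
  exact (map_comp_eq (F.add (TorsorHom.id P K')).functor h2).symm

end TorsorHom

end Presentations

/-! ### The pentagon for the associativity isomorphisms of products. -/

section Pentagon

lemma comp_map_comp_comp {A : Type w₁} [Category.{t₁} A] {B : Type w₂} [Category.{t₂} B] (F : A ⥤ B)
    {x y z y' : A} {r : B} (p : x ⟶ y) (m : y ⟶ z) (e : z ⟶ y') (i : F.obj y' ⟶ r) :
    F.map p ≫ F.map m ≫ F.map e ≫ i = F.map (p ≫ m ≫ e) ≫ i := by
  simp

lemma map_comp_map_comp {A : Type w₁} [Category.{t₁} A] {B : Type w₂} [Category.{t₂} B]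
    {E : Type w₃} [Category.{t₃} E] (F : A ⥤ B) (H : B ⥤ E) {x y z : A} {r : B}
    (p : x ⟶ y) (m : y ⟶ z) (i : F.obj z ⟶ r) :
    H.map (F.map p) ≫ H.map (F.map m ≫ i) = H.map (F.map (p ≫ m) ≫ i) := by
  simp

variable {G : Type w₂} [Group G]
  {P : Type u} [Category.{v} P] [MonoidalCategory P] [SymmetricCategory P] [PicardGroupoid P]
  {L : CentralExtension.{u, v, w₁, t₁, w₂} G P}

open TorsorHom

namespace CentralExtension

variable {a b c d ab bc cd abc bcd abcd : G} (ab_eq : a * b = ab) (bc_eq : b * c = bc)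
    (cd_eq : c * d = cd) (ab_c : ab * c = abc) (a_bc : a * bc = abc) (bc_d : bc * d = bcd)
    (b_cd : b * cd = bcd) (abc_d : abc * d = abcd) (a_bcd : a * bcd = abcd) (ab_cd : ab * cd = abcd)

variable (v : L.torsor a) (w : L.torsor b) (u : L.torsor c) (t : L.torsor d)

/-- The evaluation of `((v * w) * u) * t`. -/
noncomputable def ctRR : (((L.mul abc_d).comp ((L.mul ab_c).add (L.one d))).comp
    (((L.mul ab_eq).add (L.one c)).add (L.one d))).functor.obj
      (L.pr abc_d (L.pr ab_c (L.pr ab_eq v w) u) t) ⟶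
        (⟨⟨⟨v, w⟩, u⟩, t⟩ : TSum P (TSum P (TSum P (L.torsor a) (L.torsor b)) (L.torsor c))
          (L.torsor d)) :=
  (((L.mul ab_eq).add (L.one c)).add (L.one d)).functor.map
      ((L.mul abc_d).evR (L.mul ab_c) (L.ct abc_d (L.pr ab_c (L.pr ab_eq v w) u) t)
        (L.ct ab_c (L.pr ab_eq v w) u)) ≫
    TSum.injR (TSum.injR (L.ct ab_eq v w) u) t

/-- By naturality of `A` in its first summand, the product `v * w` may be evaluated before the outer
rebracketing. All evaluations of the fourfold product are brought to the form `ctRR` followed by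
constraints of sums. -/
lemma evR_ctR_right :
    ((L.mul ab_eq).add (TorsorHom.id P (TSum P (L.torsor c) (L.torsor d)))).functor.map
        (L.ctR ab_c abc_d (L.pr ab_eq v w) u t) ≫
        TSum.injR (L.ct ab_eq v w) (⟨u, t⟩ : TSum P (L.torsor c) (L.torsor d)) =
      (assoc P (TSum P (L.torsor a) (L.torsor b)) (L.torsor c) (L.torsor d)).functor.map
        (ctRR ab_eq ab_c abc_d v w u t) := by
  have h := asc_map_first (L.mul ab_eq) (M := L.torsor c) (N := L.torsor d) ((L.mul abc_d).evR (L.mul ab_c)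
    (L.ct abc_d (L.pr ab_c (L.pr ab_eq v w) u) t) (L.ct ab_c (L.pr ab_eq v w) u))
  have h1 := asc_map_inj_inj (P := P) (L.ct ab_eq v w) (𝟙 u) (𝟙 t)
  refine Eq.trans ?_ ((assoc P (TSum P (L.torsor a) (L.torsor b)) (L.torsor c)
    (L.torsor d)).functor.map_comp
      ((((L.mul ab_eq).add (L.one c)).add (L.one d)).functor.map
        ((L.mul abc_d).evR (L.mul ab_c) (L.ct abc_d (L.pr ab_c (L.pr ab_eq v w) u) t)
          (L.ct ab_c (L.pr ab_eq v w) u))) (TSum.injR (TSum.injR (L.ct ab_eq v w) u) t)).symm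
  refine congrArg₂ (· ≫ ·) h (Eq.trans ?_ h1.symm)
  exact congrArg (TSum.inj P (L.ct ab_eq v w)) (TSum.inj_id _ _).symm

/-- In `(v * w) * (u * t)` the two inner products lie in different summands, so they may be
evaluated in either order. -/
lemma ctR_third {x : L.torsor abcd} (f : x ⟶ L.pr ab_cd (L.pr ab_eq v w) (L.pr cd_eq u t)) :
    ((L.one a).add ((L.one b).add (L.mul cd_eq))).functor.map
      ((((L.mul ab_cd).comp ((L.mul ab_eq).add (L.one cd))).comp (L.asc a b cd)).functor.map f ≫
        L.ctR ab_eq ab_cd v w (L.pr cd_eq u t)) ≫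
      TSum.injL v (TSum.injL w (L.ct cd_eq u t)) =
    (assoc P (L.torsor a) (L.torsor b) (TSum P (L.torsor c) (L.torsor d))).functor.map
      (((L.mul ab_eq).add (TorsorHom.id P (TSum P (L.torsor c) (L.torsor d)))).functor.map
        (((L.mul ab_cd).comp ((L.one ab).add (L.mul cd_eq))).functor.map f ≫
          L.ctL cd_eq ab_cd (L.pr ab_eq v w) u t) ≫
        TSum.injR (L.ct ab_eq v w) (⟨u, t⟩ : TSum P (L.torsor c) (L.torsor d))) := by
  have h1 := evR_pre (L.mul ab_cd) (L.mul ab_eq) f (L.ct ab_cd (L.pr ab_eq v w) (L.pr cd_eq u t))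
    (L.ct ab_eq v w)
  have h2 := evL_pre (L.mul ab_cd) (L.mul cd_eq) f (L.ct ab_cd (L.pr ab_eq v w) (L.pr cd_eq u t))
    (L.ct cd_eq u t)
  have h3 := ev_exchange (L.mul ab_eq) (L.mul cd_eq)
    ((L.mul ab_cd).functor.map f ≫ L.ct ab_cd (L.pr ab_eq v w) (L.pr cd_eq u t))
    (L.ct ab_eq v w) (L.ct cd_eq u t)
  have h4 := asc_map_third (L := L.torsor a) (M := L.torsor b) (L.mul cd_eq)
    ((L.mul ab_cd).evR (L.mul ab_eq) ((L.mul ab_cd).functor.map f ≫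
      L.ct ab_cd (L.pr ab_eq v w) (L.pr cd_eq u t)) (L.ct ab_eq v w))
  have h5 : (assoc P (L.torsor a) (L.torsor b) (TSum P (L.torsor c) (L.torsor d))).functor.map
      (TSum.injL (⟨v, w⟩ : TSum P (L.torsor a) (L.torsor b)) (L.ct cd_eq u t)) =
      TSum.injL v (TSum.injL w (L.ct cd_eq u t)) :=
    (congrArg _ (congrArg (TSum.inj P · (L.ct cd_eq u t)) (TSum.inj_id v w).symm)).trans
      (asc_map_inj_inj (𝟙 v) (𝟙 w) (L.ct cd_eq u t))
  refine (congrArg (· ≫ _) (congrArg ((L.one a).add ((L.one b).add (L.mul cd_eq))).functor.map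
    (((L.asc a b cd).functor.map_comp _ _).symm.trans
      (congrArg (L.asc a b cd).functor.map h1)))).trans ?_
  refine (congrArg₂ (· ≫ ·) h4 h5.symm).trans ?_
  refine ((assoc P _ _ _).functor.map_comp _ _).symm.trans (congrArg (assoc P _ _ _).functor.map ?_)
  refine h3.trans (congrArg (· ≫ _) ?_)
  exact congrArg _ h2.symm

lemma ctL_eq : ((L.one a).add ((L.one b).add (L.mul cd_eq))).functor.map
      (L.ctL b_cd a_bcd v w (L.pr cd_eq u t)) ≫
      TSum.injL v (TSum.injL w (L.ct cd_eq u t)) =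
    ((L.one a).add ((L.mul b_cd).comp ((L.one b).add (L.mul cd_eq)))).functor.map
        (L.ct a_bcd v (L.pr b_cd w (L.pr cd_eq u t))) ≫
      TSum.injL v (L.ctL cd_eq b_cd w u t) := by
  have h1 := eq_of_heq (map_heq (agree_id_add_comp (M := L.torsor a) (L.mul b_cd)
    ((L.one b).add (L.mul cd_eq))).eq (L.ct a_bcd v (L.pr b_cd w (L.pr cd_eq u t))))
  have h2 : ((L.one a).add ((L.one b).add (L.mul cd_eq))).functor.map
      (TSum.injL v (L.ct b_cd w (L.pr cd_eq u t))) ≫ TSum.injL v (TSum.injL w (L.ct cd_eq u t)) =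
      TSum.injL v (L.ctL cd_eq b_cd w u t) :=
    (congrArg (· ≫ _) (add_map_injL _ _ _ _)).trans (TSum.injL_comp _ _ _)
  refine (map_comp_eq _ h2).trans (congrArg (· ≫ _) h1)

lemma injR_ctR :
    ((((L.mul ab_c).comp ((L.mul ab_eq).add (L.one c))).comp (L.asc a b c)).add
        (L.one d)).functor.map (L.ct abc_d (L.pr ab_c (L.pr ab_eq v w) u) t) ≫
        TSum.injR (L.ctR ab_eq ab_c v w u) t =
      ((L.asc a b c).add (L.one d)).functor.map (ctRR ab_eq ab_c abc_d v w u t) := by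
  have h1 := eq_of_heq (map_heq (agree_add_id_comp (M := L.torsor d)
    ((L.mul ab_c).comp ((L.mul ab_eq).add (L.one c))) (L.asc a b c)).eq
      (L.ct abc_d (L.pr ab_c (L.pr ab_eq v w) u) t))
  have h2 := eq_of_heq (map_heq (agree_add_id_comp (M := L.torsor d)
    (L.mul ab_c) ((L.mul ab_eq).add (L.one c))).eq
      (L.ct abc_d (L.pr ab_c (L.pr ab_eq v w) u) t))
  have h3 : (((L.mul ab_eq).add (L.one c)).add (L.one d)).functor.map
      (TSum.injR (L.ct ab_c (L.pr ab_eq v w) u) t) ≫ TSum.injR (TSum.injR (L.ct ab_eq v w) u) t =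
      TSum.injR ((L.mul ab_c).evR (L.mul ab_eq) (L.ct ab_c (L.pr ab_eq v w) u) (L.ct ab_eq v w)) t :=
    (congrArg (· ≫ _) (add_map_injR _ _ _ _)).trans (TSum.injR_comp _ _ _)
  have h4 : ctRR ab_eq ab_c abc_d v w u t = _ :=
    (map_comp_eq (((L.mul ab_eq).add (L.one c)).add (L.one d)).functor h3).trans
      (congrArg (· ≫ _) h2)
  refine Eq.trans ?_ (congrArg ((L.asc a b c).add (L.one d)).functor.map h4).symm
  refine Eq.trans ?_ (((L.asc a b c).add (L.one d)).functor.map_comp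
    (((L.mul ab_c).comp ((L.mul ab_eq).add (L.one c))).add (L.one d) |>.functor.map
      (L.ct abc_d (L.pr ab_c (L.pr ab_eq v w) u) t))
    (TSum.injR ((L.mul ab_c).evR (L.mul ab_eq) (L.ct ab_c (L.pr ab_eq v w) u)
      (L.ct ab_eq v w)) t)).symm
  exact congrArg₂ (· ≫ ·) h1.symm (add_map_injR (L.asc a b c) (L.one d)
    ((L.mul ab_c).evR (L.mul ab_eq) (L.ct ab_c (L.pr ab_eq v w) u) (L.ct ab_eq v w)) t).symm

/-- This removes the associativity `2`-isomorphism for `(b, c, d)` together with the `ass` of `w`,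
`u`, `t`, both of which act inside the second entry. -/
lemma map_ctR_injL {x : L.torsor abcd} (f : x ⟶ L.pr a_bcd v (L.pr bc_d (L.pr bc_eq w u) t)) :
    TSum.injL ((L.mul a_bcd).functor.obj x).fst
        (L.assocApp bc_eq cd_eq bc_d b_cd ((L.mul a_bcd).functor.obj x).snd).hom ≫
      ((L.one a).add ((L.mul b_cd).comp ((L.one b).add (L.mul cd_eq)))).functor.map
        ((L.mul a_bcd).functor.map (f ≫ L.mp a_bcd (𝟙 v) (L.ass bc_eq cd_eq bc_d b_cd w u t)) ≫
          L.ct a_bcd v (L.pr b_cd w (L.pr cd_eq u t))) ≫ TSum.injL v (L.ctL cd_eq b_cd w u t) =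
    ((L.one a).add (((L.mul bc_d).comp ((L.mul bc_eq).add (L.one d))).comp
        (L.asc b c d))).functor.map
        ((L.mul a_bcd).functor.map f ≫ L.ct a_bcd v (L.pr bc_d (L.pr bc_eq w u) t)) ≫
      TSum.injL v (L.ctR bc_eq bc_d w u t) := by
  have h1 := map_comp_eq (L.mul a_bcd).functor (f := f)
    (map_mp a_bcd (𝟙 v) (L.ass bc_eq cd_eq bc_d b_cd w u t))
  have h2 : ((L.one a).add ((L.mul b_cd).comp ((L.one b).add (L.mul cd_eq)))).functor.map
      (TSum.injL v (L.ass bc_eq cd_eq bc_d b_cd w u t)) ≫ TSum.injL v (L.ctL cd_eq b_cd w u t) =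
      TSum.injL v ((L.assocApp bc_eq cd_eq bc_d b_cd _).inv ≫ L.ctR bc_eq bc_d w u t) :=
    (congrArg (· ≫ _) (add_map_injL _ _ _ _)).trans ((TSum.injL_comp _ _ _).trans
      (congrArg (TSum.injL v) (L.map_ass bc_eq cd_eq bc_d b_cd w u t)))
  have h3 := ((Natural.id (L.one a)).add (Natural.of_iso₂
    (L.mulAssoc bc_eq cd_eq bc_d b_cd))).map_eq ((L.mul a_bcd).functor.map f ≫
      L.ct a_bcd v (L.pr bc_d (L.pr bc_eq w u) t))
  refine (congrArg (_ ≫ ·) (congrArg (· ≫ _) (congrArg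
    ((L.one a).add ((L.mul b_cd).comp ((L.one b).add (L.mul cd_eq)))).functor.map
    (h1.trans (Category.assoc _ _ _).symm)))).trans ?_
  refine (congrArg (_ ≫ ·) (map_comp_eq _ h2)).trans ?_
  refine (Category.assoc _ _ _).symm.trans ((congrArg (· ≫ _) h3.symm).trans ?_)
  refine (Category.assoc _ _ _).trans (congrArg (_ ≫ ·) ?_)
  exact (TSum.injL_comp _ _ _).trans (congrArg (TSum.injL v)
    (Iso.hom_inv_id_assoc (L.assocApp bc_eq cd_eq bc_d b_cd _) _))

lemma ctR_injL {x : TSum P (L.torsor a) (L.torsor bcd)}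
    (f : x ⟶ (⟨v, L.pr bc_d (L.pr bc_eq w u) t⟩ : TSum P (L.torsor a) (L.torsor bcd))) :
    ((L.one a).add (((L.mul bc_d).comp ((L.mul bc_eq).add (L.one d))).comp
        (L.asc b c d))).functor.map f ≫ TSum.injL v (L.ctR bc_eq bc_d w u t) =
    (((L.one a).add ((L.mul bc_eq).add (L.one d))).comp
        ((L.one a).add (L.asc b c d))).functor.map (((L.one a).add (L.mul bc_d)).functor.map f ≫
          TSum.injL v (L.ct bc_d (L.pr bc_eq w u) t)) ≫
      TSum.injL v ((L.asc b c d).functor.map (TSum.injR (L.ct bc_eq w u) t)) := by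
  have h1 : (((L.one a).add ((L.mul bc_eq).add (L.one d))).comp
        ((L.one a).add (L.asc b c d))).functor.map
        (TSum.injL v (L.ct bc_d (L.pr bc_eq w u) t)) ≫
      TSum.injL v ((L.asc b c d).functor.map (TSum.injR (L.ct bc_eq w u) t)) =
      TSum.injL v (L.ctR bc_eq bc_d w u t) := by
    refine (congrArg (· ≫ _) (congrArg ((L.one a).add (L.asc b c d)).functor.map
      (add_map_injL _ _ _ _))).trans ?_
    refine (congrArg (· ≫ _) (add_map_injL _ _ _ _)).trans ((TSum.injL_comp _ _ _).trans ?_)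
    exact congrArg (TSum.injL v) ((L.asc b c d).functor.map_comp _ _).symm
  have e : ((L.one a).add (L.mul bc_d)).comp (((L.one a).add ((L.mul bc_eq).add (L.one d))).comp
        ((L.one a).add (L.asc b c d))) = (L.one a).add (((L.mul bc_d).comp
          ((L.mul bc_eq).add (L.one d))).comp (L.asc b c d)) := by
    rw [(agree_id_add_comp _ _).eq, (agree_id_add_comp _ _).eq, comp_assoc]
  exact ((map_comp_eq (((L.one a).add ((L.mul bc_eq).add (L.one d))).comp
    ((L.one a).add (L.asc b c d))).functor (f := ((L.one a).add (L.mul bc_d)).functor.map f)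
      h1).trans (congrArg (· ≫ TSum.injL v (L.ctR bc_eq bc_d w u t))
        (eq_of_heq (map_heq e f)))).symm

lemma ctR_second {x : L.torsor abcd} (f : x ⟶ L.pr abc_d (L.pr a_bc v (L.pr bc_eq w u)) t) :
    (((L.one a).add ((L.mul bc_eq).add (L.one d))).comp
        ((L.one a).add (L.asc b c d))).functor.map
        ((((L.mul abc_d).comp ((L.mul a_bc).add (L.one d))).comp (L.asc a bc d)).functor.map f ≫
          L.ctR a_bc abc_d v (L.pr bc_eq w u) t) ≫
      TSum.injL v ((L.asc b c d).functor.map (TSum.injR (L.ct bc_eq w u) t)) =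
    ((assoc P (L.torsor a) (TSum P (L.torsor b) (L.torsor c)) (L.torsor d)).comp
        ((L.one a).add (L.asc b c d))).functor.map
      ((((L.mul a_bc).comp ((L.one a).add (L.mul bc_eq))).add (L.one d)).functor.map
        ((L.mul abc_d).functor.map f ≫ L.ct abc_d (L.pr a_bc v (L.pr bc_eq w u)) t) ≫
          TSum.injR (L.ctL bc_eq a_bc v w u) t) := by
  have h1 := evR_pre (L.mul abc_d) (L.mul a_bc) f (L.ct abc_d (L.pr a_bc v (L.pr bc_eq w u)) t)
    (L.ct a_bc v (L.pr bc_eq w u))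
  have h2 := asc_map_second (L := L.torsor a) (L.mul bc_eq) ((L.mul abc_d).evR (L.mul a_bc)
    ((L.mul abc_d).functor.map f ≫ L.ct abc_d (L.pr a_bc v (L.pr bc_eq w u)) t)
      (L.ct a_bc v (L.pr bc_eq w u)))
  have h3 := asc_map_inj_inj (P := P) (𝟙 v) (L.ct bc_eq w u) (𝟙 t)
  have h4 := eq_of_heq (map_heq (agree_add_id_comp (M := L.torsor d) (L.mul a_bc)
    ((L.one a).add (L.mul bc_eq))).eq
      ((L.mul abc_d).functor.map f ≫ L.ct abc_d (L.pr a_bc v (L.pr bc_eq w u)) t))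
  have h5 : (((L.one a).add (L.mul bc_eq)).add (L.one d)).functor.map
      (TSum.injR (L.ct a_bc v (L.pr bc_eq w u)) t) ≫ TSum.injR (TSum.injL v (L.ct bc_eq w u)) t =
      TSum.injR (L.ctL bc_eq a_bc v w u) t :=
    (congrArg (· ≫ _) (add_map_injR _ _ _ _)).trans (TSum.injR_comp _ _ _)
  have h6 : TSum.injL v ((L.asc b c d).functor.map (TSum.injR (L.ct bc_eq w u) t)) =
      ((assoc P (L.torsor a) (TSum P (L.torsor b) (L.torsor c)) (L.torsor d)).comp
        ((L.one a).add (L.asc b c d))).functor.map (TSum.injR (TSum.injL v (L.ct bc_eq w u)) t) :=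
    (add_map_injL (L.one a) (L.asc b c d) v (TSum.injR (L.ct bc_eq w u) t)).symm.trans
      (congrArg ((L.one a).add (L.asc b c d)).functor.map h3.symm)
  refine (congrArg (· ≫ TSum.injL v ((L.asc b c d).functor.map (TSum.injR (L.ct bc_eq w u) t)))
    (congrArg (((L.one a).add ((L.mul bc_eq).add (L.one d))).comp
        ((L.one a).add (L.asc b c d))).functor.map
      (((L.asc a bc d).functor.map_comp _ _).symm.trans
        (congrArg (L.asc a bc d).functor.map h1)))).trans ?_
  refine (congrArg₂ (· ≫ ·) (congrArg ((L.one a).add (L.asc b c d)).functor.map h2) h6).trans ?_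
  refine (((assoc P (L.torsor a) (TSum P (L.torsor b) (L.torsor c)) (L.torsor d)).comp
        ((L.one a).add (L.asc b c d))).functor.map_comp
      ((((L.one a).add (L.mul bc_eq)).add (L.one d)).functor.map ((L.mul abc_d).evR (L.mul a_bc)
        ((L.mul abc_d).functor.map f ≫ L.ct abc_d (L.pr a_bc v (L.pr bc_eq w u)) t)
          (L.ct a_bc v (L.pr bc_eq w u)))) (TSum.injR (TSum.injL v (L.ct bc_eq w u)) t)).symm.trans ?_
  refine congrArg ((assoc P (L.torsor a) (TSum P (L.torsor b) (L.torsor c)) (L.torsor d)).comp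
        ((L.one a).add (L.asc b c d))).functor.map ?_
  exact (map_comp_eq _ h5).trans (congrArg (· ≫ TSum.injR (L.ctL bc_eq a_bc v w u) t) h4)

/-- The counterpart in the first entry: the associativity `2`-isomorphism for `(a, b, c)` cancels
against the `ass` of `v`, `w`, `u`. -/
lemma map_ctL_injR {x : L.torsor abcd} (f : x ⟶ L.pr abc_d (L.pr ab_c (L.pr ab_eq v w) u) t) :
    TSum.injR (L.assocApp ab_eq bc_eq ab_c a_bc ((L.mul abc_d).functor.obj x).fst).hom
        ((L.mul abc_d).functor.obj x).snd ≫
      (((L.mul a_bc).comp ((L.one a).add (L.mul bc_eq))).add (L.one d)).functor.map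
        ((L.mul abc_d).functor.map (f ≫ L.mp abc_d (L.ass ab_eq bc_eq ab_c a_bc v w u) (𝟙 t)) ≫
          L.ct abc_d (L.pr a_bc v (L.pr bc_eq w u)) t) ≫ TSum.injR (L.ctL bc_eq a_bc v w u) t =
    ((((L.mul ab_c).comp ((L.mul ab_eq).add (L.one c))).comp (L.asc a b c)).add
        (L.one d)).functor.map
        ((L.mul abc_d).functor.map f ≫ L.ct abc_d (L.pr ab_c (L.pr ab_eq v w) u) t) ≫
      TSum.injR (L.ctR ab_eq ab_c v w u) t := by
  have h1 := map_comp_eq (L.mul abc_d).functor (f := f)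
    (map_mp abc_d (L.ass ab_eq bc_eq ab_c a_bc v w u) (𝟙 t))
  have h2 : (((L.mul a_bc).comp ((L.one a).add (L.mul bc_eq))).add (L.one d)).functor.map
      (TSum.injR (L.ass ab_eq bc_eq ab_c a_bc v w u) t) ≫ TSum.injR (L.ctL bc_eq a_bc v w u) t =
      TSum.injR ((L.assocApp ab_eq bc_eq ab_c a_bc _).inv ≫ L.ctR ab_eq ab_c v w u) t :=
    (congrArg (· ≫ _) (add_map_injR _ _ _ _)).trans ((TSum.injR_comp _ _ _).trans
      (congrArg (TSum.injR · t) (L.map_ass ab_eq bc_eq ab_c a_bc v w u)))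
  have h3 := ((Natural.of_iso₂ (L.mulAssoc ab_eq bc_eq ab_c a_bc)).add
    (Natural.id (L.one d))).map_eq ((L.mul abc_d).functor.map f ≫
      L.ct abc_d (L.pr ab_c (L.pr ab_eq v w) u) t)
  refine (congrArg (_ ≫ ·) (congrArg (· ≫ _) (congrArg
    (((L.mul a_bc).comp ((L.one a).add (L.mul bc_eq))).add (L.one d)).functor.map
    (h1.trans (Category.assoc _ _ _).symm)))).trans ?_
  refine (congrArg (_ ≫ ·) (map_comp_eq _ h2)).trans ?_
  refine (Category.assoc _ _ _).symm.trans ((congrArg (· ≫ _) h3.symm).trans ?_)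
  refine (Category.assoc _ _ _).trans (congrArg (_ ≫ ·) ?_)
  exact (TSum.injR_comp _ _ _).trans (congrArg (TSum.injR · t)
    (Iso.hom_inv_id_assoc (L.assocApp ab_eq bc_eq ab_c a_bc _) _))

lemma ctR_eq : (L.assocApp ab_eq bc_eq ab_c a_bc _).hom ≫
      ((L.mul a_bc).comp ((L.one a).add (L.mul bc_eq))).functor.map
        (L.ass ab_eq bc_eq ab_c a_bc v w u) ≫ L.ctL bc_eq a_bc v w u = L.ctR ab_eq ab_c v w u :=
  ((Iso.eq_inv_comp _).1 (L.map_ass ab_eq bc_eq ab_c a_bc v w u))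

/-- The pentagon equation. -/
lemma ass_pentagon :
    L.mp abc_d (L.ass ab_eq bc_eq ab_c a_bc v w u) (𝟙 t) ≫
        L.ass a_bc bc_d abc_d a_bcd v (L.pr bc_eq w u) t ≫
        L.mp a_bcd (𝟙 v) (L.ass bc_eq cd_eq bc_d b_cd w u t) =
      L.ass ab_c cd_eq abc_d ab_cd (L.pr ab_eq v w) u t ≫
        L.ass ab_eq b_cd ab_cd a_bcd v w (L.pr cd_eq u t) := by
  set x := L.pr abc_d (L.pr ab_c (L.pr ab_eq v w) u) t
  set Φ := ((L.mul a_bcd).comp ((L.one a).add (L.mul b_cd))).comp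
    ((L.one a).add ((L.one b).add (L.mul cd_eq)))
  have := Φ.isEquivalence
  have := IsTorsor.isGroupoid P
    (TSum P (L.torsor a) (TSum P (L.torsor b) (TSum P (L.torsor c) (L.torsor d))))
  set pre := (((L.mul ab_eq).add (TorsorHom.id P (TSum P (L.torsor c) (L.torsor d)))).comp
        (assoc P (L.torsor a) (L.torsor b) (TSum P (L.torsor c) (L.torsor d)))).functor.map
      (L.assocApp ab_c cd_eq abc_d ab_cd x).hom
  set pre' := ((L.one a).add ((L.one b).add (L.mul cd_eq))).functor.map
      (L.assocApp ab_eq b_cd ab_cd a_bcd x).hom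
  set ev := ((L.one a).add ((L.one b).add (L.mul cd_eq))).functor.map
      (L.ctL b_cd a_bcd v w (L.pr cd_eq u t)) ≫ TSum.injL v (TSum.injL w (L.ct cd_eq u t))
  have : IsIso pre := IsGroupoid.all_isIso _
  have : IsIso pre' := IsGroupoid.all_isIso _
  -- The comparison takes place in the fourfold sum. The factors `pre` and `pre'` form one side of
  -- the coherence condition of the extension, which is replaced by the other side below.
  refine @map_injective_of_comp _ _ _ _ Φ.functor _ _ _ _ _ _ ev (IsGroupoid.all_isIso _)
    ((cancel_epi pre').1 ((cancel_epi pre).1 ?_))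
  -- Each `ass` on this side cancels one associativity `2`-isomorphism; what remains is the
  -- evaluation of `((v * w) * u) * t` followed by constraints of sums.
  have right : pre ≫ pre' ≫ Φ.functor.map (L.ass ab_c cd_eq abc_d ab_cd (L.pr ab_eq v w) u t ≫
        L.ass ab_eq b_cd ab_cd a_bcd v w (L.pr cd_eq u t)) ≫ ev =
      ((assoc P (TSum P (L.torsor a) (L.torsor b)) (L.torsor c) (L.torsor d)).comp
        (assoc P (L.torsor a) (L.torsor b) (TSum P (L.torsor c) (L.torsor d)))).functor.map
        (ctRR ab_eq ab_c abc_d v w u t) := by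
    have r1 : pre' ≫ Φ.functor.map (L.ass ab_c cd_eq abc_d ab_cd (L.pr ab_eq v w) u t ≫
        L.ass ab_eq b_cd ab_cd a_bcd v w (L.pr cd_eq u t)) ≫ ev =
        ((L.one a).add ((L.one b).add (L.mul cd_eq))).functor.map
          ((((L.mul ab_cd).comp ((L.mul ab_eq).add (L.one cd))).comp (L.asc a b cd)).functor.map
            (L.ass ab_c cd_eq abc_d ab_cd (L.pr ab_eq v w) u t) ≫
            L.ctR ab_eq ab_cd v w (L.pr cd_eq u t)) ≫ TSum.injL v (TSum.injL w (L.ct cd_eq u t)) := by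
      refine (comp_map_comp_comp ((L.one a).add ((L.one b).add (L.mul cd_eq))).functor _ _ _ _).trans (congrArg (· ≫ _) ?_)
      exact congrArg _ (map_ctR ab_eq b_cd ab_cd a_bcd v w (L.pr cd_eq u t)
        (L.ass ab_c cd_eq abc_d ab_cd (L.pr ab_eq v w) u t)).symm
    refine (congrArg (pre ≫ ·) (r1.trans (ctR_third ab_eq cd_eq ab_cd v w u t _))).trans ?_
    refine (map_comp_map_comp ((L.mul ab_eq).add
      (TorsorHom.id P (TSum P (L.torsor c) (L.torsor d)))).functor (assoc P (L.torsor a) (L.torsor b)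
      (TSum P (L.torsor c) (L.torsor d))).functor _ _ _).trans ?_
    refine congrArg (assoc P (L.torsor a) (L.torsor b) (TSum P (L.torsor c) (L.torsor d))).functor.map ?_
    refine Eq.trans (congrArg (· ≫ _) (congrArg _ ?_)) (evR_ctR_right ab_eq ab_c abc_d v w u t)
    exact ctR_eq ab_c cd_eq abc_d ab_cd (L.pr ab_eq v w) u t
  refine Eq.trans ?_ right.symm
  have coh := L.coherence ab_eq bc_eq cd_eq ab_c a_bc bc_d b_cd abc_d a_bcd ab_cd x
  have l0 : Φ.functor.map (L.mp abc_d (L.ass ab_eq bc_eq ab_c a_bc v w u) (𝟙 t) ≫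
        L.ass a_bc bc_d abc_d a_bcd v (L.pr bc_eq w u) t ≫
        L.mp a_bcd (𝟙 v) (L.ass bc_eq cd_eq bc_d b_cd w u t)) ≫ ev =
      ((L.one a).add ((L.mul b_cd).comp ((L.one b).add (L.mul cd_eq)))).functor.map
        ((L.mul a_bcd).functor.map ((L.mp abc_d (L.ass ab_eq bc_eq ab_c a_bc v w u) (𝟙 t) ≫
        L.ass a_bc bc_d abc_d a_bcd v (L.pr bc_eq w u) t) ≫
        L.mp a_bcd (𝟙 v) (L.ass bc_eq cd_eq bc_d b_cd w u t)) ≫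
          L.ct a_bcd v (L.pr b_cd w (L.pr cd_eq u t))) ≫ TSum.injL v (L.ctL cd_eq b_cd w u t) := by
    have h := eq_of_heq (map_heq (congrArg (TorsorHom.comp (L.mul a_bcd)) (agree_id_add_comp
      (M := L.torsor a) (L.mul b_cd) ((L.one b).add (L.mul cd_eq))).eq)
      ((L.mp abc_d (L.ass ab_eq bc_eq ab_c a_bc v w u) (𝟙 t) ≫
        L.ass a_bc bc_d abc_d a_bcd v (L.pr bc_eq w u) t) ≫
        L.mp a_bcd (𝟙 v) (L.ass bc_eq cd_eq bc_d b_cd w u t)))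
    refine (congrArg₂ (· ≫ ·) (congrArg Φ.functor.map (Category.assoc _ _ _).symm)
      (ctL_eq cd_eq b_cd a_bcd v w u t)).trans ?_
    refine (congrArg (· ≫ _) h).trans ?_
    exact (map_comp_eq ((L.one a).add ((L.mul b_cd).comp ((L.one b).add (L.mul cd_eq)))).functor
      rfl).symm
  refine (Category.assoc _ _ _).symm.trans ((congrArg₂ (· ≫ ·) coh.symm l0).trans ?_)
  refine (Category.assoc _ _ _).trans ((congrArg (_ ≫ ·) (Category.assoc _ _ _)).trans ?_)
  refine (congrArg (_ ≫ _ ≫ ·) ((map_ctR_injL bc_eq cd_eq bc_d b_cd a_bcd v w u t _).trans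
    (ctR_injL bc_eq bc_d v w u t _))).trans ?_
  have l1 : (((L.one a).add ((L.mul bc_eq).add (L.one d))).comp
        ((L.one a).add (L.asc b c d))).functor.map (L.assocApp a_bc bc_d abc_d a_bcd x).hom ≫
      (((L.one a).add ((L.mul bc_eq).add (L.one d))).comp
        ((L.one a).add (L.asc b c d))).functor.map (((L.one a).add (L.mul bc_d)).functor.map
          ((L.mul a_bcd).functor.map (L.mp abc_d (L.ass ab_eq bc_eq ab_c a_bc v w u) (𝟙 t) ≫
            L.ass a_bc bc_d abc_d a_bcd v (L.pr bc_eq w u) t) ≫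
              L.ct a_bcd v (L.pr bc_d (L.pr bc_eq w u) t)) ≫
          TSum.injL v (L.ct bc_d (L.pr bc_eq w u) t)) ≫
      TSum.injL v ((L.asc b c d).functor.map (TSum.injR (L.ct bc_eq w u) t)) =
      (((L.one a).add ((L.mul bc_eq).add (L.one d))).comp
        ((L.one a).add (L.asc b c d))).functor.map
        ((((L.mul abc_d).comp ((L.mul a_bc).add (L.one d))).comp (L.asc a bc d)).functor.map
          (L.mp abc_d (L.ass ab_eq bc_eq ab_c a_bc v w u) (𝟙 t)) ≫
          L.ctR a_bc abc_d v (L.pr bc_eq w u) t) ≫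
      TSum.injL v ((L.asc b c d).functor.map (TSum.injR (L.ct bc_eq w u) t)) := by
    refine (Category.assoc _ _ _).symm.trans (congrArg (· ≫ _) ?_)
    refine ((((L.one a).add ((L.mul bc_eq).add (L.one d))).comp
        ((L.one a).add (L.asc b c d))).functor.map_comp _ _).symm.trans ?_
    refine congrArg (((L.one a).add ((L.mul bc_eq).add (L.one d))).comp
        ((L.one a).add (L.asc b c d))).functor.map ?_
    refine Eq.trans (congrArg (_ ≫ ·) (evL_pre (L.mul a_bcd) (L.mul bc_d) _ _ _).symm) ?_
    exact (map_ctR a_bc bc_d abc_d a_bcd v (L.pr bc_eq w u) t _).symm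
  refine (congrArg (_ ≫ ·) (l1.trans (ctR_second bc_eq a_bc abc_d v w u t _))).trans ?_
  refine ((((assoc P (L.torsor a) (TSum P (L.torsor b) (L.torsor c)) (L.torsor d)).comp
        ((L.one a).add (L.asc b c d)))).functor.map_comp _ _).symm.trans ?_
  have l2 := map_ctL_injR ab_eq bc_eq ab_c a_bc abc_d v w u t (𝟙 x)
  rw [Category.id_comp, CategoryTheory.Functor.map_id, Category.id_comp] at l2
  refine (congrArg ((assoc P (L.torsor a) (TSum P (L.torsor b) (L.torsor c)) (L.torsor d)).comp
        ((L.one a).add (L.asc b c d))).functor.map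
          (l2.trans (injR_ctR ab_eq ab_c abc_d v w u t))).trans ?_
  -- All `2`-isomorphisms are used up, and the two sides differ by the pentagon for `A`.
  exact eq_of_heq (map_heq agree_pentagon.eq (ctRR ab_eq ab_c abc_d v w u t))

end CentralExtension

end Pentagon

end PicardTorsor

namespace PicardTorsor

/-! ### Exchange of the first two factors of a longer product. -/

section Rotation

variable {G : Type w₂} [Group G]
  {P : Type u} [Category.{v} P] [MonoidalCategory P] [SymmetricCategory P] [PicardGroupoid P]
  {L : CentralExtension.{u, v, w₁, t₁, w₂} G P}

namespace CentralExtension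

instance (g : G) : IsGroupoid (L.torsor g) := IsTorsor.isGroupoid P _

lemma act_mp_wr_id {g h k : G} (e : g * h = k) {x : P} {v v' v'' : L.torsor g} (w : L.torsor h)
    (f : v ⟶ v') (φ : x ⊙ₗ v' ⟶ v'') :
    x ⊴ₗ L.mp e f (𝟙 w) ≫ L.wr e φ w = L.wr e (x ⊴ₗ f ≫ φ) w := by
  rw [act_mp_wr, mp_id, Category.comp_id]

lemma act_mp_wl_id {g h k : G} (e : g * h = k) {x : P} (v : L.torsor g) {w w' w'' : L.torsor h}
    (f : w ⟶ w') (φ : x ⊙ₗ w' ⟶ w'') :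
    x ⊴ₗ L.mp e (𝟙 v) f ≫ L.wl e v φ = L.wl e v (x ⊴ₗ f ≫ φ) := by
  rw [act_mp_wl, mp_id, Category.comp_id]

section

variable {a b c ab ac bc abc : G} (ab_eq : a * b = ab) (ba_eq : b * a = ab) (bc_eq : b * c = bc)
  (ac_eq : a * c = ac) (ab_c : ab * c = abc) (a_bc : a * bc = abc) (b_ac : b * ac = abc)

/-- The isomorphism `x + v * (w * u) ⟶ w * (v * u)` induced by `x + v * w ⟶ w * v`. -/
noncomputable def rot {x : P} {v : L.torsor a} {w : L.torsor b}
    (s : x ⊙ₗ L.pr ab_eq v w ⟶ L.pr ba_eq w v) (u : L.torsor c) :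
    x ⊙ₗ L.pr a_bc v (L.pr bc_eq w u) ⟶ L.pr b_ac w (L.pr ac_eq v u) :=
  x ⊴ₗ CategoryTheory.inv (L.ass ab_eq bc_eq ab_c a_bc v w u) ≫ L.wr ab_c s u ≫
    L.ass ba_eq ac_eq ab_c b_ac w v u

lemma act_ass_rot {x : P} {v : L.torsor a} {w : L.torsor b}
    (s : x ⊙ₗ L.pr ab_eq v w ⟶ L.pr ba_eq w v) (u : L.torsor c) :
    x ⊴ₗ L.ass ab_eq bc_eq ab_c a_bc v w u ≫
      rot ab_eq ba_eq bc_eq ac_eq ab_c a_bc b_ac s u =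
    L.wr ab_c s u ≫ L.ass ba_eq ac_eq ab_c b_ac w v u := by
  rw [rot, ← Category.assoc, ← actionHomRight_comp, IsIso.hom_inv_id, actionHomRight_id,
    Category.id_comp]

/-- The exchange of `v` and `w` does not touch the remaining factor, so it commutes with a morphism
of that factor, up to the interchange of `x` and `z`. -/
lemma rot_exchange {x z : P} {v : L.torsor a} {w : L.torsor b}
    (s : x ⊙ₗ L.pr ab_eq v w ⟶ L.pr ba_eq w v) {u u' : L.torsor c} (φ : z ⊙ₗ u ⟶ u') :
    x ⊴ₗ L.wl a_bc v (L.wl bc_eq w φ) ≫ rot ab_eq ba_eq bc_eq ac_eq ab_c a_bc b_ac s u' =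
      (swap x z _).hom ≫ z ⊴ₗ rot ab_eq ba_eq bc_eq ac_eq ab_c a_bc b_ac s u ≫
        L.wl b_ac w (L.wl ac_eq v φ) := by
  rw [← cancel_epi (x ⊴ₗ z ⊴ₗ L.ass ab_eq bc_eq ab_c a_bc v w u)]
  have h1 : x ⊴ₗ z ⊴ₗ L.ass ab_eq bc_eq ab_c a_bc v w u ≫ x ⊴ₗ L.wl a_bc v (L.wl bc_eq w φ) =
      x ⊴ₗ L.wl ab_c (L.pr ab_eq v w) φ ≫ x ⊴ₗ L.ass ab_eq bc_eq ab_c a_bc v w u' := by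
    rw [← actionHomRight_comp, ass_nat₃, actionHomRight_comp]
  rw [reassoc_of% h1, act_ass_rot, ← Category.assoc, wl_wr_exchange,
    reassoc_of% (swap_nat_right x z (L.ass ab_eq bc_eq ab_c a_bc v w u)), ← Category.assoc (z ⊴ₗ _),
    ← actionHomRight_comp, act_ass_rot, actionHomRight_comp]
  simp only [Category.assoc, ass_nat₃]

end

section

variable {a b c d ab ba bc ac cd bd ad abc acd bcd abd abcd : G}

/-- The compatibility of `rot` with products on the right. -/
lemma rot_rot (ab_eq : a * b = ab) (ba_eq : b * a = ab) (bc_eq : b * c = bc) (ac_eq : a * c = ac)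
    (cd_eq : c * d = cd) (ab_c : ab * c = abc) (a_bc : a * bc = abc) (b_ac : b * ac = abc)
    (bc_d : bc * d = bcd) (b_cd : b * cd = bcd) (ac_d : ac * d = acd) (a_cd : a * cd = acd)
    (abc_d : abc * d = abcd) (a_bcd : a * bcd = abcd) (ab_cd : ab * cd = abcd)
    (b_acd : b * acd = abcd) {x : P} {v : L.torsor a} {w : L.torsor b}
    (s : x ⊙ₗ L.pr ab_eq v w ⟶ L.pr ba_eq w v) (u : L.torsor c) (t : L.torsor d) :
    L.wr abc_d (rot ab_eq ba_eq bc_eq ac_eq ab_c a_bc b_ac s u) t ≫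
        L.ass b_ac ac_d abc_d b_acd w (L.pr ac_eq v u) t ≫
        L.mp b_acd (𝟙 w) (L.ass ac_eq cd_eq ac_d a_cd v u t) =
      x ⊴ₗ (L.ass a_bc bc_d abc_d a_bcd v (L.pr bc_eq w u) t ≫
        L.mp a_bcd (𝟙 v) (L.ass bc_eq cd_eq bc_d b_cd w u t)) ≫
        rot ab_eq ba_eq b_cd a_cd ab_cd a_bcd b_acd s (L.pr cd_eq u t) := by
  -- One pentagon is needed for each of the two orders of `v` and `w`.
  have p1 := ass_pentagon ba_eq ac_eq cd_eq ab_c b_ac ac_d a_cd abc_d b_acd ab_cd w v u t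
  have p2 := ass_pentagon ab_eq bc_eq cd_eq ab_c a_bc bc_d b_cd abc_d a_bcd ab_cd v w u t
  rw [← cancel_epi (x ⊴ₗ L.mp abc_d (L.ass ab_eq bc_eq ab_c a_bc v w u) (𝟙 t)),
    ← Category.assoc, act_mp_wr_id, act_ass_rot, ← wr_mp, Category.assoc, p1,
    ← Category.assoc (x ⊴ₗ _), ← actionHomRight_comp, p2, actionHomRight_comp, Category.assoc,
    act_ass_rot, ← Category.assoc, ← Category.assoc, ass_nat₁]

/-- The compatibility of `rot` with products on the left. -/
lemma wl_rot (bc_eq : b * c = bc) (cb_eq : c * b = bc)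
    (cd_eq : c * d = cd) (bd_eq : b * d = bd) (a_bc : a * bc = abc)
    (bc_d : bc * d = bcd) (b_cd : b * cd = bcd) (c_bd : c * bd = bcd)
    (abc_d : abc * d = abcd) (a_bcd : a * bcd = abcd) {x : P} (v : L.torsor a) {w : L.torsor b}
    {u : L.torsor c} (s : x ⊙ₗ L.pr bc_eq w u ⟶ L.pr cb_eq u w) (t : L.torsor d) :
    L.wr abc_d (L.wl a_bc v s) t ≫ L.ass a_bc bc_d abc_d a_bcd v (L.pr cb_eq u w) t ≫
        L.mp a_bcd (𝟙 v) (L.ass cb_eq bd_eq bc_d c_bd u w t) =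
      x ⊴ₗ (L.ass a_bc bc_d abc_d a_bcd v (L.pr bc_eq w u) t ≫
        L.mp a_bcd (𝟙 v) (L.ass bc_eq cd_eq bc_d b_cd w u t)) ≫
        L.wl a_bcd v (rot bc_eq cb_eq cd_eq bd_eq bc_d b_cd c_bd s t) := by
  rw [← Category.assoc, ← ass_nat₂, Category.assoc, wl_mp, actionHomRight_comp, Category.assoc,
    act_mp_wl_id, act_ass_rot]

end

end CentralExtension

end Rotation

end PicardTorsor

namespace PicardTorsor

/-! ### The hexagons in the presence of a further factor. -/

section RotationOfProducts

variable {G : Type w₂} [Group G]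
  {P : Type u} [Category.{v} P] [MonoidalCategory P] [SymmetricCategory P] [PicardGroupoid P]
  {L : CentralExtension.{u, v, w₁, t₁, w₂} G P}

namespace CentralExtension

/-- A hexagon that decomposes the exchange of `v * w` with `u` remains valid when all products are
multiplied by `t` on the right. The factor `t` is carried through by `rot_rot` and `wl_rot`, and the
brackets are adjusted by the pentagon. -/
lemma merge_rot_left {a b c h ab bc ah bh ch abc abh bch abch : G}
    (ab_eq : a * b = ab) (bc_eq : b * c = bc) (ah_eq : a * h = ah) (ha_eq : h * a = ah)
    (bh_eq : b * h = bh) (hb_eq : h * b = bh) (hc_eq : h * c = ch) (ab_c : ab * c = abc)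
    (a_bc : a * bc = abc) (ab_h : ab * h = abh) (h_ab : h * ab = abh) (ah_b : ah * b = abh)
    (a_bh : a * bh = abh) (bh_c : bh * c = bch) (b_hc : b * ch = bch) (h_bc : h * bc = bch)
    (abh_c : abh * c = abch) (ab_hc : ab * ch = abch) (a_bch : a * bch = abch)
    (ah_bc : ah * bc = abch) (h_abc : h * abc = abch) {x y z : P} (k : x ⊗ y ⟶ z)
    {v : L.torsor a} {w : L.torsor b} {u : L.torsor h}
    {s : z ⊙ₗ L.pr ab_h (L.pr ab_eq v w) u ⟶ L.pr h_ab u (L.pr ab_eq v w)}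
    {s₁ : x ⊙ₗ L.pr ah_eq v u ⟶ L.pr ha_eq u v} {s₂ : y ⊙ₗ L.pr bh_eq w u ⟶ L.pr hb_eq u w}
    (hs : merge k _ ≫ s = x ⊴ₗ (y ⊴ₗ L.ass ab_eq bh_eq ab_h a_bh v w u ≫ L.wl a_bh v s₂) ≫
      rot ah_eq ha_eq hb_eq ab_eq ah_b a_bh h_ab s₁ w) (t : L.torsor c) :
    merge k _ ≫ rot ab_h h_ab hc_eq ab_c abh_c ab_hc h_abc s t ≫
        L.mp h_abc (𝟙 u) (L.ass ab_eq bc_eq ab_c a_bc v w t) =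
      x ⊴ₗ (y ⊴ₗ L.ass ab_eq b_hc ab_hc a_bch v w (L.pr hc_eq u t) ≫
        L.wl a_bch v (rot bh_eq hb_eq hc_eq bc_eq bh_c b_hc h_bc s₂ t)) ≫
      rot ah_eq ha_eq h_bc a_bc ah_bc a_bch h_abc s₁ (L.pr bc_eq w t) := by
  have h1 := rot_rot ah_eq ha_eq hb_eq ab_eq bc_eq ah_b a_bh h_ab bh_c h_bc ab_c a_bc abh_c a_bch
    ah_bc h_abc s₁ w t
  have h2 := wl_rot bh_eq hb_eq hc_eq bc_eq a_bh bh_c b_hc h_bc abh_c a_bch v s₂ t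
  have p := ass_pentagon ab_eq bh_eq hc_eq ab_h a_bh bh_c b_hc abh_c a_bch ab_hc v w u t
  -- After rebracketing to `((v * w) * u) * t`, the exchange `s` acts on the left factor alone, and
  -- `hs` can be multiplied by `t`.
  rw [← cancel_epi (x ⊴ₗ y ⊴ₗ L.ass ab_h hc_eq abh_c ab_hc (L.pr ab_eq v w) u t),
    ← Category.assoc, merge_nat, Category.assoc, ← Category.assoc (z ⊴ₗ _), act_ass_rot,
    Category.assoc, ← Category.assoc (merge _ _), merge_wr abh_c k t hs, Category.assoc, h1,
    ← Category.assoc, ← Category.assoc, ← actionHomRight_comp, ← actionHomRight_comp]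
  congr 2
  rw [← act_mp_wr_id, Category.assoc, h2, ← Category.assoc, ← Category.assoc,
    ← actionHomRight_comp, ← actionHomRight_comp, p]

/-- The analogue of `merge_rot_left` for one factor moving past the product of two others. -/
lemma merge_rot_right {a b c g ab bc ag bg cg abc abg bcg abcg : G}
    (ab_eq : a * b = ab) (bc_eq : b * c = bc) (ga_eq : g * a = ag) (ag_eq : a * g = ag)
    (gb_eq : g * b = bg) (bg_eq : b * g = bg) (gc_eq : g * c = cg) (ab_c : ab * c = abc)
    (a_bc : a * bc = abc) (g_ab : g * ab = abg) (ab_g : ab * g = abg) (ga_b : ag * b = abg)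
    (a_gb : a * bg = abg) (gb_c : bg * c = bcg) (g_bc : g * bc = bcg) (b_gc : b * cg = bcg)
    (gab_c : abg * c = abcg) (g_abc : g * abc = abcg) (ab_gc : ab * cg = abcg)
    (a_gbc : a * bcg = abcg) (ga_bc : ag * bc = abcg) {x y z : P} (k : x ⊗ y ⟶ z)
    {v : L.torsor g} {w : L.torsor a} {u : L.torsor b}
    {s : z ⊙ₗ L.pr g_ab v (L.pr ab_eq w u) ⟶ L.pr ab_g (L.pr ab_eq w u) v}
    {s₁ : y ⊙ₗ L.pr ga_eq v w ⟶ L.pr ag_eq w v} {s₂ : x ⊙ₗ L.pr gb_eq v u ⟶ L.pr bg_eq u v}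
    (hs : (merge k _ ≫ s) ≫ L.ass ab_eq bg_eq ab_g a_gb w u v =
      x ⊴ₗ rot ga_eq ag_eq ab_eq gb_eq ga_b g_ab a_gb s₁ u ≫ L.wl a_gb w s₂) (t : L.torsor c) :
    merge k _ ≫ rot g_ab ab_g ab_c gc_eq gab_c g_abc ab_gc s t ≫
        L.ass ab_eq b_gc ab_gc a_gbc w u (L.pr gc_eq v t) =
      x ⊴ₗ (y ⊴ₗ L.mp g_abc (𝟙 v) (L.ass ab_eq bc_eq ab_c a_bc w u t) ≫
        rot ga_eq ag_eq a_bc g_bc ga_bc g_abc a_gbc s₁ (L.pr bc_eq u t)) ≫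
      L.wl a_gbc w (rot gb_eq bg_eq bc_eq gc_eq gb_c g_bc b_gc s₂ t) := by
  have h1 := rot_rot ga_eq ag_eq ab_eq gb_eq bc_eq ga_b g_ab a_gb ab_c a_bc gb_c g_bc gab_c g_abc
    ga_bc a_gbc s₁ u t
  have h2 := wl_rot gb_eq bg_eq bc_eq gc_eq a_gb gb_c g_bc b_gc gab_c a_gbc w s₂ t
  have p := ass_pentagon ab_eq bg_eq gc_eq ab_g a_gb gb_c b_gc gab_c a_gbc ab_gc w u v t
  rw [Category.assoc] at hs
  rw [← cancel_epi (x ⊴ₗ y ⊴ₗ L.ass g_ab ab_c gab_c g_abc v (L.pr ab_eq w u) t),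
    ← Category.assoc, merge_nat, Category.assoc, ← Category.assoc (z ⊴ₗ _), act_ass_rot,
    Category.assoc, ← p, ← Category.assoc (L.wr _ _ _), wr_mp, ← Category.assoc (merge _ _),
    merge_wr gab_c k t hs, Category.assoc, h2, ← Category.assoc, ← actionHomRight_comp, h1,
    ← Category.assoc, ← actionHomRight_comp, ← Category.assoc (y ⊴ₗ _), ← actionHomRight_comp]

end CentralExtension

end RotationOfProducts

end PicardTorsor

namespace PicardTorsor

/-! ### Testing associativity in `P` on one object. -/

section MergeExt

variable {P : Type u} [Category.{v} P] [MonoidalCategory P] [SymmetricCategory P]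
  {L : Type w₁} [Category.{t₁} L] [MonoidalLeftAction P L]

lemma merge_assoc_left {x y z xy xyz : P} (k : x ⊗ y ⟶ xy) (l : xy ⊗ z ⟶ xyz) (v : L) :
    (αₗ x y (z ⊙ₗ v)).inv ≫ merge (k ▷ z ≫ l) v = merge k (z ⊙ₗ v) ≫ merge l v := by
  simp [merge]

lemma merge_assoc_right {x y z yz xyz : P} (k : y ⊗ z ⟶ yz) (l : x ⊗ yz ⟶ xyz) (v : L) :
    (αₗ x y (z ⊙ₗ v)).inv ≫ merge ((α_ x y z).hom ≫ x ◁ k ≫ l) v =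
      x ⊴ₗ merge k v ≫ merge l v := by
  have := assoc_act x y z v
  simp [merge, reassoc_of% this]

variable [PicardGroupoid P] [IsTorsor P L]

/-- The action on `v` is faithful, and the associator of `P` acts by rebracketing; both sides thus
become successive `merge`s. -/
lemma merge_assoc_ext {x y z xy yz xyz : P} {k₁ : x ⊗ y ⟶ xy} {l₁ : xy ⊗ z ⟶ xyz}
    {k₂ : y ⊗ z ⟶ yz} {l₂ : x ⊗ yz ⟶ xyz} {v : L}
    (h : merge k₁ (z ⊙ₗ v) ≫ merge l₁ v = x ⊴ₗ merge k₂ v ≫ merge l₂ v) :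
    k₁ ▷ z ≫ l₁ = (α_ x y z).hom ≫ x ◁ k₂ ≫ l₂ := by
  refine merge_injective (v := v) ?_
  rw [← cancel_epi (αₗ x y (z ⊙ₗ v)).inv, merge_assoc_left, merge_assoc_right, h]

end MergeExt

/-! ### The multiplicativity isomorphisms and their hexagons. -/

section Coherence

variable {G : Type w₂} [Group G]
  {P : Type u} [Category.{v} P] [MonoidalCategory P] [SymmetricCategory P] [PicardGroupoid P]
  {L : CentralExtension.{u, v, w₁, t₁, w₂} G P}

namespace CentralExtension.Commutator

variable (C : L.Commutator)

lemma mul_mul_eq_of_commute {a b c ab : G} (e : a * b = ab) (cb : Commute b c) :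
    a * c * b = ab * c := by
  rw [mul_assoc, ← cb.eq, ← mul_assoc, e]

/-- The isomorphism `C (a, c) + C (b, c) ⟶ C (a * b, c)`. -/
noncomputable def kL {a b c ab : G} (e : a * b = ab) (ca : Commute a c) (cb : Commute b c)
    (cab : Commute ab c) : C.obj a c ca ⊗ C.obj b c cb ⟶ C.obj ab c cab :=
  (C.existsUnique_mulLeftEq e rfl ca.eq.symm rfl cb.eq.symm rfl cab.eq.symm
    ((mul_assoc a b c).symm.trans (congrArg (· * c) e)) (mul_mul_eq_of_commute e cb)).choose

/-- The isomorphism `C (a, c) + C (a, b) ⟶ C (a, b * c)`. -/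
noncomputable def kR {a b c bc : G} (e : b * c = bc) (cb : Commute a b) (cc : Commute a c)
    (cbc : Commute a bc) : C.obj a c cc ⊗ C.obj a b cb ⟶ C.obj a bc cbc :=
  (C.existsUnique_mulRightEq rfl cb.eq.symm rfl cc.eq.symm e rfl
    ((congrArg (a * ·) e.symm).trans (mul_assoc a b c).symm)
    (cbc.eq.symm.trans ((congrArg (a * ·) e.symm).trans (mul_assoc a b c).symm))
    ((mul_assoc b a c).symm.trans (congrArg (· * c) cb.eq.symm))).choose

section Left

variable {a b c ab ac bc abc : G} (ab_eq : a * b = ab) (ac_eq : a * c = ac) (ca_eq : c * a = ac)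
  (bc_eq : b * c = bc) (cb_eq : c * b = bc) (ab_c : ab * c = abc) (c_ab : c * ab = abc)
  (a_bc : a * bc = abc) (ac_b : ac * b = abc)

/-- `kL` is chosen for the literal products of group elements. Substitution gives the equation for
arbitrary names of these products. -/
lemma mulLeftEq_kL (x : L.torsor abc) : C.MulLeftEq ab_eq ac_eq ca_eq bc_eq cb_eq ab_c c_ab a_bc ac_b
    (C.kL ab_eq (ac_eq.trans ca_eq.symm) (bc_eq.trans cb_eq.symm) (ab_c.trans c_ab.symm)) x := by
  subst ac_eq bc_eq ab_c
  exact (C.existsUnique_mulLeftEq ab_eq rfl ca_eq rfl cb_eq rfl c_ab a_bc ac_b).choose_spec.1 x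

/-- From here on only this consequence of (2a) is used: `u` is exchanged first with `w` and then
with `v`. -/
lemma merge_kL (v : L.torsor a) (w : L.torsor b) (u : L.torsor c) :
    merge (C.kL ab_eq (ac_eq.trans ca_eq.symm) (bc_eq.trans cb_eq.symm) (ab_c.trans c_ab.symm))
        (L.pr ab_c (L.pr ab_eq v w) u) ≫ C.sig ab_c c_ab (L.pr ab_eq v w) u =
      C.obj a c (ac_eq.trans ca_eq.symm) ⊴ₗ
        (C.obj b c (bc_eq.trans cb_eq.symm) ⊴ₗ L.ass ab_eq bc_eq ab_c a_bc v w u ≫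
          L.wl a_bc v (C.sig bc_eq cb_eq w u)) ≫
      rot ac_eq ca_eq cb_eq ab_eq ac_b a_bc c_ab (C.sig ac_eq ca_eq v u) w := by
  have h := C.merge_sig_left ab_eq ac_eq ca_eq bc_eq cb_eq ab_c c_ab a_bc ac_b v w u
    (C.mulLeftEq_kL ab_eq ac_eq ca_eq bc_eq cb_eq ab_c c_ab a_bc ac_b _)
    ((C.obj b c (bc_eq.trans cb_eq.symm) ⊴ₗ L.ass ab_eq bc_eq ab_c a_bc v w u ≫
      L.wl a_bc v (C.sig bc_eq cb_eq w u)) ≫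
        CategoryTheory.inv (L.ass ac_eq cb_eq ac_b a_bc v u w)) (by simp)
  rw [h, rot]
  simp only [actionHomRight_comp, Category.assoc]

end Left

section Right

variable {a b c ab ac bc abc : G} (ab_eq : a * b = ab) (ba_eq : b * a = ab) (ac_eq : a * c = ac)
  (ca_eq : c * a = ac) (bc_eq : b * c = bc) (ab_c : ab * c = abc) (a_bc : a * bc = abc)
  (bc_a : bc * a = abc) (b_ac : b * ac = abc)

lemma mulRightEq_kR (x : L.torsor abc) :
    C.MulRightEq ab_eq ba_eq ac_eq ca_eq bc_eq ab_c a_bc bc_a b_ac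
      (C.kR bc_eq (ab_eq.trans ba_eq.symm) (ac_eq.trans ca_eq.symm) (a_bc.trans bc_a.symm)) x := by
  subst ab_eq ac_eq ab_c
  exact (C.existsUnique_mulRightEq rfl ba_eq rfl ca_eq bc_eq rfl a_bc bc_a b_ac).choose_spec.1 x

/-- The factor `v` meets `w` first, so `C (a, b)` acts before `C (a, c)`. This is why `kR` has its
arguments in the opposite order. -/
lemma merge_kR (v : L.torsor a) (w : L.torsor b) (u : L.torsor c) :
    (merge (C.kR bc_eq (ab_eq.trans ba_eq.symm) (ac_eq.trans ca_eq.symm) (a_bc.trans bc_a.symm))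
        (L.pr a_bc v (L.pr bc_eq w u)) ≫ C.sig a_bc bc_a v (L.pr bc_eq w u)) ≫
      L.ass bc_eq ca_eq bc_a b_ac w u v =
    C.obj a c (ac_eq.trans ca_eq.symm) ⊴ₗ
        rot ab_eq ba_eq bc_eq ac_eq ab_c a_bc b_ac (C.sig ab_eq ba_eq v w) u ≫
      L.wl b_ac w (C.sig ac_eq ca_eq v u) := by
  have h := C.merge_sig_right ab_eq ba_eq ac_eq ca_eq bc_eq ab_c a_bc bc_a b_ac v w u
    (C.mulRightEq_kR ab_eq ba_eq ac_eq ca_eq bc_eq ab_c a_bc bc_a b_ac _)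
    (CategoryTheory.inv (L.ass ab_eq bc_eq ab_c a_bc v w u)) (by simp)
  rw [h, rot]
  simp only [Category.assoc]

end Right

end CentralExtension.Commutator

end Coherence

end PicardTorsor

namespace PicardTorsor

/-! ### Associativity in the first variable. -/

section AssocLeft

variable {G : Type w₂} [Group G]
  {P : Type u} [Category.{v} P] [MonoidalCategory P] [SymmetricCategory P] [PicardGroupoid P]
  {L : CentralExtension.{u, v, w₁, t₁, w₂} G P}

lemma merge_nat_assoc {P : Type u} [Category.{v} P] [MonoidalCategory P] [SymmetricCategory P]
    {L : Type w₁} [Category.{t₁} L] [MonoidalLeftAction P L] {x y z : P}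
    (k : x ⊗ y ⟶ z) {v w : L} (f : v ⟶ w) {u : L} (g : z ⊙ₗ w ⟶ u) :
    merge k v ≫ z ⊴ₗ f ≫ g = x ⊴ₗ y ⊴ₗ f ≫ merge k w ≫ g := by
  rw [← Category.assoc, ← merge_nat, Category.assoc]

variable (C : L.Commutator)

lemma mul_mul_eq_of_mul_eq {a b ab : G} (e : a * b = ab) (c : G) : a * (b * c) = ab * c := by
  rw [← e, mul_assoc]

namespace CentralExtension.Commutator

/-- Both sides describe how `t : L h` moves to the left past `u`, `w` and `v`. The bracketing of
`a`, `b`, `c` determines only which exchanges are combined first. -/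
lemma kL_assoc {a b c h ab bc abc : G} (ab_eq : a * b = ab) (bc_eq : b * c = bc)
    (ab_c : ab * c = abc) (a_bc : a * bc = abc) (ca : Commute a h) (cb : Commute b h)
    (cc : Commute c h) (cab : Commute ab h) (cbc : Commute bc h) (cabc : Commute abc h) :
    C.kL ab_eq ca cb cab ▷ C.obj c h cc ≫ C.kL ab_c cab cc cabc =
      (α_ _ _ _).hom ≫ C.obj a h ca ◁ C.kL bc_eq cb cc cbc ≫ C.kL a_bc ca cbc cabc := by
  obtain ⟨v⟩ := IsTorsor.nonempty (P := P) (L := L.torsor a)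
  obtain ⟨w⟩ := IsTorsor.nonempty (P := P) (L := L.torsor b)
  obtain ⟨u⟩ := IsTorsor.nonempty (P := P) (L := L.torsor c)
  obtain ⟨t⟩ := IsTorsor.nonempty (P := P) (L := L.torsor h)
  have ha := ca.eq.symm
  have hb := cb.eq.symm
  have hc := cc.eq.symm
  have h_ab := cab.eq.symm
  have h_bc := cbc.eq.symm
  have h_abc := cabc.eq.symm
  have a_bh := mul_mul_eq_of_mul_eq ab_eq h
  have b_ch := mul_mul_eq_of_mul_eq bc_eq h
  have ab_ch := mul_mul_eq_of_mul_eq ab_c h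
  have a_bch := mul_mul_eq_of_mul_eq a_bc h
  have ah_b := mul_mul_eq_of_commute ab_eq cb
  have bh_c := mul_mul_eq_of_commute bc_eq cc
  have abh_c := mul_mul_eq_of_commute ab_c cc
  have ah_bc := mul_mul_eq_of_commute a_bc cbc
  refine merge_assoc_ext (v := L.pr rfl (L.pr ab_c (L.pr ab_eq v w) u) t) ?_
  -- The test object is `((v * w) * u) * t`. The second factor rebrackets the result to `t * (v * (w
  -- * u))`, the form produced by the decomposition according to `a * (b * c)`.
  rw [← cancel_mono (C.sig rfl h_abc _ t ≫
    L.mp h_abc (𝟙 t) (L.ass ab_eq bc_eq ab_c a_bc v w u))]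
  have r12 := merge_rot_left ab_eq bc_eq rfl ha rfl hb hc ab_c a_bc rfl h_ab ah_b a_bh bh_c b_ch h_bc
    abh_c ab_ch a_bch ah_bc h_abc (C.kL ab_eq ca cb cab)
    (C.merge_kL ab_eq rfl ha rfl hb rfl h_ab a_bh ah_b v w t) u
  have k123 := C.merge_kL ab_c rfl h_ab rfl hc rfl h_abc ab_ch abh_c (L.pr ab_eq v w) u t
  have k1_23 := C.merge_kL a_bc rfl ha rfl h_bc rfl h_abc a_bch ah_bc v (L.pr bc_eq w u) t
  have k23 := C.merge_kL bc_eq rfl hb rfl hc rfl h_bc b_ch bh_c w u t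
  have p := ass_pentagon ab_eq bc_eq rfl ab_c a_bc rfl b_ch rfl a_bch ab_ch v w u t
  -- The common value: after full rebracketing, `t` is exchanged with `u`, then with `w`, then with
  -- `v`.
  trans C.obj a h ca ⊴ₗ (C.obj b h cb ⊴ₗ (C.obj c h cc ⊴ₗ
      (L.ass ab_c rfl rfl ab_ch (L.pr ab_eq v w) u t ≫
      L.ass ab_eq b_ch ab_ch a_bch v w (L.pr rfl u t)) ≫
      L.wl a_bch v (L.wl b_ch w (C.sig rfl hc u t))) ≫
      L.wl a_bch v (rot rfl hb hc bc_eq bh_c b_ch h_bc (C.sig rfl hb w t) u)) ≫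
      rot rfl ha h_bc a_bc ah_bc a_bch h_abc (C.sig rfl ha v t) (L.pr bc_eq w u)
  · rw [Category.assoc, reassoc_of% k123, ← Category.assoc, ← merge_nat, Category.assoc, r12,
      ← Category.assoc, ← actionHomRight_comp]
    congr 2
    simp only [actionHomRight_comp, Category.assoc]
    congr 1
    rw [← actionHomRight_comp_assoc, ← ass_nat₃]
    simp only [actionHomRight_comp, Category.assoc]
  · rw [← p, Category.assoc, ← C.sig_nat, ← Category.assoc (merge _ _), ← merge_nat,
      Category.assoc, k1_23, ← actionHomRight_comp_assoc, ← actionHomRight_comp_assoc]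
    refine congrArg (fun f => C.obj a h ca ⊴ₗ f ≫ rot rfl ha h_bc a_bc ah_bc a_bch h_abc
      (C.sig rfl ha v t) (L.pr bc_eq w u)) ?_
    simp only [Category.assoc, merge_nat_assoc]
    rw [merge_wl _ _ _ k23]
    simp only [actionHomRight_comp, Category.assoc, act_mp_wl_id]

end CentralExtension.Commutator

end AssocLeft

end PicardTorsor

namespace PicardTorsor

/-! ### Associativity in the second variable. -/

section AssocRight

variable {G : Type w₂} [Group G]
  {P : Type u} [Category.{v} P] [MonoidalCategory P] [SymmetricCategory P] [PicardGroupoid P]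
  {L : CentralExtension.{u, v, w₁, t₁, w₂} G P}

namespace CentralExtension.Commutator

variable (C : L.Commutator)

lemma kR_assoc {g a b c ab bc abc : G} (ab_eq : a * b = ab) (bc_eq : b * c = bc)
    (ab_c : ab * c = abc) (a_bc : a * bc = abc) (ca : Commute g a) (cb : Commute g b)
    (cc : Commute g c) (cab : Commute g ab) (cbc : Commute g bc) (cabc : Commute g abc) :
    C.kR bc_eq cb cc cbc ▷ C.obj g a ca ≫ C.kR a_bc ca cbc cabc =
      (α_ _ _ _).hom ≫ C.obj g c cc ◁ C.kR ab_eq ca cb cab ≫ C.kR ab_c cab cc cabc := by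
  obtain ⟨t⟩ := IsTorsor.nonempty (P := P) (L := L.torsor g)
  obtain ⟨v⟩ := IsTorsor.nonempty (P := P) (L := L.torsor a)
  obtain ⟨w⟩ := IsTorsor.nonempty (P := P) (L := L.torsor b)
  obtain ⟨u⟩ := IsTorsor.nonempty (P := P) (L := L.torsor c)
  have ga := ca.eq
  have gb := cb.eq
  have gc := cc.eq
  have g_ab := cab.eq
  have g_bc := cbc.eq
  have g_abc := cabc.eq
  have a_bg := mul_mul_eq_of_mul_eq ab_eq g
  have b_cg := mul_mul_eq_of_mul_eq bc_eq g
  have ab_cg := mul_mul_eq_of_mul_eq ab_c g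
  have a_bcg := mul_mul_eq_of_mul_eq a_bc g
  have ag_b := mul_mul_eq_of_commute ab_eq cb.symm
  have bg_c := mul_mul_eq_of_commute bc_eq cc.symm
  have abg_c := mul_mul_eq_of_commute ab_c cc.symm
  have ag_bc := mul_mul_eq_of_commute a_bc cbc.symm
  refine merge_assoc_ext (v := L.pr g_abc t (L.pr ab_c (L.pr ab_eq v w) u)) ?_
  -- Here `t : L g` stands on the left and moves to the right. The result is rebracketed to `v * (w
  -- * (u * t))`.
  rw [← cancel_mono (C.sig g_abc rfl t _ ≫ L.ass ab_c rfl rfl ab_cg (L.pr ab_eq v w) u t ≫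
    L.ass ab_eq b_cg ab_cg a_bcg v w (L.pr rfl u t))]
  have r12 := merge_rot_right ab_eq bc_eq ga rfl gb rfl gc ab_c a_bc g_ab rfl ag_b a_bg bg_c g_bc b_cg
    abg_c g_abc ab_cg a_bcg ag_bc (C.kR ab_eq ca cb cab)
    (C.merge_kR ga rfl gb rfl ab_eq ag_b g_ab rfl a_bg t v w) u
  have k12_3 := C.merge_kR g_ab rfl gc rfl ab_c abg_c g_abc rfl ab_cg t (L.pr ab_eq v w) u
  have k1_23 := C.merge_kR ga rfl g_bc rfl a_bc ag_bc g_abc rfl a_bcg t v (L.pr bc_eq w u)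
  have k23 := C.merge_kR gb rfl gc rfl bc_eq bg_c g_bc rfl b_cg t w u
  have p := ass_pentagon ab_eq bc_eq rfl ab_c a_bc rfl b_cg rfl a_bcg ab_cg v w u t
  rw [Category.assoc] at k12_3 k1_23 k23
  -- The common value: `t` is exchanged with `v`, then with `w`, then with `u`.
  trans C.obj g c cc ⊴ₗ (C.obj g b cb ⊴ₗ (C.obj g a ca ⊴ₗ
      L.mp g_abc (𝟙 t) (L.ass ab_eq bc_eq ab_c a_bc v w u) ≫
      rot ga rfl a_bc g_bc ag_bc g_abc a_bcg (C.sig ga rfl t v) (L.pr bc_eq w u))) ≫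
    C.obj g c cc ⊴ₗ L.wl a_bcg v (rot gb rfl bc_eq gc bg_c g_bc b_cg (C.sig gb rfl t w) u) ≫
      L.wl a_bcg v (L.wl b_cg w (C.sig gc rfl t u))
  · rw [← p, ← reassoc_of% (C.sig_nat g_abc rfl (𝟙 t) (L.ass ab_eq bc_eq ab_c a_bc v w u)),
      Category.assoc, merge_nat_assoc, reassoc_of% k1_23]
    simp only [wl_mp, merge_nat_assoc, ← actionHomRight_comp_assoc]
    rw [merge_wl _ _ _ k23]
    simp only [actionHomRight_comp, Category.assoc]
  · rw [Category.assoc, reassoc_of% k12_3, ← ass_nat₃]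
    simp only [← actionHomRight_comp_assoc]
    rw [r12]

end CentralExtension.Commutator

end AssocRight

end PicardTorsor

namespace PicardTorsor

/-! ### Compatibility of the two multiplicative structures. -/

section Interchange

variable {G : Type w₂} [Group G]
  {P : Type u} [Category.{v} P] [MonoidalCategory P] [SymmetricCategory P] [PicardGroupoid P]
  {L : CentralExtension.{u, v, w₁, t₁, w₂} G P}

/-- Acting on an object, `tensorμ` becomes the interchange of the two middle objects `x₂` and `y₁`.
-/
lemma merge_tensorμ_ext {M : Type w₁} [Category.{t₁} M] [MonoidalLeftAction P M] [IsTorsor P M]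
    {x₁ x₂ y₁ y₂ x y x' y' z : P} {k₁ : x₁ ⊗ x₂ ⟶ x} {k₂ : y₁ ⊗ y₂ ⟶ y} {k : x ⊗ y ⟶ z}
    {l₁ : x₁ ⊗ y₁ ⟶ x'} {l₂ : x₂ ⊗ y₂ ⟶ y'} {l : x' ⊗ y' ⟶ z} {v : M}
    (h : x₁ ⊴ₗ x₂ ⊴ₗ merge k₂ v ≫ merge k₁ (y ⊙ₗ v) ≫ merge k v =
      x₁ ⊴ₗ (swap x₂ y₁ (y₂ ⊙ₗ v)).hom ≫ x₁ ⊴ₗ y₁ ⊴ₗ merge l₂ v ≫ merge l₁ (y' ⊙ₗ v) ≫ merge l v) :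
    (k₁ ⊗ₘ k₂) ≫ k = tensorμ x₁ x₂ y₁ y₂ ≫ (l₁ ⊗ₘ l₂) ≫ l := by
  refine merge_injective (v := v) ?_
  rw [← cancel_epi ((αₗ x₁ x₂ _).inv ≫ (x₁ ⊗ x₂) ⊴ₗ (αₗ y₁ y₂ v).inv)]
  have e (p q r : P) : (α_ p q r).inv ⊵ₗ v = (αₗ p (q ⊗ r) v).hom ≫ p ⊴ₗ (αₗ q r v).hom ≫
      (αₗ p q (r ⊙ₗ v)).inv ≫ (αₗ (p ⊗ q) r v).inv := by
    rw [← cancel_epi ((α_ p q r).hom ⊵ₗ v), hom_inv_actionHomLeft, assoc_act]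
    simp
  simp [merge] at h
  simp [merge, MonoidalCategory.tensorHom_def', tensorμ, e]
  simp only [whiskerRight_actionHomLeft, Category.assoc, Iso.inv_hom_id_assoc, braid_act]
  have c : x₁ ⊴ₗ x₂ ⊴ₗ (αₗ y₁ y₂ v).inv ≫ x₁ ⊴ₗ x₂ ⊴ₗ (αₗ y₁ y₂ v).hom = 𝟙 _ := by
    simp only [← actionHomRight_comp, Iso.inv_hom_id, actionHomRight_id]
  simp [h, assoc_act, reassoc_of% c]

lemma mul_mul_eq_of_mul_eq' {c d cd : G} (e : c * d = cd) (a : G) : a * c * d = a * cd := by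
  rw [← e, mul_assoc]

lemma mul_mul_eq_of_commute' {c d cd a : G} (e : c * d = cd) (h : Commute a c) :
    c * (a * d) = a * cd := by
  rw [← mul_assoc, ← h.eq, mul_assoc, e]

namespace CentralExtension.Commutator

variable (C : L.Commutator)

/-- Moving `v * w` past `u * t` takes four exchanges. One side moves `u` and then `t` to the left
past `w` and `v`; the other moves `w` and then `v` to the right past `u` and `t`. The orders differ
in the exchanges of `v`, `u` and of `w`, `t`, which involve disjoint adjacent pairs. -/
lemma kL_kR_interchange {a b c d ab cd : G} (ab_eq : a * b = ab) (cd_eq : c * d = cd)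
    (ac : Commute a c) (ad : Commute a d) (bc : Commute b c) (bd : Commute b d)
    (a_cd : Commute a cd) (b_cd : Commute b cd) (ab_c : Commute ab c) (ab_d : Commute ab d)
    (ab_cd : Commute ab cd) :
    (C.kL ab_eq ad bd ab_d ⊗ₘ C.kL ab_eq ac bc ab_c) ≫ C.kR cd_eq ab_c ab_d ab_cd =
      tensorμ _ _ _ _ ≫ (C.kR cd_eq ac ad a_cd ⊗ₘ C.kR cd_eq bc bd b_cd) ≫
        C.kL ab_eq a_cd b_cd ab_cd := by
  obtain ⟨v⟩ := IsTorsor.nonempty (P := P) (L := L.torsor a)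
  obtain ⟨w⟩ := IsTorsor.nonempty (P := P) (L := L.torsor b)
  obtain ⟨u⟩ := IsTorsor.nonempty (P := P) (L := L.torsor c)
  obtain ⟨t⟩ := IsTorsor.nonempty (P := P) (L := L.torsor d)
  have e_ac := ac.eq.symm
  have e_ad := ad.eq.symm
  have e_bc := bc.eq.symm
  have e_bd := bd.eq.symm
  have e_a_cd := a_cd.eq.symm
  have e_b_cd := b_cd.eq.symm
  have e_ab_c := ab_c.eq.symm
  have e_ab_d := ab_d.eq.symm
  have e_ab_cd := ab_cd.eq.symm
  have a_bc := mul_mul_eq_of_mul_eq ab_eq c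
  have a_bd := mul_mul_eq_of_mul_eq ab_eq d
  have a_bcd := mul_mul_eq_of_mul_eq ab_eq cd
  have ac_b := mul_mul_eq_of_commute ab_eq bc
  have ad_b := mul_mul_eq_of_commute ab_eq bd
  have acd_b := mul_mul_eq_of_commute ab_eq b_cd
  have ab_c_d := mul_mul_eq_of_mul_eq' cd_eq ab
  have ac_d := mul_mul_eq_of_mul_eq' cd_eq a
  have bc_d := mul_mul_eq_of_mul_eq' cd_eq b
  have c_abd := mul_mul_eq_of_commute' cd_eq ab_c
  have c_ad := mul_mul_eq_of_commute' cd_eq ac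
  have c_bd := mul_mul_eq_of_commute' cd_eq bc
  have ac_bd : a * c * (b * d) = ab * cd := by rw [← mul_assoc, ac_b, ab_c_d]
  refine merge_tensorμ_ext (v := L.pr rfl (L.pr ab_eq v w) (L.pr cd_eq u t)) ?_
  rw [← cancel_mono (C.sig rfl e_ab_cd _ _ ≫
    L.ass cd_eq e_ab_d e_ab_cd c_abd u t (L.pr ab_eq v w))]
  have kR_ab := C.merge_kR rfl e_ab_c rfl e_ab_d cd_eq ab_c_d rfl e_ab_cd c_abd (L.pr ab_eq v w) u t
  have kL_c := C.merge_kL ab_eq rfl e_ac rfl e_bc rfl e_ab_c a_bc ac_b v w u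
  have kL_d := C.merge_kL ab_eq rfl e_ad rfl e_bd rfl e_ab_d a_bd ad_b v w t
  have rL := merge_rot_left ab_eq rfl rfl e_ac rfl e_bc cd_eq rfl a_bd rfl e_ab_c ac_b a_bc bc_d rfl
    c_bd ab_c_d rfl a_bcd ac_bd c_abd _ kL_c t
  have kL_cd := C.merge_kL ab_eq rfl e_a_cd rfl e_b_cd rfl e_ab_cd a_bcd acd_b v w (L.pr cd_eq u t)
  have kR_a := C.merge_kR rfl e_ac rfl e_ad cd_eq ac_d rfl e_a_cd c_ad v u t
  have kR_b := C.merge_kR rfl e_bc rfl e_bd cd_eq bc_d rfl e_b_cd c_bd w u t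
  have rR := merge_rot_right cd_eq e_bd rfl e_ac rfl e_ad ab_eq e_b_cd c_bd rfl e_a_cd ac_d c_ad ad_b
    a_bd e_ab_d acd_b a_bcd e_ab_cd c_abd ac_bd _ kR_a w
  -- The two exchanges that occur in different orders commute up to `swap`, which later cancels the
  -- `swap` coming from `tensorμ`.
  have ex := rot_exchange rfl e_ac c_bd a_bd ac_bd a_bcd c_abd (C.sig rfl e_ac v u) (C.sig rfl e_bd w t)
  rw [Category.assoc] at kR_ab kR_b
  have key : merge (C.kR cd_eq bc bd b_cd) _ ≫ C.obj b cd b_cd ⊴ₗ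
      L.ass ab_eq rfl rfl a_bcd v w (L.pr cd_eq u t) ≫
      L.wl a_bcd v (C.sig rfl e_b_cd w (L.pr cd_eq u t)) ≫
        L.mp a_bcd (𝟙 v) (L.ass cd_eq e_bd e_b_cd c_bd u t w) =
      C.obj b d bd ⊴ₗ (C.obj b c bc ⊴ₗ L.ass ab_eq rfl rfl a_bcd v w (L.pr cd_eq u t) ≫
        L.wl a_bcd v (rot rfl e_bc cd_eq rfl bc_d rfl c_bd (C.sig rfl e_bc w u) t)) ≫
      L.wl a_bcd v (L.wl c_bd u (C.sig rfl e_bd w t)) := by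
    rw [merge_nat_assoc, wl_mp, merge_wl _ _ _ kR_b, actionHomRight_comp, Category.assoc]
  have key' := congrArg (C.obj a d ad ⊴ₗ C.obj a c ac ⊴ₗ ·) key
  have ex' := congrArg (C.obj a d ad ⊴ₗ ·) ex
  have n := congrArg (C.obj a d ad ⊴ₗ ·) (swap_nat_right (C.obj b d bd) (C.obj a c ac)
    (C.obj b c bc ⊴ₗ L.ass ab_eq rfl rfl a_bcd v w (L.pr cd_eq u t) ≫
        L.wl a_bcd v (rot rfl e_bc cd_eq rfl bc_d rfl c_bd (C.sig rfl e_bc w u) t)))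
  have ss := congrArg (C.obj a d ad ⊴ₗ ·) (swap_swap (C.obj b d bd) (C.obj a c ac)
    (L.pr a_bcd v (L.pr c_bd u (L.pr rfl w t))))
  simp only [actionHomRight_comp, Category.assoc, actionHomRight_id] at key' ex' n ss
  -- The common value performs the exchanges in the order `w`, `u`; `v`, `u`; `w`, `t`; `v`, `t`.
  trans C.obj a d ad ⊴ₗ (C.obj b d bd ⊴ₗ (C.obj a c ac ⊴ₗ (C.obj b c bc ⊴ₗ
      L.ass ab_eq rfl rfl a_bcd v w (L.pr cd_eq u t) ≫
        L.wl a_bcd v (rot rfl e_bc cd_eq rfl bc_d rfl c_bd (C.sig rfl e_bc w u) t)) ≫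
      rot rfl e_ac c_bd a_bd ac_bd a_bcd c_abd (C.sig rfl e_ac v u) (L.pr rfl w t)) ≫
      L.wl c_abd u (L.wl a_bd v (C.sig rfl e_bd w t))) ≫
      L.wl c_abd u (rot rfl e_ad e_bd ab_eq ad_b a_bd e_ab_d (C.sig rfl e_ad v t) w)
  · simp only [Category.assoc]
    rw [kR_ab, merge_nat_assoc, merge_wl _ _ _ kL_d, ← act_mp_wl_id]
    simp only [← actionHomRight_comp_assoc, rL]
  · simp only [Category.assoc]
    rw [reassoc_of% kL_cd]
    simp only [actionHomRight_comp, Category.assoc, merge_nat_assoc]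
    rw [rR]
    simp only [actionHomRight_comp, Category.assoc]
    rw [reassoc_of% key', reassoc_of% ex', ← reassoc_of% n, reassoc_of% ss]

end CentralExtension.Commutator

end Interchange

end PicardTorsor

namespace PicardTorsor

/-! ### Passage to the order of summands and the direction of arrows in `Bimultiplicative`. -/

section Symmetric

variable {P : Type u} [Category.{v} P] [MonoidalCategory P] [SymmetricCategory P]

/-- If the braiding of the tensor products is expanded, `b` and `c` cross twice, which is trivial by
symmetry. -/
lemma tensorμ_braiding (a b c d : P) : tensorμ a b c d ≫ (β_ (a ⊗ c) (b ⊗ d)).hom =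
    ((β_ a b).hom ⊗ₘ (β_ c d).hom) ≫ tensorμ b a d c := by
  simp only [tensorμ, Category.assoc,
    BraidedCategory.braiding_tensor_right_hom, BraidedCategory.braiding_tensor_left_hom,
    comp_whiskerRight, whisker_assoc, MonoidalCategory.whiskerLeft_comp, pentagon_assoc,
    pentagon_inv_hom_hom_hom_inv_assoc, Iso.inv_hom_id_assoc, whiskerLeft_hom_inv_assoc]
  slice_lhs 3 4 =>
    rw [← MonoidalCategory.whiskerLeft_comp, ← comp_whiskerRight, SymmetricCategory.symmetry]
  simp only [id_whiskerRight, MonoidalCategory.whiskerLeft_id, Category.id_comp, Category.assoc,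
    pentagon_inv_assoc, Iso.hom_inv_id_assoc]
  slice_lhs 1 2 =>
    rw [← associator_inv_naturality_left]
  slice_lhs 2 3 =>
    rw [Iso.inv_hom_id]
  rw [Category.id_comp]
  slice_lhs 2 3 =>
    rw [← associator_naturality_right]
  slice_lhs 1 2 =>
    rw [← MonoidalCategory.tensorHom_def]
  simp only [Category.assoc]

lemma tensorμ_tensorμ (a b c d : P) : tensorμ a b c d ≫ tensorμ a c b d = 𝟙 _ := by
  have : tensorμ a c b d = tensorδ a b c d := by
    rw [tensorμ, tensorδ, SymmetricCategory.braiding_swap_eq_inv_braiding]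
  rw [this, tensorμ_tensorδ]

lemma braiding_tensorμ (a b c d : P) : (β_ (a ⊗ b) (c ⊗ d)).hom ≫ tensorμ c d a b =
    tensorμ a b c d ≫ ((β_ a c).hom ⊗ₘ (β_ b d).hom) := by
  have h := congrArg (fun f => tensorμ a b c d ≫ f ≫ tensorμ c d a b) (tensorμ_braiding a c b d)
  simp only [Category.assoc, tensorμ_tensorμ, Category.comp_id] at h
  rw [← h, ← Category.assoc (tensorμ a b c d), tensorμ_tensorμ, Category.id_comp]

/-- Associativity for operations with reversed arguments gives associativity after composing with
the braiding; the two ways of reversing three factors agree by the Yang–Baxter equation. -/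
lemma assoc_braiding {x y z xy yz t : P} {k : z ⊗ y ⟶ yz} {k' : y ⊗ x ⟶ xy} {l : yz ⊗ x ⟶ t}
    {l' : z ⊗ xy ⟶ t} (h : k ▷ x ≫ l = (α_ z y x).hom ≫ z ◁ k' ≫ l') :
    ((β_ x y).hom ≫ k') ▷ z ≫ (β_ xy z).hom ≫ l' =
      (α_ x y z).hom ≫ x ◁ ((β_ y z).hom ≫ k) ≫ (β_ x yz).hom ≫ l := by
  have e := BraidedCategory.yang_baxter x y z
  simp only [comp_whiskerRight, MonoidalCategory.whiskerLeft_comp, Category.assoc,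
    BraidedCategory.braiding_naturality_right_assoc, BraidedCategory.braiding_naturality_left_assoc,
    h, BraidedCategory.braiding_tensor_left_hom, BraidedCategory.braiding_tensor_right_hom,
    Iso.inv_hom_id_assoc]
  rw [← reassoc_of% e, Iso.hom_inv_id_assoc]

lemma inv_assoc {x y z xy yz t : P} {k : x ⊗ y ≅ xy} {l : xy ⊗ z ≅ t} {k' : y ⊗ z ≅ yz}
    {l' : x ⊗ yz ≅ t} (h : k.hom ▷ z ≫ l.hom = (α_ x y z).hom ≫ x ◁ k'.hom ≫ l'.hom) :
    l.inv ≫ k.inv ▷ z ≫ (α_ x y z).hom = l'.inv ≫ x ◁ k'.inv := by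
  rw [← cancel_epi (k.hom ▷ z ≫ l.hom)]
  conv_rhs => rw [h]
  simp

lemma inv_interchange {a b c d x y x' y' t : P} {k₁ : a ⊗ b ≅ x} {k₂ : c ⊗ d ≅ y} {k : x ⊗ y ≅ t}
    {l₁ : a ⊗ c ≅ x'} {l₂ : b ⊗ d ≅ y'} {l : x' ⊗ y' ≅ t}
    (h : (k₁.hom ⊗ₘ k₂.hom) ≫ k.hom = tensorμ a b c d ≫ (l₁.hom ⊗ₘ l₂.hom) ≫ l.hom) :
    k.inv ≫ (k₁.inv ⊗ₘ k₂.inv) ≫ tensorμ a b c d = l.inv ≫ (l₁.inv ⊗ₘ l₂.inv) := by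
  rw [← cancel_epi ((k₁.hom ⊗ₘ k₂.hom) ≫ k.hom)]
  conv_rhs => rw [h]
  simp

end Symmetric

/-! ### The unique bimultiplicative structure. -/

section Bimultiplicative

variable {G : Type w₂} [Group G]
  {P : Type u} [Category.{v} P] [MonoidalCategory P] [SymmetricCategory P] [PicardGroupoid P]
  {L : CentralExtension.{u, v, w₁, t₁, w₂} G P}

namespace CentralExtension.Commutator

variable (C : L.Commutator)

instance {a b c ab : G} (e : a * b = ab) (ca : Commute a c) (cb : Commute b c)
    (cab : Commute ab c) : IsIso (C.kL e ca cb cab) := IsGroupoid.all_isIso _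

instance {a b c bc : G} (e : b * c = bc) (cb : Commute a b) (cc : Commute a c)
    (cbc : Commute a bc) : IsIso (C.kR e cb cc cbc) := IsGroupoid.all_isIso _

/-- The bimultiplicative structure of the commutator. -/
noncomputable def bimultiplicative : Bimultiplicative C.obj where
  mulLeft e c₁ c₂ c := (asIso (C.kL e c₁ c₂ c)).symm
  mulRight e c₁ c₂ c := (β_ _ _ ≪≫ asIso (C.kR e c₁ c₂ c)).symm
  assoc_left e₁₂ e₂₃ e e' c₁ c₂ c₃ c₁₂ c₂₃ c := 
    inv_assoc (k := asIso _) (l := asIso _) (k' := asIso _) (l' := asIso _)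
      (C.kL_assoc e₁₂ e₂₃ e e' c₁ c₂ c₃ c₁₂ c₂₃ c)
  assoc_right e₁₂ e₂₃ e e' c₁ c₂ c₃ c₁₂ c₂₃ c :=
    inv_assoc (k := β_ _ _ ≪≫ asIso _) (l := β_ _ _ ≪≫ asIso _) (k' := β_ _ _ ≪≫ asIso _)
      (l' := β_ _ _ ≪≫ asIso _) (assoc_braiding (C.kR_assoc e₁₂ e₂₃ e e' c₁ c₂ c₃ c₁₂ c₂₃ c))
  interchange e e' c₁₁ c₁₂ c₂₁ c₂₂ c₁ c₂ c₁' c₂' c := by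
    have h := C.kL_kR_interchange e e' c₁₁ c₁₂ c₂₁ c₂₂ c₁ c₂ c₁' c₂' c
    refine inv_interchange (k₁ := asIso _) (k₂ := asIso _) (k := β_ _ _ ≪≫ asIso _)
      (l₁ := β_ _ _ ≪≫ asIso _) (l₂ := β_ _ _ ≪≫ asIso _) (l := asIso _) ?_
    simp only [asIso_hom, Iso.trans_hom, BraidedCategory.braiding_naturality_assoc, h,
      reassoc_of% (braiding_tensorμ (C.obj _ _ c₁₁) (C.obj _ _ c₂₁) (C.obj _ _ c₁₂)
        (C.obj _ _ c₂₂)), tensorHom_comp_tensorHom_assoc]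

/-- The condition (2a) fixes the first family of isomorphisms completely, as its equation has only
one solution. The same holds for (2b) and the second family. -/
lemma isMulLeft_iff (B : Bimultiplicative C.obj) : C.IsMulLeft B ↔
    ∀ (a b c ab : G) (e : a * b = ab) (ca : Commute a c) (cb : Commute b c) (cab : Commute ab c),
      (B.mulLeft e ca cb cab).inv = C.kL e ca cb cab := by
  constructor
  · intro h a b c ab e ca cb cab
    refine (C.existsUnique_mulLeftEq e rfl ca.eq.symm rfl cb.eq.symm rfl cab.eq.symm
      ((mul_assoc a b c).symm.trans (congrArg (· * c) e)) (mul_mul_eq_of_commute e cb)).unique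
        (fun x => h e rfl ca.eq.symm rfl cb.eq.symm rfl cab.eq.symm _ _ x) fun x => ?_
    exact C.mulLeftEq_kL e rfl ca.eq.symm rfl cb.eq.symm rfl cab.eq.symm _ _ x
  · intro h a b c ab ac bc abc ab_eq ac_eq ca_eq bc_eq cb_eq ab_c c_ab a_bc ac_b x
    have := C.mulLeftEq_kL ab_eq ac_eq ca_eq bc_eq cb_eq ab_c c_ab a_bc ac_b x
    rwa [← h _ _ _ _ ab_eq (ac_eq.trans ca_eq.symm) (bc_eq.trans cb_eq.symm)
      (ab_c.trans c_ab.symm)] at this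

lemma isMulRight_iff (B : Bimultiplicative C.obj) : C.IsMulRight B ↔
    ∀ (a b c bc : G) (e : b * c = bc) (cb : Commute a b) (cc : Commute a c) (cbc : Commute a bc),
      (β_ _ _).hom ≫ (B.mulRight e cb cc cbc).inv = C.kR e cb cc cbc := by
  constructor
  · intro h a b c bc e cb cc cbc
    refine (C.existsUnique_mulRightEq rfl cb.eq.symm rfl cc.eq.symm e rfl
      ((congrArg (a * ·) e.symm).trans (mul_assoc a b c).symm)
      (cbc.eq.symm.trans ((congrArg (a * ·) e.symm).trans (mul_assoc a b c).symm))
      ((mul_assoc b a c).symm.trans (congrArg (· * c) cb.eq.symm))).unique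
        (fun x => ?_) fun x => ?_
    · have := h rfl cb.eq.symm rfl cc.eq.symm e rfl
        ((congrArg (a * ·) e.symm).trans (mul_assoc a b c).symm)
        (cbc.eq.symm.trans ((congrArg (a * ·) e.symm).trans (mul_assoc a b c).symm))
        ((mul_assoc b a c).symm.trans (congrArg (· * c) cb.eq.symm)) x
      rw [← comp_actionHomLeft] at this
      exact this
    · exact C.mulRightEq_kR rfl cb.eq.symm rfl cc.eq.symm e rfl _ _ _ x
  · intro h a b c ab ac bc abc ab_eq ba_eq ac_eq ca_eq bc_eq ab_c a_bc bc_a b_ac x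
    have := C.mulRightEq_kR ab_eq ba_eq ac_eq ca_eq bc_eq ab_c a_bc bc_a b_ac x
    rw [← h _ _ _ _ bc_eq (ab_eq.trans ba_eq.symm) (ac_eq.trans ca_eq.symm) (a_bc.trans bc_a.symm),
      MulRightEq, merge, comp_actionHomLeft] at this
    exact this

/-- The two conditions leave no choice for the isomorphisms, and the remaining fields of a
bimultiplicative structure are propositions. -/
theorem existsUnique_bimultiplicative :
    ∃! B : Bimultiplicative C.obj, C.IsMulLeft B ∧ C.IsMulRight B := by
  refine ⟨C.bimultiplicative, ⟨(C.isMulLeft_iff _).2 fun _ _ _ _ _ _ _ _ => rfl,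
    (C.isMulRight_iff _).2 fun _ _ _ _ _ _ _ _ => ?_⟩, fun B hB => ?_⟩
  · simp [bimultiplicative]
  · have hl := (C.isMulLeft_iff _).1 hB.1
    have hr := (C.isMulRight_iff _).1 hB.2
    obtain ⟨l, r, _, _, _⟩ := B
    have el : @l = @C.bimultiplicative.mulLeft := by
      funext a b ab c e ca cb cab
      exact Iso.ext_inv (hl _ _ _ _ e ca cb cab)
    have er : @r = @C.bimultiplicative.mulRight := by
      funext a b c bc e cb cc cbc
      refine Iso.ext_inv ?_
      rw [← cancel_epi (β_ _ _).hom]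
      refine (hr _ _ _ _ e cb cc cbc).trans ?_
      simp [bimultiplicative]
    subst el er
    rfl

end CentralExtension.Commutator

end Bimultiplicative

end PicardTorsor

namespace PicardTorsor

/-! ### The unique anti-symmetric structure. -/

section Antisymmetry

variable {P : Type u} [Category.{v} P] [MonoidalCategory P] [SymmetricCategory P]

lemma merge_leftUnitor_ext {M : Type w₁} [Category.{t₁} M] [MonoidalLeftAction P M]
    [PicardGroupoid P] [IsTorsor P M] {x y : P} {f : x ⊗ y ⟶ 𝟙_ P} {f' : y ⊗ x ⟶ 𝟙_ P} {v : M}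
    (h : x ⊴ₗ (merge f' v ≫ (λₗ[P] v).hom) = merge f (x ⊙ₗ v) ≫ (λₗ[P] (x ⊙ₗ v)).hom) :
    f ▷ x ≫ (λ_ x).hom = (α_ x y x).hom ≫ x ◁ f' ≫ (ρ_ x).hom := by
  refine merge_injective (v := v) ?_
  rw [← cancel_epi (αₗ x y _).inv]
  simp [merge] at h
  simp [merge, h, assoc_act]

section Inverses

variable [PicardGroupoid P] (I : Inverses P)

lemma Inverses.whiskerLeft_negMap {x y : P} (f : x ≅ y) :
    x ◁ (I.negMap f).hom = (I.iso x).hom ≫ (I.iso y).inv ≫ f.inv ▷ I.neg y :=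
  ((tensorLeft x).map_preimage _).trans (by simp)

/-- `θ'` and `θ` define pairings `x + y ≃ e` and `y + x ≃ e`. The hypothesis says that the two
resulting isomorphisms `x + y + x ≃ x` agree. The isomorphism `-(-x) ≃ x` is the solution of this
very condition for the chosen pairings of `x`, `-x` and `-(-x)`. -/
lemma Inverses.comp_negMap_negNeg {x y : P} (θ : x ≅ I.neg y) (θ' : y ≅ I.neg x)
    (h : (x ◁ θ'.hom ≫ (I.iso x).hom) ▷ x ≫ (λ_ x).hom =
      (α_ x y x).hom ≫ x ◁ (y ◁ θ.hom ≫ (I.iso y).hom) ≫ (ρ_ x).hom) :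
    θ.hom ≫ (I.negMap θ').hom ≫ (I.negNeg x).hom = 𝟙 x := by
  set φ := θ.hom ≫ (I.negMap θ').hom
  -- The composition `φ : x ⟶ -(-x)` carries the pairing of `y` with `x` to the chosen pairing of
  -- `-x` with `-(-x)`.
  have hφ : y ◁ φ ≫ θ'.hom ▷ _ ≫ (I.iso (I.neg x)).hom = y ◁ θ.hom ≫ (I.iso y).hom := by
    simp [φ, I.whiskerLeft_negMap]
  have hn : (I.iso x).hom ▷ _ ≫ (λ_ _).hom ≫ (I.negNeg x).hom =
      (α_ _ _ _).hom ≫ x ◁ (I.iso (I.neg x)).hom ≫ (ρ_ x).hom := by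
    simp [Inverses.negNeg]
  rw [← Category.assoc, ← cancel_epi ((x ◁ θ'.hom ≫ (I.iso x).hom) ▷ x ≫ (λ_ x).hom),
    Category.comp_id]
  conv_rhs => rw [h, ← hφ]
  simp only [comp_whiskerRight, Category.assoc, ← leftUnitor_naturality_assoc,
    ← whisker_exchange_assoc, hn]
  simp [φ]

end Inverses

section Commutator

variable {G : Type w₂} [Group G] [PicardGroupoid P] {L : CentralExtension.{u, v, w₁, t₁, w₂} G P}

namespace CentralExtension.Commutator

variable (C : L.Commutator)

/-- The isomorphism `C (h, g) + C (g, h) ⟶ e`. -/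
noncomputable def kA (g h : G) (c : Commute g h) : C.obj h g c.symm ⊗ C.obj g h c ⟶ 𝟙_ P :=
  (C.existsUnique_antisymmEq c.eq rfl).choose

lemma antisymmEq_kA {g h k : G} (e : g * h = k) (e' : h * g = k) (x : L.torsor k) :
    C.AntisymmEq e e' (C.kA g h (e.trans e'.symm)) x := by
  subst e'
  exact (C.existsUnique_antisymmEq e rfl).choose_spec.1 x

/-- The two ways of contracting three alternating commutators agree: naturality moves the first
contraction past the remaining commutator, and `C ∘ C = id` identifies the result with the other
contraction. -/
lemma act_merge_kA {g h k : G} (e : g * h = k) (e' : h * g = k) (x : L.torsor k) :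
    C.obj g h (e.trans e'.symm) ⊴ₗ (merge (C.kA g h (e.trans e'.symm)) x ≫ (λₗ[P] x).hom) =
      merge (C.kA h g (e'.trans e.symm)) (C.obj g h (e.trans e'.symm) ⊙ₗ x) ≫ (λₗ[P] _).hom := by
  have := (L.mul e').isEquivalence
  have h1 := (C.app_natural e e').map_eq (merge (C.kA g h (e.trans e'.symm)) x ≫ (λₗ[P] x).hom)
  have h2 : (L.mul e).functor.map _ = _ := C.antisymmEq_kA e e' x
  have h3 : (L.mul e').functor.map _ = _ :=
    C.antisymmEq_kA e' e (C.obj g h (e.trans e'.symm) ⊙ₗ x)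
  refine (L.mul e').functor.map_injective ((cancel_mono (C.app e e' x).hom).1 ?_)
  refine h1.trans ?_
  refine Eq.trans ?_ (congrArg (· ≫ (C.app e e' x).hom) h3).symm
  refine Eq.trans ?_ (Category.assoc _ _ _).symm
  refine congrArg (_ ≫ ·) ?_
  refine (congrArg (L.com g h).functor.map h2).trans ?_
  refine ((L.com g h).functor.map_comp _ _).trans ?_
  exact congrArg (_ ≫ ·) (TorsorHom.comm_map_comm_map _)

/-- The identity between actions on one object is turned into an identity in `P`; it is the
hypothesis of `Inverses.comp_negMap_negNeg`. -/
lemma kA_zigzag (g h : G) (c : Commute g h) :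
    C.kA h g c.symm ▷ C.obj g h c ≫ (λ_ _).hom =
      (α_ _ _ _).hom ≫ C.obj g h c ◁ C.kA g h c ≫ (ρ_ _).hom := by
  obtain ⟨x⟩ := IsTorsor.nonempty (P := P) (L := L.torsor (h * g))
  exact merge_leftUnitor_ext (C.act_merge_kA c.eq rfl x)

variable (I : Inverses P)

lemma isAntisymm_iff (A : I.Antisymmetric C.obj) : C.IsAntisymm I A ↔
    ∀ (g h : G) (c : Commute g h),
      C.obj h g c.symm ◁ (A.iso g h c).hom ≫ (I.iso _).hom = C.kA g h c := by
  constructor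
  · intro H g h c
    refine (C.existsUnique_antisymmEq c.eq rfl).unique (fun x => ?_) (C.antisymmEq_kA c.eq rfl)
    have := H c.eq rfl x
    rw [← Category.assoc] at this
    exact this
  · intro H g h k e e' x
    have := C.antisymmEq_kA e e' x
    rw [← H g h (e.trans e'.symm), AntisymmEq, merge, Category.assoc] at this
    exact this

/-- Tensoring with `C (h, g)` is an equivalence of `P`, so `θ` can be recovered from the contraction
it has to induce. -/
lemma exists_antisymm_iso (g h : G) (c : Commute g h) : ∃ θ : C.obj g h c ≅ I.neg (C.obj h g c.symm),
    C.obj h g c.symm ◁ θ.hom ≫ (I.iso _).hom = C.kA g h c := by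
  have : IsIso (C.kA g h c) := IsGroupoid.all_isIso _
  refine ⟨(tensorLeft (C.obj h g c.symm)).preimageIso (asIso (C.kA g h c) ≪≫ (I.iso _).symm), ?_⟩
  have := (tensorLeft (C.obj h g c.symm)).map_preimage (C.kA g h c ≫ (I.iso _).inv)
  refine (congrArg (· ≫ (I.iso _).hom) this).trans ?_
  simp

theorem existsUnique_antisymmetric : ∃! A : I.Antisymmetric C.obj, C.IsAntisymm I A := by
  choose θ hθ using C.exists_antisymm_iso I
  refine ⟨⟨θ, fun g h c => ?_⟩, (C.isAntisymm_iff I _).2 hθ, fun A hA => ?_⟩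
  · refine I.comp_negMap_negNeg _ _ ?_
    rw [hθ, hθ]
    exact C.kA_zigzag g h c
  · have hA := (C.isAntisymm_iff I _).1 hA
    obtain ⟨θ', _⟩ := A
    have : θ' = θ := by
      funext g h c
      refine Iso.ext ((tensorLeft (C.obj h g c.symm)).map_injective ?_)
      exact (cancel_mono (I.iso _).hom).1 ((hA g h c).trans (hθ g h c).symm)
    subst this
    rfl

end CentralExtension.Commutator

end Commutator

end Antisymmetry

end PicardTorsor

theorem mainTheorem5 {G : Type w₂} [Group G] {P : Type u} [Category.{v} P] [MonoidalCategory P]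
    [SymmetricCategory P] [PicardTorsor.PicardGroupoid P]
    (L : PicardTorsor.CentralExtension.{u, v, w₁, t₁, w₂} G P) :
    Nonempty L.Commutator ∧
    (∀ C C' : L.Commutator, Nonempty (Unique (C.Iso C'))) ∧
    ∀ C : L.Commutator,
      (∃! B : PicardTorsor.Bimultiplicative C.obj, C.IsMulLeft B ∧ C.IsMulRight B) ∧
      ∀ I : PicardTorsor.Inverses P, ∃! A : I.Antisymmetric C.obj, C.IsAntisymm I A := by
  exact ⟨L.nonempty_commutator, fun C C' => PicardTorsor.CentralExtension.Commutator.nonempty_unique_iso C C',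
    fun C => ⟨C.existsUnique_bimultiplicative, C.existsUnique_antisymmetric⟩⟩
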